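/- **Exact categories and bimodules.** Let $C$ be an exact category in the sense of Quillen, with a chosen zero object, and let $M\colon C^{op}\otimes C\to Ab$ be a bimodule over $C$, i.e. an additive functor that is exact in both variables. For $f\colon a\to b$ write $f_*\colon M(c,a)\to M(c,b)$ and $f^*\colon M(b,c)\to M(a,c)$. The category $C\ltimes M$ has the objects of $C$, morphism groups $C(a,b)\oplus M(a,b)$ and composition $(f,m)\circ(g,n)=(f\circ g,\ f_*n+g^*m)$. A sequence $a\to b\to c$ in $C\ltimes M$ with zero composite is called exact if its projection to $C$ is exact. This makes $C\ltimes M$ an exact category, and the projection $C\ltimes M\to C$ is an exact functor. **The $S$-construction.** For $\underline p=(p_1,\dots,p_n)$ let $S^{(n)}_{\underline p}C=S_{p_1}\cdots S_{p_n}C$ be the category of diagrams $X\colon\prod_i Cat([1],[p_i])\to C$ such that in each variable $X$ has the chosen zero object as value at identities and the sequences $X_{a\le b}\to X_{a\le c}\to X_{b\le c}$ are exact for all $a\le b\le c$. Let $iS^{(n)}_{\underline p}C$ be its groupoid of isomorphisms and $\mathcal N_\bullet$ the nerve. The $K$-theory of $C$ is the symmetric spectrum (of topological spaces) $K(C)$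 with $$K(C)_n=|\mathcal N_\bullet iS^{(n)}_\bullet C| .$$ The group $\Sigma_n$ permutes the $S$-constructions, and the structure map $S^1\wedge K(C)_n\to K(C)_{n+1}$ is induced by the identification $S^{(n)}_{\underline p}C=S^{(n+1)}_{(1,\underline p)}C$, where $S^1$ is the interval with its end points identified. Let $$\widetilde K(C\ltimes M)=\mathrm{hofib}\big(K(C\ltimes M)\to K(C)\big)$$ be the levelwise homotopy fiber of the map induced by the projection. **The reduced model.** For $X,Y\in S^{(n)}_{\underline p}C$ let $S^{(n)}_{\underline p}M(X,Y)$ be the abelian group of families $(m_\theta)\in\prod_\theta M(X_\theta,Y_\theta)$, where $\theta$ runs over the objects of $\prod_iCat([1],[p_i])$, such that $X(\alpha)^*m_\theta=Y(\alpha)_*m_\rho$ in $M(X_\rho,Y_\theta)$ for all morphisms $\alpha\colon\rho\to\theta$. Let $\widetilde K(C;M)$ be the symmetric spectrum with $$\widetilde K(C;M)_n=\Big|\bigvee_{X\in Ob\,S^{(n)}_\bullet C}B\,S^{(n)}_\bullet M(X,X)\Big| ,$$ where $BG$ is the nerve of the group $G$ regarded as a category with one object, and the wedge is formed in each multisimplicial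 degree. The $\Sigma_n$-actions and the structure maps are given as for $K(C)$. **Naturality.** A morphism of pairs $(C,M)\to(D,N)$ is an exact functor $F\colon C\to D$ that preserves the chosen zero objects, together with homomorphisms $M(a,b)\to N(Fa,Fb)$ that are natural in $a,b\in C$. Then $(C,M)\mapsto\widetilde K(C;M)$ and $(C,M)\mapsto\widetilde K(C\ltimes M)$ are functors from pairs to symmetric spectra. **Corollary.** There is a natural equivalence of symmetric spectra $$\widetilde K(C;M)\simeq\widetilde K(C\ltimes M).$$ More precisely, there are a functor $(C,M)\mapsto E(C,M)$ from pairs to symmetric spectra and natural transformations $$\widetilde K(C;M)\longleftarrow E(C,M)\longrightarrow\widetilde K(C\ltimes M)$$ such that for every pair $(C,M)$ both maps induce isomorphisms on all stable homotopy groups $\pi_k=\operatorname{colim}_n\pi_{k+n}$, $k\in\mathbb Z$. -/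

import Mathlib

open CategoryTheory CategoryTheory.Limits Opposite
open scoped unitInterval

universe v u

namespace SplitK

/-! ### Exact categories -/

/-- An exact category in the sense of Quillen: a class of kernel-cokernel pairs (the exact
sequences, or conflations) in an additive category, satisfying the usual axioms. As always for the
`S`-construction, a zero object is part of the structure. -/
class ExactCategory (C : Type u) [Category.{v} C] [Preadditive C] where
  zero : C
  isZero_zero : IsZero zero
  hasFiniteBiproducts : HasFiniteBiproducts C
  /-- The exact sequences `a ⟶ b ⟶ c`. -/
  conflation : ShortComplex C → Prop
  conflation_of_iso : ∀ {S T : ShortComplex C}, (S ≅ T) → conflation S → conflation T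
  kernel : ∀ {S : ShortComplex C}, conflation S → Nonempty (IsLimit (KernelFork.ofι S.f S.zero))
  cokernel : ∀ {S : ShortComplex C}, conflation S →
    Nonempty (IsColimit (CokernelCofork.ofπ S.g S.zero))
  /-- Identities are admissible monomorphisms. -/
  inflation_id : ∀ a : C, ∃ (c : C) (q : a ⟶ c) (w : 𝟙 a ≫ q = 0), conflation ⟨𝟙 a, q, w⟩
  /-- Identities are admissible epimorphisms. -/
  deflation_id : ∀ c : C, ∃ (a : C) (i : a ⟶ c) (w : i ≫ 𝟙 c = 0), conflation ⟨i, 𝟙 c, w⟩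
  /-- Admissible monomorphisms compose. -/
  inflation_comp : ∀ {a b c : C} (i : a ⟶ b) (j : b ⟶ c),
    (∃ (d : C) (q : b ⟶ d) (w : i ≫ q = 0), conflation ⟨i, q, w⟩) →
    (∃ (d : C) (q : c ⟶ d) (w : j ≫ q = 0), conflation ⟨j, q, w⟩) →
    ∃ (d : C) (q : c ⟶ d) (w : (i ≫ j) ≫ q = 0), conflation ⟨i ≫ j, q, w⟩
  /-- Admissible epimorphisms compose. -/
  deflation_comp : ∀ {a b c : C} (p : a ⟶ b) (q : b ⟶ c),
    (∃ (d : C) (i : d ⟶ a) (w : i ≫ p = 0), conflation ⟨i, p, w⟩) →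
    (∃ (d : C) (i : d ⟶ b) (w : i ≫ q = 0), conflation ⟨i, q, w⟩) →
    ∃ (d : C) (i : d ⟶ a) (w : i ≫ p ≫ q = 0), conflation ⟨i, p ≫ q, w⟩
  /-- Admissible monomorphisms have pushouts, and these are admissible monomorphisms. -/
  inflation_pushout : ∀ {a b a' : C} (i : a ⟶ b) (g : a ⟶ a'),
    (∃ (d : C) (q : b ⟶ d) (w : i ≫ q = 0), conflation ⟨i, q, w⟩) →
    ∃ (b' : C) (i' : a' ⟶ b') (g' : b ⟶ b'), IsPushout i g g' i' ∧
      ∃ (d : C) (q : b' ⟶ d) (w : i' ≫ q = 0), conflation ⟨i', q, w⟩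
  /-- Admissible epimorphisms have pullbacks, and these are admissible epimorphisms. -/
  deflation_pullback : ∀ {a b b' : C} (p : a ⟶ b) (g : b' ⟶ b),
    (∃ (d : C) (i : d ⟶ a) (w : i ≫ p = 0), conflation ⟨i, p, w⟩) →
    ∃ (a' : C) (p' : a' ⟶ b') (g' : a' ⟶ a), IsPullback g' p' p g ∧
      ∃ (d : C) (i : d ⟶ a') (w : i ≫ p' = 0), conflation ⟨i, p', w⟩

namespace ExactCategory

variable {C : Type u} [Category.{v} C] [Preadditive C] [ExactCategory C]

theorem conflation_id_right {X Y : C} {f : (zero : C) ⟶ X} {g : X ⟶ Y} (hg : IsIso g) :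
    ∃ w, conflation (ShortComplex.mk f g w) := by
  have hf : f = 0 := isZero_zero.eq_of_src _ _
  subst hf
  refine ⟨zero_comp, ?_⟩
  obtain ⟨a, i, w, h⟩ := deflation_id X
  have hi : i = 0 := by simpa using w
  obtain ⟨hl⟩ := kernel h
  have ha : IsZero a := by
    rw [IsZero.iff_id_eq_zero]
    apply Fork.IsLimit.hom_ext hl
    simp [hi]
  refine conflation_of_iso ?_ h
  refine ShortComplex.isoMk (ha.iso isZero_zero) (Iso.refl _) (asIso g) ?_ ?_
  · simp [hi]
  · simp

theorem conflation_id_left {X Y : C} {f : X ⟶ Y} {g : Y ⟶ (zero : C)} (hf : IsIso f) :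
    ∃ w, conflation (ShortComplex.mk f g w) := by
  have hg : g = 0 := isZero_zero.eq_of_tgt _ _
  subst hg
  refine ⟨comp_zero, ?_⟩
  obtain ⟨c, q, w, h⟩ := inflation_id X
  have hq : q = 0 := by simpa using w
  obtain ⟨hl⟩ := cokernel h
  have hc : IsZero c := by
    rw [IsZero.iff_id_eq_zero]
    apply Cofork.IsColimit.hom_ext hl
    simp [hq]
  refine conflation_of_iso ?_ h
  refine ShortComplex.isoMk (Iso.refl _) (asIso f) (hc.iso isZero_zero) ?_ ?_
  · simp
  · simp [hq]

end ExactCategory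

/-! ### Bimodules -/

/-- A functor `Cᵒᵖ ⊗ C ⥤ Ab` of categories enriched in abelian groups. -/
structure BiadditiveFunctor (C : Type u) [Category.{v} C] [Preadditive C] where
  functor : Cᵒᵖ ⥤ C ⥤ AddCommGrpCat.{v}
  additive_right : ∀ a : Cᵒᵖ, (functor.obj a).Additive
  additive_left : ∀ b : C, (functor.flip.obj b).Additive

namespace BiadditiveFunctor

variable {C : Type u} [Category.{v} C] [Preadditive C] (M : BiadditiveFunctor C)

/-- The abelian group `M(a, b)`. -/
abbrev val (a b : C) : Type v := (M.functor.obj (op a)).obj b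

/-- The map `f_* : M(c, a) → M(c, b)` induced by `f : a ⟶ b`. -/
def push {a b : C} (f : a ⟶ b) {c : C} : M.val c a →+ M.val c b :=
  ((M.functor.obj (op c)).map f).hom

/-- The map `f^* : M(b, c) → M(a, c)` induced by `f : a ⟶ b`. -/
def pull {a b : C} (f : a ⟶ b) {c : C} : M.val b c →+ M.val a c :=
  ((M.functor.map f.op).app c).hom

@[simp] theorem push_id {a c : C} (x : M.val c a) : M.push (𝟙 a) x = x := by simp [push]

@[simp] theorem pull_id {a c : C} (x : M.val a c) : M.pull (𝟙 a) x = x := by simp [pull]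

theorem push_comp {a b d c : C} (f : a ⟶ b) (g : b ⟶ d) (x : M.val c a) :
    M.push (f ≫ g) x = M.push g (M.push f x) := by simp [push]

theorem pull_comp {a b d c : C} (f : a ⟶ b) (g : b ⟶ d) (x : M.val d c) :
    M.pull (f ≫ g) x = M.pull f (M.pull g x) := by simp [pull]

theorem push_pull {a b c d : C} (f : a ⟶ b) (g : c ⟶ d) (x : M.val b c) :
    M.push g (M.pull f x) = M.pull f (M.push g x) := by
  have := (M.functor.map f.op).naturality g
  exact (ConcreteCategory.congr_hom this x).symm

theorem add_push {a b c : C} (f g : a ⟶ b) (x : M.val c a) :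
    M.push (f + g) x = M.push f x + M.push g x := by
  have := M.additive_right (op c)
  simp [push, Functor.map_add]

theorem add_pull {a b c : C} (f g : a ⟶ b) (x : M.val b c) :
    M.pull (f + g) x = M.pull f x + M.pull g x := by
  have := M.additive_left c
  have h := (M.functor.flip.obj c).map_add (f := f.op) (g := g.op)
  exact ConcreteCategory.congr_hom h x

@[simp] theorem zero_push {a b c : C} (x : M.val c a) : M.push (0 : a ⟶ b) x = 0 := by
  have h := M.add_push (0 : a ⟶ b) 0 x
  simpa using h

@[simp] theorem zero_pull {a b c : C} (x : M.val b c) : M.pull (0 : a ⟶ b) x = 0 := by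
  have h := M.add_pull (0 : a ⟶ b) 0 x
  simpa using h

end BiadditiveFunctor

/-- A bimodule over an exact category `C`: an additive functor `Cᵒᵖ ⊗ C ⥤ Ab` which is exact in
both variables, that is, takes exact sequences in each variable to short exact sequences of
abelian groups. -/
structure Bimodule (C : Type u) [Category.{v} C] [Preadditive C] [ExactCategory C] extends
    BiadditiveFunctor C where
  push_injective : ∀ (S : ShortComplex C), ExactCategory.conflation S → ∀ c : C,
    Function.Injective (toBiadditiveFunctor.push S.f (c := c))
  push_exact : ∀ (S : ShortComplex C), ExactCategory.conflation S → ∀ c : C,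
    Function.Exact (toBiadditiveFunctor.push S.f (c := c)) (toBiadditiveFunctor.push S.g (c := c))
  push_surjective : ∀ (S : ShortComplex C), ExactCategory.conflation S → ∀ c : C,
    Function.Surjective (toBiadditiveFunctor.push S.g (c := c))
  pull_injective : ∀ (S : ShortComplex C), ExactCategory.conflation S → ∀ c : C,
    Function.Injective (toBiadditiveFunctor.pull S.g (c := c))
  pull_exact : ∀ (S : ShortComplex C), ExactCategory.conflation S → ∀ c : C,
    Function.Exact (toBiadditiveFunctor.pull S.g (c := c)) (toBiadditiveFunctor.pull S.f (c := c))
  pull_surjective : ∀ (S : ShortComplex C), ExactCategory.conflation S → ∀ c : C,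
    Function.Surjective (toBiadditiveFunctor.pull S.f (c := c))

/-! ### The semi-direct product `C ⋉ M` -/

/-- The objects of `C ⋉ M`, which are those of `C`. -/
structure Semidirect {C : Type u} [Category.{v} C] [Preadditive C]
    (M : BiadditiveFunctor C) where
  of : C

/-- The morphisms of `C ⋉ M`, which are the elements of `C(a, b) ⊕ M(a, b)`. -/
@[ext]
structure SemidirectHom {C : Type u} [Category.{v} C] [Preadditive C]
    (M : BiadditiveFunctor C) (a b : Semidirect M) where
  fst : a.of ⟶ b.of
  snd : M.val a.of b.of

namespace Semidirect

section

variable {C : Type u} [Category.{v} C] [Preadditive C] {M : BiadditiveFunctor C}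

instance : Category.{v} (Semidirect M) where
  Hom a b := SemidirectHom M a b
  id a := ⟨𝟙 a.of, 0⟩
  comp g f := ⟨g.fst ≫ f.fst, M.push f.fst g.snd + M.pull g.fst f.snd⟩
  id_comp f := by ext <;> simp
  comp_id f := by ext <;> simp
  assoc f g h := by
    ext
    · simp
    · simp [M.push_comp, M.pull_comp, M.push_pull, add_assoc]

@[ext] theorem hom_ext {a b : Semidirect M} {f g : a ⟶ b} (h₁ : f.fst = g.fst)
    (h₂ : f.snd = g.snd) : f = g := SemidirectHom.ext h₁ h₂

@[simp] theorem id_fst (a : Semidirect M) : SemidirectHom.fst (𝟙 a) = 𝟙 a.of := rfl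
@[simp] theorem id_snd (a : Semidirect M) : SemidirectHom.snd (𝟙 a) = 0 := rfl
@[simp] theorem comp_fst {a b c : Semidirect M} (f : a ⟶ b) (g : b ⟶ c) :
    (f ≫ g).fst = f.fst ≫ g.fst := rfl
@[simp] theorem comp_snd {a b c : Semidirect M} (f : a ⟶ b) (g : b ⟶ c) :
    (f ≫ g).snd = M.push g.fst f.snd + M.pull f.fst g.snd := rfl

/-- The morphism groups of `C ⋉ M` are `C(a, b) ⊕ M(a, b)`. -/
def homEquiv (a b : Semidirect M) : (a ⟶ b) ≃ (a.of ⟶ b.of) × M.val a.of b.of where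
  toFun f := (f.fst, f.snd)
  invFun x := ⟨x.1, x.2⟩

instance (a b : Semidirect M) : AddCommGroup (a ⟶ b) := (homEquiv a b).addCommGroup

@[simp] theorem add_fst {a b : Semidirect M} (f g : a ⟶ b) : (f + g).fst = f.fst + g.fst := rfl
@[simp] theorem add_snd {a b : Semidirect M} (f g : a ⟶ b) : (f + g).snd = f.snd + g.snd := rfl

instance : Preadditive (Semidirect M) where
  add_comp a b c f g h := by
    ext
    · simp
    · simp [M.add_pull]; abel
  comp_add a b c f g h := by
    ext
    · simp
    · simp [M.add_push]; abel

@[simp] theorem zero_fst (a b : Semidirect M) : (0 : a ⟶ b).fst = 0 := rfl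
@[simp] theorem zero_snd (a b : Semidirect M) : (0 : a ⟶ b).snd = 0 := rfl

variable (M) in
/-- The projection `C ⋉ M ⥤ C`. -/
def proj : Semidirect M ⥤ C where
  obj a := a.of
  map f := f.fst

instance : (proj M).Additive where

end

end Semidirect

/-! ### The exact structure on `C ⋉ M` -/

namespace Bimodule

variable {C : Type u} [Category.{v} C] [Preadditive C] [ExactCategory C] (M : Bimodule C)

open ExactCategory

theorem pullback_unique {a b c p : C} {f : a ⟶ b} {g : c ⟶ b} {f' : p ⟶ c} {g' : p ⟶ a}
    (sq : IsPullback g' f' f g) (hf : ∃ (d : C) (i : d ⟶ a) (w : i ≫ f = 0), conflation ⟨i, f, w⟩)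
    (hf' : ∃ (d : C) (i : d ⟶ p) (w : i ≫ f' = 0), conflation ⟨i, f', w⟩) (e : C)
    (x : M.val e a) (y : M.val e c) (h : M.push f x = M.push g y) :
    ∃! z : M.val e p, M.push g' z = x ∧ M.push f' z = y := by
  obtain ⟨k, i, w, hi⟩ := hf
  obtain ⟨k', i', w', hi'⟩ := hf'
  obtain ⟨hl⟩ := kernel hi
  obtain ⟨hl'⟩ := kernel hi'
  obtain ⟨κ, hκ⟩ : ∃ κ : k' ⟶ k, κ ≫ i = i' ≫ g' :=
    ⟨hl.lift (KernelFork.ofι (i' ≫ g') (by rw [Category.assoc, sq.w, reassoc_of% w', zero_comp])),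
      Fork.IsLimit.lift_ι hl⟩
  obtain ⟨j, hj, hj'⟩ : ∃ j : k ⟶ p, j ≫ g' = i ∧ j ≫ f' = 0 :=
    ⟨sq.lift i 0 (by simp [w]), by simp, by simp⟩
  obtain ⟨l, hlj⟩ : ∃ l : k ⟶ k', l ≫ i' = j :=
    ⟨hl'.lift (KernelFork.ofι j hj'), Fork.IsLimit.lift_ι hl'⟩
  have hκj : κ ≫ j = i' := sq.hom_ext (by simp [hj, hκ]) (by simp [hj', w'])
  obtain ⟨z₀, hz₀⟩ := M.push_surjective _ hi' e y
  obtain ⟨t, ht⟩ := (M.push_exact _ hi e (x - M.push g' z₀)).1 (by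
    change M.push f _ = 0
    change M.push f' z₀ = y at hz₀
    rw [map_sub, h, ← hz₀, ← M.push_comp, ← M.push_comp, sq.w, sub_self])
  change M.push f' z₀ = y at hz₀
  change M.push i t = _ at ht
  refine ⟨z₀ + M.push j t, ⟨?_, ?_⟩, ?_⟩
  · rw [map_add, ← M.push_comp, hj, ht]; abel
  · rw [map_add, ← M.push_comp, hj', hz₀]; simp
  · rintro z ⟨h₁, h₂⟩
    rw [← sub_eq_zero]
    set d := z - (z₀ + M.push j t) with hd
    have e₁ : M.push g' d = 0 := by
      rw [hd, map_sub, h₁, map_add, ← M.push_comp, hj, ht]; abel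
    have e₂ : M.push f' d = 0 := by
      rw [hd, map_sub, h₂, map_add, ← M.push_comp, hj', hz₀]; simp
    obtain ⟨r, hr⟩ := (M.push_exact _ hi' e d).1 e₂
    change M.push i' r = d at hr
    have e₃ : M.push κ r = 0 := by
      apply M.push_injective _ hi e
      change M.push i (M.push κ r) = M.push i 0
      rw [← M.push_comp, hκ, M.push_comp, hr, e₁, map_zero]
    rw [← hr, ← hκj, M.push_comp, e₃, map_zero]

theorem pushout_unique {a b c p : C} {f : a ⟶ b} {g : a ⟶ c} {f' : c ⟶ p} {g' : b ⟶ p}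
    (sq : IsPushout f g g' f') (hf : ∃ (d : C) (q : b ⟶ d) (w : f ≫ q = 0), conflation ⟨f, q, w⟩)
    (hf' : ∃ (d : C) (q : p ⟶ d) (w : f' ≫ q = 0), conflation ⟨f', q, w⟩) (e : C)
    (x : M.val b e) (y : M.val c e) (h : M.pull f x = M.pull g y) :
    ∃! z : M.val p e, M.pull g' z = x ∧ M.pull f' z = y := by
  obtain ⟨k, q, w, hi⟩ := hf
  obtain ⟨k', q', w', hi'⟩ := hf'
  obtain ⟨hl⟩ := cokernel hi
  obtain ⟨hl'⟩ := cokernel hi'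
  obtain ⟨κ, hκ⟩ : ∃ κ : k ⟶ k', q ≫ κ = g' ≫ q' :=
    ⟨hl.desc (CokernelCofork.ofπ (g' ≫ q') (by rw [reassoc_of% sq.w, w', comp_zero])),
      Cofork.IsColimit.π_desc hl⟩
  obtain ⟨j, hj, hj'⟩ : ∃ j : p ⟶ k, g' ≫ j = q ∧ f' ≫ j = 0 :=
    ⟨sq.desc q 0 (by simp [w]), by simp, by simp⟩
  obtain ⟨l, hlj⟩ : ∃ l : k' ⟶ k, q' ≫ l = j :=
    ⟨hl'.desc (CokernelCofork.ofπ j hj'), Cofork.IsColimit.π_desc hl'⟩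
  have hκj : j ≫ κ = q' := sq.hom_ext (by simp [reassoc_of% hj, hκ]) (by simp [reassoc_of% hj', w'])
  obtain ⟨z₀, hz₀⟩ := M.pull_surjective _ hi' e y
  obtain ⟨t, ht⟩ := (M.pull_exact _ hi e (x - M.pull g' z₀)).1 (by
    change M.pull f _ = 0
    change M.pull f' z₀ = y at hz₀
    rw [map_sub, h, ← hz₀, ← M.pull_comp, ← M.pull_comp, sq.w, sub_self])
  change M.pull f' z₀ = y at hz₀
  change M.pull q t = _ at ht
  refine ⟨z₀ + M.pull j t, ⟨?_, ?_⟩, ?_⟩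
  · rw [map_add, ← M.pull_comp, hj, ht]; abel
  · rw [map_add, ← M.pull_comp, hj', hz₀]; simp
  · rintro z ⟨h₁, h₂⟩
    rw [← sub_eq_zero]
    set d := z - (z₀ + M.pull j t) with hd
    have e₁ : M.pull g' d = 0 := by
      rw [hd, map_sub, h₁, map_add, ← M.pull_comp, hj, ht]; abel
    have e₂ : M.pull f' d = 0 := by
      rw [hd, map_sub, h₂, map_add, ← M.pull_comp, hj', hz₀]; simp
    obtain ⟨r, hr⟩ := (M.pull_exact _ hi' e d).1 e₂
    change M.pull q' r = d at hr
    have e₃ : M.pull κ r = 0 := by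
      apply M.pull_injective _ hi e
      change M.pull q (M.pull κ r) = M.pull q 0
      rw [← M.pull_comp, hκ, M.pull_comp, hr, e₁, map_zero]
    rw [← hr, ← hκj, M.pull_comp, e₃, map_zero]

end Bimodule

namespace Semidirect

open ExactCategory

variable {C : Type u} [Category.{v} C] [Preadditive C] [ExactCategory C] {M : Bimodule C}

/-- A sequence `(i, m)`, `(q, n)` in `C ⋉ M` is exact if its composite vanishes, that is
`q ∘ i = 0` and `q_* m + i^* n = 0`, and the underlying sequence `i`, `q` is exact in `C`. -/
def IsConflation (S : ShortComplex (Semidirect M.toBiadditiveFunctor)) : Prop :=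
  conflation (S.map (proj M.toBiadditiveFunctor))

theorem isZero_zero : IsZero (⟨zero⟩ : Semidirect M.toBiadditiveFunctor) := by
  rw [IsZero.iff_id_eq_zero]
  ext
  · exact ExactCategory.isZero_zero.eq_of_src _ _
  · rfl

theorem inflation_iff {a b : Semidirect M.toBiadditiveFunctor} (i : a ⟶ b) :
    (∃ (d : _) (q : b ⟶ d) (w : i ≫ q = 0), IsConflation ⟨i, q, w⟩) ↔
      ∃ (d : C) (q : b.of ⟶ d) (w : i.fst ≫ q = 0), conflation ⟨i.fst, q, w⟩ := by
  constructor
  · rintro ⟨d, q, w, h⟩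
    exact ⟨d.of, q.fst, congrArg SemidirectHom.fst w, h⟩
  · rintro ⟨d, q, w, h⟩
    obtain ⟨n, hn⟩ := M.pull_surjective _ h d (-M.push q i.snd)
    change M.pull i.fst n = _ at hn
    refine ⟨⟨d⟩, ⟨q, n⟩, ?_, h⟩
    ext
    · exact w
    · simp [hn]

theorem deflation_iff {a b : Semidirect M.toBiadditiveFunctor} (p : a ⟶ b) :
    (∃ (d : _) (i : d ⟶ a) (w : i ≫ p = 0), IsConflation ⟨i, p, w⟩) ↔
      ∃ (d : C) (i : d ⟶ a.of) (w : i ≫ p.fst = 0), conflation ⟨i, p.fst, w⟩ := by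
  constructor
  · rintro ⟨d, i, w, h⟩
    exact ⟨d.of, i.fst, congrArg SemidirectHom.fst w, h⟩
  · rintro ⟨d, i, w, h⟩
    obtain ⟨m, hm⟩ := M.push_surjective _ h d (-M.pull i p.snd)
    change M.push p.fst m = _ at hm
    refine ⟨⟨d⟩, ⟨i, m⟩, ?_, h⟩
    ext
    · exact w
    · simp [hm]

theorem hasFiniteBiproducts : HasFiniteBiproducts (Semidirect M.toBiadditiveFunctor) := by
  have := ExactCategory.hasFiniteBiproducts (C := C)
  have : HasBinaryBiproducts C := hasBinaryBiproducts_of_finite_biproducts C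
  have : HasBinaryBiproducts (Semidirect M.toBiadditiveFunctor) :=
    { has_binary_biproduct := fun a b => by
        refine hasBinaryBiproduct_of_total
          { pt := ⟨a.of ⊞ b.of⟩
            fst := ⟨biprod.fst, 0⟩
            snd := ⟨biprod.snd, 0⟩
            inl := ⟨biprod.inl, 0⟩
            inr := ⟨biprod.inr, 0⟩
            inl_fst := by ext <;> simp
            inl_snd := by ext <;> simp
            inr_fst := by ext <;> simp
            inr_snd := by ext <;> simp } ?_
        ext <;> simp }
  have : HasZeroObject (Semidirect M.toBiadditiveFunctor) := ⟨⟨zero⟩, isZero_zero⟩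
  have : HasFiniteProducts (Semidirect M.toBiadditiveFunctor) :=
    hasFiniteProducts_of_has_binary_and_terminal
  exact HasFiniteBiproducts.of_hasFiniteProducts

theorem nonempty_isLimit {S : ShortComplex (Semidirect M.toBiadditiveFunctor)}
    (h : IsConflation S) : Nonempty (IsLimit (KernelFork.ofι S.f S.zero)) := by
  obtain ⟨hl⟩ := kernel h
  have key : ∀ {d : Semidirect M.toBiadditiveFunctor} (f : d ⟶ S.X₂), f ≫ S.g = 0 →
      ∃ u : d ⟶ S.X₁, u ≫ S.f = f := by
    intro d f hf
    have h₁ : f.fst ≫ S.g.fst = 0 := congrArg SemidirectHom.fst hf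
    have h₂ : M.push S.g.fst f.snd + M.pull f.fst S.g.snd = 0 := congrArg SemidirectHom.snd hf
    have h₃ : M.push S.g.fst S.f.snd + M.pull S.f.fst S.g.snd = 0 :=
      congrArg SemidirectHom.snd S.zero
    obtain ⟨u, hu⟩ : ∃ u : d.of ⟶ S.X₁.of, u ≫ S.f.fst = f.fst :=
      ⟨hl.lift (KernelFork.ofι f.fst h₁), Fork.IsLimit.lift_ι hl⟩
    obtain ⟨x, hx⟩ := (M.push_exact _ h d.of (f.snd - M.pull u S.f.snd)).1 (by
      change M.push S.g.fst _ = 0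
      rw [map_sub, M.push_pull, eq_neg_of_add_eq_zero_left h₃, map_neg, ← M.pull_comp, hu,
        eq_neg_of_add_eq_zero_left h₂, sub_self])
    change M.push S.f.fst x = _ at hx
    refine ⟨⟨u, x⟩, ?_⟩
    ext
    · exact hu
    · simp [hx]
  have mono : ∀ {d : Semidirect M.toBiadditiveFunctor} (u u' : d ⟶ S.X₁),
      u ≫ S.f = u' ≫ S.f → u = u' := by
    intro d u u' hu
    have h₁ : u.fst = u'.fst := Fork.IsLimit.hom_ext hl (congrArg SemidirectHom.fst hu)
    have h₂ : M.push S.f.fst u.snd + M.pull u.fst S.f.snd =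
      M.push S.f.fst u'.snd + M.pull u'.fst S.f.snd := congrArg SemidirectHom.snd hu
    ext
    · exact h₁
    · rw [h₁] at h₂
      have h₃ := add_right_cancel h₂
      exact M.push_injective _ h d.of h₃
  choose l hl' using @key
  exact ⟨KernelFork.IsLimit.ofι _ _ (fun g w => l g w) (fun g w => hl' g w)
    (fun g w m hm => mono _ _ (hm.trans (hl' g w).symm))⟩

theorem nonempty_isColimit {S : ShortComplex (Semidirect M.toBiadditiveFunctor)}
    (h : IsConflation S) : Nonempty (IsColimit (CokernelCofork.ofπ S.g S.zero)) := by
  obtain ⟨hl⟩ := cokernel h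
  have key : ∀ {d : Semidirect M.toBiadditiveFunctor} (f : S.X₂ ⟶ d), S.f ≫ f = 0 →
      ∃ u : S.X₃ ⟶ d, S.g ≫ u = f := by
    intro d f hf
    have h₁ : S.f.fst ≫ f.fst = 0 := congrArg SemidirectHom.fst hf
    have h₂ : M.push f.fst S.f.snd + M.pull S.f.fst f.snd = 0 := congrArg SemidirectHom.snd hf
    have h₃ : M.push S.g.fst S.f.snd + M.pull S.f.fst S.g.snd = 0 :=
      congrArg SemidirectHom.snd S.zero
    obtain ⟨u, hu⟩ : ∃ u : S.X₃.of ⟶ d.of, S.g.fst ≫ u = f.fst :=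
      ⟨hl.desc (CokernelCofork.ofπ f.fst h₁), Cofork.IsColimit.π_desc hl⟩
    obtain ⟨x, hx⟩ := (M.pull_exact _ h d.of (f.snd - M.push u S.g.snd)).1 (by
      change M.pull S.f.fst _ = 0
      rw [map_sub, ← M.push_pull, eq_neg_of_add_eq_zero_right h₃, map_neg, ← M.push_comp, hu,
        eq_neg_of_add_eq_zero_right h₂, sub_self])
    change M.pull S.g.fst x = _ at hx
    refine ⟨⟨u, x⟩, ?_⟩
    ext
    · exact hu
    · simp [hx]
  have epi : ∀ {d : Semidirect M.toBiadditiveFunctor} (u u' : S.X₃ ⟶ d),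
      S.g ≫ u = S.g ≫ u' → u = u' := by
    intro d u u' hu
    have h₁ : u.fst = u'.fst := Cofork.IsColimit.hom_ext hl (congrArg SemidirectHom.fst hu)
    have h₂ : M.push u.fst S.g.snd + M.pull S.g.fst u.snd =
      M.push u'.fst S.g.snd + M.pull S.g.fst u'.snd := congrArg SemidirectHom.snd hu
    ext
    · exact h₁
    · rw [h₁] at h₂
      have h₃ := add_left_cancel h₂
      exact M.pull_injective _ h d.of h₃
  choose l hl' using @key
  exact ⟨CokernelCofork.IsColimit.ofπ _ _ (fun g w => l g w) (fun g w => hl' g w)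
    (fun g w m hm => epi _ _ (hm.trans (hl' g w).symm))⟩

theorem exists_pullback {a b b' : Semidirect M.toBiadditiveFunctor} (p : a ⟶ b) (g : b' ⟶ b)
    (hp : ∃ (d : C) (i : d ⟶ a.of) (w : i ≫ p.fst = 0), conflation ⟨i, p.fst, w⟩) :
    ∃ (a' : _) (p' : a' ⟶ b') (g' : a' ⟶ a), IsPullback g' p' p g ∧
      ∃ (d : C) (i : d ⟶ a'.of) (w : i ≫ p'.fst = 0), conflation ⟨i, p'.fst, w⟩ := by
  obtain ⟨a', p', g', sq, hp'⟩ := deflation_pullback p.fst g.fst hp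
  obtain ⟨n, hn⟩ : ∃ n : M.val a' a.of, M.push p.fst n = M.pull p' g.snd - M.pull g' p.snd := by
    obtain ⟨d, i, w, hi⟩ := hp
    exact M.push_surjective _ hi a' _
  have uniq := M.pullback_unique sq hp hp'
  have comm : (⟨g', n⟩ : (⟨a'⟩ : Semidirect M.toBiadditiveFunctor) ⟶ a) ≫ p =
      (⟨p', 0⟩ : (⟨a'⟩ : Semidirect M.toBiadditiveFunctor) ⟶ b') ≫ g := by
    ext
    · exact sq.w
    · simp [hn]
  have key : ∀ s : PullbackCone p g, ∃! l : s.pt ⟶ (⟨a'⟩ : Semidirect M.toBiadditiveFunctor),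
      l ≫ (⟨g', n⟩ : (⟨a'⟩ : Semidirect M.toBiadditiveFunctor) ⟶ a) = s.fst ∧
      l ≫ (⟨p', 0⟩ : (⟨a'⟩ : Semidirect M.toBiadditiveFunctor) ⟶ b') = s.snd := by
    intro s
    have h₁ : s.fst.fst ≫ p.fst = s.snd.fst ≫ g.fst := congrArg SemidirectHom.fst s.condition
    have h₂ : M.push p.fst s.fst.snd + M.pull s.fst.fst p.snd =
      M.push g.fst s.snd.snd + M.pull s.snd.fst g.snd := congrArg SemidirectHom.snd s.condition
    have u₁ := sq.lift_fst _ _ h₁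
    have u₂ := sq.lift_snd _ _ h₁
    set u := sq.lift _ _ h₁
    obtain ⟨z, ⟨hz₁, hz₂⟩, hz⟩ := uniq s.pt.of (s.fst.snd - M.pull u n) s.snd.snd (by
      rw [map_sub, M.push_pull, hn, map_sub, ← M.pull_comp, ← M.pull_comp, u₁, u₂]
      rw [← sub_eq_zero] at h₂ ⊢
      rw [← h₂]; abel)
    refine ⟨⟨u, z⟩, ⟨?_, ?_⟩, ?_⟩
    · ext
      · exact u₁
      · simp [hz₁]
    · ext
      · exact u₂
      · simp [hz₂]
    · rintro l ⟨hl₁, hl₂⟩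
      have hu : l.fst = u := sq.hom_ext ((congrArg SemidirectHom.fst hl₁).trans u₁.symm)
        ((congrArg SemidirectHom.fst hl₂).trans u₂.symm)
      ext
      · exact hu
      · apply hz
        rw [← hu, ← hl₁, ← hl₂]
        simp
  choose l hl hl' using key
  exact ⟨⟨a'⟩, ⟨p', 0⟩, ⟨g', n⟩, ⟨⟨comm⟩, ⟨PullbackCone.IsLimit.mk comm l (fun s => (hl s).1)
    (fun s => (hl s).2) (fun s m h₁ h₂ => hl' s m ⟨h₁, h₂⟩)⟩⟩, hp'⟩

theorem exists_pushout {a b a' : Semidirect M.toBiadditiveFunctor} (i : a ⟶ b) (g : a ⟶ a')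
    (hi : ∃ (d : C) (q : b.of ⟶ d) (w : i.fst ≫ q = 0), conflation ⟨i.fst, q, w⟩) :
    ∃ (b' : _) (i' : a' ⟶ b') (g' : b ⟶ b'), IsPushout i g g' i' ∧
      ∃ (d : C) (q : b'.of ⟶ d) (w : i'.fst ≫ q = 0), conflation ⟨i'.fst, q, w⟩ := by
  obtain ⟨b', i', g', sq, hi'⟩ := inflation_pushout i.fst g.fst hi
  obtain ⟨n, hn⟩ : ∃ n : M.val b.of b', M.pull i.fst n = M.push i' g.snd - M.push g' i.snd := by
    obtain ⟨d, q, w, hq⟩ := hi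
    exact M.pull_surjective _ hq b' _
  have uniq := M.pushout_unique sq hi hi'
  have comm : i ≫ (⟨g', n⟩ : b ⟶ (⟨b'⟩ : Semidirect M.toBiadditiveFunctor)) =
      g ≫ (⟨i', 0⟩ : a' ⟶ (⟨b'⟩ : Semidirect M.toBiadditiveFunctor)) := by
    ext
    · exact sq.w
    · simp [hn]
  have key : ∀ s : PushoutCocone i g, ∃! l : (⟨b'⟩ : Semidirect M.toBiadditiveFunctor) ⟶ s.pt,
      (⟨g', n⟩ : b ⟶ (⟨b'⟩ : Semidirect M.toBiadditiveFunctor)) ≫ l = s.inl ∧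
      (⟨i', 0⟩ : a' ⟶ (⟨b'⟩ : Semidirect M.toBiadditiveFunctor)) ≫ l = s.inr := by
    intro s
    have h₁ : i.fst ≫ s.inl.fst = g.fst ≫ s.inr.fst := congrArg SemidirectHom.fst s.condition
    have h₂ : M.push s.inl.fst i.snd + M.pull i.fst s.inl.snd =
      M.push s.inr.fst g.snd + M.pull g.fst s.inr.snd := congrArg SemidirectHom.snd s.condition
    have u₁ := sq.inl_desc _ _ h₁
    have u₂ := sq.inr_desc _ _ h₁
    set u := sq.desc _ _ h₁
    obtain ⟨z, ⟨hz₁, hz₂⟩, hz⟩ := uniq s.pt.of (s.inl.snd - M.push u n) s.inr.snd (by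
      rw [map_sub, ← M.push_pull, hn, map_sub, ← M.push_comp, ← M.push_comp, u₁, u₂]
      rw [← sub_eq_zero] at h₂ ⊢
      rw [← h₂]; abel)
    refine ⟨⟨u, z⟩, ⟨?_, ?_⟩, ?_⟩
    · ext
      · exact u₁
      · simp [hz₁]
    · ext
      · exact u₂
      · simp [hz₂]
    · rintro l ⟨hl₁, hl₂⟩
      have hu : l.fst = u := sq.hom_ext ((congrArg SemidirectHom.fst hl₁).trans u₁.symm)
        ((congrArg SemidirectHom.fst hl₂).trans u₂.symm)
      ext
      · exact hu
      · apply hz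
        rw [← hu, ← hl₁, ← hl₂]
        simp
  choose l hl hl' using key
  exact ⟨⟨b'⟩, ⟨i', 0⟩, ⟨g', n⟩, ⟨⟨comm⟩, ⟨PushoutCocone.IsColimit.mk comm l (fun s => (hl s).1)
    (fun s => (hl s).2) (fun s m h₁ h₂ => hl' s m ⟨h₁, h₂⟩)⟩⟩, hi'⟩

instance : ExactCategory (Semidirect M.toBiadditiveFunctor) where
  zero := ⟨zero⟩
  isZero_zero := isZero_zero
  hasFiniteBiproducts := hasFiniteBiproducts
  conflation := IsConflation
  conflation_of_iso e h := conflation_of_iso ((proj M.toBiadditiveFunctor).mapShortComplex.mapIso e) h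
  kernel h := nonempty_isLimit h
  cokernel h := nonempty_isColimit h
  inflation_id a := (inflation_iff (𝟙 a)).2 (inflation_id a.of)
  deflation_id a := (deflation_iff (𝟙 a)).2 (deflation_id a.of)
  inflation_comp i j hi hj := (inflation_iff (i ≫ j)).2
    (inflation_comp i.fst j.fst ((inflation_iff i).1 hi) ((inflation_iff j).1 hj))
  deflation_comp p q hp hq := (deflation_iff (p ≫ q)).2
    (deflation_comp p.fst q.fst ((deflation_iff p).1 hp) ((deflation_iff q).1 hq))
  inflation_pushout i g hi := by
    obtain ⟨b', i', g', sq, h⟩ := exists_pushout i g ((inflation_iff i).1 hi)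
    exact ⟨b', i', g', sq, (inflation_iff i').2 h⟩
  deflation_pullback p g hp := by
    obtain ⟨a', p', g', sq, h⟩ := exists_pullback p g ((deflation_iff p).1 hp)
    exact ⟨a', p', g', sq, (deflation_iff p').2 h⟩

end Semidirect

/-! ### Symmetric spectra -/

/-- The permutation of `{0, …, n}` that fixes `0` and acts by `e` on `{1, …, n}`. -/
def consPerm {n : ℕ} (e : Equiv.Perm (Fin n)) : Equiv.Perm (Fin (n + 1)) where
  toFun := Fin.cases 0 (fun i => (e i).succ)
  invFun := Fin.cases 0 (fun i => (e.symm i).succ)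
  left_inv i := by induction i using Fin.cases <;> simp
  right_inv i := by induction i using Fin.cases <;> simp

/-- A symmetric spectrum of topological spaces: pointed spaces `X_n` with an action of `Σ_n` and
structure maps `σ : S¹ ∧ X_n → X_{1+n}` such that the iterates `S^p ∧ X_n → X_{p+n}` are
`Σ_p × Σ_n`-equivariant. The circle is `S¹ = I / ∂I`, so that `σ` is given as a map
`I × X_n → X_{1+n}` which collapses `∂I × X_n ∪ I × *`. The first coordinate of `{0, …, n}` is the
new one. As `Σ_p` is generated by the transpositions of neighbours, the iterates are equivariant as
soon as `σ` is `Σ_n`-equivariant and `σ²` is `Σ_2`-equivariant. -/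
structure SymmetricSpectrum where
  level : ℕ → Type u
  [topology : ∀ n, TopologicalSpace (level n)]
  [action : ∀ n, MulAction (Equiv.Perm (Fin n)) (level n)]
  pt : ∀ n, level n
  continuous_smul : ∀ n (e : Equiv.Perm (Fin n)), Continuous fun x : level n => e • x
  smul_pt : ∀ n (e : Equiv.Perm (Fin n)), e • pt n = pt n
  str : ∀ n, I → level n → level (n + 1)
  continuous_str : ∀ n, Continuous fun z : I × level n => str n z.1 z.2
  str_zero : ∀ n (x : level n), str n 0 x = pt (n + 1)
  str_one : ∀ n (x : level n), str n 1 x = pt (n + 1)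
  str_pt : ∀ n (s : I), str n s (pt n) = pt (n + 1)
  smul_str : ∀ n (e : Equiv.Perm (Fin n)) (s : I) (x : level n),
    consPerm e • str n s x = str n s (e • x)
  swap_str : ∀ n (s t : I) (x : level n),
    Equiv.swap (0 : Fin (n + 2)) 1 • str (n + 1) s (str n t x) = str (n + 1) t (str n s x)

namespace SymmetricSpectrum

attribute [instance] topology action

/-- Maps of symmetric spectra. -/
@[ext]
structure Hom (X Y : SymmetricSpectrum.{u}) where
  toFun : ∀ n, X.level n → Y.level n
  continuous_toFun : ∀ n, Continuous (toFun n)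
  map_pt : ∀ n, toFun n (X.pt n) = Y.pt n
  map_smul : ∀ n (e : Equiv.Perm (Fin n)) x, toFun n (e • x) = e • toFun n x
  map_str : ∀ n s x, toFun (n + 1) (X.str n s x) = Y.str n s (toFun n x)

instance : Category SymmetricSpectrum.{u} where
  Hom := Hom
  id X :=
    { toFun := fun _ x => x
      continuous_toFun := fun _ => continuous_id
      map_pt := fun _ => rfl
      map_smul := fun _ _ _ => rfl
      map_str := fun _ _ _ => rfl }
  comp f g :=
    { toFun := fun n x => g.toFun n (f.toFun n x)
      continuous_toFun := fun n => (g.continuous_toFun n).comp (f.continuous_toFun n)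
      map_pt := fun n => by rw [f.map_pt, g.map_pt]
      map_smul := fun n e x => by rw [f.map_smul, g.map_smul]
      map_str := fun n s x => by rw [f.map_str, g.map_str] }

/-- The suspension `Ω^m X_n → Ω^{1+m} X_{1+n}` of loops. -/
def suspLoop (X : SymmetricSpectrum.{u}) {n m : ℕ} (f : GenLoop (Fin m) (X.level n) (X.pt n)) :
    GenLoop (Fin (m + 1)) (X.level (n + 1)) (X.pt (n + 1)) :=
  ⟨⟨fun y => X.str n (y 0) (f fun i => y i.succ), by
    have h : Continuous fun y : Fin (m + 1) → I => (y 0, f fun i => y i.succ) :=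
      (continuous_apply 0).prodMk (f.1.continuous.comp
        (continuous_pi fun i => continuous_apply i.succ))
    exact (X.continuous_str n).comp h⟩, by
    rintro y ⟨i, hi⟩
    change X.str n (y 0) (f fun i => y i.succ) = _
    induction i using Fin.cases with
    | zero =>
      rcases hi with hi | hi
      · rw [hi, X.str_zero]
      · rw [hi, X.str_one]
    | succ i =>
      have : f (fun i => y i.succ) = X.pt n := f.2 _ ⟨i, hi⟩
      rw [this, X.str_pt]⟩

theorem suspLoop_homotopic (X : SymmetricSpectrum.{u}) {n m : ℕ}
    {f g : GenLoop (Fin m) (X.level n) (X.pt n)} (h : GenLoop.Homotopic f g) :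
    GenLoop.Homotopic (X.suspLoop f) (X.suspLoop g) := by
  obtain ⟨H⟩ := h
  refine ⟨⟨⟨⟨fun z => X.str n (z.2 0) (H (z.1, fun i => z.2 i.succ)), ?_⟩, ?_, ?_⟩, ?_⟩⟩
  · have h : Continuous fun z : I × (Fin (m + 1) → I) =>
        (z.2 0, H (z.1, fun i => z.2 i.succ)) :=
      ((continuous_apply 0).comp continuous_snd).prodMk (H.continuous.comp
        (continuous_fst.prodMk
          (continuous_pi fun i => (continuous_apply i.succ).comp continuous_snd)))
    exact (X.continuous_str n).comp h
  · intro y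
    exact congrArg (X.str n (y 0)) (H.map_zero_left _)
  · intro y
    exact congrArg (X.str n (y 0)) (H.map_one_left _)
  · rintro t y ⟨i, hi⟩
    induction i using Fin.cases with
    | zero =>
      change X.str n (y 0) _ = X.str n (y 0) _
      rcases hi with hi | hi
      · rw [hi, X.str_zero, X.str_zero]
      · rw [hi, X.str_one, X.str_one]
    | succ i =>
      change X.str n (y 0) _ = X.str n (y 0) _
      congr 1
      exact H.eq_fst t ⟨i, hi⟩

/-- The suspension `π_m(X_n) → π_{1+m}(X_{1+n})`. -/
def suspHomotopy (X : SymmetricSpectrum.{u}) (n m : ℕ) :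
    HomotopyGroup.Pi m (X.level n) (X.pt n) →
      HomotopyGroup.Pi (m + 1) (X.level (n + 1)) (X.pt (n + 1)) :=
  Quotient.map X.suspLoop fun _ _ h => X.suspLoop_homotopic h

/-- The elements of the groups `π_{k+n}(X_n)`, for all `n` with `k + n ≥ 0`. -/
abbrev PreStableHomotopy (X : SymmetricSpectrum.{u}) (k : ℤ) : Type u :=
  Σ (n : ℕ) (m : {m : ℕ // (m : ℤ) = k + n}), HomotopyGroup.Pi m.1 (X.level n) (X.pt n)

/-- The identification of elements of `π_{k+n}(X_n)` with their suspensions. -/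
inductive StableRel (X : SymmetricSpectrum.{u}) (k : ℤ) :
    X.PreStableHomotopy k → X.PreStableHomotopy k → Prop
  | susp (n m : ℕ) (h : (m : ℤ) = k + n) (h' : ((m + 1 : ℕ) : ℤ) = k + (n + 1 : ℕ))
      (a : HomotopyGroup.Pi m (X.level n) (X.pt n)) :
      StableRel X k ⟨n, ⟨m, h⟩, a⟩ ⟨n + 1, ⟨m + 1, h'⟩, X.suspHomotopy n m a⟩

/-- The stable homotopy group `π_k X = colim_n π_{k+n}(X_n)`, for `k : ℤ`. -/
def StableHomotopy (X : SymmetricSpectrum.{u}) (k : ℤ) : Type u := Quot (X.StableRel k)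

variable {X Y : SymmetricSpectrum.{u}}

/-- The map on loops induced by a map of symmetric spectra. -/
def Hom.mapLoop (f : X.Hom Y) {n m : ℕ} (a : GenLoop (Fin m) (X.level n) (X.pt n)) :
    GenLoop (Fin m) (Y.level n) (Y.pt n) :=
  ⟨⟨fun y => f.toFun n (a y), (f.continuous_toFun n).comp a.1.continuous⟩, fun y hy => by
    have : a y = X.pt n := a.2 y hy
    simp [this, f.map_pt]⟩

/-- The map on homotopy groups induced by a map of symmetric spectra. -/
def Hom.mapHomotopy (f : X.Hom Y) (n m : ℕ) :
    HomotopyGroup.Pi m (X.level n) (X.pt n) → HomotopyGroup.Pi m (Y.level n) (Y.pt n) :=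
  Quotient.map f.mapLoop fun _ _ h => h.comp_continuousMap ⟨f.toFun n, f.continuous_toFun n⟩

/-- The map on stable homotopy groups induced by a map of symmetric spectra. -/
def Hom.mapStableHomotopy (f : X.Hom Y) (k : ℤ) : X.StableHomotopy k → Y.StableHomotopy k :=
  Quot.map (fun a => ⟨a.1, a.2.1, f.mapHomotopy _ _ a.2.2⟩) (by
    rintro _ _ ⟨n, m, h, h', a⟩
    have : f.mapHomotopy (n + 1) (m + 1) (X.suspHomotopy n m a) =
        Y.suspHomotopy n m (f.mapHomotopy n m a) := by
      induction a using Quotient.inductionOn with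
      | h a =>
        refine congrArg (Quotient.mk _) ?_
        refine GenLoop.ext _ _ fun y => ?_
        exact f.map_str n (y 0) (a fun i => y i.succ)
    dsimp only
    rw [this]
    exact StableRel.susp n m h h' _)

/-- A map of symmetric spectra is an equivalence (a `π_*`-isomorphism) if it induces isomorphisms
on all stable homotopy groups. -/
def IsEquivalence (f : X ⟶ Y) : Prop :=
  ∀ k : ℤ, Function.Bijective (Hom.mapStableHomotopy f k)

/-- The levelwise homotopy fiber of a map `f : X ⟶ Y` of symmetric spectra. Its points in level `n`
are the pairs of a point `x` of `X_n` and a path in `Y_n` from the base point to `f(x)`. -/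
def hofib (f : X ⟶ Y) : SymmetricSpectrum.{u} where
  level n := {z : X.level n × C(I, Y.level n) // z.2 0 = Y.pt n ∧ z.2 1 = Hom.toFun f n z.1}
  action n :=
    { smul := fun e z => ⟨(e • z.1.1, ⟨fun t => e • z.1.2 t,
          (Y.continuous_smul n e).comp z.1.2.continuous⟩), by
        constructor
        · change e • z.1.2 0 = _
          rw [z.2.1, Y.smul_pt]
        · change e • z.1.2 1 = _
          rw [z.2.2, Hom.map_smul]⟩
      one_smul := fun z => Subtype.ext (Prod.ext (one_smul _ _)
        (ContinuousMap.ext fun t => one_smul _ (z.1.2 t)))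
      mul_smul := fun e e' z => Subtype.ext (Prod.ext (mul_smul e e' z.1.1)
        (ContinuousMap.ext fun t => mul_smul e e' (z.1.2 t))) }
  pt n := ⟨(X.pt n, ContinuousMap.const I (Y.pt n)), rfl, (Hom.map_pt f n).symm⟩
  continuous_smul n e := by
    refine Continuous.subtype_mk (Continuous.prodMk ?_ ?_) _
    · exact (X.continuous_smul n e).comp (continuous_fst.comp continuous_subtype_val)
    · exact (ContinuousMap.continuous_postcomp ⟨_, Y.continuous_smul n e⟩).comp
        (continuous_snd.comp continuous_subtype_val)
  smul_pt n e := Subtype.ext (Prod.ext (X.smul_pt n e)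
    (ContinuousMap.ext fun _ => Y.smul_pt n e))
  str n s z := ⟨(X.str n s z.1.1, ⟨fun t => Y.str n s (z.1.2 t), (Y.continuous_str n).comp
      (continuous_const.prodMk z.1.2.continuous)⟩), by
    constructor
    · change Y.str n s (z.1.2 0) = _
      rw [z.2.1, Y.str_pt]
    · change Y.str n s (z.1.2 1) = _
      rw [z.2.2, Hom.map_str]⟩
  continuous_str n := by
    refine Continuous.subtype_mk (Continuous.prodMk ?_ ?_) _
    · exact (X.continuous_str n).comp (continuous_fst.prodMk
        (continuous_fst.comp (continuous_subtype_val.comp continuous_snd)))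
    · refine ContinuousMap.continuous_of_continuous_uncurry _ ?_
      refine (Y.continuous_str n).comp (Continuous.prodMk (continuous_fst.comp continuous_fst) ?_)
      have : Continuous fun w : (I × {z : X.level n × C(I, Y.level n) //
          z.2 0 = Y.pt n ∧ z.2 1 = Hom.toFun f n z.1}) × I => (w.1.2.1.2, w.2) :=
        (continuous_snd.comp (continuous_subtype_val.comp
          (continuous_snd.comp continuous_fst))).prodMk continuous_snd
      exact ContinuousEval.continuous_eval.comp this
  str_zero n z := Subtype.ext (Prod.ext (X.str_zero n _)
    (ContinuousMap.ext fun _ => Y.str_zero n _))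
  str_one n z := Subtype.ext (Prod.ext (X.str_one n _)
    (ContinuousMap.ext fun _ => Y.str_one n _))
  str_pt n s := Subtype.ext (Prod.ext (X.str_pt n s)
    (ContinuousMap.ext fun _ => Y.str_pt n s))
  smul_str n e s z := Subtype.ext (Prod.ext (X.smul_str n e s _)
    (ContinuousMap.ext fun _ => Y.smul_str n e s _))
  swap_str n s t z := Subtype.ext (Prod.ext (X.swap_str n s t _)
    (ContinuousMap.ext fun _ => Y.swap_str n s t _))

/-- The homotopy fiber as a functor on maps of symmetric spectra. -/
def hofibFunctor : Arrow SymmetricSpectrum.{u} ⥤ SymmetricSpectrum.{u} where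
  obj f := hofib f.hom
  map {f g} φ :=
    { toFun := fun n z => ⟨(Hom.toFun φ.left n z.1.1,
          ⟨fun t => Hom.toFun φ.right n (z.1.2 t),
            (Hom.continuous_toFun φ.right n).comp z.1.2.continuous⟩), by
        constructor
        · change Hom.toFun φ.right n (z.1.2 0) = _
          rw [z.2.1, Hom.map_pt]
        · change Hom.toFun φ.right n (z.1.2 1) = _
          rw [z.2.2]
          exact (congrArg (fun h : f.left ⟶ g.right => Hom.toFun h n z.1.1) φ.w).symm⟩
      continuous_toFun := fun n => by
        refine Continuous.subtype_mk (Continuous.prodMk ?_ ?_) _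
        · exact (Hom.continuous_toFun φ.left n).comp (continuous_fst.comp continuous_subtype_val)
        · exact (ContinuousMap.continuous_postcomp ⟨_, Hom.continuous_toFun φ.right n⟩).comp
            (continuous_snd.comp continuous_subtype_val)
      map_pt := fun n => Subtype.ext (Prod.ext (Hom.map_pt φ.left n)
        (ContinuousMap.ext fun _ => Hom.map_pt φ.right n))
      map_smul := fun n e z => Subtype.ext (Prod.ext (Hom.map_smul φ.left n e _)
        (ContinuousMap.ext fun _ => Hom.map_smul φ.right n e _))
      map_str := fun n s z => Subtype.ext (Prod.ext (Hom.map_str φ.left n s _)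
        (ContinuousMap.ext fun _ => Hom.map_str φ.right n s _)) }

end SymmetricSpectrum

/-! ### Symmetric multisimplicial sets and their realization -/

/-- The isomorphism of ordered sets `[a] ≅ [b]` for `a = b`. -/
def castHom {a b : ℕ} (h : a = b) : Fin (a + 1) →o Fin (b + 1) :=
  ⟨Fin.cast (congrArg (· + 1) h), fun _ _ hij => hij⟩

/-- The multi-index `(1, p_1, …, p_n)`. -/
abbrev consOne {n : ℕ} (p : Fin n → ℕ) : Fin (n + 1) → ℕ := Fin.cons 1 p

theorem consOne_swap {n : ℕ} (p : Fin n → ℕ) (i : Fin (n + 2)) :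
    consOne (consOne p) (Equiv.swap 0 1 i) = consOne (consOne p) i := by
  induction i using Fin.cases with
  | zero => simp [consOne]
  | succ i =>
    induction i using Fin.cases with
    | zero => simp [consOne]
    | succ i =>
      rw [Equiv.swap_apply_of_ne_of_ne (Fin.succ_ne_zero _)]
      exact fun h => Fin.succ_ne_zero i (Fin.succ_injective _ h)

/-- A sequence of pointed `(n+1)`-simplicial sets `X_{p_1, …, p_n, q}`, for `n = 0, 1, …`, where
`Σ_n` permutes the first `n` simplicial directions, with suspension maps
`X_{p_1, …, p_n, q} → X_{1, p_1, …, p_n, q}`. A permutation `e` and monotone maps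
`f_i : [p'_{e(i)}] → [p_i]`, `g : [q'] → [q]` together induce a map `X_{p, q} → X_{p', q'}`. -/
structure SymmetricMultisimplicialSet where
  cell : ∀ {n : ℕ}, (Fin n → ℕ) → ℕ → Type u
  map : ∀ {n : ℕ} {p p' : Fin n → ℕ} {q q' : ℕ} (e : Equiv.Perm (Fin n))
    (_ : ∀ i, Fin (p' (e i) + 1) →o Fin (p i + 1)) (_ : Fin (q' + 1) →o Fin (q + 1)),
    cell p q → cell p' q'
  map_id : ∀ {n : ℕ} {p : Fin n → ℕ} {q : ℕ} (x : cell p q),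
    map 1 (fun _ => OrderHom.id) OrderHom.id x = x
  map_map : ∀ {n : ℕ} {p p' p'' : Fin n → ℕ} {q q' q'' : ℕ} (e e' : Equiv.Perm (Fin n))
    (f : ∀ i, Fin (p' (e i) + 1) →o Fin (p i + 1))
    (f' : ∀ i, Fin (p'' (e' i) + 1) →o Fin (p' i + 1))
    (g : Fin (q' + 1) →o Fin (q + 1)) (g' : Fin (q'' + 1) →o Fin (q' + 1)) (x : cell p q),
    map e' f' g' (map e f g x) =
      map (p' := p'') (e' * e) (fun i => (f i).comp (f' (e i))) (g.comp g') x
  pt : ∀ {n : ℕ} (p : Fin n → ℕ) (q : ℕ), cell p q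
  map_pt : ∀ {n : ℕ} {p p' : Fin n → ℕ} {q q' : ℕ} (e : Equiv.Perm (Fin n))
    (f : ∀ i, Fin (p' (e i) + 1) →o Fin (p i + 1)) (g : Fin (q' + 1) →o Fin (q + 1)),
    map e f g (pt p q) = pt p' q'
  susp : ∀ {n : ℕ} {p : Fin n → ℕ} {q : ℕ}, cell p q → cell (consOne p) q
  susp_pt : ∀ {n : ℕ} (p : Fin n → ℕ) (q : ℕ), susp (pt p q) = pt (consOne p) q
  susp_map : ∀ {n : ℕ} {p p' : Fin n → ℕ} {q q' : ℕ} (e : Equiv.Perm (Fin n))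
    (f : ∀ i, Fin (p' (e i) + 1) →o Fin (p i + 1)) (g : Fin (q' + 1) →o Fin (q + 1))
    (x : cell p q),
    susp (map e f g x) = map (p := consOne p) (p' := consOne p') (consPerm e)
      (Fin.cases (motive := fun i => Fin (consOne p' (consPerm e i) + 1) →o
        Fin (consOne p i + 1)) OrderHom.id f) g (susp x)
  /-- The faces of a suspension in the new direction are the base point. -/
  susp_face : ∀ {n : ℕ} {p : Fin n → ℕ} {p' : Fin (n + 1) → ℕ} {q q' : ℕ}
    (f : ∀ i, Fin (p' i + 1) →o Fin (consOne p i + 1)) (g : Fin (q' + 1) →o Fin (q + 1))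
    (_ : ∀ a b, f 0 a = f 0 b) (x : cell p q), map 1 f g (susp x) = pt p' q'
  swap_susp : ∀ {n : ℕ} {p : Fin n → ℕ} {q : ℕ} (x : cell p q),
    map (Equiv.swap 0 1) (fun i => castHom (consOne_swap p i)) OrderHom.id (susp (susp x)) =
      susp (susp x)

namespace SymmetricMultisimplicialSet

/-- Maps of symmetric multisimplicial sets. -/
@[ext]
structure Hom (X Y : SymmetricMultisimplicialSet.{u}) where
  toFun : ∀ {n : ℕ} (p : Fin n → ℕ) (q : ℕ), X.cell p q → Y.cell p q
  toFun_map : ∀ {n : ℕ} {p p' : Fin n → ℕ} {q q' : ℕ} (e : Equiv.Perm (Fin n))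
    (f : ∀ i, Fin (p' (e i) + 1) →o Fin (p i + 1)) (g : Fin (q' + 1) →o Fin (q + 1))
    (x : X.cell p q), toFun p' q' (X.map e f g x) = Y.map e f g (toFun p q x)
  toFun_pt : ∀ {n : ℕ} (p : Fin n → ℕ) (q : ℕ), toFun p q (X.pt p q) = Y.pt p q
  toFun_susp : ∀ {n : ℕ} {p : Fin n → ℕ} {q : ℕ} (x : X.cell p q),
    toFun _ q (X.susp x) = Y.susp (toFun p q x)

instance : Category SymmetricMultisimplicialSet.{u} where
  Hom := Hom
  id X :=
    { toFun := fun _ _ x => x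
      toFun_map := fun _ _ _ _ => rfl
      toFun_pt := fun _ _ => rfl
      toFun_susp := fun _ => rfl }
  comp F G :=
    { toFun := fun p q x => G.toFun p q (F.toFun p q x)
      toFun_map := fun e f g x => by rw [F.toFun_map, G.toFun_map]
      toFun_pt := fun p q => by rw [F.toFun_pt, G.toFun_pt]
      toFun_susp := fun x => by rw [F.toFun_susp, G.toFun_susp] }

variable (X : SymmetricMultisimplicialSet.{u})

/-- The simplicial structure maps. -/
def smap {n : ℕ} {p p' : Fin n → ℕ} {q q' : ℕ} (f : ∀ i, Fin (p' i + 1) →o Fin (p i + 1))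
    (g : Fin (q' + 1) →o Fin (q + 1)) (x : X.cell p q) : X.cell p' q' :=
  X.map 1 f g x

theorem smap_pt {n : ℕ} {p p' : Fin n → ℕ} {q q' : ℕ}
    (f : ∀ i, Fin (p' i + 1) →o Fin (p i + 1)) (g : Fin (q' + 1) →o Fin (q + 1)) :
    X.smap f g (X.pt p q) = X.pt p' q' :=
  X.map_pt 1 f g

theorem map_congr {n : ℕ} {p p' : Fin n → ℕ} {q q' : ℕ} {e e' : Equiv.Perm (Fin n)} (he : e = e')
    {f : ∀ i, Fin (p' (e i) + 1) →o Fin (p i + 1)} {f' : ∀ i, Fin (p' (e' i) + 1) →o Fin (p i + 1)}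
    (hf : ∀ i, f i ≍ f' i) (g : Fin (q' + 1) →o Fin (q + 1)) (x : X.cell p q) :
    X.map e f g x = X.map e' f' g x := by
  subst he
  obtain rfl : f = f' := funext fun i => eq_of_heq (hf i)
  rfl

theorem susp_smap {n : ℕ} {p p' : Fin n → ℕ} {q q' : ℕ}
    (f : ∀ i, Fin (p' i + 1) →o Fin (p i + 1)) (g : Fin (q' + 1) →o Fin (q + 1))
    (x : X.cell p q) :
    X.susp (X.smap f g x) = X.smap (p := consOne p) (p' := consOne p')
      (Fin.cases (motive := fun i => Fin (consOne p' i + 1) →o Fin (consOne p i + 1))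
        OrderHom.id f) g (X.susp x) := by
  refine (X.susp_map 1 f g x).trans (X.map_congr ?_ ?_ g _)
  · ext i
    induction i using Fin.cases <;> rfl
  · intro i
    induction i using Fin.cases <;> rfl

theorem susp_smap_face {n : ℕ} {p : Fin n → ℕ} {p' : Fin (n + 1) → ℕ} {q q' : ℕ}
    (f : ∀ i, Fin (p' i + 1) →o Fin (consOne p i + 1)) (g : Fin (q' + 1) →o Fin (q + 1))
    (h : ∀ a b, f 0 a = f 0 b) (x : X.cell p q) : X.smap f g (X.susp x) = X.pt p' q' :=
  X.susp_face f g h x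

/-- The disjoint union of the spaces `X_{p, q} × Δ^{p_1} × ⋯ × Δ^{p_n} × Δ^q`, where `X_{p, q}`
is discrete. -/
abbrev PreRealization (n : ℕ) : Type u :=
  Σ c : (Σ (p : Fin n → ℕ) (q : ℕ), X.cell p q),
    (∀ i, stdSimplex ℝ (Fin (c.1 i + 1))) × stdSimplex ℝ (Fin (c.2.1 + 1))

/-- The identification of `(f, g)^* x, t, u` with `x, f_* t, g_* u`. -/
inductive Glue (n : ℕ) : X.PreRealization n → X.PreRealization n → Prop
  | glue {p p' : Fin n → ℕ} {q q' : ℕ} (f : ∀ i, Fin (p' i + 1) →o Fin (p i + 1))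
      (g : Fin (q' + 1) →o Fin (q + 1)) (x : X.cell p q)
      (t : ∀ i, stdSimplex ℝ (Fin (p' i + 1))) (u : stdSimplex ℝ (Fin (q' + 1))) :
      Glue n ⟨⟨p', q', X.smap f g x⟩, t, u⟩
        ⟨⟨p, q, x⟩, fun i => stdSimplex.map (f i) (t i), stdSimplex.map g u⟩

/-- The geometric realization of an `(n+1)`-simplicial set. -/
def Realization (n : ℕ) : Type u := Quot (X.Glue n)

instance (n : ℕ) : TopologicalSpace (X.Realization n) :=
  inferInstanceAs (TopologicalSpace (Quot (X.Glue n)))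

variable {X} in
/-- The point of the realization with coordinates `t`, `u` in the cell `x`. -/
def point {n : ℕ} {p : Fin n → ℕ} {q : ℕ} (x : X.cell p q) (t : ∀ i, stdSimplex ℝ (Fin (p i + 1)))
    (u : stdSimplex ℝ (Fin (q + 1))) : X.Realization n :=
  Quot.mk _ ⟨⟨p, q, x⟩, t, u⟩

variable {X}

theorem point_smap {n : ℕ} {p p' : Fin n → ℕ} {q q' : ℕ} (f : ∀ i, Fin (p' i + 1) →o Fin (p i + 1))
    (g : Fin (q' + 1) →o Fin (q + 1)) (x : X.cell p q)
    (t : ∀ i, stdSimplex ℝ (Fin (p' i + 1))) (u : stdSimplex ℝ (Fin (q' + 1))) :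
    point (X.smap f g x) t u = point x (fun i => stdSimplex.map (f i) (t i)) (stdSimplex.map g u) :=
  Quot.sound (Glue.glue f g x t u)

theorem ind {n : ℕ} {P : X.Realization n → Prop}
    (h : ∀ {p : Fin n → ℕ} {q : ℕ} (x : X.cell p q) t u, P (point x t u)) (z : X.Realization n) :
    P z := by
  induction z using Quot.ind with
  | mk z =>
    obtain ⟨⟨p, q, x⟩, t, u⟩ := z
    exact h x t u

theorem continuous_point {n : ℕ} {p : Fin n → ℕ} {q : ℕ} (x : X.cell p q) :
    Continuous fun z : (∀ i, stdSimplex ℝ (Fin (p i + 1))) × stdSimplex ℝ (Fin (q + 1)) =>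
      point x z.1 z.2 := by
  have h : Continuous (Sigma.mk (β := fun c : (Σ (p : Fin n → ℕ) (q : ℕ), X.cell p q) =>
      (∀ i, stdSimplex ℝ (Fin (c.1 i + 1))) × stdSimplex ℝ (Fin (c.2.1 + 1))) ⟨p, q, x⟩) :=
    continuous_sigmaMk
  exact continuous_quot_mk.comp h

theorem continuous_of_point {n : ℕ} {Z : Type*} [TopologicalSpace Z] {F : X.Realization n → Z}
    (h : ∀ {p : Fin n → ℕ} {q : ℕ} (x : X.cell p q), Continuous fun z :
      (∀ i, stdSimplex ℝ (Fin (p i + 1))) × stdSimplex ℝ (Fin (q + 1)) => F (point x z.1 z.2)) :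
    Continuous F :=
  continuous_coinduced_dom.2 (continuous_sigma fun c => h c.2.2)

variable (X) in
/-- The base point of the realization. -/
def basePt (n : ℕ) : X.Realization n :=
  point (X.pt (fun _ => 0) 0) (fun _ => stdSimplex.vertex 0) (stdSimplex.vertex 0)

theorem stdSimplex_eq_vertex (s : stdSimplex ℝ (Fin (0 + 1))) : s = stdSimplex.vertex 0 := by
  ext i
  have h := stdSimplex.sum_eq_one s
  fin_cases i
  simp

theorem point_pt {n : ℕ} (p : Fin n → ℕ) (q : ℕ) (t : ∀ i, stdSimplex ℝ (Fin (p i + 1)))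
    (u : stdSimplex ℝ (Fin (q + 1))) : point (X.pt p q) t u = X.basePt n := by
  rw [← X.smap_pt (p := fun _ => 0) (q := 0) (fun _ => OrderHom.const _ 0) (OrderHom.const _ 0),
    point_smap]
  unfold basePt
  congr 1
  · funext i
    exact stdSimplex_eq_vertex _
  · exact stdSimplex_eq_vertex _

/-- The action of a permutation on cells. -/
def perm {n : ℕ} {p : Fin n → ℕ} {q : ℕ} (e : Equiv.Perm (Fin n)) (x : X.cell p q) :
    X.cell (fun i => p (e.symm i)) q :=
  X.map e (fun i => castHom (congrArg p (e.symm_apply_apply i))) OrderHom.id x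

theorem perm_smap {n : ℕ} {p p' : Fin n → ℕ} {q q' : ℕ} (e : Equiv.Perm (Fin n))
    (f : ∀ i, Fin (p' i + 1) →o Fin (p i + 1)) (g : Fin (q' + 1) →o Fin (q + 1))
    (x : X.cell p q) : perm e (X.smap f g x) =
      X.smap (fun i => f (e.symm i)) g (perm e x) := by
  refine (X.map_map (p'' := fun i => p' (e.symm i)) 1 e f _ g _ x).trans (Eq.trans ?_
    (X.map_map (p' := fun i => p (e.symm i)) (p'' := fun i => p' (e.symm i)) e 1
      (fun i => castHom (congrArg p (e.symm_apply_apply i))) (fun i => f (e.symm i))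
      OrderHom.id g x).symm)
  change X.map e _ _ x = X.map e _ _ x
  congr 1
  funext i
  ext a
  have : ∀ (j : Fin n) (h : j = i) (a : Fin (p' j + 1)), ((f i (castHom (congrArg p' h) a)) : ℕ) =
      castHom (congrArg p h) (f j a) := by
    rintro j rfl a
    rfl
  exact this _ (e.symm_apply_apply i) a

theorem perm_mul {n : ℕ} {p : Fin n → ℕ} {q : ℕ} (e e' : Equiv.Perm (Fin n)) (x : X.cell p q) :
    perm (e * e') x = perm e (perm e' x) :=
  (X.map_map (p' := fun i => p (e'.symm i)) (p'' := fun i => p (e'.symm (e.symm i))) e' e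
    (fun i => castHom (congrArg p (e'.symm_apply_apply i)))
    (fun i => castHom (congrArg (fun i => p (e'.symm i)) (e.symm_apply_apply i)))
    OrderHom.id OrderHom.id x).symm

theorem point_cast {n : ℕ} {p p' : Fin n → ℕ} {q : ℕ} (h : ∀ i, p' i = p i) {x : X.cell p q}
    {x' : X.cell p' q} (hx : x' = X.smap (fun i => castHom (h i)) OrderHom.id x)
    {t : ∀ i, stdSimplex ℝ (Fin (p i + 1))} {t' : ∀ i, stdSimplex ℝ (Fin (p' i + 1))}
    (ht : ∀ i, stdSimplex.map (castHom (h i)) (t' i) = t i) (u : stdSimplex ℝ (Fin (q + 1))) :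
    point x' t' u = point x t u := by
  rw [hx, point_smap, funext ht]
  exact congrArg (point x t) (stdSimplex.map_id_apply u)

theorem stdSimplex_map_castHom {n : ℕ} {p : Fin n → ℕ}
    (t : ∀ i, stdSimplex ℝ (Fin (p i + 1))) {i j : Fin n} (hij : i = j) (h : p i = p j) :
    stdSimplex.map (castHom h) (t i) = t j := by
  subst hij
  exact stdSimplex.map_id_apply _

/-- The action of a permutation on the realization: it permutes the simplicial directions. -/
def smul {n : ℕ} (e : Equiv.Perm (Fin n)) : X.Realization n → X.Realization n :=
  Quot.lift (fun z => point (perm e z.1.2.2) (fun i => z.2.1 (e.symm i)) z.2.2) (by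
    rintro _ _ ⟨f, g, x, t, u⟩
    dsimp only
    rw [perm_smap]
    exact point_smap _ _ _ _ _)

theorem smul_point {n : ℕ} {p : Fin n → ℕ} {q : ℕ} (e : Equiv.Perm (Fin n)) (x : X.cell p q)
    (t : ∀ i, stdSimplex ℝ (Fin (p i + 1))) (u : stdSimplex ℝ (Fin (q + 1))) :
    smul e (point x t u) = point (perm e x) (fun i => t (e.symm i)) u := rfl

instance (n : ℕ) : MulAction (Equiv.Perm (Fin n)) (X.Realization n) where
  smul := smul
  one_smul z := by
    induction z using ind with
    | h x t u =>
      change point (perm 1 x) _ u = point x t u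
      exact congrArg (fun y => point y t u) (X.map_id x)
  mul_smul e e' z := by
    induction z using ind with
    | h x t u =>
      change point (perm (e * e') x) _ u = point (perm e (perm e' x)) _ u
      rw [perm_mul]
      rfl

/-- The point `(1 - s, s)` of `Δ¹`. -/
def simplexPt (s : I) : stdSimplex ℝ (Fin (1 + 1)) := stdSimplexHomeomorphUnitInterval.symm s

theorem simplexPt_zero : simplexPt 0 = stdSimplex.vertex 0 :=
  (Homeomorph.symm_apply_eq _).2 stdSimplexHomeomorphUnitInterval_zero.symm

theorem simplexPt_one : simplexPt 1 = stdSimplex.vertex 1 :=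
  (Homeomorph.symm_apply_eq _).2 stdSimplexHomeomorphUnitInterval_one.symm

/-- The coordinates `(s, t_1, …, t_n)`. -/
abbrev consPt {n : ℕ} {p : Fin n → ℕ} (s : stdSimplex ℝ (Fin (1 + 1)))
    (t : ∀ i, stdSimplex ℝ (Fin (p i + 1))) :
    ∀ i, stdSimplex ℝ (Fin (consOne p i + 1)) :=
  Fin.cases (motive := fun i => stdSimplex ℝ (Fin (consOne p i + 1))) s t

/-- The structure map `I × X_n → X_{1+n}`, given by the inclusion
`Δ¹ × X_{p, q} → Δ¹ × X_{1, p, q}`. -/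
def str {n : ℕ} (s : I) : X.Realization n → X.Realization (n + 1) :=
  Quot.lift (fun z => point (X.susp z.1.2.2) (consPt (simplexPt s) z.2.1) z.2.2) (by
    rintro _ _ ⟨f, g, x, t, u⟩
    dsimp only
    rw [X.susp_smap]
    refine (point_smap _ _ _ _ _).trans ?_
    congr 1
    funext i
    induction i using Fin.cases with
    | zero => exact stdSimplex.map_id_apply _
    | succ i => rfl)

theorem str_point {n : ℕ} {p : Fin n → ℕ} {q : ℕ} (s : I) (x : X.cell p q)
    (t : ∀ i, stdSimplex ℝ (Fin (p i + 1))) (u : stdSimplex ℝ (Fin (q + 1))) :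
    str s (point x t u) = point (X.susp x) (consPt (simplexPt s) t) u := rfl

theorem str_vertex {n : ℕ} {p : Fin n → ℕ} {q : ℕ} (a : Fin (1 + 1)) (x : X.cell p q)
    (t : ∀ i, stdSimplex ℝ (Fin (p i + 1))) (u : stdSimplex ℝ (Fin (q + 1))) :
    point (X.susp x) (consPt (stdSimplex.vertex a) t) u = X.basePt (n + 1) := by
  let f : ∀ i, Fin ((Fin.cons 0 p : Fin (n + 1) → ℕ) i + 1) →o Fin (consOne p i + 1) :=
    Fin.cases (motive := fun i => Fin ((Fin.cons 0 p : Fin (n + 1) → ℕ) i + 1) →o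
      Fin (consOne p i + 1)) (OrderHom.const (Fin (0 + 1)) a) (fun i => OrderHom.id)
  have h := point_smap f OrderHom.id (X.susp x) (Fin.cases
    (motive := fun i => stdSimplex ℝ (Fin ((Fin.cons 0 p : Fin (n + 1) → ℕ) i + 1)))
    (stdSimplex.vertex (X := Fin (0 + 1)) 0 : stdSimplex ℝ (Fin (0 + 1))) t) u
  rw [X.susp_smap_face f OrderHom.id (fun _ _ => rfl) x, point_pt] at h
  rw [h]
  congr 1
  · funext i
    induction i using Fin.cases with
    | zero => exact (stdSimplex.map_vertex (S := ℝ)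
        (OrderHom.const (Fin (0 + 1)) a : Fin (0 + 1) → Fin (1 + 1)) 0).symm
    | succ i => exact (stdSimplex.map_id_apply _).symm
  · exact (stdSimplex.map_id_apply _).symm

theorem perm_susp {n : ℕ} {p : Fin n → ℕ} {q : ℕ} (e : Equiv.Perm (Fin n)) (x : X.cell p q)
    (h : ∀ i, consOne p ((consPerm e).symm i) = consOne (fun i => p (e.symm i)) i) :
    perm (consPerm e) (X.susp x) =
      X.smap (fun i => castHom (h i)) OrderHom.id (X.susp (perm e x)) := by
  unfold perm
  rw [X.susp_map]
  refine Eq.trans ?_ (X.map_map (p' := consOne (fun i => p (e.symm i)))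
    (p'' := fun i => consOne p ((consPerm e).symm i)) (consPerm e) 1
    (Fin.cases (motive := fun i => Fin (consOne (fun i => p (e.symm i)) (consPerm e i) + 1) →o
        Fin (consOne p i + 1)) OrderHom.id
        (fun i => castHom (congrArg p (e.symm_apply_apply i))))
    (fun i => castHom (h i)) OrderHom.id OrderHom.id (X.susp x)).symm
  change X.map (consPerm e) _ _ _ = X.map (consPerm e) _ _ _
  congr 1
  funext i
  induction i using Fin.cases <;> rfl

theorem perm_swap {n : ℕ} {p : Fin n → ℕ} {q : ℕ} (x : X.cell p q)
    (h : ∀ i, consOne (consOne p) ((Equiv.swap 0 1).symm i) = consOne (consOne p) i) :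
    perm (Equiv.swap 0 1) (X.susp (X.susp x)) =
      X.smap (fun i => castHom (h i)) OrderHom.id (X.susp (X.susp x)) := by
  conv_rhs => rw [← X.swap_susp]
  exact (X.map_map (p' := consOne (consOne p))
    (p'' := fun i => consOne (consOne p) ((Equiv.swap 0 1).symm i)) (Equiv.swap 0 1) 1
    (fun i => castHom (consOne_swap p i)) (fun i => castHom (h i))
    OrderHom.id OrderHom.id (X.susp (X.susp x))).symm

theorem continuous_str (n : ℕ) : Continuous fun z : I × X.Realization n => str z.1 z.2 := by
  have hs : Continuous simplexPt := stdSimplexHomeomorphUnitInterval.symm.continuous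
  have h₀ : ∀ z : X.Realization n, Continuous fun s : I => str s z := by
    intro z
    induction z using ind with
    | h x t u =>
      refine (continuous_point (X.susp x)).comp (g := fun z => point (X.susp x) z.1 z.2)
        (f := fun s => (consPt (simplexPt s) t, u)) ?_
      refine Continuous.prodMk (continuous_pi fun i => ?_) continuous_const
      induction i using Fin.cases with
      | zero => exact hs
      | succ i => exact continuous_const
  have h₁ : Continuous fun z : X.Realization n => (⟨fun s => str s z, h₀ z⟩ : C(I, _)) := by
    refine continuous_of_point fun x => ?_
    refine ContinuousMap.continuous_of_continuous_uncurry _ ?_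
    refine (continuous_point (X.susp x)).comp (g := fun z => point (X.susp x) z.1 z.2)
      (f := fun w : ((∀ i, stdSimplex ℝ (Fin (_ + 1))) × stdSimplex ℝ (Fin (_ + 1))) × I => (consPt (simplexPt w.2) w.1.1, w.1.2)) ?_
    refine Continuous.prodMk (continuous_pi fun i => ?_) (continuous_snd.comp continuous_fst)
    induction i using Fin.cases with
    | zero => exact hs.comp continuous_snd
    | succ i => exact (continuous_apply i).comp (continuous_fst.comp continuous_fst)
  exact (ContinuousMap.continuous_uncurry_of_continuous ⟨_, h₁⟩).comp continuous_swap

variable (X) in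
/-- The symmetric spectrum of realizations of a symmetric multisimplicial set. -/
def spectrum : SymmetricSpectrum.{u} where
  level n := X.Realization n
  pt n := X.basePt n
  continuous_smul n e := by
    refine continuous_of_point fun x => ?_
    refine (continuous_point (perm e x)).comp (g := fun z => point (perm e x) z.1 z.2)
      (f := fun z : ((∀ i, stdSimplex ℝ (Fin (_ + 1))) × stdSimplex ℝ (Fin (_ + 1))) =>
        (fun i => z.1 (e.symm i), z.2)) ?_
    exact Continuous.prodMk (continuous_pi fun i => (continuous_apply (e.symm i)).comp
      continuous_fst) continuous_snd
  smul_pt n e := by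
    change point (perm e _) _ _ = _
    rw [perm, X.map_pt, point_pt]
  str n s z := str s z
  continuous_str := continuous_str
  str_zero n z := by
    induction z using ind with
    | h x t u => rw [str_point, simplexPt_zero, str_vertex]
  str_one n z := by
    induction z using ind with
    | h x t u => rw [str_point, simplexPt_one, str_vertex]
  str_pt n s := by
    rw [basePt, str_point, X.susp_pt, point_pt]
  smul_str n e s z := by
    induction z using ind with
    | @h p q x t u =>
      change point (perm (consPerm e) (X.susp x)) _ u = point (X.susp (perm e x)) _ u
      have h : ∀ i, consOne p ((consPerm e).symm i) = consOne (fun i => p (e.symm i)) i := by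
        intro i
        induction i using Fin.cases <;> rfl
      refine point_cast h (perm_susp e x h) (fun i => ?_) u
      induction i using Fin.cases <;> exact stdSimplex.map_id_apply _
  swap_str n s t z := by
    induction z using ind with
    | @h p q x v u =>
      change point (perm (Equiv.swap 0 1) (X.susp (X.susp x))) _ u = point (X.susp (X.susp x)) _ u
      have h : ∀ i, consOne (consOne p) ((Equiv.swap 0 1).symm i) = consOne (consOne p) i :=
        consOne_swap p
      refine point_cast h (perm_swap x h) (fun i => ?_) u
      let w := consPt (simplexPt s) (consPt (simplexPt t) v)
      change stdSimplex.map (castHom (h i)) (w ((Equiv.swap 0 1).symm i)) = _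
      induction i using Fin.cases with
      | zero => exact stdSimplex_map_castHom w (j := (0 : Fin (n + 1)).succ) (by simp) _
      | succ i =>
        induction i using Fin.cases with
        | zero => exact stdSimplex_map_castHom w (j := 0) (by simp) _
        | succ i =>
          exact stdSimplex_map_castHom w (j := i.succ.succ) (Equiv.swap_apply_of_ne_of_ne
            (Fin.succ_ne_zero _) fun h => Fin.succ_ne_zero i (Fin.succ_injective _ h)) _

/-- The realization as a functor to symmetric spectra. -/
def realization : SymmetricMultisimplicialSet.{u} ⥤ SymmetricSpectrum.{u} where
  obj X := X.spectrum
  map {X Y} F :=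
    { toFun := fun n => Quot.lift
        (fun z => point (X := Y) (Hom.toFun F _ _ z.1.2.2) z.2.1 z.2.2) (by
          rintro _ _ ⟨f, g, x, t, u⟩
          refine Eq.trans ?_ (point_smap f g (Hom.toFun F _ _ x) t u)
          exact congrArg (fun y => point y t u) (Hom.toFun_map F 1 f g x))
      continuous_toFun := fun n => continuous_of_point fun x =>
        continuous_point (X := Y) (Hom.toFun F _ _ x)
      map_pt := fun n => by
        change point (X := Y) (Hom.toFun F _ _ (X.pt _ _)) _ _ = _
        rw [Hom.toFun_pt]
        rfl
      map_smul := fun n e z => by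
        induction z using ind with
        | h x t u => exact congrArg (fun y => point (X := Y) y _ u) (Hom.toFun_map F e _ _ x)
      map_str := fun n s z => by
        induction z using ind with
        | h x t u => exact congrArg (fun y => point (X := Y) y _ u) (Hom.toFun_susp F x) }
  map_id X := by
    refine SymmetricSpectrum.Hom.ext ?_
    funext n z
    induction z using ind with
    | h x t u => rfl
  map_comp F G := by
    refine SymmetricSpectrum.Hom.ext ?_
    funext n z
    induction z using ind with
    | h x t u => rfl

end SymmetricMultisimplicialSet

/-! ### The `S`-construction and `K`-theory -/

/-- The objects of the product of the categories `Cat([1], [p_i])`. -/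
@[ext]
structure MultiArrow {n : ℕ} (p : Fin n → ℕ) where
  arr : ∀ i, Fin 2 →o Fin (p i + 1)

namespace MultiArrow

variable {n : ℕ} {p p' : Fin n → ℕ}

instance : PartialOrder (MultiArrow p) := PartialOrder.lift arr fun _ _ => MultiArrow.ext

/-- The functor `∏ Cat([1], [p'_i]) ⥤ ∏ Cat([1], [p_i])` induced by a permutation and monotone
maps. -/
def reindex (e : Equiv.Perm (Fin n)) (f : ∀ i, Fin (p' (e i) + 1) →o Fin (p i + 1)) :
    MultiArrow p' ⥤ MultiArrow p where
  obj θ := ⟨fun i => (f i).comp (θ.arr (e i))⟩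
  map {θ θ'} h := homOfLE fun i a => (f i).monotone (leOfHom h (e i) a)

/-- Whether the component in `Cat([1], [1])` of an object is the identity `0 ⟶ 1`. -/
def head (θ : MultiArrow (consOne p)) : Bool := decide (θ.arr 0 0 ≠ θ.arr 0 1)

/-- The components of an object except for the new one. -/
def tail : MultiArrow (consOne p) ⥤ MultiArrow p where
  obj θ := ⟨fun i => θ.arr i.succ⟩
  map {θ θ'} h := homOfLE fun i a => leOfHom h i.succ a

theorem fin_aux (u₀ u₁ v₀ v₁ w₀ w₁ : Fin (1 + 1)) (b₁ : u₁ ≤ v₁) (b₂ : v₀ ≤ w₀)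
    (a₁ : u₀ ≤ u₁) (a₃ : w₀ ≤ w₁) (h₁ : u₀ ≠ u₁) (h₃ : w₀ ≠ w₁) : v₀ ≠ v₁ := by omega

theorem head_iff (θ : MultiArrow (consOne p)) :
    θ.head = true ↔ (θ.arr 0 0 : Fin (1 + 1)) ≠ θ.arr 0 1 := by
  simp [head]

theorem head_of_le {θ₁ θ₂ θ₃ : MultiArrow (consOne p)} (h : θ₁ ≤ θ₂) (h' : θ₂ ≤ θ₃)
    (h₁ : θ₁.head = true) (h₃ : θ₃.head = true) : θ₂.head = true :=
  θ₂.head_iff.2 (fin_aux _ _ _ _ _ _ (h 0 1) (h' 0 0) ((θ₁.arr 0).monotone (by decide))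
    ((θ₃.arr 0).monotone (by decide)) (θ₁.head_iff.1 h₁) (θ₃.head_iff.1 h₃))

theorem fin_aux' (a b c : Fin (1 + 1)) (hab : a ≤ b) (hbc : b ≤ c) :
    (decide (a ≠ b) = false ∧ decide (a ≠ c) = false ∧ decide (b ≠ c) = false) ∨
      (decide (a ≠ b) = false ∧ decide (a ≠ c) = true ∧ decide (b ≠ c) = true) ∨
      (decide (a ≠ b) = true ∧ decide (a ≠ c) = true ∧ decide (b ≠ c) = false) := by
  revert a b c
  decide

theorem head_cases {θ₁ θ₂ θ₃ : MultiArrow (consOne p)} (h₀ : θ₁.arr 0 0 = θ₂.arr 0 0)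
    (h₁ : θ₁.arr 0 1 = θ₃.arr 0 0) (h₂ : θ₂.arr 0 1 = θ₃.arr 0 1) :
    (θ₁.head = false ∧ θ₂.head = false ∧ θ₃.head = false) ∨
      (θ₁.head = false ∧ θ₂.head = true ∧ θ₃.head = true) ∨
      (θ₁.head = true ∧ θ₂.head = true ∧ θ₃.head = false) := by
  have := fin_aux' (θ₁.arr 0 0) (θ₁.arr 0 1) (θ₂.arr 0 1) ((θ₁.arr 0).monotone (by decide)) (by
    rw [h₁, h₂]
    exact (θ₃.arr 0).monotone (by decide))
  unfold head
  rw [← h₀, ← h₁, ← h₂]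
  exact this

end MultiArrow

section ZeroExtension

variable {C : Type u} [Category.{v} C] [Preadditive C] [ExactCategory C]

/-- The object `c` or zero. -/
def zext : Bool → C → C
  | true, c => c
  | false, _ => ExactCategory.zero

/-- The morphism `f` or zero. -/
def zmap : ∀ (b b' : Bool) {c c' : C}, (c ⟶ c') → (zext b c ⟶ zext b' c')
  | true, true, _, _, f => f
  | true, false, _, _, _ => 0
  | false, _, _, _, _ => 0

theorem zmap_id (b : Bool) (c : C) : zmap b b (𝟙 c) = 𝟙 (zext b c) := by
  cases b
  · exact ExactCategory.isZero_zero.eq_of_src _ _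
  · rfl

theorem zmap_comp {b b' b'' : Bool} (h : b = true → b'' = true → b' = true) {c c' c'' : C}
    (f : c ⟶ c') (g : c' ⟶ c'') : zmap b b' f ≫ zmap b' b'' g = zmap b b'' (f ≫ g) := by
  rcases b with _ | _
  · exact zero_comp
  · rcases b'' with _ | _
    · rcases b' with _ | _ <;> exact comp_zero
    · obtain rfl := h rfl rfl
      rfl

theorem conflation_zmap_const {b b' b'' : Bool} (e : b = b') (e' : b' = b'') {c₁ c₂ c₃ : C} {f : c₁ ⟶ c₂} {g : c₂ ⟶ c₃}
    (h : ∃ w, ExactCategory.conflation (ShortComplex.mk f g w)) :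
    ∃ w, ExactCategory.conflation (ShortComplex.mk (zmap b b' f) (zmap b' b'' g) w) := by
  subst e e'
  cases b
  · exact ExactCategory.conflation_id_right (isIso_of_isTerminal
      ExactCategory.isZero_zero.isTerminal ExactCategory.isZero_zero.isTerminal _)
  · exact h

theorem conflation_zmap {b₁ b₂ b₃ : Bool} (h : (b₁ = false ∧ b₂ = false ∧ b₃ = false) ∨
    (b₁ = false ∧ b₂ = true ∧ b₃ = true) ∨ (b₁ = true ∧ b₂ = true ∧ b₃ = false))
    {c₁ c₂ c₃ : C} {f : c₁ ⟶ c₂} {g : c₂ ⟶ c₃} (hf : IsIso f) (hg : IsIso g) :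
    ∃ w, ExactCategory.conflation (ShortComplex.mk (zmap b₁ b₂ f) (zmap b₂ b₃ g) w) := by
  rcases h with ⟨rfl, rfl, rfl⟩ | ⟨rfl, rfl, rfl⟩ | ⟨rfl, rfl, rfl⟩
  · exact ExactCategory.conflation_id_right (isIso_of_isTerminal
      ExactCategory.isZero_zero.isTerminal ExactCategory.isZero_zero.isTerminal _)
  · exact ExactCategory.conflation_id_right hg
  · exact ExactCategory.conflation_id_left hf

end ZeroExtension

section SConstruction

variable (C : Type u) [Category.{v} C] [Preadditive C] [ExactCategory C]

/-- The diagrams `X : ∏ Cat([1], [p_i]) ⥤ C` that are objects of `S_p C = S_{p_1} … S_{p_n} C`: in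
each variable, they vanish on identities, and the sequences
`X_{a ≤ b} ⟶ X_{a ≤ c} ⟶ X_{b ≤ c}` are exact for all `a ≤ b ≤ c`. -/
structure IsSDiagram {n : ℕ} {p : Fin n → ℕ} (X : MultiArrow p ⥤ C) : Prop where
  zero : ∀ (θ : MultiArrow p) (i : Fin n), θ.arr i 0 = θ.arr i 1 → X.obj θ = ExactCategory.zero
  exact : ∀ (i : Fin n) (θ₁ θ₂ θ₃ : MultiArrow p) (h : θ₁ ⟶ θ₂) (h' : θ₂ ⟶ θ₃),
    (∀ j, j ≠ i → θ₁.arr j = θ₂.arr j ∧ θ₂.arr j = θ₃.arr j) →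
    θ₁.arr i 0 = θ₂.arr i 0 → θ₁.arr i 1 = θ₃.arr i 0 → θ₂.arr i 1 = θ₃.arr i 1 →
    ∃ w, ExactCategory.conflation (ShortComplex.mk (X.map h) (X.map h') w)

/-- The category `S_p^{(n)} C`, for `p = (p_1, …, p_n)`. -/
abbrev SCat {n : ℕ} (p : Fin n → ℕ) :=
  ObjectProperty.FullSubcategory (fun X : MultiArrow p ⥤ C => IsSDiagram C X)

variable {C}

/-- The functor `S_p^{(n)} C ⥤ S_{p'}^{(n)} C` induced by a permutation and monotone maps. -/
def SCat.reindex {n : ℕ} {p p' : Fin n → ℕ} (e : Equiv.Perm (Fin n))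
    (f : ∀ i, Fin (p' (e i) + 1) →o Fin (p i + 1)) : SCat C p ⥤ SCat C p' where
  obj X := ⟨MultiArrow.reindex e f ⋙ X.obj, by
    constructor
    · intro θ i h
      obtain ⟨i, rfl⟩ := e.surjective i
      exact X.property.zero _ i (congrArg (f i) h)
    · intro i θ₁ θ₂ θ₃ h h' hj h₀ h₁ h₂
      obtain ⟨i, rfl⟩ := e.surjective i
      refine X.property.exact i _ _ _ _ _ (fun j hji => ?_) (congrArg (f i) h₀)
        (congrArg (f i) h₁) (congrArg (f i) h₂)
      obtain ⟨e₁, e₂⟩ := hj (e j) (fun he => hji (e.injective he))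
      exact ⟨congrArg (f j).comp e₁, congrArg (f j).comp e₂⟩⟩
  map α := ⟨Functor.whiskerLeft (MultiArrow.reindex e f) α.hom⟩

variable (C) in
/-- The zero diagram. -/
def SCat.zero {n : ℕ} (p : Fin n → ℕ) : SCat C p :=
  ⟨(Functor.const _).obj ExactCategory.zero, fun _ _ _ => rfl,
    fun _ _ _ _ _ _ _ _ _ _ => ExactCategory.conflation_id_right (by
      dsimp; infer_instance)⟩

/-- The inclusion `S_p^{(n)} C = S_{1, p}^{(n+1)} C`, which sends a diagram `X` to the diagram with
value `X` at the identity `0 ⟶ 1` in `Cat([1], [1])` and with value zero at the other two objects.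
-/
def SCat.susp {n : ℕ} {p : Fin n → ℕ} : SCat C p ⥤ SCat C (consOne p) where
  obj X := ⟨
    { obj := fun θ => zext θ.head (X.obj.obj (MultiArrow.tail.obj θ))
      map := fun {θ θ'} h => zmap θ.head θ'.head (X.obj.map (MultiArrow.tail.map h))
      map_id := fun θ => by rw [CategoryTheory.Functor.map_id, CategoryTheory.Functor.map_id, zmap_id]
      map_comp := fun h h' => by
        rw [zmap_comp (MultiArrow.head_of_le (leOfHom h) (leOfHom h')), Functor.map_comp,
          Functor.map_comp] }, by
    constructor
    · intro θ i h
      induction i using Fin.cases with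
      | zero =>
        have : θ.head = false := by simpa [MultiArrow.head] using h
        simp only [this]
        rfl
      | succ i =>
        have : X.obj.obj (MultiArrow.tail.obj θ) = ExactCategory.zero := X.property.zero _ i h
        dsimp only
        rw [this]
        cases θ.head <;> rfl
    · intro i θ₁ θ₂ θ₃ h h' hj h₀ h₁ h₂
      induction i using Fin.cases with
      | zero =>
        have t : MultiArrow.tail.obj θ₁ = MultiArrow.tail.obj θ₂ :=
          MultiArrow.ext (funext fun i => (hj i.succ (Fin.succ_ne_zero i)).1)
        have t' : MultiArrow.tail.obj θ₂ = MultiArrow.tail.obj θ₃ :=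
          MultiArrow.ext (funext fun i => (hj i.succ (Fin.succ_ne_zero i)).2)
        refine conflation_zmap ?_ ?_ ?_
        · exact MultiArrow.head_cases h₀ h₁ h₂
        · have : IsIso (MultiArrow.tail.map h) := ⟨eqToHom t.symm, rfl, rfl⟩
          exact Functor.map_isIso _ _
        · have : IsIso (MultiArrow.tail.map h') := ⟨eqToHom t'.symm, rfl, rfl⟩
          exact Functor.map_isIso _ _
      | succ i =>
        have b : θ₁.head = θ₂.head := by
          simp only [MultiArrow.head, (hj 0 (Fin.succ_ne_zero i).symm).1]
        have b' : θ₂.head = θ₃.head := by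
          simp only [MultiArrow.head, (hj 0 (Fin.succ_ne_zero i).symm).2]
        refine conflation_zmap_const b b' ?_
        exact X.property.exact i _ _ _ _ _ (fun j hji => hj j.succ
          fun he => hji (Fin.succ_injective _ he)) h₀ h₁ h₂⟩
  map {X Y} α := ⟨
    { app := fun θ => zmap θ.head θ.head (α.hom.app (MultiArrow.tail.obj θ))
      naturality := fun θ θ' h => by
        dsimp only
        rw [zmap_comp (by simp_all), zmap_comp (by simp_all), α.hom.naturality] }⟩
  map_id X := by
    ext θ
    exact zmap_id _ _
  map_comp α β := by
    ext θ
    exact (zmap_comp (by simp_all) _ _).symm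

end SConstruction

/-! ### The category of exact categories -/

/-- An exact functor between exact categories. It preserves the chosen zero objects. -/
structure ExactFunctor (C : Type u) [Category.{v} C] [Preadditive C] [ExactCategory C]
    (D : Type u) [Category.{v} D] [Preadditive D] [ExactCategory D] where
  functor : C ⥤ D
  additive : functor.Additive
  map_zero : functor.obj ExactCategory.zero = ExactCategory.zero
  map_conflation : ∀ S : ShortComplex C, ExactCategory.conflation S →
    ExactCategory.conflation (S.map functor)

theorem ExactFunctor.ext {C : Type u} [Category.{v} C] [Preadditive C] [ExactCategory C]
    {D : Type u} [Category.{v} D] [Preadditive D] [ExactCategory D] {F G : ExactFunctor C D}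
    (h : F.functor = G.functor) : F = G := by
  cases F; cases G
  cases h
  rfl

/-- The category of exact categories and exact functors: objects. -/
structure ExactCat where
  carrier : Type u
  [category : Category.{v} carrier]
  [preadditive : Preadditive carrier]
  [exact : ExactCategory carrier]

attribute [instance] ExactCat.category ExactCat.preadditive ExactCat.exact

instance : Category ExactCat.{v, u} where
  Hom C D := ExactFunctor C.carrier D.carrier
  id C :=
    { functor := 𝟭 C.carrier
      additive := inferInstance
      map_zero := rfl
      map_conflation := fun _ h => h }
  comp F G :=
    { functor := F.functor ⋙ G.functor
      additive := by
        have := F.additive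
        have := G.additive
        infer_instance
      map_zero := by
        rw [Functor.comp_obj, F.map_zero, G.map_zero]
      map_conflation := fun S h => by
        have := F.additive
        have := G.additive
        exact G.map_conflation _ (F.map_conflation S h) }

section

variable {C : Type u} [Category.{v} C] [Preadditive C] [ExactCategory C]

theorem zext_zext (b b' : Bool) (c : C) : zext b (zext b' c) = zext b' (zext b c) := by
  cases b <;> cases b' <;> rfl

theorem zmap_zmap (b₁ b₁' b₂ b₂' : Bool) {c c' : C} (f : c ⟶ c') :
    zmap b₁ b₁' (zmap b₂ b₂' f) ≍ zmap b₂ b₂' (zmap b₁ b₁' f) := by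
  cases b₁ <;> cases b₁' <;> cases b₂ <;> cases b₂' <;> rfl

theorem zmap_heq {b₁ b₁' b₂ b₂' : Bool} (h : b₁ = b₂) (h' : b₁' = b₂') {c c' d d' : C}
    {f : c ⟶ c'} {g : d ⟶ d'} (hc : c = d) (hc' : c' = d') (hf : f ≍ g) :
    zmap b₁ b₁' f ≍ zmap b₂ b₂' g := by
  subst h h' hc hc'
  obtain rfl := eq_of_heq hf
  rfl

theorem zero_heq {c c' d d' : C} {f : c ⟶ c'} {g : d ⟶ d'} (hc : c = d) (hc' : c' = d')
    (h : c = ExactCategory.zero) : f ≍ g := by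
  subst hc hc'
  subst h
  exact heq_of_eq (ExactCategory.isZero_zero.eq_of_src _ _)

theorem zero_heq_zero {c d d' : C} (h : d = d') : (0 : c ⟶ d) ≍ (0 : c ⟶ d') := by
  subst h
  rfl

theorem zext_zero (b : Bool) : zext b (ExactCategory.zero : C) = ExactCategory.zero := by
  cases b <;> rfl

theorem map_heq {J D : Type*} [PartialOrder J] [Category D] (X : J ⥤ D) {i j i' j' : J} (hi : i = i')
    (hj : j = j') (f : i ⟶ j) (g : i' ⟶ j') : X.map f ≍ X.map g := by
  subst hi hj
  obtain rfl : f = g := Subsingleton.elim _ _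
  rfl

theorem MultiArrow.castHom_arr {n : ℕ} {p : Fin n → ℕ} (θ : MultiArrow p) {i j : Fin n}
    (hij : i = j) (h : p i = p j) : (castHom h).comp (θ.arr i) = θ.arr j := by
  subst hij
  rfl

/-- The functor that exchanges the first two components. -/
abbrev MultiArrow.swap {n : ℕ} (p : Fin n → ℕ) :
    MultiArrow (consOne (consOne p)) ⥤ MultiArrow (consOne (consOne p)) :=
  MultiArrow.reindex (Equiv.swap 0 1) (fun i => castHom (consOne_swap p i))

section

variable {n : ℕ} {p : Fin n → ℕ} (θ : MultiArrow (consOne (consOne p)))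

theorem MultiArrow.swap_zero : ((MultiArrow.swap p).obj θ).arr 0 = θ.arr (0 : Fin (n + 1)).succ :=
  MultiArrow.castHom_arr θ (j := (0 : Fin (n + 1)).succ) (by simp) (consOne_swap p 0)

theorem MultiArrow.swap_one : ((MultiArrow.swap p).obj θ).arr (0 : Fin (n + 1)).succ = θ.arr 0 :=
  MultiArrow.castHom_arr θ (j := 0) (by simp) (consOne_swap p (0 : Fin (n + 1)).succ)

theorem MultiArrow.head_swap :
    ((MultiArrow.swap p).obj θ).head = (MultiArrow.tail.obj θ).head := by
  unfold MultiArrow.head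
  rw [MultiArrow.swap_zero]
  rfl

theorem MultiArrow.head_tail_swap :
    (MultiArrow.tail.obj ((MultiArrow.swap p).obj θ)).head = θ.head := by
  change decide (((MultiArrow.swap p).obj θ).arr (0 : Fin (n + 1)).succ 0 ≠
    ((MultiArrow.swap p).obj θ).arr (0 : Fin (n + 1)).succ 1) = _
  rw [MultiArrow.swap_one]
  rfl

theorem MultiArrow.tail_tail_swap :
    MultiArrow.tail.obj (MultiArrow.tail.obj ((MultiArrow.swap p).obj θ)) =
      MultiArrow.tail.obj (MultiArrow.tail.obj θ) := by
  ext i : 2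
  exact MultiArrow.castHom_arr θ (i := Equiv.swap 0 1 i.succ.succ) (j := i.succ.succ)
    (Equiv.swap_apply_of_ne_of_ne (Fin.succ_ne_zero _)
      fun h => Fin.succ_ne_zero i (Fin.succ_injective _ h)) (consOne_swap p i.succ.succ)

end

theorem SCat.ext {n : ℕ} {p : Fin n → ℕ} {X Y : SCat C p}
    (h : ∀ θ, X.obj.obj θ = Y.obj.obj θ)
    (h' : ∀ (θ θ' : MultiArrow p) (a : θ ⟶ θ'), X.obj.map a ≍ Y.obj.map a) : X = Y :=
  ObjectProperty.FullSubcategory.ext (Functor.hext h h')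

theorem SCat.swap_susp {n : ℕ} {p : Fin n → ℕ} (X : SCat C p) :
    (SCat.reindex (Equiv.swap 0 1) (fun i => castHom (consOne_swap p i))).obj
      (SCat.susp.obj (SCat.susp.obj X)) = SCat.susp.obj (SCat.susp.obj X) := by
  refine SCat.ext (fun θ => ?_) (fun θ θ' a => ?_)
  · change zext ((MultiArrow.swap p).obj θ).head
      (zext (MultiArrow.tail.obj ((MultiArrow.swap p).obj θ)).head (X.obj.obj
        (MultiArrow.tail.obj (MultiArrow.tail.obj ((MultiArrow.swap p).obj θ))))) = _
    rw [MultiArrow.head_swap, MultiArrow.head_tail_swap, MultiArrow.tail_tail_swap, zext_zext]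
    rfl
  · refine HEq.trans ?_ (zmap_zmap _ _ _ _ _)
    refine zmap_heq (MultiArrow.head_swap θ) (MultiArrow.head_swap θ') ?_ ?_ ?_
    · exact congrArg₂ (fun b j => zext b (X.obj.obj j)) (MultiArrow.head_tail_swap θ)
        (MultiArrow.tail_tail_swap θ)
    · exact congrArg₂ (fun b j => zext b (X.obj.obj j)) (MultiArrow.head_tail_swap θ')
        (MultiArrow.tail_tail_swap θ')
    · refine zmap_heq (MultiArrow.head_tail_swap θ) (MultiArrow.head_tail_swap θ')
        (congrArg _ (MultiArrow.tail_tail_swap θ)) (congrArg _ (MultiArrow.tail_tail_swap θ')) ?_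
      exact map_heq X.obj (MultiArrow.tail_tail_swap θ) (MultiArrow.tail_tail_swap θ') _ _

theorem SCat.susp_zero {n : ℕ} (p : Fin n → ℕ) :
    SCat.susp.obj (SCat.zero C p) = SCat.zero C (consOne p) :=
  SCat.ext (fun _ => zext_zero _) (fun _ _ _ => zero_heq (zext_zero _) (zext_zero _) (zext_zero _))

theorem MultiArrow.head_face {n : ℕ} {p : Fin n → ℕ} {p' : Fin (n + 1) → ℕ}
    (f : ∀ i, Fin (p' i + 1) →o Fin (consOne p i + 1)) (h : ∀ a b, f 0 a = f 0 b)
    (θ : MultiArrow p') : ((MultiArrow.reindex 1 f).obj θ).head = false :=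
  decide_eq_false (not_not.2 (h (θ.arr 0 0) (θ.arr 0 1)))

theorem SCat.susp_face {n : ℕ} {p : Fin n → ℕ} {p' : Fin (n + 1) → ℕ}
    (f : ∀ i, Fin (p' i + 1) →o Fin (consOne p i + 1)) (h : ∀ a b, f 0 a = f 0 b)
    (X : SCat C p) : (SCat.reindex 1 f).obj (SCat.susp.obj X) = SCat.zero C p' := by
  have e : ∀ θ, zext ((MultiArrow.reindex 1 f).obj θ).head (X.obj.obj (MultiArrow.tail.obj
      ((MultiArrow.reindex 1 f).obj θ))) = ExactCategory.zero := fun θ => by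
    rw [MultiArrow.head_face f h]
    rfl
  exact SCat.ext e (fun θ θ' _ => zero_heq (e θ) (e θ') (e θ))

theorem coreHom_heq {n : ℕ} {p : Fin n → ℕ} {X X' Y Y' : Core (SCat C p)} (hX : X = X')
    (hY : Y = Y') {α : X ⟶ Y} {β : X' ⟶ Y'}
    (h : ∀ θ, α.iso.hom.hom.app θ ≍ β.iso.hom.hom.app θ) : α ≍ β := by
  subst hX hY
  refine heq_of_eq (Core.hom_ext (ObjectProperty.hom_ext _ ?_))
  ext θ
  exact eq_of_heq (h θ)

theorem chain_ext {n : ℕ} {p : Fin n → ℕ} {q : ℕ} {Y Y' : Fin (q + 1) ⥤ Core (SCat C p)}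
    (h : ∀ j, (Y.obj j).of = (Y'.obj j).of)
    (h' : ∀ (j j' : Fin (q + 1)) (a : j ⟶ j') (θ : MultiArrow p),
      (Y.map a).iso.hom.hom.app θ ≍ (Y'.map a).iso.hom.hom.app θ) : Y = Y' := by
  have e : ∀ j, Y.obj j = Y'.obj j := fun j => by
    have := h j
    cases hY : Y.obj j
    cases hY' : Y'.obj j
    rw [hY, hY'] at this
    exact congrArg Core.mk this
  exact Functor.hext e fun j j' a => coreHom_heq (e j) (e j') (h' j j' a)

end

/-- The functor on `S`-constructions induced by an exact functor. -/
def SCat.mapExact {C : Type u} [Category.{v} C] [Preadditive C] [ExactCategory C] {D : Type u}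
    [Category.{v} D] [Preadditive D] [ExactCategory D] (F : ExactFunctor C D) {n : ℕ}
    (p : Fin n → ℕ) : SCat C p ⥤ SCat D p where
  obj X := ⟨X.obj ⋙ F.functor, by
    constructor
    · intro θ i h
      rw [Functor.comp_obj, X.property.zero θ i h, F.map_zero]
    · intro i θ₁ θ₂ θ₃ h h' hj h₀ h₁ h₂
      obtain ⟨w, hw⟩ := X.property.exact i θ₁ θ₂ θ₃ h h' hj h₀ h₁ h₂
      have := F.additive
      exact ⟨_, F.map_conflation _ hw⟩⟩
  map α := ⟨Functor.whiskerRight α.hom F.functor⟩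

section

variable {C : Type u} [Category.{v} C] [Preadditive C] [ExactCategory C] {D : Type u}
  [Category.{v} D] [Preadditive D] [ExactCategory D] (F : ExactFunctor C D)

theorem ExactFunctor.zext (b : Bool) (c : C) :
    F.functor.obj (zext b c) = SplitK.zext b (F.functor.obj c) := by
  cases b
  · exact F.map_zero
  · rfl

theorem ExactFunctor.zmap (b b' : Bool) {c c' : C} (f : c ⟶ c') :
    F.functor.map (zmap b b' f) ≍ SplitK.zmap b b' (F.functor.map f) := by
  have := F.additive
  rcases b with _ | _
  · exact zero_heq F.map_zero (F.zext _ _) F.map_zero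
  · rcases b' with _ | _
    · change F.functor.map 0 ≍ (0 : F.functor.obj c ⟶ ExactCategory.zero)
      rw [Functor.map_zero]
      exact zero_heq_zero F.map_zero
    · rfl

theorem SCat.mapExact_zero {n : ℕ} (p : Fin n → ℕ) :
    (SCat.mapExact F p).obj (SCat.zero C p) = SCat.zero D p :=
  SCat.ext (fun _ => F.map_zero) (fun _ _ _ => zero_heq F.map_zero F.map_zero F.map_zero)

theorem SCat.mapExact_susp {n : ℕ} {p : Fin n → ℕ} (X : SCat C p) :
    (SCat.mapExact F (consOne p)).obj (SCat.susp.obj X) =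
      SCat.susp.obj ((SCat.mapExact F p).obj X) :=
  SCat.ext (fun _ => F.zext _ _) (fun _ _ _ => F.zmap _ _ _)

end

/-! ### The `K`-theory spectrum -/

section

variable (C : Type u) [Category.{v} C] [Preadditive C] [ExactCategory C]

/-- The multisimplicial sets `N_• i S^{(n)}_• C`, where `i S^{(n)}_p C` is the groupoid of
isomorphisms of `S^{(n)}_p C` and `N_q` are the `q`-simplices of the nerve. -/
def nerveS : SymmetricMultisimplicialSet.{max u v} where
  cell p q := Fin (q + 1) ⥤ Core (SCat C p)
  map e f g Y := g.monotone.functor ⋙ Y ⋙ (SCat.reindex e f).core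
  map_id Y := rfl
  map_map e e' f f' g g' Y := rfl
  pt p q := (Functor.const _).obj ⟨SCat.zero C p⟩
  map_pt e f g := chain_ext (fun _ => rfl) (fun _ _ _ _ => HEq.rfl)
  susp Y := Y ⋙ SCat.susp.core
  susp_pt p q := chain_ext (fun _ => SCat.susp_zero p)
    (fun _ _ _ _ => zero_heq (zext_zero _) (zext_zero _) (zext_zero _))
  susp_map e f g Y := rfl
  susp_face f g h Y := by
    refine chain_ext (fun _ => SCat.susp_face f h _) (fun j j' a θ => ?_)
    have e : ∀ X : SCat C _, ((SCat.reindex 1 f).obj (SCat.susp.obj X)).obj.obj θ =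
        ExactCategory.zero := fun X => by
      rw [SCat.susp_face f h X]
      rfl
    exact zero_heq (e _) (e _) (e _)
  swap_susp Y := by
    refine chain_ext (fun _ => SCat.swap_susp _) (fun j j' a θ => ?_)
    refine HEq.trans ?_ (zmap_zmap _ _ _ _ _)
    refine zmap_heq (MultiArrow.head_swap θ) (MultiArrow.head_swap θ) ?_ ?_ ?_
    · exact congrArg₂ (fun b j => zext b (((Y.obj _).of.obj).obj j))
        (MultiArrow.head_tail_swap θ) (MultiArrow.tail_tail_swap θ)
    · exact congrArg₂ (fun b j => zext b (((Y.obj _).of.obj).obj j))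
        (MultiArrow.head_tail_swap θ) (MultiArrow.tail_tail_swap θ)
    · refine zmap_heq (MultiArrow.head_tail_swap θ) (MultiArrow.head_tail_swap θ)
        (congrArg _ (MultiArrow.tail_tail_swap θ)) (congrArg _ (MultiArrow.tail_tail_swap θ)) ?_
      have := MultiArrow.tail_tail_swap θ
      generalize MultiArrow.tail.obj (MultiArrow.tail.obj θ) = t at *
      subst this
      rfl

end

/-- The functor `N_• i S^{(n)}_•`. -/
def nerveSFunctor : ExactCat.{v, u} ⥤ SymmetricMultisimplicialSet.{max u v} where
  obj C := nerveS C.carrier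
  map F :=
    { toFun := fun p _ Y => Y ⋙ (SCat.mapExact F p).core
      toFun_map := fun _ _ _ _ => rfl
      toFun_pt := fun p _ => chain_ext (fun _ => SCat.mapExact_zero F p)
        (fun _ _ _ _ => zero_heq F.map_zero F.map_zero F.map_zero)
      toFun_susp := fun _ => chain_ext (fun _ => SCat.mapExact_susp F _)
        (fun _ _ _ _ => F.zmap _ _ _) }
  map_id _ := rfl
  map_comp _ _ := rfl

/-- The `K`-theory spectrum `K(C)`, with `K(C)_n` the realization of `N_• i S^{(n)}_• C`. -/
def K : ExactCat.{v, u} ⥤ SymmetricSpectrum.{max u v} :=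
  nerveSFunctor ⋙ SymmetricMultisimplicialSet.realization

/-! ### The reduced model `K̃(C; M)` -/

section

variable {C : Type u} [Category.{v} C] [Preadditive C] [ExactCategory C]

/-- The abelian group `S^{(n)}_p M(X, Y)` of families `m_θ ∈ M(X_θ, Y_θ)` with
`X(a)^* m_θ = Y(a)_* m_ρ` in `M(X_ρ, Y_θ)` for all `a : ρ ⟶ θ`. -/
def SBimod (M : BiadditiveFunctor C) {n : ℕ} {p : Fin n → ℕ} (X Y : SCat C p) :
    AddSubgroup (∀ θ, M.val (X.obj.obj θ) (Y.obj.obj θ)) where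
  carrier := {m | ∀ (ρ θ : MultiArrow p) (a : ρ ⟶ θ),
    M.pull (X.obj.map a) (m θ) = M.push (Y.obj.map a) (m ρ)}
  zero_mem' := by
    intro ρ θ a
    simp
  add_mem' := by
    intro m m' h h' ρ θ a
    simp [h ρ θ a, h' ρ θ a]
  neg_mem' := by
    intro m h ρ θ a
    simp [h ρ θ a]

/-- The simplicial structure maps of `S^{(n)}_• M`, together with the permutations. -/
def SBimod.reindex (M : BiadditiveFunctor C) {n : ℕ} {p p' : Fin n → ℕ} (e : Equiv.Perm (Fin n))
    (f : ∀ i, Fin (p' (e i) + 1) →o Fin (p i + 1)) (X : SCat C p) :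
    SBimod M X X →+ SBimod M ((SCat.reindex e f).obj X) ((SCat.reindex e f).obj X) where
  toFun m := ⟨fun θ => m.1 ((MultiArrow.reindex e f).obj θ), fun _ _ a =>
    m.2 _ _ ((MultiArrow.reindex e f).map a)⟩
  map_zero' := rfl
  map_add' _ _ := rfl

/-- The element `m` of `M(c, c)`, or zero. -/
def zelt (M : BiadditiveFunctor C) : ∀ (b : Bool) {c c' : C}, M.val c c' →+
    M.val (zext b c) (zext b c')
  | true, _, _ => AddMonoidHom.id _
  | false, _, _ => 0

theorem zelt_compat (M : BiadditiveFunctor C) (b b' : Bool) {c c' d d' : C} (f : c ⟶ c')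
    (g : d ⟶ d') {m : M.val c' d'} {m' : M.val c d} (h : M.pull f m = M.push g m') :
    M.pull (zmap b b' f) (zelt M b' m) = M.push (zmap b b' g) (zelt M b m') := by
  rcases b with _ | _ <;> rcases b' with _ | _
  · exact (M.zero_pull _).trans (M.zero_push _).symm
  · exact (M.zero_pull _).trans (M.zero_push _).symm
  · exact (M.zero_pull _).trans (M.zero_push _).symm
  · exact h

/-- The identification of `S^{(n)}_p M` with `S^{(n+1)}_{1, p} M`. -/
def SBimod.susp (M : BiadditiveFunctor C) {n : ℕ} {p : Fin n → ℕ} (X : SCat C p) :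
    SBimod M X X →+ SBimod M (SCat.susp.obj X) (SCat.susp.obj X) where
  toFun m := ⟨fun θ => zelt M θ.head (m.1 (MultiArrow.tail.obj θ)), fun ρ θ a =>
    zelt_compat M _ _ _ _ (m.2 _ _ (MultiArrow.tail.map a))⟩
  map_zero' := Subtype.ext (funext fun _ => map_zero _)
  map_add' _ _ := Subtype.ext (funext fun _ => map_add _ _ _)

/-- The disjoint union over all objects `X` of `S^{(n)}_p C` of the `q`-simplices of the classifying
space of the group `S^{(n)}_p M(X, X)`, that is, of the nerve of this group as a category with one
object. -/
abbrev Coprod (M : BiadditiveFunctor C) {n : ℕ} (p : Fin n → ℕ) (q : ℕ) : Type (max u v) :=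
  Σ X : SCat C p, Fin (q + 1) ⥤ SingleObj (Multiplicative (SBimod M X X))

/-- The element of the group that a simplex of its classifying space assigns to `j ≤ j'`. -/
def Coprod.elt {M : BiadditiveFunctor C} {n : ℕ} {p : Fin n → ℕ} {q : ℕ} (c : Coprod M p q)
    {j j' : Fin (q + 1)} (a : j ⟶ j') : SBimod M c.1 c.1 :=
  Multiplicative.toAdd (c.2.map a : Multiplicative (SBimod M c.1 c.1))

/-- Whether a simplex is the base point of the classifying space of its group. -/
def Coprod.IsBase {M : BiadditiveFunctor C} {n : ℕ} {p : Fin n → ℕ} {q : ℕ}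
    (c : Coprod M p q) : Prop :=
  ∀ (j j' : Fin (q + 1)) (a : j ⟶ j'), c.elt a = 0

/-- The map of simplices induced by a map `Φ` on objects, a family `φ` of homomorphisms of groups and
a monotone map `g`. -/
def Coprod.map {M : BiadditiveFunctor C} {D : Type u} [Category.{v} D] [Preadditive D]
    [ExactCategory D] {M' : BiadditiveFunctor D} {n n' : ℕ} {p : Fin n → ℕ} {p' : Fin n' → ℕ}
    {q q' : ℕ} (Φ : SCat C p → SCat D p')
    (φ : ∀ X, SBimod M X X →+ SBimod M' (Φ X) (Φ X)) (g : Fin (q' + 1) →o Fin (q + 1))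
    (c : Coprod M p q) : Coprod M' p' q' :=
  ⟨Φ c.1, g.monotone.functor ⋙ c.2 ⋙ (AddMonoidHom.toMultiplicative (φ c.1)).toFunctor⟩

theorem Coprod.IsBase.map {M : BiadditiveFunctor C} {D : Type u} [Category.{v} D] [Preadditive D]
    [ExactCategory D] {M' : BiadditiveFunctor D} {n n' : ℕ} {p : Fin n → ℕ} {p' : Fin n' → ℕ}
    {q q' : ℕ} (Φ : SCat C p → SCat D p')
    (φ : ∀ X, SBimod M X X →+ SBimod M' (Φ X) (Φ X)) (g : Fin (q' + 1) →o Fin (q + 1))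
    {c : Coprod M p q} (hc : c.IsBase) : (Coprod.map Φ φ g c).IsBase := fun _ _ a => by
  change φ c.1 (c.elt (g.monotone.functor.map a)) = 0
  rw [hc, map_zero]

theorem Coprod.ext {M : BiadditiveFunctor C} {n : ℕ} {p : Fin n → ℕ} {q : ℕ}
    {c c' : Coprod M p q} (h : c.1 = c'.1)
    (h' : ∀ (j j' : Fin (q + 1)) (a : j ⟶ j') θ, (c.elt a).1 θ ≍ (c'.elt a).1 θ) : c = c' := by
  obtain ⟨X, c⟩ := c
  obtain ⟨X', c'⟩ := c'
  subst h
  have : c = c' := by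
    refine Functor.hext (fun _ => rfl) (fun j j' a => heq_of_eq ?_)
    exact Subtype.ext (funext fun θ => eq_of_heq (h' j j' a θ))
  rw [this]

/-- All base points are identified. -/
def wedgeSetoid (M : BiadditiveFunctor C) {n : ℕ} (p : Fin n → ℕ) (q : ℕ) :
    Setoid (Coprod M p q) where
  r c c' := c = c' ∨ (c.IsBase ∧ c'.IsBase)
  iseqv :=
    { refl := fun _ => Or.inl rfl
      symm := by
        rintro c c' (h | h)
        · exact Or.inl h.symm
        · exact Or.inr h.symm
      trans := by
        rintro c c' c'' (rfl | h) (rfl | h')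
        · exact Or.inl rfl
        · exact Or.inr h'
        · exact Or.inr h
        · exact Or.inr ⟨h.1, h'.2⟩ }

/-- The `q`-simplices of the wedge of the classifying spaces of the groups `S^{(n)}_p M(X, X)` over
all objects `X` of `S^{(n)}_p C`. -/
def Wedge (M : BiadditiveFunctor C) {n : ℕ} (p : Fin n → ℕ) (q : ℕ) : Type (max u v) :=
  Quotient (wedgeSetoid M p q)

/-- The map of wedges induced by a map `Φ` on objects, a family `φ` of homomorphisms of groups and
a monotone map `g`. -/
def Wedge.map {M : BiadditiveFunctor C} {D : Type u} [Category.{v} D] [Preadditive D]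
    [ExactCategory D] {M' : BiadditiveFunctor D} {n n' : ℕ} {p : Fin n → ℕ} {p' : Fin n' → ℕ}
    {q q' : ℕ} (Φ : SCat C p → SCat D p')
    (φ : ∀ X, SBimod M X X →+ SBimod M' (Φ X) (Φ X)) (g : Fin (q' + 1) →o Fin (q + 1)) :
    Wedge M p q → Wedge M' p' q' :=
  Quotient.map (Coprod.map Φ φ g) (by
    rintro c c' (rfl | h)
    · exact Or.inl rfl
    · exact Or.inr ⟨h.1.map Φ φ g, h.2.map Φ φ g⟩)

/-- The base point of the wedge. -/
def Wedge.pt (M : BiadditiveFunctor C) {n : ℕ} (p : Fin n → ℕ) (q : ℕ) : Wedge M p q :=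
  Quotient.mk _ ⟨SCat.zero C p, (Functor.const _).obj (SingleObj.star _)⟩

theorem Wedge.eq_pt {M : BiadditiveFunctor C} {n : ℕ} {p : Fin n → ℕ} {q : ℕ} {c : Coprod M p q}
    (h : c.IsBase) : (Quotient.mk _ c : Wedge M p q) = Wedge.pt M p q :=
  Quotient.sound (Or.inr ⟨h, fun _ _ _ => rfl⟩)

theorem Wedge.map_pt {M : BiadditiveFunctor C} {D : Type u} [Category.{v} D] [Preadditive D]
    [ExactCategory D] {M' : BiadditiveFunctor D} {n n' : ℕ} {p : Fin n → ℕ} {p' : Fin n' → ℕ}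
    {q q' : ℕ} (Φ : SCat C p → SCat D p')
    (φ : ∀ X, SBimod M X X →+ SBimod M' (Φ X) (Φ X)) (g : Fin (q' + 1) →o Fin (q + 1)) :
    Wedge.map Φ φ g (Wedge.pt M p q) = Wedge.pt M' p' q' :=
  Wedge.eq_pt (Coprod.IsBase.map Φ φ g (fun _ _ _ => rfl))

theorem zelt_zelt (M : BiadditiveFunctor C) (b b' : Bool) {c c' : C} (m : M.val c c') :
    zelt M b (zelt M b' m) ≍ zelt M b' (zelt M b m) := by
  cases b <;> cases b' <;> rfl

theorem zelt_heq (M : BiadditiveFunctor C) {b b' : Bool} (h : b = b') {c d : C}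
    {m : M.val c c} {m' : M.val d d} (hc : c = d) (hm : m ≍ m') : zelt M b m ≍ zelt M b' m' := by
  subst h hc
  obtain rfl := eq_of_heq hm
  rfl

/-- The multisimplicial sets `⋁_{X ∈ Ob S^{(n)}_• C} B S^{(n)}_• M(X, X)`. -/
def wedgeS (M : BiadditiveFunctor C) : SymmetricMultisimplicialSet.{max u v} where
  cell p q := Wedge M p q
  map e f g := Wedge.map (SCat.reindex e f).obj (SBimod.reindex M e f) g
  map_id y := by
    induction y using Quotient.inductionOn with
    | h c => rfl
  map_map e e' f f' g g' y := by
    induction y using Quotient.inductionOn with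
    | h c => rfl
  pt p q := Wedge.pt M p q
  map_pt e f g := Wedge.map_pt _ _ _
  susp := Wedge.map SCat.susp.obj (SBimod.susp M) OrderHom.id
  susp_pt p q := Wedge.map_pt _ _ _
  susp_map e f g y := by
    induction y using Quotient.inductionOn with
    | h c => rfl
  susp_face f g h y := by
    induction y using Quotient.inductionOn with
    | h c =>
      refine Wedge.eq_pt fun j j' a => Subtype.ext (funext fun θ => ?_)
      change zelt M ((MultiArrow.reindex 1 f).obj θ).head _ = 0
      rw [MultiArrow.head_face f h θ]
      rfl
  swap_susp y := by
    induction y using Quotient.inductionOn with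
    | h c =>
      refine congrArg (Quotient.mk _) (Coprod.ext (SCat.swap_susp c.1) fun j j' a θ => ?_)
      refine HEq.trans ?_ (zelt_zelt M _ _ _)
      refine zelt_heq M (MultiArrow.head_swap θ) ?_ ?_
      · exact congrArg₂ (fun b j => zext b (c.1.obj.obj j))
          (MultiArrow.head_tail_swap θ) (MultiArrow.tail_tail_swap θ)
      · refine zelt_heq M (MultiArrow.head_tail_swap θ)
          (congrArg _ (MultiArrow.tail_tail_swap θ)) ?_
        have := MultiArrow.tail_tail_swap θ
        generalize MultiArrow.tail.obj (MultiArrow.tail.obj θ) = t at *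
        subst this
        rfl

end

/-! ### Naturality -/

/-- Pairs `(C, M)` of an exact category and a bimodule over it. -/
structure ExactBimod where
  carrier : Type u
  [category : Category.{v} carrier]
  [preadditive : Preadditive carrier]
  [exact : ExactCategory carrier]
  bimodule : Bimodule carrier

attribute [instance] ExactBimod.category ExactBimod.preadditive ExactBimod.exact

/-- A morphism `(C, M) ⟶ (D, N)`: an exact functor `F : C ⥤ D` and a natural transformation
`M(a, b) → N(F a, F b)`. -/
structure ExactBimodHom (A B : ExactBimod.{v, u}) where
  base : ExactFunctor A.carrier B.carrier
  app : ∀ a b : A.carrier, A.bimodule.val a b →+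
    B.bimodule.val (base.functor.obj a) (base.functor.obj b)
  app_push : ∀ {a b c : A.carrier} (f : a ⟶ b) (x : A.bimodule.val c a),
    app c b (A.bimodule.push f x) = B.bimodule.push (base.functor.map f) (app c a x)
  app_pull : ∀ {a b c : A.carrier} (f : a ⟶ b) (x : A.bimodule.val b c),
    app a c (A.bimodule.pull f x) = B.bimodule.pull (base.functor.map f) (app b c x)

instance : Category ExactBimod.{v, u} where
  Hom A B := ExactBimodHom A B
  id A :=
    { base := 𝟙 (⟨A.carrier⟩ : ExactCat)
      app := fun _ _ => AddMonoidHom.id _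
      app_push := fun _ _ => rfl
      app_pull := fun _ _ => rfl }
  comp {A B D} F G :=
    { base := (show (⟨A.carrier⟩ : ExactCat) ⟶ ⟨B.carrier⟩ from F.base) ≫
        (show (⟨B.carrier⟩ : ExactCat) ⟶ ⟨D.carrier⟩ from G.base)
      app := fun a b => (G.app _ _).comp (F.app a b)
      app_push := fun f x => by
        change G.app _ _ (F.app _ _ _) = _
        rw [F.app_push, G.app_push]
        rfl
      app_pull := fun f x => by
        change G.app _ _ (F.app _ _ _) = _
        rw [F.app_pull, G.app_pull]
        rfl }

/-- The functor `(C, M) ↦ C`. -/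
def baseFunctor : ExactBimod.{v, u} ⥤ ExactCat.{v, u} where
  obj A := ⟨A.carrier⟩
  map F := ExactBimodHom.base F

/-- The exact functor `C ⋉ M ⥤ D ⋉ N` induced by a morphism `(C, M) ⟶ (D, N)`. -/
def ExactBimodHom.semidirect {A B : ExactBimod.{v, u}} (F : ExactBimodHom A B) :
    ExactFunctor (Semidirect A.bimodule.toBiadditiveFunctor)
      (Semidirect B.bimodule.toBiadditiveFunctor) where
  functor :=
    { obj := fun a => ⟨F.base.functor.obj a.of⟩
      map := fun f => ⟨F.base.functor.map f.fst, F.app _ _ f.snd⟩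
      map_id := fun a => by
        ext
        · exact F.base.functor.map_id _
        · exact map_zero _
      map_comp := fun f g => by
        ext
        · exact F.base.functor.map_comp _ _
        · simp [F.app_push, F.app_pull] }
  additive :=
    { map_add := fun {a b f g} => by
        have := F.base.additive
        ext
        · exact F.base.functor.map_add
        · exact map_add _ _ _ }
  map_zero := congrArg Semidirect.mk F.base.map_zero
  map_conflation := fun S h => F.base.map_conflation _ h

/-- The functor `(C, M) ↦ C ⋉ M`. -/
def semidirectFunctor : ExactBimod.{v, u} ⥤ ExactCat.{v, u} where
  obj A := ⟨Semidirect A.bimodule.toBiadditiveFunctor⟩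
  map F := ExactBimodHom.semidirect F

/-- The projections `C ⋉ M ⟶ C`. -/
def projection : semidirectFunctor.{v, u} ⟶ baseFunctor where
  app A :=
    { functor := Semidirect.proj A.bimodule.toBiadditiveFunctor
      additive := { map_add := rfl }
      map_zero := rfl
      map_conflation := fun _ h => h }

/-- The functor `(C, M) ↦ K̃(C ⋉ M)`, the homotopy fiber of `K(C ⋉ M) ⟶ K(C)`. -/
def relativeK : ExactBimod.{v, u} ⥤ SymmetricSpectrum.{max u v} where
  obj A := SymmetricSpectrum.hofibFunctor.{max u v}.obj (Arrow.mk (K.{v, u}.map (projection.app A)))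
  map {A B} F := SymmetricSpectrum.hofibFunctor.{max u v}.map
    (Arrow.homMk (f := Arrow.mk (K.{v, u}.map (projection.app A)))
      (g := Arrow.mk (K.{v, u}.map (projection.app B)))
      (K.{v, u}.map (semidirectFunctor.map F)) (K.{v, u}.map (baseFunctor.map F))
      ((K.{v, u}.map_comp _ _).symm.trans
        ((congrArg K.{v, u}.map (projection.naturality F)).trans (K.{v, u}.map_comp _ _))))
  map_id A := by
    refine Eq.trans ?_ (SymmetricSpectrum.hofibFunctor.{max u v}.map_id _)
    refine congrArg SymmetricSpectrum.hofibFunctor.{max u v}.map (Arrow.hom_ext _ _ ?_ ?_)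
    · exact (congrArg K.map (semidirectFunctor.map_id A)).trans (K.map_id _)
    · exact (congrArg K.map (baseFunctor.map_id A)).trans (K.map_id _)
  map_comp F G := by
    refine Eq.trans ?_ (SymmetricSpectrum.hofibFunctor.{max u v}.map_comp _ _)
    refine congrArg SymmetricSpectrum.hofibFunctor.{max u v}.map (Arrow.hom_ext _ _ ?_ ?_)
    · exact (congrArg K.map (semidirectFunctor.map_comp F G)).trans (K.map_comp _ _)
    · exact (congrArg K.map (baseFunctor.map_comp F G)).trans (K.map_comp _ _)

/-- The map `S^{(n)}_p M(X, X) → S^{(n)}_p N(F X, F X)` induced by a morphism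
`(C, M) ⟶ (D, N)`. -/
def ExactBimodHom.mapS {A B : ExactBimod.{v, u}} (F : ExactBimodHom A B) {n : ℕ} {p : Fin n → ℕ}
    (X : SCat A.carrier p) : SBimod A.bimodule.toBiadditiveFunctor X X →+
      SBimod B.bimodule.toBiadditiveFunctor ((SCat.mapExact F.base p).obj X)
        ((SCat.mapExact F.base p).obj X) where
  toFun m := ⟨fun θ => F.app _ _ (m.1 θ), fun ρ θ a => by
    refine (F.app_pull _ _).symm.trans (Eq.trans ?_ (F.app_push _ _))
    exact congrArg _ (m.2 ρ θ a)⟩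
  map_zero' := Subtype.ext (funext fun _ => map_zero _)
  map_add' _ _ := Subtype.ext (funext fun _ => map_add _ _ _)

theorem ExactBimodHom.app_zelt {A B : ExactBimod.{v, u}} (F : ExactBimodHom A B) (b : Bool)
    {c : A.carrier} (m : A.bimodule.val c c) :
    F.app _ _ (zelt A.bimodule.toBiadditiveFunctor b m) ≍
      zelt B.bimodule.toBiadditiveFunctor b (F.app _ _ m) := by
  cases b
  · change F.app _ _ 0 ≍ (0 : B.bimodule.val ExactCategory.zero ExactCategory.zero)
    rw [map_zero]
    change (0 : B.bimodule.val (F.base.functor.obj ExactCategory.zero)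
      (F.base.functor.obj ExactCategory.zero)) ≍ _
    rw [F.base.map_zero]
  · rfl

/-- The functor `(C, M) ↦ ⋁_{X ∈ Ob S^{(n)}_• C} B S^{(n)}_• M(X, X)`. -/
def wedgeSFunctor : ExactBimod.{v, u} ⥤ SymmetricMultisimplicialSet.{max u v} where
  obj A := wedgeS A.bimodule.toBiadditiveFunctor
  map F :=
    { toFun := fun p _ => Wedge.map (SCat.mapExact (ExactBimodHom.base F) p).obj
        (ExactBimodHom.mapS F) OrderHom.id
      toFun_map := fun e f g y => by
        induction y using Quotient.inductionOn with
        | h c => rfl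
      toFun_pt := fun _ _ => Wedge.map_pt _ _ _
      toFun_susp := fun y => by
        induction y using Quotient.inductionOn with
        | h c =>
          exact congrArg (Quotient.mk _) (Coprod.ext
            (SCat.mapExact_susp (ExactBimodHom.base F) c.1)
            fun j j' a θ => ExactBimodHom.app_zelt F _ _) }
  map_id A := by
    refine SymmetricMultisimplicialSet.Hom.ext ?_
    funext n p q y
    induction y using Quotient.inductionOn with
    | h c => rfl
  map_comp F G := by
    refine SymmetricMultisimplicialSet.Hom.ext ?_
    funext n p q y
    induction y using Quotient.inductionOn with
    | h c => rfl

/-- The functor `(C, M) ↦ K̃(C; M)`, where `K̃(C; M)_n` is the realization of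
`⋁_{X ∈ Ob S^{(n)}_• C} B S^{(n)}_• M(X, X)`. -/
def reducedModel : ExactBimod.{v, u} ⥤ SymmetricSpectrum.{max u v} :=
  wedgeSFunctor ⋙ SymmetricMultisimplicialSet.realization

end SplitK

/-!
The two spectra are compared through the homotopy fiber `E` of the projection
`∐_X B S^{(n)}_• M(X, X) → Ob S^{(n)}_• C` (`relativeCoprod`). The disjoint union maps to the wedge
by collapsing the base points of the groups, and it maps to `K(C ⋉ M)`, since an element `m` of
`S^{(n)}_• M(X, X)` is the same as an automorphism `(id, m)` of `X` in `S^{(n)}_• (C ⋉ M)`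
(`coprodToNerve`).

Nothing below is a statement about connectivity or about weak equivalences of spaces. An equivalence
of spectra is recognized by an inverse up to suspension: it suffices to have operations on the
elements of all the groups `π_{k+n}(X_n)` whose composites with the given map are iterated
suspensions (`isEquivalence_of_interleaving`). Such operations come from families of maps
`S¹ ∧ X_n → Y_{1+n}` (`ShiftMap`), which need be compatible neither with structure maps nor with
permutations.

For the first equivalence, note that the projection `r` from the disjoint union has the section `i`
given by the base points, whose image is collapsed in the wedge. The difference of the suspensions of
`x` and `i r x` is a loop that is null homotopic after applying `r` and also if `x` is in the image of
`i`. By the first property it lifts to the homotopy fiber, and by the second property and homotopy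
extension, it can be deformed to factor through the wedge (`exists_splitLoop_homotopy`). Hence the
homotopy fiber of `r` is equivalent to the wedge (`isEquivalence_hofibProj_coprodToWedge`).

For the second equivalence, both `r` and `K(C ⋉ M) → K(C)` are split, so it is enough to invert the
map from the disjoint union to `K(C ⋉ M)` up to suspension (`isEquivalence_hofibMap`). The inverse is
made of two steps.

* The structure map of `K`-theory factors up to homotopy through the objects
  (`homotopic_str_coneShift`). A chain of isomorphisms `Y_0 ≅ … ≅ Y_q` has a cone in
  `S_{q+1} S^{(n)}_•`, with `Y_j` as its value at `0 ≤ j + 1`, and zero at all arrows that are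
  not of this form. This gives a map `S¹ ∧ |N_• i S^{(n)}_•| → |Ob S^{(1+n)}_•|`, and the
  isomorphisms of the chain connect the suspension of the chain with its cone.
* Every diagram in `S^{(n)}_• (C ⋉ M)` is isomorphic to its underlying diagram in `C`, by an
  isomorphism `(id, h)` (`nonempty_triv`). The family `h` is constructed by induction over the
  objects `0 ≤ b`; the extension problems that occur are solvable since `M` is exact, and exactness
  also yields the values at `a ≤ b`. Trivializations `h` may be chosen differently at each vertex of a
  simplex in an additional simplicial direction, and this direction is contractible. So diagrams with
  trivializations are equivalent to diagrams (`exists_trivToObj_inverse`). The differences of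
  trivializations define a map to `∐_X B S^{(n)}_• M(X, X)`, which becomes homotopic to the inclusion
  of the objects in `N_• i S^{(n)}_• (C ⋉ M)` (`exists_triv_homotopy`).

The composite of the two steps is inverse to `coprodToNerve` up to suspension
(`exists_coprodToNerve_inverse`), because the cone of a chain of automorphisms `(id, m)` carries
canonical trivializations, whose differences are again the elements `m` (`toCoprod_coneTriv`).

The homotopies on realizations are constructed cell by cell: data on the cells extend from the
boundaries of the cells to all cells, once they can be pulled back along degeneracies
(`MultisimplicialSet.exists_section`). The extension over a cell moves points away from the
barycenter until they hit the boundary (`collar`).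
-/

namespace SplitK

/-! ### Stable homotopy groups and maps that raise the level by one -/

namespace SymmetricSpectrum

variable {X Y Z : SymmetricSpectrum.{u}}

/-- A family of pointed maps `S¹ ∧ X_n → Y_{1+n}`, with no compatibility between different `n` and
no equivariance. Such a family does not define a map of stable homotopy groups, but it acts on the
elements of the groups `π_{k+n}(X_n)`. -/
structure ShiftMap (X Y : SymmetricSpectrum.{u}) where
  toFun : ∀ n, I → X.level n → Y.level (n + 1)
  continuous_toFun : ∀ n, Continuous fun z : I × X.level n => toFun n z.1 z.2
  map_zero : ∀ n x, toFun n 0 x = Y.pt (n + 1)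
  map_one : ∀ n x, toFun n 1 x = Y.pt (n + 1)
  map_pt : ∀ n s, toFun n s (X.pt n) = Y.pt (n + 1)

namespace ShiftMap

/-- The structure maps of a symmetric spectrum. -/
def str (X : SymmetricSpectrum.{u}) : ShiftMap X X where
  toFun := X.str
  continuous_toFun := X.continuous_str
  map_zero := X.str_zero
  map_one := X.str_one
  map_pt := X.str_pt

/-- The composite with a map of spectra out of the target. -/
def postcomp (g : ShiftMap X Y) (f : Y ⟶ Z) : ShiftMap X Z where
  toFun n s x := Hom.toFun f (n + 1) (g.toFun n s x)
  continuous_toFun n := (Hom.continuous_toFun f (n + 1)).comp (g.continuous_toFun n)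
  map_zero n x := by rw [g.map_zero, Hom.map_pt]
  map_one n x := by rw [g.map_one, Hom.map_pt]
  map_pt n s := by rw [g.map_pt, Hom.map_pt]

/-- The composite with a map of spectra into the source. -/
def precomp (f : X ⟶ Y) (g : ShiftMap Y Z) : ShiftMap X Z where
  toFun n s x := g.toFun n s (Hom.toFun f n x)
  continuous_toFun n := (g.continuous_toFun n).comp
    (continuous_fst.prodMk ((Hom.continuous_toFun f n).comp continuous_snd))
  map_zero n x := g.map_zero _ _
  map_one n x := g.map_one _ _
  map_pt n s := by rw [Hom.map_pt, g.map_pt]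

/-- The map `Ω^m X_n → Ω^{1+m} Y_{1+n}`. -/
def mapLoop (g : ShiftMap X Y) {n m : ℕ} (f : GenLoop (Fin m) (X.level n) (X.pt n)) :
    GenLoop (Fin (m + 1)) (Y.level (n + 1)) (Y.pt (n + 1)) :=
  ⟨⟨fun y => g.toFun n (y 0) (f fun i => y i.succ), by
    have h : Continuous fun y : Fin (m + 1) → I => (y 0, f fun i => y i.succ) :=
      (continuous_apply 0).prodMk (f.1.continuous.comp
        (continuous_pi fun i => continuous_apply i.succ))
    exact (g.continuous_toFun n).comp h⟩, by
    rintro y ⟨i, hi⟩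
    change g.toFun n (y 0) (f fun i => y i.succ) = _
    induction i using Fin.cases with
    | zero =>
      rcases hi with hi | hi
      · rw [hi, g.map_zero]
      · rw [hi, g.map_one]
    | succ i =>
      have : f (fun i => y i.succ) = X.pt n := f.2 _ ⟨i, hi⟩
      rw [this, g.map_pt]⟩

theorem mapLoop_homotopic (g : ShiftMap X Y) {n m : ℕ}
    {f f' : GenLoop (Fin m) (X.level n) (X.pt n)} (h : GenLoop.Homotopic f f') :
    GenLoop.Homotopic (g.mapLoop f) (g.mapLoop f') := by
  obtain ⟨H⟩ := h
  refine ⟨⟨⟨⟨fun z => g.toFun n (z.2 0) (H (z.1, fun i => z.2 i.succ)), ?_⟩, ?_, ?_⟩, ?_⟩⟩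
  · have h : Continuous fun z : I × (Fin (m + 1) → I) =>
        (z.2 0, H (z.1, fun i => z.2 i.succ)) :=
      ((continuous_apply 0).comp continuous_snd).prodMk (H.continuous.comp
        (continuous_fst.prodMk
          (continuous_pi fun i => (continuous_apply i.succ).comp continuous_snd)))
    exact (g.continuous_toFun n).comp h
  · exact fun y => congrArg (g.toFun n (y 0)) (H.map_zero_left _)
  · exact fun y => congrArg (g.toFun n (y 0)) (H.map_one_left _)
  · rintro t y ⟨i, hi⟩
    change g.toFun n (y 0) _ = g.toFun n (y 0) _
    induction i using Fin.cases with
    | zero =>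
      rcases hi with hi | hi
      · rw [hi, g.map_zero, g.map_zero]
      · rw [hi, g.map_one, g.map_one]
    | succ i => exact congrArg (g.toFun n (y 0)) (H.eq_fst t ⟨i, hi⟩)

/-- The map `π_m(X_n) → π_{1+m}(Y_{1+n})`. -/
def mapHomotopy (g : ShiftMap X Y) (n m : ℕ) :
    HomotopyGroup.Pi m (X.level n) (X.pt n) →
      HomotopyGroup.Pi (m + 1) (Y.level (n + 1)) (Y.pt (n + 1)) :=
  Quotient.map g.mapLoop fun _ _ h => g.mapLoop_homotopic h

/-- The action on the elements of the groups `π_{k+n}(X_n)`. -/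
def onPre (g : ShiftMap X Y) (k : ℤ) (a : X.PreStableHomotopy k) : Y.PreStableHomotopy k :=
  ⟨a.1 + 1, ⟨a.2.1.1 + 1, by have := a.2.1.2; push_cast; omega⟩, g.mapHomotopy _ _ a.2.2⟩

/-- Homotopies that are pointed maps `S¹ ∧ X_n → Y_{1+n}` at all times. -/
def Homotopic (g g' : ShiftMap X Y) : Prop :=
  ∀ n, ∃ H : I → I → X.level n → Y.level (n + 1),
    (Continuous fun z : I × I × X.level n => H z.1 z.2.1 z.2.2) ∧
    (∀ s x, H 0 s x = g.toFun n s x) ∧ (∀ s x, H 1 s x = g'.toFun n s x) ∧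
    (∀ r x, H r 0 x = Y.pt (n + 1)) ∧ (∀ r x, H r 1 x = Y.pt (n + 1)) ∧
    (∀ r s, H r s (X.pt n) = Y.pt (n + 1))

theorem Homotopic.mapHomotopy_eq {g g' : ShiftMap X Y} (h : Homotopic g g') (n m : ℕ) :
    g.mapHomotopy n m = g'.mapHomotopy n m := by
  funext a
  induction a using Quotient.inductionOn with
  | h a =>
    obtain ⟨H, hc, h₀, h₁, hz, ho, hp⟩ := h n
    refine Quotient.sound ⟨⟨⟨⟨fun z => H z.1 (z.2 0) (a fun i => z.2 i.succ), ?_⟩, ?_, ?_⟩, ?_⟩⟩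
    · have h : Continuous fun z : I × (Fin (m + 1) → I) =>
          (z.1, z.2 0, a fun i => z.2 i.succ) :=
        continuous_fst.prodMk (((continuous_apply 0).comp continuous_snd).prodMk
          (a.1.continuous.comp
            (continuous_pi fun i => (continuous_apply i.succ).comp continuous_snd)))
      exact hc.comp h
    · exact fun y => h₀ _ _
    · exact fun y => h₁ _ _
    · rintro t y ⟨i, hi⟩
      change H t (y 0) _ = g.toFun n (y 0) _
      induction i using Fin.cases with
      | zero =>
        rcases hi with hi | hi
        · rw [hi, hz, g.map_zero]
        · rw [hi, ho, g.map_one]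
      | succ i =>
        have : a (fun i => y i.succ) = X.pt n := a.2 _ ⟨i, hi⟩
        rw [this, hp, g.map_pt]

theorem Homotopic.onPre_eq {g g' : ShiftMap X Y} (h : Homotopic g g') (k : ℤ) :
    g.onPre k = g'.onPre k := by
  funext a
  simp only [onPre, h.mapHomotopy_eq]

end ShiftMap

/-- The action of a map of spectra on the elements of the groups `π_{k+n}(X_n)`. -/
def Hom.onPre (f : X ⟶ Y) (k : ℤ) (a : X.PreStableHomotopy k) : Y.PreStableHomotopy k :=
  ⟨a.1, a.2.1, Hom.mapHomotopy f _ _ a.2.2⟩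

/-- The suspension of elements of `π_{k+n}(X_n)`. -/
abbrev step (X : SymmetricSpectrum.{u}) (k : ℤ) : X.PreStableHomotopy k → X.PreStableHomotopy k :=
  (ShiftMap.str X).onPre k

theorem Hom.onPre_comp (f : X ⟶ Y) (g : Y ⟶ Z) (k : ℤ) (a : X.PreStableHomotopy k) :
    Hom.onPre (f ≫ g) k a = Hom.onPre g k (Hom.onPre f k a) := by
  obtain ⟨n, m, a⟩ := a
  induction a using Quotient.inductionOn with
  | h a => rfl

theorem ShiftMap.onPre_postcomp (g : ShiftMap X Y) (f : Y ⟶ Z) (k : ℤ)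
    (a : X.PreStableHomotopy k) : (g.postcomp f).onPre k a = Hom.onPre f k (g.onPre k a) := by
  obtain ⟨n, m, a⟩ := a
  induction a using Quotient.inductionOn with
  | h a => rfl

theorem ShiftMap.onPre_precomp (f : X ⟶ Y) (g : ShiftMap Y Z) (k : ℤ)
    (a : X.PreStableHomotopy k) : (g.precomp f).onPre k a = g.onPre k (Hom.onPre f k a) := by
  obtain ⟨n, m, a⟩ := a
  induction a using Quotient.inductionOn with
  | h a => rfl

theorem ShiftMap.ext_toFun {g g' : ShiftMap X Y} (h : ∀ n s x, g.toFun n s x = g'.toFun n s x) :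
    g = g' := by
  cases g; cases g'
  congr
  funext n s x
  exact h n s x

theorem Hom.onPre_step (f : X ⟶ Y) (k : ℤ) (a : X.PreStableHomotopy k) :
    Hom.onPre f k (step X k a) = step Y k (Hom.onPre f k a) := by
  change Hom.onPre f k ((ShiftMap.str X).onPre k a) = (ShiftMap.str Y).onPre k (Hom.onPre f k a)
  rw [← ShiftMap.onPre_postcomp, ← ShiftMap.onPre_precomp]
  exact congrArg (fun g : ShiftMap X Y => g.onPre k a)
    (ShiftMap.ext_toFun fun n s x => Hom.map_str f n s x)

theorem Hom.onPre_iterate_step (f : X ⟶ Y) (k : ℤ) (i : ℕ) (a : X.PreStableHomotopy k) :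
    Hom.onPre f k ((step X k)^[i] a) = (step Y k)^[i] (Hom.onPre f k a) :=
  Function.Semiconj.iterate_right (fun a => Hom.onPre_step f k a) i a

theorem stableRel_iff {k : ℤ} {a b : X.PreStableHomotopy k} :
    X.StableRel k a b ↔ b = step X k a := by
  constructor
  · rintro ⟨n, m, h, h', a⟩
    rfl
  · rintro rfl
    obtain ⟨n, ⟨m, h⟩, a⟩ := a
    exact StableRel.susp n m h (by push_cast; omega) a

theorem mk_step {k : ℤ} (a : X.PreStableHomotopy k) (i : ℕ) :
    (Quot.mk (X.StableRel k) ((step X k)^[i] a)) = Quot.mk _ a := by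
  induction i with
  | zero => rfl
  | succ i ih =>
    rw [Function.iterate_succ_apply', ← ih]
    exact (Quot.sound (stableRel_iff.2 rfl)).symm

/-- Two elements agree in the stable homotopy group if and only if they agree after suspension. -/
theorem stableHomotopy_eq_iff {k : ℤ} {a b : X.PreStableHomotopy k} :
    (Quot.mk (X.StableRel k) a) = Quot.mk _ b ↔
      ∃ i j : ℕ, (step X k)^[i] a = (step X k)^[j] b := by
  constructor
  · intro h
    have h' := Quot.eqvGen_exact h
    clear h
    induction h' with
    | rel a b h => exact ⟨1, 0, (stableRel_iff.1 h).symm⟩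
    | refl a => exact ⟨0, 0, rfl⟩
    | symm a b _ ih =>
      obtain ⟨i, j, h⟩ := ih
      exact ⟨j, i, h.symm⟩
    | trans a b c _ _ ih ih' =>
      obtain ⟨i, j, h⟩ := ih
      obtain ⟨i', j', h'⟩ := ih'
      refine ⟨i' + i, j + j', ?_⟩
      rw [Function.iterate_add_apply, h, Function.iterate_add_apply _ j j', ← h',
        ← Function.iterate_add_apply, ← Function.iterate_add_apply, add_comm]
  · rintro ⟨i, j, h⟩
    rw [← mk_step a i, h, mk_step]

/-- A map of spectra is an equivalence if it has, on the level of the groups `π_{k+n}(X_n)`, an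
inverse up to suspensions. -/
theorem isEquivalence_of_interleaving (f : X ⟶ Y) (i : ℕ)
    (Φ : ∀ k, Y.PreStableHomotopy k → X.PreStableHomotopy k)
    (h : ∀ k a, Φ k (Hom.onPre f k a) = (step X k)^[i] a)
    (h' : ∀ k b, Hom.onPre f k (Φ k b) = (step Y k)^[i] b) : IsEquivalence f := by
  intro k
  constructor
  · intro a b
    induction a using Quot.ind with | mk a =>
    induction b using Quot.ind with | mk b =>
    intro hab
    obtain ⟨j, j', hj⟩ := stableHomotopy_eq_iff.1
      (show Quot.mk (Y.StableRel k) (Hom.onPre f k a) = Quot.mk _ (Hom.onPre f k b) from hab)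
    rw [← Hom.onPre_iterate_step, ← Hom.onPre_iterate_step] at hj
    have := congrArg (Φ k) hj
    rw [h, h, ← Function.iterate_add_apply, ← Function.iterate_add_apply] at this
    exact stableHomotopy_eq_iff.2 ⟨_, _, this⟩
  · intro b
    induction b using Quot.ind with | mk b =>
    refine ⟨Quot.mk _ (Φ k b), ?_⟩
    change Quot.mk (Y.StableRel k) (Hom.onPre f k (Φ k b)) = _
    rw [h', mk_step]

end SymmetricSpectrum

/-! ### Homotopy fibers of split maps -/

/-- The retraction of `ℝ` onto the unit interval. -/
noncomputable def clamp (a : ℝ) : I := Set.projIcc 0 1 zero_le_one a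

theorem continuous_clamp : Continuous clamp := continuous_projIcc (h := zero_le_one)

theorem clamp_of_nonpos {a : ℝ} (h : a ≤ 0) : clamp a = 0 := Set.projIcc_of_le_left _ h

theorem clamp_of_one_le {a : ℝ} (h : 1 ≤ a) : clamp a = 1 := Set.projIcc_of_right_le _ h

@[simp] theorem clamp_coe (a : I) : clamp a = a := Set.projIcc_val _ a

@[fun_prop]
theorem Continuous.clamp {Z : Type*} [TopologicalSpace Z] {f : Z → ℝ} (h : Continuous f) :
    Continuous fun z => clamp (f z) := continuous_clamp.comp h

namespace SymmetricSpectrum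

variable {X Y A B : SymmetricSpectrum.{u}}

theorem continuous_str_comp {Z : Type*} [TopologicalSpace Z] {n : ℕ} {s : Z → I}
    {x : Z → X.level n} (hs : Continuous s) (hx : Continuous x) :
    Continuous fun z => X.str n (s z) (x z) :=
  (X.continuous_str n).comp (hs.prodMk hx)

/-- The projection from the homotopy fiber of `r : X ⟶ A` to `X`. -/
def hofibProj (r : X ⟶ A) : hofib r ⟶ X where
  toFun _ z := z.1.1
  continuous_toFun _ := continuous_fst.comp continuous_subtype_val
  map_pt _ := rfl
  map_smul _ _ _ := rfl
  map_str _ _ _ := rfl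

/-- The point of the homotopy fiber given by a point `x` and a path `γ` from the base point
to the image of `x`. -/
def hofibMk (r : X ⟶ A) {n : ℕ} (x : X.level n) (γ : I → A.level n) (hγ : Continuous γ)
    (h₀ : γ 0 = A.pt n) (h₁ : γ 1 = Hom.toFun r n x) : (hofib r).level n :=
  ⟨(x, ⟨γ, hγ⟩), h₀, h₁⟩

theorem hofib_ext (r : X ⟶ A) {n : ℕ} {z z' : (hofib r).level n} (h : z.1.1 = z'.1.1)
    (h' : ∀ k, z.1.2 k = z'.1.2 k) : z = z' :=
  Subtype.ext (Prod.ext h (ContinuousMap.ext h'))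

theorem continuous_hofibMk (r : X ⟶ A) {n : ℕ} {Z : Type*} [TopologicalSpace Z]
    {x : Z → X.level n} {γ : Z → I → A.level n} (hx : Continuous x)
    (hγ : Continuous fun z : Z × I => γ z.1 z.2) (h₀ : ∀ z, γ z 0 = A.pt n)
    (h₁ : ∀ z, γ z 1 = Hom.toFun r n (x z)) :
    Continuous fun z => hofibMk r (x z) (γ z)
      (hγ.comp (continuous_const.prodMk continuous_id)) (h₀ z) (h₁ z) := by
  refine Continuous.subtype_mk (hx.prodMk ?_) _
  exact ContinuousMap.continuous_of_continuous_uncurry _ hγ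

theorem continuous_hofib_path (r : X ⟶ A) {n : ℕ} :
    Continuous fun z : (hofib r).level n × I => z.1.1.2 z.2 := by
  have : Continuous fun z : (hofib r).level n × I => (z.1.1.2, z.2) :=
    (continuous_snd.comp (continuous_subtype_val.comp continuous_fst)).prodMk continuous_snd
  exact ContinuousEval.continuous_eval.comp this

/-- The zigzag `0, 1, 0` with its vertex at `1 / 2`. -/
noncomputable def tent (s : I) : I := clamp (min (2 * s) (2 - 2 * s))

@[fun_prop]
theorem continuous_tent : Continuous tent := by
  unfold tent
  fun_prop

theorem tent_zero : tent 0 = 0 := clamp_of_nonpos (by simp)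

theorem tent_one : tent 1 = 0 := clamp_of_nonpos (by simp)

theorem tent_half {s : I} (h : (s : ℝ) = 1 / 2) : tent s = 1 :=
  clamp_of_one_le (by rw [h]; norm_num)

theorem tent_eq {s : I} (h : (s : ℝ) ≤ 1 / 2) : tent s = clamp (2 * s) := by
  rw [tent, min_eq_left (by linarith)]

/-- The loop which follows the suspension coordinate of `x` in the first half and returns along the
one of `y` in the second half. -/
noncomputable def loopDiff {n : ℕ} (s : I) (x y : X.level n) : X.level (n + 1) :=
  if (s : ℝ) ≤ 1 / 2 then X.str n (tent s) x else X.str n (tent s) y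

theorem continuous_loopDiff {Z : Type*} [TopologicalSpace Z] {n : ℕ} {s : Z → I}
    {x y : Z → X.level n} (hs : Continuous s) (hx : Continuous x) (hy : Continuous y) :
    Continuous fun z => loopDiff (s z) (x z) (y z) := by
  refine Continuous.if_le (continuous_str_comp (continuous_tent.comp hs) hx)
    (continuous_str_comp (continuous_tent.comp hs) hy) (continuous_subtype_val.comp hs)
    continuous_const fun z hz => ?_
  rw [tent_half hz, X.str_one, X.str_one]

theorem loopDiff_zero {n : ℕ} (x y : X.level n) : loopDiff 0 x y = X.pt (n + 1) := by
  unfold loopDiff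
  split_ifs <;> rw [tent_zero, X.str_zero]

theorem loopDiff_one {n : ℕ} (x y : X.level n) : loopDiff 1 x y = X.pt (n + 1) := by
  unfold loopDiff
  split_ifs <;> rw [tent_one, X.str_zero]

theorem loopDiff_pt {n : ℕ} (s : I) : loopDiff s (X.pt n) (X.pt n) = X.pt (n + 1) := by
  unfold loopDiff
  split_ifs <;> rw [X.str_pt]

theorem map_loopDiff (r : X ⟶ A) {n : ℕ} (s : I) (x y : X.level n) :
    Hom.toFun r (n + 1) (loopDiff s x y) = loopDiff s (Hom.toFun r n x) (Hom.toFun r n y) := by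
  unfold loopDiff
  split_ifs <;> rw [Hom.map_str]

theorem loopDiff_self {n : ℕ} (s : I) (x : X.level n) : loopDiff s x x = X.str n (tent s) x := by
  unfold loopDiff
  split_ifs <;> rfl

theorem section_apply {r : X ⟶ A} {i : A ⟶ X} (hi : i ≫ r = 𝟙 A) {n : ℕ} (a : A.level n) :
    Hom.toFun r n (Hom.toFun i n a) = a :=
  congrArg (fun f : A ⟶ A => Hom.toFun f n a) hi

/-- For a retraction `r : X ⟶ A` with section `i`, the map `S¹ ∧ X_n → X_{1+n}` which subtracts
from the suspension of `x` the suspension of `i r x`. -/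
noncomputable def splitLoop (r : X ⟶ A) (i : A ⟶ X) : ShiftMap X X where
  toFun n s x := loopDiff s x (Hom.toFun i n (Hom.toFun r n x))
  continuous_toFun n := continuous_loopDiff continuous_fst continuous_snd
    ((Hom.continuous_toFun i n).comp ((Hom.continuous_toFun r n).comp continuous_snd))
  map_zero _ _ := loopDiff_zero _ _
  map_one _ _ := loopDiff_one _ _
  map_pt n s := by rw [Hom.map_pt, Hom.map_pt, loopDiff_pt]

/-- The lift of `splitLoop` to the homotopy fiber of `r`: the image of the difference loop in `A` is
contracted along the suspension coordinate. -/
noncomputable def splitLift (r : X ⟶ A) (i : A ⟶ X) (hi : i ≫ r = 𝟙 A) : ShiftMap X (hofib r) where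
  toFun n s x := hofibMk r (loopDiff s x (Hom.toFun i n (Hom.toFun r n x)))
    (fun k => A.str n (min (tent s) (clamp (2 * k))) (Hom.toFun r n x))
    (continuous_str_comp (by fun_prop) continuous_const)
    (by rw [clamp_of_nonpos (by simp), min_eq_right unitInterval.nonneg', A.str_zero])
    (by
      rw [clamp_of_one_le (by simp), min_eq_left unitInterval.le_one', map_loopDiff,
        section_apply hi, loopDiff_self])
  continuous_toFun n := continuous_hofibMk r ((splitLoop r i).continuous_toFun n)
    (continuous_str_comp (by fun_prop)
      ((Hom.continuous_toFun r n).comp (continuous_snd.comp continuous_fst))) _ _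
  map_zero n x := hofib_ext r (loopDiff_zero _ _) fun k => by
    change A.str n (min (tent 0) _) _ = A.pt _
    rw [tent_zero, min_eq_left unitInterval.nonneg', A.str_zero]
  map_one n x := hofib_ext r (loopDiff_one _ _) fun k => by
    change A.str n (min (tent 1) _) _ = A.pt _
    rw [tent_one, min_eq_left unitInterval.nonneg', A.str_zero]
  map_pt n s := hofib_ext r ((splitLoop r i).map_pt n s) fun k => by
    change A.str n _ (Hom.toFun r n (X.pt n)) = A.pt _
    rw [Hom.map_pt, A.str_pt]

theorem splitLift_postcomp (r : X ⟶ A) (i : A ⟶ X) (hi : i ≫ r = 𝟙 A) :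
    (splitLift r i hi).postcomp (hofibProj r) = splitLoop r i := rfl

/-- On the homotopy fiber of `r`, half of a suspension. -/
noncomputable def halfStr (r : X ⟶ A) : ShiftMap (hofib r) (hofib r) where
  toFun n s z := hofibMk r (X.str n (clamp (2 * s)) z.1.1)
    (fun k => A.str n (clamp (2 * s)) (z.1.2 (clamp (2 * k - 1))))
    (continuous_str_comp continuous_const (z.1.2.continuous.comp (by fun_prop)))
    (by rw [clamp_of_nonpos (a := 2 * ((0 : I) : ℝ) - 1) (by simp), z.2.1, A.str_pt])
    (by rw [clamp_of_one_le (a := 2 * ((1 : I) : ℝ) - 1) (by norm_num), z.2.2, Hom.map_str])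
  continuous_toFun n := continuous_hofibMk r
    (continuous_str_comp (by fun_prop)
      ((Hom.continuous_toFun (hofibProj r) n).comp continuous_snd))
    (continuous_str_comp (by fun_prop) ((continuous_hofib_path r).comp
      ((continuous_snd.comp continuous_fst).prodMk (by fun_prop)))) _ _
  map_zero n z := hofib_ext r
    (by
      change X.str n (clamp _) _ = X.pt _
      rw [clamp_of_nonpos (by simp), X.str_zero])
    fun k => by
      change A.str n (clamp (2 * ((0 : I) : ℝ))) _ = A.pt _
      rw [clamp_of_nonpos (by simp), A.str_zero]
  map_one n z := hofib_ext r
    (by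
      change X.str n (clamp _) _ = X.pt _
      rw [clamp_of_one_le (by simp), X.str_one])
    fun k => by
      change A.str n (clamp (2 * ((1 : I) : ℝ))) _ = A.pt _
      rw [clamp_of_one_le (by simp), A.str_one]
  map_pt n s := hofib_ext r (X.str_pt n _) fun k => A.str_pt n _

/-- The null homotopy of the second half of the difference loop: it moves along the path that belongs
to a point of the homotopy fiber. -/
theorem halfStr_homotopic (r : X ⟶ A) (i : A ⟶ X) (hi : i ≫ r = 𝟙 A) :
    ((halfStr r).Homotopic ((splitLift r i hi).precomp (hofibProj r))) := by
  intro n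
  -- At time `h`, the base point of the loop is `i` of the point at time `h` of the given path. The
  -- path in `A` unfolds the tent in its first half and follows the rest of the given path after it.
  let path : I → I → (hofib r).level n → I → A.level (n + 1) := fun h s z k =>
    if (k : ℝ) ≤ 1 / 2 then A.str n (min (tent s) (clamp (2 * k))) (z.1.2 h)
    else loopDiff s (z.1.2 (max h (clamp (2 * k - 1)))) (z.1.2 h)
  have hp : Continuous fun w : (I × I × (hofib r).level n) × I => path w.1.1 w.1.2.1 w.1.2.2 w.2 := by
    have h₁ : Continuous fun w : (I × I × (hofib r).level n) × I => w.1.2.2.1.2 w.1.1 :=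
      (continuous_hofib_path r).comp ((continuous_snd.comp (continuous_snd.comp continuous_fst)).prodMk
        (continuous_fst.comp continuous_fst))
    have h₂ : Continuous fun w : (I × I × (hofib r).level n) × I =>
        w.1.2.2.1.2 (max w.1.1 (clamp (2 * w.2 - 1))) :=
      (continuous_hofib_path r).comp ((continuous_snd.comp (continuous_snd.comp continuous_fst)).prodMk
        (by fun_prop))
    refine Continuous.if_le (continuous_str_comp (by fun_prop) h₁)
      (continuous_loopDiff (by fun_prop) h₂ h₁) (by fun_prop) continuous_const fun w hw => ?_
    rw [hw, clamp_of_one_le (by norm_num), clamp_of_nonpos (by norm_num),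
      min_eq_left unitInterval.le_one', max_eq_left unitInterval.nonneg', loopDiff_self]
  have hp₀ : ∀ h s z, path h s z 0 = A.pt (n + 1) := fun h s z => by
    change ite _ _ _ = _
    rw [if_pos (by simp), clamp_of_nonpos (by simp), min_eq_right unitInterval.nonneg', A.str_zero]
  have hp₁ : ∀ h s z, path h s z 1 = Hom.toFun r (n + 1)
      (loopDiff s z.1.1 (Hom.toFun i n (z.1.2 h))) := fun h s z => by
    change ite _ _ _ = _
    rw [if_neg (by norm_num), clamp_of_one_le (by norm_num), max_eq_right unitInterval.le_one',
      map_loopDiff, section_apply hi, z.2.2]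
  have hx : Continuous fun w : I × I × (hofib r).level n =>
      loopDiff w.2.1 w.2.2.1.1 (Hom.toFun i n (w.2.2.1.2 w.1)) :=
    continuous_loopDiff (by fun_prop)
      ((Hom.continuous_toFun (hofibProj r) n).comp (continuous_snd.comp continuous_snd))
      ((Hom.continuous_toFun i n).comp ((continuous_hofib_path r).comp
        ((continuous_snd.comp continuous_snd).prodMk continuous_fst)))
  refine ⟨fun h s z => hofibMk r _ _ (hp.comp ((continuous_const (y := (h, s, z))).prodMk
    continuous_id)) (hp₀ h s z) (hp₁ h s z), continuous_hofibMk r hx hp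
      (fun w => hp₀ w.1 w.2.1 w.2.2) (fun w => hp₁ w.1 w.2.1 w.2.2), ?_, ?_, ?_, ?_, ?_⟩
  · intro s z
    refine hofib_ext r ?_ fun k => ?_
    · change loopDiff s z.1.1 (Hom.toFun i n (z.1.2 0)) = X.str n (clamp (2 * s)) z.1.1
      rw [z.2.1, Hom.map_pt, loopDiff]
      split_ifs with h
      · rw [tent_eq h]
      · rw [X.str_pt, clamp_of_one_le (by linarith), X.str_one]
    · change (if (k : ℝ) ≤ 1 / 2 then A.str n (min (tent s) (clamp (2 * k))) (z.1.2 0) else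
        loopDiff s (z.1.2 (max 0 (clamp (2 * k - 1)))) (z.1.2 0)) = 
        A.str n (clamp (2 * s)) (z.1.2 (clamp (2 * k - 1)))
      rw [z.2.1]
      split_ifs with h
      · rw [clamp_of_nonpos (a := 2 * (k : ℝ) - 1) (by linarith), z.2.1, A.str_pt, A.str_pt]
      · rw [max_eq_right unitInterval.nonneg', loopDiff]
        split_ifs with h
        · rw [tent_eq h]
        · rw [A.str_pt, clamp_of_one_le (a := 2 * (s : ℝ)) (by linarith), A.str_one]
  · intro s z
    refine hofib_ext r ?_ fun k => ?_
    · change loopDiff s z.1.1 (Hom.toFun i n (z.1.2 1)) = _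
      rw [z.2.2]
      rfl
    · change (if (k : ℝ) ≤ 1 / 2 then A.str n (min (tent s) (clamp (2 * k))) (z.1.2 1) else
        loopDiff s (z.1.2 (max 1 (clamp (2 * k - 1)))) (z.1.2 1)) = 
        A.str n (min (tent s) (clamp (2 * k))) (Hom.toFun r n z.1.1)
      split_ifs with h
      · rw [z.2.2]
      · rw [max_eq_left unitInterval.le_one', loopDiff_self, clamp_of_one_le (by linarith),
          min_eq_left unitInterval.le_one', z.2.2]
  · intro h z
    refine hofib_ext r (loopDiff_zero _ _) fun k => ?_
    change ite _ _ _ = A.pt _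
    rw [tent_zero, min_eq_left unitInterval.nonneg', A.str_zero, loopDiff_zero, ite_self]
  · intro h z
    refine hofib_ext r (loopDiff_one _ _) fun k => ?_
    change ite _ _ _ = A.pt _
    rw [tent_one, min_eq_left unitInterval.nonneg', A.str_zero, loopDiff_one, ite_self]
  · intro h s
    refine hofib_ext r ?_ fun k => ?_
    · change loopDiff s (X.pt n) (Hom.toFun i n (A.pt n)) = X.pt _
      rw [Hom.map_pt, loopDiff_pt]
    · change ite _ (A.str n _ (A.pt n)) (loopDiff s (A.pt n) (A.pt n)) = A.pt _
      rw [A.str_pt, loopDiff_pt, ite_self]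

/-- Reparametrization. -/
theorem halfStr_homotopic_str (r : X ⟶ A) : (halfStr r).Homotopic (ShiftMap.str (hofib r)) := by
  intro n
  have hc : Continuous fun w : (I × I × (hofib r).level n) × I => A.str n
      (clamp ((2 - w.1.1) * w.1.2.1))
      (w.1.2.2.1.2 (clamp ((2 - w.1.1) * w.2 - (1 - w.1.1)))) :=
    continuous_str_comp (by fun_prop) ((continuous_hofib_path r).comp
      ((continuous_snd.comp (continuous_snd.comp continuous_fst)).prodMk (by fun_prop)))
  have h₀ : ∀ w : I × I × (hofib r).level n, A.str n (clamp ((2 - w.1) * w.2.1))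
      (w.2.2.1.2 (clamp ((2 - w.1) * ((0 : I) : ℝ) - (1 - w.1)))) = A.pt (n + 1) := fun w => by
    rw [clamp_of_nonpos (a := (2 - (w.1 : ℝ)) * ((0 : I) : ℝ) - _) (by
      have := w.1.2.2
      simpa using this), w.2.2.2.1, A.str_pt]
  have h₁ : ∀ w : I × I × (hofib r).level n, A.str n (clamp ((2 - w.1) * w.2.1))
      (w.2.2.1.2 (clamp ((2 - w.1) * ((1 : I) : ℝ) - (1 - w.1)))) =
        Hom.toFun r (n + 1) (X.str n (clamp ((2 - w.1) * w.2.1)) w.2.2.1.1) := fun w => by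
    rw [clamp_of_one_le (a := (2 - (w.1 : ℝ)) * ((1 : I) : ℝ) - _) (by simp; linarith), w.2.2.2.2,
      Hom.map_str]
  have hx : Continuous fun w : I × I × (hofib r).level n =>
      X.str n (clamp ((2 - w.1) * w.2.1)) w.2.2.1.1 :=
    continuous_str_comp (by fun_prop)
      ((Hom.continuous_toFun (hofibProj r) n).comp (continuous_snd.comp continuous_snd))
  refine ⟨fun h s z => hofibMk r _ _ (hc.comp ((continuous_const (y := (h, s, z))).prodMk
    continuous_id)) (h₀ (h, s, z)) (h₁ (h, s, z)), continuous_hofibMk r hx hc h₀ h₁, ?_, ?_, ?_, ?_, ?_⟩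
  · intro s z
    refine hofib_ext r ?_ fun k => ?_
    · change X.str n (clamp ((2 - ((0 : I) : ℝ)) * s)) _ = X.str n (clamp (2 * s)) _
      simp
    · change A.str n (clamp ((2 - ((0 : I) : ℝ)) * s))
        (z.1.2 (clamp ((2 - ((0 : I) : ℝ)) * k - (1 - ((0 : I) : ℝ))))) =
        A.str n (clamp (2 * s)) (z.1.2 (clamp (2 * k - 1)))
      simp
  · intro s z
    have e : (2 - ((1 : I) : ℝ)) = 1 := by norm_num
    refine hofib_ext r ?_ fun k => ?_
    · change X.str n (clamp ((2 - ((1 : I) : ℝ)) * s)) _ = X.str n s _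
      rw [e, one_mul, clamp_coe]
    · change A.str n (clamp ((2 - ((1 : I) : ℝ)) * s))
        (z.1.2 (clamp ((2 - ((1 : I) : ℝ)) * k - (1 - ((1 : I) : ℝ))))) = A.str n s (z.1.2 k)
      rw [e, one_mul, clamp_coe, one_mul]
      simp
  · intro h z
    refine hofib_ext r ?_ fun k => ?_
    · change X.str n (clamp (_ * ((0 : I) : ℝ))) _ = X.pt _
      rw [clamp_of_nonpos (by simp), X.str_zero]
    · change A.str n (clamp ((2 - (h : ℝ)) * ((0 : I) : ℝ))) _ = A.pt _
      rw [clamp_of_nonpos (by simp), A.str_zero]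
  · intro h z
    have e : (1 : ℝ) ≤ (2 - (h : ℝ)) * ((1 : I) : ℝ) := by
      have := h.2.2
      simp
      linarith
    refine hofib_ext r ?_ fun k => ?_
    · change X.str n (clamp (_ * ((1 : I) : ℝ))) _ = X.pt _
      rw [clamp_of_one_le e, X.str_one]
    · change A.str n (clamp ((2 - (h : ℝ)) * ((1 : I) : ℝ))) _ = A.pt _
      rw [clamp_of_one_le e, A.str_one]
  · exact fun h s => hofib_ext r (X.str_pt n _) fun k => A.str_pt n _

/-- Up to homotopy, the lifted difference loop of the underlying point of an element of the homotopy
fiber is its suspension. -/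
theorem splitLift_onPre_hofibProj (r : X ⟶ A) (i : A ⟶ X) (hi : i ≫ r = 𝟙 A) (k : ℤ)
    (a : (hofib r).PreStableHomotopy k) :
    (splitLift r i hi).onPre k (Hom.onPre (hofibProj r) k a) = step (hofib r) k a := by
  rw [← ShiftMap.onPre_precomp, ← (halfStr_homotopic r i hi).onPre_eq k,
    (halfStr_homotopic_str r).onPre_eq k]

/-- The map of homotopy fibers induced by a commutative square. -/
abbrev hofibMap {f g : Arrow SymmetricSpectrum.{u}} (φ : f ⟶ g) : hofib f.hom ⟶ hofib g.hom :=
  hofibFunctor.map φ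

theorem splitLift_postcomp_hofibMap {f g : Arrow SymmetricSpectrum.{u}} (φ : f ⟶ g)
    (i : f.right ⟶ f.left) (hi : i ≫ f.hom = 𝟙 _) (j : g.right ⟶ g.left) (hj : j ≫ g.hom = 𝟙 _)
    (h : i ≫ φ.left = φ.right ≫ j) :
    (splitLift f.hom i hi).postcomp (hofibMap φ) = (splitLift g.hom j hj).precomp φ.left := by
  have hr : ∀ n x, Hom.toFun φ.right n (Hom.toFun f.hom n x) =
      Hom.toFun g.hom n (Hom.toFun φ.left n x) := fun n x =>
    (congrArg (fun h : f.left ⟶ g.right => Hom.toFun h n x) φ.w).symm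
  have hi' : ∀ n a, Hom.toFun φ.left n (Hom.toFun i n a) =
      Hom.toFun j n (Hom.toFun φ.right n a) := fun n a =>
    congrArg (fun h : f.right ⟶ g.left => Hom.toFun h n a) h
  refine ShiftMap.ext_toFun fun n s x => hofib_ext g.hom ?_ fun k => ?_
  · change Hom.toFun φ.left (n + 1) (loopDiff s x _) = loopDiff s (Hom.toFun φ.left n x) _
    rw [map_loopDiff, hi', hr]
  · change Hom.toFun φ.right (n + 1) (f.right.str n _ (Hom.toFun f.hom n x)) =
      g.right.str n _ (Hom.toFun g.hom n (Hom.toFun φ.left n x))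
    rw [Hom.map_str, hr]

/-- A map of retractions is an equivalence on homotopy fibers if it has, up to suspensions, a homotopy
inverse on total spaces. -/
theorem isEquivalence_hofibMap {f g : Arrow SymmetricSpectrum.{u}} (φ : f ⟶ g)
    (i : f.right ⟶ f.left) (hi : i ≫ f.hom = 𝟙 _) (j : g.right ⟶ g.left) (hj : j ≫ g.hom = 𝟙 _)
    (h : i ≫ φ.left = φ.right ≫ j) (Θ : ∀ k, g.left.PreStableHomotopy k →
      f.left.PreStableHomotopy k)
    (h₁ : ∀ k a, Θ k (Hom.onPre φ.left k a) = step f.left k a)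
    (h₂ : ∀ k b, Hom.onPre φ.left k (Θ k b) = step g.left k b) :
    IsEquivalence (hofibMap φ) := by
  have hp : hofibMap φ ≫ hofibProj g.hom = hofibProj f.hom ≫ φ.left := rfl
  refine isEquivalence_of_interleaving (hofibMap φ) 2
    (fun k b => (splitLift f.hom i hi).onPre k (Θ k (Hom.onPre (hofibProj g.hom) k b))) ?_ ?_
  · intro k a
    rw [← Hom.onPre_comp, hp, Hom.onPre_comp, h₁, ← Hom.onPre_step, splitLift_onPre_hofibProj]
    rfl
  · intro k b
    rw [← ShiftMap.onPre_postcomp, splitLift_postcomp_hofibMap φ i hi j hj h,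
      ShiftMap.onPre_precomp, h₂, ← Hom.onPre_step, splitLift_onPre_hofibProj]
    rfl

end SymmetricSpectrum

/-! ### The multisimplicial sets of objects and of endomorphisms -/

section

variable {C : Type u} [Category.{v} C] [Preadditive C] [ExactCategory C]

theorem BiadditiveFunctor.val_zero_left (M : BiadditiveFunctor C) {c : C} (m : M.val ExactCategory.zero c) :
    m = 0 := by
  rw [← M.pull_id m, ExactCategory.isZero_zero.eq_of_src (𝟙 ExactCategory.zero) 0, M.zero_pull]

theorem BiadditiveFunctor.val_heq_of_eq_zero (M : BiadditiveFunctor C) {c d : C} (h : c = d)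
    (hc : c = ExactCategory.zero) (m : M.val c c) (m' : M.val d d) : m ≍ m' := by
  subst h hc
  rw [M.val_zero_left m, M.val_zero_left m']

variable (C) in
/-- The multisimplicial sets `Ob S^{(n)}_• C`, constant in the last direction. -/
def objS : SymmetricMultisimplicialSet.{max u v} where
  cell p _ := SCat C p
  map e f _ X := (SCat.reindex e f).obj X
  map_id _ := rfl
  map_map _ _ _ _ _ _ _ := rfl
  pt p _ := SCat.zero C p
  map_pt _ _ _ := rfl
  susp X := SCat.susp.obj X
  susp_pt p _ := SCat.susp_zero p
  susp_map _ _ _ _ := rfl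
  susp_face f _ h X := SCat.susp_face f h X
  swap_susp X := SCat.swap_susp X

theorem Coprod.elt_map {M : BiadditiveFunctor C} {D : Type u} [Category.{v} D] [Preadditive D]
    [ExactCategory D] {M' : BiadditiveFunctor D} {n n' : ℕ} {p : Fin n → ℕ} {p' : Fin n' → ℕ}
    {q q' : ℕ} (Φ : SCat C p → SCat D p')
    (φ : ∀ X, SBimod M X X →+ SBimod M' (Φ X) (Φ X)) (g : Fin (q' + 1) →o Fin (q + 1))
    (c : Coprod M p q) {j j' : Fin (q' + 1)} (a : j ⟶ j') :
    (Coprod.map Φ φ g c).elt a = φ c.1 (c.elt (g.monotone.functor.map a)) := rfl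

/-- The simplex of the classifying space that assigns zero to all `j ≤ j'`. -/
def Coprod.base (M : BiadditiveFunctor C) {n : ℕ} {p : Fin n → ℕ} (q : ℕ) (X : SCat C p) :
    Coprod M p q :=
  ⟨X, (Functor.const _).obj (SingleObj.star _)⟩

theorem Coprod.elt_base (M : BiadditiveFunctor C) {n : ℕ} {p : Fin n → ℕ} {q : ℕ} (X : SCat C p)
    {j j' : Fin (q + 1)} (a : j ⟶ j') : (Coprod.base M q X).elt a = 0 := rfl

theorem Coprod.map_base {M : BiadditiveFunctor C} {D : Type u} [Category.{v} D] [Preadditive D]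
    [ExactCategory D] {M' : BiadditiveFunctor D} {n n' : ℕ} {p : Fin n → ℕ} {p' : Fin n' → ℕ}
    {q q' : ℕ} (Φ : SCat C p → SCat D p')
    (φ : ∀ X, SBimod M X X →+ SBimod M' (Φ X) (Φ X)) (g : Fin (q' + 1) →o Fin (q + 1))
    (X : SCat C p) : Coprod.map Φ φ g (Coprod.base M q X) = Coprod.base M' q' (Φ X) :=
  Coprod.ext rfl fun _ _ a θ => by
    rw [Coprod.elt_map, Coprod.elt_base, Coprod.elt_base, map_zero]
    rfl

theorem Coprod.base_eq_of_isBase {M : BiadditiveFunctor C} {n : ℕ} {p : Fin n → ℕ} {q : ℕ}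
    {c : Coprod M p q} (h : c.IsBase) : c = Coprod.base M q c.1 :=
  Coprod.ext rfl fun _ _ a θ => by
    rw [h, Coprod.elt_base]
    rfl

/-- The multisimplicial sets `∐_{X ∈ Ob S^{(n)}_• C} B S^{(n)}_• M(X, X)`. -/
def coprodS (M : BiadditiveFunctor C) : SymmetricMultisimplicialSet.{max u v} where
  cell p q := Coprod M p q
  map e f g := Coprod.map (SCat.reindex e f).obj (SBimod.reindex M e f) g
  map_id _ := rfl
  map_map _ _ _ _ _ _ _ := rfl
  pt p q := Coprod.base M q (SCat.zero C p)
  map_pt _ _ _ := Coprod.map_base _ _ _ _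
  susp := Coprod.map SCat.susp.obj (SBimod.susp M) OrderHom.id
  susp_pt p q := (Coprod.map_base _ _ _ _).trans (congrArg _ (SCat.susp_zero p))
  susp_map _ _ _ _ := rfl
  susp_face f g h c := Coprod.ext (SCat.susp_face f h c.1) fun j j' a θ =>
    M.val_heq_of_eq_zero (congrArg (fun X : SCat C _ => X.obj.obj θ) (SCat.susp_face f h c.1))
      (congrArg (fun X : SCat C _ => X.obj.obj θ) (SCat.susp_face f h c.1)) _ _
  swap_susp c := by
    refine Coprod.ext (SCat.swap_susp c.1) fun j j' a θ => ?_
    refine HEq.trans ?_ (zelt_zelt M _ _ _)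
    refine zelt_heq M (MultiArrow.head_swap θ) ?_ ?_
    · exact congrArg₂ (fun b j => zext b (c.1.obj.obj j))
        (MultiArrow.head_tail_swap θ) (MultiArrow.tail_tail_swap θ)
    · refine zelt_heq M (MultiArrow.head_tail_swap θ)
        (congrArg _ (MultiArrow.tail_tail_swap θ)) ?_
      have := MultiArrow.tail_tail_swap θ
      generalize MultiArrow.tail.obj (MultiArrow.tail.obj θ) = t at *
      subst this
      rfl

/-- The map `∐_X B S^{(n)}_• M(X, X) → Ob S^{(n)}_• C`. -/
def coprodToObj (M : BiadditiveFunctor C) : coprodS M ⟶ objS C where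
  toFun _ _ c := c.1
  toFun_map _ _ _ _ := rfl
  toFun_pt _ _ := rfl
  toFun_susp _ := rfl

/-- The inclusion of the base points of the classifying spaces. -/
def objToCoprod (M : BiadditiveFunctor C) : objS C ⟶ coprodS M where
  toFun _ q X := Coprod.base M q X
  toFun_map _ _ _ _ := (Coprod.map_base _ _ _ _).symm
  toFun_pt _ _ := rfl
  toFun_susp _ := (Coprod.map_base _ _ _ _).symm

/-- The quotient map from the disjoint union to the wedge. -/
def coprodToWedge (M : BiadditiveFunctor C) : coprodS M ⟶ wedgeS M where
  toFun _ _ c := Quotient.mk _ c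
  toFun_map _ _ _ _ := rfl
  toFun_pt _ _ := rfl
  toFun_susp _ := rfl

variable (C) in
/-- The inclusion of the objects as the constant chains of isomorphisms. -/
def objToNerve : objS C ⟶ nerveS C where
  toFun _ _ X := (Functor.const _).obj ⟨X⟩
  toFun_map _ _ _ _ := chain_ext (fun _ => rfl) (fun _ _ _ _ => HEq.rfl)
  toFun_pt _ _ := rfl
  toFun_susp _ := chain_ext (fun _ => rfl) (fun _ _ _ _ => heq_of_eq (zmap_id _ _).symm)

end

/-! ### Automorphisms in `C ⋉ M` over the identity -/

section

variable {C : Type u} [Category.{v} C] [Preadditive C] [ExactCategory C] (M : Bimodule C)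

/-- The exact functor `C ⥤ C ⋉ M` that sends `f` to `(f, 0)`. -/
def trivExt : ExactFunctor C (Semidirect M.toBiadditiveFunctor) where
  functor :=
    { obj := fun a => ⟨a⟩
      map := fun f => ⟨f, 0⟩
      map_comp := fun f g => by ext <;> simp }
  additive := ⟨by intros; ext <;> simp⟩
  map_zero := rfl
  map_conflation := fun _ h => h

/-- The exact functor `C ⋉ M ⥤ C`. -/
def projExact : ExactFunctor (Semidirect M.toBiadditiveFunctor) C where
  functor := Semidirect.proj M.toBiadditiveFunctor
  additive := { map_add := rfl }
  map_zero := rfl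
  map_conflation := fun _ h => h

variable {n : ℕ} {p : Fin n → ℕ}

/-- A diagram in `C`, regarded as a diagram in `C ⋉ M`. -/
abbrev trivDiag (X : SCat C p) : SCat (Semidirect M.toBiadditiveFunctor) p :=
  (SCat.mapExact (trivExt M) p).obj X

/-- The diagram in `C` that underlies a diagram in `C ⋉ M`. -/
abbrev projDiag (X : SCat (Semidirect M.toBiadditiveFunctor) p) : SCat C p :=
  (SCat.mapExact (projExact M) p).obj X

/-- The automorphism `(id, m)` of a diagram in `C`, regarded as a diagram in `C ⋉ M`. -/
def gaugeHom (X : SCat C p) (m : SBimod M.toBiadditiveFunctor X X) :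
    trivDiag M X ⟶ trivDiag M X :=
  ⟨{ app := fun θ => ⟨𝟙 (X.obj.obj θ), m.1 θ⟩
     naturality := fun ρ θ a => by
      ext
      · exact (Category.comp_id _).trans (Category.id_comp _).symm
      · change M.push (𝟙 (X.obj.obj θ)) (0 : M.val (X.obj.obj ρ) (X.obj.obj θ)) +
            M.pull (X.obj.map a) (m.1 θ) = M.push (X.obj.map a) (m.1 ρ) +
          M.pull (𝟙 (X.obj.obj ρ)) (0 : M.val (X.obj.obj ρ) (X.obj.obj θ))
        rw [m.2 ρ θ a, map_zero, map_zero, zero_add, add_zero] }⟩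

theorem gaugeHom_zero (X : SCat C p) : gaugeHom M X 0 = 𝟙 (trivDiag M X) := rfl

theorem gaugeHom_add (X : SCat C p) (m m' : SBimod M.toBiadditiveFunctor X X) :
    gaugeHom M X m ≫ gaugeHom M X m' = gaugeHom M X (m' + m) := by
  refine ObjectProperty.hom_ext _ (NatTrans.ext (funext fun θ => ?_))
  ext
  · exact Category.comp_id _
  · change M.push (𝟙 _) (m.1 θ) + M.pull (𝟙 _) (m'.1 θ) = m'.1 θ + m.1 θ
    rw [M.push_id, M.pull_id, add_comm]

/-- The group `S^{(n)}_p M(X, X)` as a group of automorphisms in `S^{(n)}_p (C ⋉ M)`. -/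
def gauge (X : SCat C p) : SingleObj (Multiplicative (SBimod M.toBiadditiveFunctor X X)) ⥤
    Core (SCat (Semidirect M.toBiadditiveFunctor) p) where
  obj _ := ⟨trivDiag M X⟩
  map {_ _} m := ⟨{
    hom := gaugeHom M X (Multiplicative.toAdd (show Multiplicative _ from m))
    inv := gaugeHom M X (-Multiplicative.toAdd (show Multiplicative _ from m))
    hom_inv_id := by rw [gaugeHom_add, neg_add_cancel, gaugeHom_zero]
    inv_hom_id := by rw [gaugeHom_add, add_neg_cancel, gaugeHom_zero] }⟩
  map_id _ := Core.hom_ext (gaugeHom_zero M X)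
  map_comp _ _ := Core.hom_ext (gaugeHom_add M X _ _).symm

theorem zmap_gauge (b : Bool) {c : C} (m : M.val c c) :
    (⟨𝟙 (zext b c), zelt M.toBiadditiveFunctor b m⟩ : SemidirectHom M.toBiadditiveFunctor
        ⟨zext b c⟩ ⟨zext b c⟩) ≍
      zmap b b (show (⟨c⟩ : Semidirect M.toBiadditiveFunctor) ⟶ ⟨c⟩ from ⟨𝟙 c, m⟩) := by
  cases b
  · exact zero_heq (C := Semidirect M.toBiadditiveFunctor) (c := ⟨ExactCategory.zero⟩)
      (c' := ⟨ExactCategory.zero⟩) rfl rfl rfl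
  · rfl

/-- The map `∐_X B S^{(n)}_• M(X, X) → N_• i S^{(n)}_• (C ⋉ M)`. -/
def coprodToNerve : coprodS M.toBiadditiveFunctor ⟶ nerveS (Semidirect M.toBiadditiveFunctor) where
  toFun _ _ c := c.2 ⋙ gauge M c.1
  toFun_map _ _ _ _ := chain_ext (fun _ => rfl) (fun _ _ _ _ => HEq.rfl)
  toFun_pt _ _ := chain_ext (fun _ => rfl) (fun _ _ _ _ => HEq.rfl)
  toFun_susp c := chain_ext (fun _ => SCat.mapExact_susp (trivExt M) c.1)
    (fun _ _ _ θ => zmap_gauge M θ.head _)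

end

/-! ### Naturality of the comparison maps -/

/-- The functor from the source of a natural transformation to its arrows. -/
def arrowFunctor {B D : Type*} [Category B] [Category D] {F G : B ⥤ D} (τ : F ⟶ G) : B ⥤ Arrow D where
  obj A := Arrow.mk (τ.app A)
  map f := Arrow.homMk (F.map f) (G.map f) (τ.naturality f)

/-- The functor `C ↦ Ob S^{(n)}_• C`. -/
def objSFunctor : ExactCat.{v, u} ⥤ SymmetricMultisimplicialSet.{max u v} where
  obj C := objS C.carrier
  map F :=
    { toFun := fun p _ X => (SCat.mapExact F p).obj X
      toFun_map := fun _ _ _ _ => rfl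
      toFun_pt := fun p _ => SCat.mapExact_zero F p
      toFun_susp := fun _ => SCat.mapExact_susp F _ }
  map_id _ := rfl
  map_comp _ _ := rfl

/-- The functor `(C, M) ↦ ∐_{X ∈ Ob S^{(n)}_• C} B S^{(n)}_• M(X, X)`. -/
def coprodSFunctor : ExactBimod.{v, u} ⥤ SymmetricMultisimplicialSet.{max u v} where
  obj A := coprodS A.bimodule.toBiadditiveFunctor
  map F :=
    { toFun := fun p _ => Coprod.map (SCat.mapExact (ExactBimodHom.base F) p).obj
        (ExactBimodHom.mapS F) OrderHom.id
      toFun_map := fun _ _ _ _ => rfl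
      toFun_pt := fun p _ => (Coprod.map_base _ _ _ _).trans
        (congrArg _ (SCat.mapExact_zero (ExactBimodHom.base F) p))
      toFun_susp := fun c => Coprod.ext (SCat.mapExact_susp (ExactBimodHom.base F) c.1)
        fun _ _ _ _ => ExactBimodHom.app_zelt F _ _ }
  map_id _ := rfl
  map_comp _ _ := rfl

/-- The natural transformation with components `coprodToObj`. -/
def coprodToObjNat : coprodSFunctor.{v, u} ⟶ baseFunctor ⋙ objSFunctor where
  app A := coprodToObj A.bimodule.toBiadditiveFunctor

/-- The natural transformation with components `coprodToWedge`. -/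
def coprodToWedgeNat : coprodSFunctor.{v, u} ⟶ wedgeSFunctor where
  app A := coprodToWedge A.bimodule.toBiadditiveFunctor

/-- The natural transformation with components `objToNerve`. -/
def objToNerveNat : objSFunctor.{v, u} ⟶ nerveSFunctor where
  app C := objToNerve C.carrier
  naturality C D F := by
    refine SymmetricMultisimplicialSet.Hom.ext ?_
    funext n p q X
    exact chain_ext (fun _ => rfl) (fun _ _ _ θ => heq_of_eq ((ExactFunctor.functor F).map_id _).symm)

/-- The natural transformation with components `coprodToNerve`. -/
def coprodToNerveNat : coprodSFunctor.{v, u} ⟶ semidirectFunctor ⋙ nerveSFunctor where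
  app A := coprodToNerve A.bimodule
  naturality A B F := by
    refine SymmetricMultisimplicialSet.Hom.ext ?_
    funext n p q c
    refine chain_ext (fun _ => ?_) (fun _ _ _ θ => ?_)
    · refine SCat.ext (fun _ => rfl) (fun _ _ a => heq_of_eq ?_)
      refine SemidirectHom.ext rfl ?_
      exact (map_zero _).symm
    · refine heq_of_eq (SemidirectHom.ext ?_ rfl)
      exact ((ExactBimodHom.base F).functor.map_id _).symm

theorem coprodToNerve_comp (A : ExactBimod.{v, u}) :
    coprodToNerveNat.app A ≫ nerveSFunctor.map (projection.app A) =
      coprodToObjNat.app A ≫ objToNerveNat.app (baseFunctor.obj A) := by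
  refine SymmetricMultisimplicialSet.Hom.ext ?_
  funext n p q c
  exact chain_ext (fun _ => rfl) (fun _ _ _ θ => HEq.rfl)

/-- The square that relates the disjoint unions of classifying spaces with `K`-theory. -/
def squareHom (A : ExactBimod.{v, u}) :
    Arrow.mk (SymmetricMultisimplicialSet.realization.{max u v}.map (coprodToObjNat.app A)) ⟶
      Arrow.mk (K.{v, u}.map (projection.app A)) :=
  Arrow.homMk (f := Arrow.mk (SymmetricMultisimplicialSet.realization.{max u v}.map
      (coprodToObjNat.app A))) (g := Arrow.mk (K.{v, u}.map (projection.app A)))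
    (SymmetricMultisimplicialSet.realization.{max u v}.map (coprodToNerveNat.app A))
    (SymmetricMultisimplicialSet.realization.{max u v}.map
      (objToNerveNat.app (baseFunctor.obj A)))
    ((Functor.map_comp _ _ _).symm.trans ((congrArg SymmetricMultisimplicialSet.realization.{max u v}.map
      (coprodToNerve_comp A)).trans (Functor.map_comp _ _ _)))

/-- The functor that sends `(C, M)` to the homotopy fiber of
`∐_X B S^{(n)}_• M(X, X) → Ob S^{(n)}_• C`. -/
def relativeCoprod : ExactBimod.{v, u} ⥤ SymmetricSpectrum.{max u v} :=
  arrowFunctor (Functor.whiskerRight coprodToObjNat.{v, u}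
    SymmetricMultisimplicialSet.realization.{max u v}) ⋙ SymmetricSpectrum.hofibFunctor

/-- The map from the homotopy fiber to the wedge, the homotopy cofiber. -/
def relativeCoprodToReduced : relativeCoprod.{v, u} ⟶ reducedModel where
  app A := SymmetricSpectrum.hofibProj (SymmetricMultisimplicialSet.realization.{max u v}.map
    (coprodToObjNat.app A)) ≫ SymmetricMultisimplicialSet.realization.{max u v}.map
      (coprodToWedgeNat.app A)
  naturality A B F := by
    refine SymmetricSpectrum.Hom.ext ?_
    funext n z
    have h := congrArg SymmetricMultisimplicialSet.realization.{max u v}.map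
      (coprodToWedgeNat.{v, u}.naturality F)
    rw [Functor.map_comp, Functor.map_comp] at h
    exact congrArg (fun f => SymmetricSpectrum.Hom.toFun f n z.1.1) h

/-- The map of homotopy fibers induced by `squareHom`. -/
def relativeCoprodToRelativeK : relativeCoprod.{v, u} ⟶ relativeK where
  app A := SymmetricSpectrum.hofibFunctor.map (squareHom A)
  naturality A B F := by
    refine (SymmetricSpectrum.hofibFunctor.{max u v}.map_comp _ _).symm.trans (Eq.trans ?_
      (SymmetricSpectrum.hofibFunctor.{max u v}.map_comp _ _))
    refine congrArg SymmetricSpectrum.hofibFunctor.{max u v}.map (Arrow.hom_ext _ _ ?_ ?_)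
    · exact (Functor.map_comp _ _ _).symm.trans ((congrArg
        SymmetricMultisimplicialSet.realization.{max u v}.map
        (coprodToNerveNat.{v, u}.naturality F)).trans (Functor.map_comp _ _ _))
    · exact (Functor.map_comp _ _ _).symm.trans ((congrArg
        SymmetricMultisimplicialSet.realization.{max u v}.map
        (objToNerveNat.{v, u}.naturality (baseFunctor.map F))).trans (Functor.map_comp _ _ _))

/-! ### Sections over multisimplicial sets -/

section

variable {ι : Type}

/-- The operators from multi-index `p'` to multi-index `p`: families of monotone maps
`[p'_i] → [p_i]`. -/
abbrev Ops (p' p : ι → ℕ) : Type := ∀ i, Fin (p' i + 1) →o Fin (p i + 1)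

namespace Ops

variable {p p' p'' : ι → ℕ}

/-- The identity operator. -/
abbrev id (p : ι → ℕ) : Ops p p := fun _ => OrderHom.id

/-- The composite of operators. -/
abbrev comp (f : Ops p' p) (g : Ops p'' p') : Ops p'' p := fun i => (f i).comp (g i)

/-- Operators that are surjective in each direction. -/
def Surj (f : Ops p' p) : Prop := ∀ i, Function.Surjective (f i)

theorem Surj.of_comp {f : Ops p' p} {g : Ops p'' p'} (h : (f.comp g).Surj) : f.Surj := fun i =>
  Function.Surjective.of_comp (g := g i) (h i)

theorem surj_id (p : ι → ℕ) : (id p).Surj := fun _ => Function.surjective_id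

theorem exists_factorization_aux {m k : ℕ} (f : Fin (m + 1) →o Fin (k + 1)) :
    ∃ (k' : ℕ) (j : Fin (k' + 1) →o Fin (k + 1)) (s : Fin (m + 1) →o Fin (k' + 1)),
      j.comp s = f ∧ k' ≤ k ∧ (¬Function.Surjective f → k' < k) := by
  by_cases hf : Function.Surjective f
  · exact ⟨k, OrderHom.id, f, rfl, le_rfl, fun h => absurd hf h⟩
  · obtain ⟨b, hb⟩ : ∃ b, ∀ a, f a ≠ b := by simpa [Function.Surjective] using hf
    obtain _ | k := k
    · exact absurd (Fin.ext (by omega)) (hb 0)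
    · have h : ∀ a, ∃ z, b.succAbove z = f a := fun a => Fin.exists_succAbove_eq (hb a)
      choose s hs using h
      refine ⟨k, b.succAboveOrderEmb.toOrderHom, ⟨s, fun a a' haa' => ?_⟩, ?_, by omega, by omega⟩
      · rw [← (Fin.strictMono_succAbove b).le_iff_le, hs, hs]
        exact f.monotone haa'
      · ext a : 2
        exact hs a

/-- An operator that is not surjective factors through a multi-index of smaller dimension. -/
theorem exists_factorization [Fintype ι] (f : Ops p' p) (hf : ¬f.Surj) :
    ∃ (p'' : ι → ℕ) (j : Ops p'' p) (s : Ops p' p''), j.comp s = f ∧ ∑ i, p'' i < ∑ i, p i := by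
  choose p'' j s h₁ h₂ h₃ using fun i => exists_factorization_aux (f i)
  obtain ⟨i, hi⟩ := not_forall.1 hf
  exact ⟨p'', j, s, funext h₁, Finset.sum_lt_sum (fun i _ => h₂ i) ⟨i, Finset.mem_univ i, h₃ i hi⟩⟩

theorem exists_section_aux {m k : ℕ} (d : Fin (m + 1) →o Fin (k + 1))
    (hd : Function.Surjective d) (a : Fin (m + 1)) :
    ∃ g : Fin (k + 1) →o Fin (m + 1), d.comp g = OrderHom.id ∧ g (d a) = a := by
  classical
  choose c hc using hd
  have h : ∀ b, d (if b = d a then a else c b) = b := fun b => by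
    split_ifs with h
    · exact h.symm
    · exact hc b
  refine ⟨⟨fun b => if b = d a then a else c b, fun b b' hb => ?_⟩, ?_, if_pos rfl⟩
  · rcases hb.lt_or_eq with hb | rfl
    · exact (d.monotone.reflect_lt (by rw [h, h]; exact hb)).le
    · rfl
  · ext b : 2
    exact h b

/-- A surjective operator has sections through all of its points. -/
theorem Surj.exists_section {d : Ops p' p} (hd : d.Surj) (a : ∀ i, Fin (p' i + 1)) :
    ∃ g : Ops p p', d.comp g = id p ∧ ∀ i, g i (d i (a i)) = a i := by
  choose g h₁ h₂ using fun i => exists_section_aux (d i) (hd i) (a i)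
  exact ⟨g, funext h₁, h₂⟩

theorem Surj.eq_id {d : Ops p p} (hd : d.Surj) : d = id p := by
  funext i
  have hs : StrictMono (d i) := (d i).monotone.strictMono_of_injective
    (Finite.injective_iff_surjective.2 (hd i))
  ext a : 2
  exact congrArg (fun e : Fin (p i + 1) ≃o Fin (p i + 1) => e a)
    (Subsingleton.elim (hs.orderIsoOfSurjective _ (hd i)) (OrderIso.refl _))

end Ops

/-- Multisimplicial sets with directions indexed by `ι`. -/
structure MultisimplicialSet (ι : Type) where
  cell : (ι → ℕ) → Type u
  map : ∀ {p p' : ι → ℕ}, Ops p' p → cell p → cell p'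
  map_id : ∀ {p : ι → ℕ} (x : cell p), map (Ops.id p) x = x
  map_map : ∀ {p p' p'' : ι → ℕ} (f : Ops p' p) (g : Ops p'' p') (x : cell p),
    map g (map f x) = map (f.comp g) x

namespace MultisimplicialSet

variable (X : MultisimplicialSet.{u} ι) {Φ : ∀ {p : ι → ℕ}, X.cell p → Type v}

/-- Sets of data on cells which contain at most one datum for each cell and restrict along all
operators. -/
structure IsPartialSection
    (Rel : ∀ {p p' : ι → ℕ} (f : Ops p' p) {x : X.cell p} {y : X.cell p'}, X.map f x = y →
      Φ x → Φ y → Prop)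
    (S : Set (Σ p : ι → ℕ, Σ x : X.cell p, Φ x)) : Prop where
  unique : ∀ {p : ι → ℕ} {x : X.cell p} {φ φ' : Φ x}, ⟨p, x, φ⟩ ∈ S → ⟨p, x, φ'⟩ ∈ S → φ = φ'
  closed : ∀ {p p' : ι → ℕ} (f : Ops p' p) {x : X.cell p} {φ : Φ x}, ⟨p, x, φ⟩ ∈ S →
    ∃ φ' : Φ (X.map f x), ⟨p', X.map f x, φ'⟩ ∈ S ∧ Rel f rfl φ φ'

variable {X}

theorem IsPartialSection.sUnion
    {Rel : ∀ {p p' : ι → ℕ} (f : Ops p' p) {x : X.cell p} {y : X.cell p'}, X.map f x = y →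
      Φ x → Φ y → Prop} {c : Set (Set (Σ p : ι → ℕ, Σ x : X.cell p, Φ x))}
    (hc : ∀ S ∈ c, X.IsPartialSection Rel S) (hc' : IsChain (· ⊆ ·) c) :
    X.IsPartialSection Rel (⋃₀ c) where
  unique := by
    rintro p x φ φ' ⟨S, hS, h⟩ ⟨S', hS', h'⟩
    rcases hc'.total hS hS' with hle | hle
    · exact (hc S' hS').unique (hle h) h'
    · exact (hc S hS).unique h (hle h')
  closed := by
    rintro p p' f x φ ⟨S, hS, h⟩
    obtain ⟨φ', h', hr⟩ := (hc S hS).closed f h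
    exact ⟨φ', ⟨S, hS, h'⟩, hr⟩

variable [Fintype ι]

/-- Degeneracies of a cell `x` outside of the domain of a partial section that contains all cells of
smaller dimension are different from each other. -/
theorem eq_of_map_eq {D : ∀ {p : ι → ℕ}, X.cell p → Prop} (hD : ∀ {p p' : ι → ℕ} (f : Ops p' p)
    {x : X.cell p}, D x → D (X.map f x)) {p : ι → ℕ} {x : X.cell p} (hx : ¬D x)
    (hlow : ∀ {p' : ι → ℕ} (x' : X.cell p'), ∑ i, p' i < ∑ i, p i → D x') {p' : ι → ℕ}
    {d d' : Ops p' p} (hd : d.Surj) (h : X.map d x = X.map d' x) : d = d' := by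
  classical
  funext i
  ext a : 2
  obtain ⟨g, hg, hga⟩ := hd.exists_section (Function.update (fun _ => 0) i a)
  have h₁ : X.map (d'.comp g) x = x := by
    rw [← X.map_map, ← h, X.map_map, hg, X.map_id]
  have h₂ : (d'.comp g).Surj := by
    by_contra hs
    obtain ⟨p'', j, s, hjs, hlt⟩ := Ops.exists_factorization _ hs
    refine hx ?_
    rw [← h₁, ← hjs, ← X.map_map]
    exact hD s (hlow _ hlt)
  have h₃ := hga i
  rw [Function.update_self] at h₃
  have h₄ : d' i (g i (d i a)) = d i a :=
    congrArg (fun f : Ops p p => f i (d i a)) h₂.eq_id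
  rw [h₃] at h₄
  exact h₄.symm

/-- A partial section of data on the cells of a multisimplicial set extends to all cells, if data can
be pulled back along degeneracies and data on the boundary of a cell extend to the cell. -/
theorem exists_section
    (Rel : ∀ {p p' : ι → ℕ} (f : Ops p' p) {x : X.cell p} {y : X.cell p'}, X.map f x = y →
      Φ x → Φ y → Prop)
    (pull : ∀ {p p' : ι → ℕ} (d : Ops p' p), d.Surj → ∀ {x : X.cell p} {y : X.cell p'},
      X.map d x = y → Φ x → Φ y)
    (rel_pull : ∀ {p p' : ι → ℕ} (d : Ops p' p) (hd : d.Surj) {x : X.cell p} {y : X.cell p'}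
      (h : X.map d x = y) (φ : Φ x), Rel d h φ (pull d hd h φ))
    (pull_rel : ∀ {p p' p'' : ι → ℕ} (d : Ops p' p) (hd : d.Surj) (f : Ops p'' p') {x : X.cell p}
      {y : X.cell p'} {z : X.cell p''} (h : X.map d x = y) (h' : X.map f y = z)
      (h'' : X.map (d.comp f) x = z) (φ : Φ x) (φ' : Φ z),
      Rel (d.comp f) h'' φ φ' → Rel f h' (pull d hd h φ) φ')
    (S₀ : Set (Σ p : ι → ℕ, Σ x : X.cell p, Φ x)) (hS₀ : X.IsPartialSection Rel S₀)
    (ext : ∀ {p : ι → ℕ} (x : X.cell p)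
      (F : ∀ {p' : ι → ℕ} (f : Ops p' p), ¬f.Surj → Φ (X.map f x)),
      (∀ {p' p'' : ι → ℕ} (f : Ops p' p) (g : Ops p'' p') (hf : ¬f.Surj) (hfg : ¬(f.comp g).Surj),
        Rel g (X.map_map f g x) (F f hf) (F (f.comp g) hfg)) →
      ∃ φ : Φ x, ∀ {p' : ι → ℕ} (f : Ops p' p) (hf : ¬f.Surj), Rel f rfl φ (F f hf)) :
    ∃ s : ∀ {p : ι → ℕ} (x : X.cell p), Φ x,
      (∀ {p p' : ι → ℕ} (f : Ops p' p) (x : X.cell p), Rel f rfl (s x) (s (X.map f x))) ∧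
      ∀ {p : ι → ℕ} (x : X.cell p) (φ : Φ x), ⟨p, x, φ⟩ ∈ S₀ → s x = φ := by
  obtain ⟨S, hS₀S, hS⟩ := zorn_subset_nonempty {S | X.IsPartialSection Rel S}
    (fun c hc hc' _ => ⟨⋃₀ c, IsPartialSection.sUnion hc hc', fun _ => Set.subset_sUnion_of_mem⟩)
    S₀ hS₀
  have hSp : X.IsPartialSection Rel S := hS.prop
  let D : ∀ {p : ι → ℕ}, X.cell p → Prop := fun {p} x => ∃ φ : Φ x, ⟨p, x, φ⟩ ∈ S
  have hD : ∀ {p p' : ι → ℕ} (f : Ops p' p) {x : X.cell p}, D x → D (X.map f x) := by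
    rintro p p' f x ⟨φ, h⟩
    obtain ⟨φ', h', -⟩ := hSp.closed f h
    exact ⟨φ', h'⟩
  obtain ⟨val, hval⟩ : ∃ val : ∀ {p : ι → ℕ} (x : X.cell p), D x → Φ x,
      ∀ {p : ι → ℕ} (x : X.cell p) (hx : D x), ⟨p, x, val x hx⟩ ∈ S :=
    ⟨fun x hx => hx.choose, fun x hx => hx.choose_spec⟩
  have hrel : ∀ {p p' : ι → ℕ} (f : Ops p' p) {x : X.cell p} {y : X.cell p'} (h : X.map f x = y)
      (hx : D x) (hy : D y), Rel f h (val x hx) (val y hy) := by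
    rintro p p' f x _ rfl hx hy
    obtain ⟨φ', h', hr⟩ := hSp.closed f (hval x hx)
    rwa [hSp.unique (hval _ hy) h']
  have key : ∀ N : ℕ, ∀ {p : ι → ℕ} (x : X.cell p), ∑ i, p i = N → D x := by
    intro N
    induction N using Nat.strong_induction_on with
    | _ N ih =>
    rintro p x rfl
    by_contra hx
    have hlow : ∀ {p' : ι → ℕ} (x' : X.cell p'), ∑ i, p' i < ∑ i, p i → D x' :=
      fun x' h => ih _ h x' rfl
    have hface : ∀ {p' : ι → ℕ} (f : Ops p' p), ¬f.Surj → D (X.map f x) := by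
      intro p' f hf
      obtain ⟨p'', j, s, hjs, hlt⟩ := Ops.exists_factorization f hf
      rw [← hjs, ← X.map_map]
      exact hD s (hlow _ hlt)
    have hdeg : ∀ {p' : ι → ℕ} (d : Ops p' p), d.Surj → ¬D (X.map d x) := by
      intro p' d hd h
      obtain ⟨g, hg, -⟩ := hd.exists_section (fun _ => 0)
      have := hD g h
      rw [X.map_map, hg, X.map_id] at this
      exact hx this
    obtain ⟨φ, hφ⟩ := ext x (fun f hf => val _ (hface f hf)) fun f g hf hfg => hrel _ _ _ _
    -- the new partial section contains all degeneracies of `x`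
    let T : Set (Σ p : ι → ℕ, Σ x : X.cell p, Φ x) := S ∪ {z | ∃ (d : Ops z.1 p) (hd : d.Surj)
      (h : X.map d x = z.2.1), z.2.2 = pull d hd h φ}
    have hT : X.IsPartialSection Rel T := by
      constructor
      · rintro q y ψ ψ' (h | ⟨d, hd, h, e⟩) (h' | ⟨d', hd', h', e'⟩)
        · exact hSp.unique h h'
        · dsimp only at d' h'
          subst h'
          exact absurd ⟨_, h⟩ (hdeg d' hd')
        · dsimp only at d h
          subst h
          exact absurd ⟨_, h'⟩ (hdeg d hd)
        · obtain rfl := eq_of_map_eq hD hx hlow hd (h.trans h'.symm)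
          exact e.trans e'.symm
      · intro q q' f y ψ hψ
        obtain h | ⟨d, hd, h, e⟩ := hψ
        · obtain ⟨φ', h', hr⟩ := hSp.closed f h
          exact ⟨φ', Or.inl h', hr⟩
        · dsimp only at d h e
          subst h
          rw [e]
          have e := X.map_map d f x
          by_cases hf : (d.comp f).Surj
          · exact ⟨pull (d.comp f) hf e.symm φ, Or.inr ⟨d.comp f, hf, e.symm, rfl⟩,
              pull_rel d hd f rfl rfl e.symm φ _ (rel_pull _ hf _ φ)⟩
          · have h₁ : ∀ (z : X.cell q') (h : X.map (d.comp f) x = z) (hz : D z),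
                Rel (d.comp f) h φ (val z hz) := by
              rintro z rfl hz
              exact hφ (d.comp f) hf
            have hz : D (X.map f (X.map d x)) := by
              rw [e]
              exact hface _ hf
            exact ⟨val _ hz, Or.inl (hval _ hz), pull_rel d hd f rfl rfl e.symm φ _ (h₁ _ e.symm hz)⟩
    refine hx ⟨pull (Ops.id p) (Ops.surj_id p) (X.map_id x) φ, ?_⟩
    exact hS.le_of_ge hT Set.subset_union_left (Or.inr ⟨_, Ops.surj_id p, X.map_id x, rfl⟩)
  have key' : ∀ {p : ι → ℕ} (x : X.cell p), D x := fun x => key _ x rfl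
  exact ⟨fun x => val x (key' x), fun f x => hrel f rfl _ _,
    fun x φ h => hSp.unique (hval _ _) (hS₀S h)⟩

end MultisimplicialSet

end

/-! ### Collars in products of simplices -/

theorem stdSimplex_map_apply {m k : ℕ} (f : Fin (m + 1) → Fin (k + 1))
    (t : stdSimplex ℝ (Fin (m + 1))) (b : Fin (k + 1)) :
    stdSimplex.map f t b = ∑ a with f a = b, t a := by
  rw [stdSimplex.map_coe, FunOnFinite.linearMap_apply_apply]

theorem stdSimplex_map_congr {m k : ℕ} {f g : Fin (m + 1) → Fin (k + 1)}
    {t : stdSimplex ℝ (Fin (m + 1))} (h : ∀ a, t a ≠ 0 → f a = g a) :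
    stdSimplex.map f t = stdSimplex.map g t := by
  refine Subtype.ext (funext fun b => ?_)
  change stdSimplex.map f t b = stdSimplex.map g t b
  rw [stdSimplex_map_apply, stdSimplex_map_apply, Finset.sum_filter, Finset.sum_filter]
  refine Finset.sum_congr rfl fun a _ => ?_
  by_cases ha : t a = 0
  · simp [ha]
  · rw [h a ha]

theorem stdSimplex_map_ne_zero {m k : ℕ} (f : Fin (m + 1) → Fin (k + 1))
    {t : stdSimplex ℝ (Fin (m + 1))} {a : Fin (m + 1)} (ha : t a ≠ 0) :
    stdSimplex.map f t (f a) ≠ 0 := by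
  rw [stdSimplex_map_apply]
  refine (lt_of_lt_of_le ((stdSimplex.zero_le t a).lt_of_ne ha.symm) ?_).ne'
  exact Finset.single_le_sum (f := fun a => t a) (fun b _ => stdSimplex.zero_le t b) (by simp)

theorem exists_stdSimplex_ne_zero {m : ℕ} (t : stdSimplex ℝ (Fin (m + 1))) : ∃ a, t a ≠ 0 := by
  by_contra h
  push Not at h
  have := stdSimplex.sum_eq_one t
  simp [h] at this

@[fun_prop]
theorem continuous_stdSimplex_apply {m : ℕ} (a : Fin (m + 1)) :
    Continuous fun t : stdSimplex ℝ (Fin (m + 1)) => t a :=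
  (continuous_apply a).comp continuous_subtype_val

/-- The monotone retraction of `{0, …, k}` onto a nonempty subset. -/
def retract {k : ℕ} (S : Finset (Fin (k + 1))) : Fin (k + 1) →o Fin (k + 1) :=
  if h : S.Nonempty then
    ⟨fun a => (insert (S.min' h) (S.filter (· ≤ a))).max' (Finset.insert_nonempty _ _),
      fun _ _ hab => Finset.max'_subset _ (Finset.insert_subset_insert _
        (Finset.monotone_filter_right S fun _ _ h => h.trans hab))⟩
  else OrderHom.id

theorem retract_mem {k : ℕ} {S : Finset (Fin (k + 1))} (h : S.Nonempty) (a : Fin (k + 1)) :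
    retract S a ∈ S := by
  rw [retract, dif_pos h]
  have := Finset.max'_mem (insert (S.min' h) (S.filter (· ≤ a))) (Finset.insert_nonempty _ _)
  rcases Finset.mem_insert.1 this with h' | h'
  · exact (congrArg (· ∈ S) h').mpr (S.min'_mem h)
  · exact (Finset.mem_filter.1 h').1

theorem retract_of_mem {k : ℕ} {S : Finset (Fin (k + 1))} {a : Fin (k + 1)} (ha : a ∈ S) :
    retract S a = a := by
  have h : S.Nonempty := ⟨a, ha⟩
  rw [retract, dif_pos h]
  change Finset.max' (insert (S.min' h) (S.filter (· ≤ a))) (Finset.insert_nonempty _ _) = a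
  rw [Finset.max'_eq_iff]
  refine ⟨Finset.mem_insert_of_mem (Finset.mem_filter.2 ⟨ha, le_rfl⟩), fun b hb => ?_⟩
  rw [Finset.mem_insert, Finset.mem_filter] at hb
  exact hb.elim (fun hb => hb.trans_le (S.min'_le a ha)) And.right

section

variable {ι : Type}

/-- The product of the simplices `Δ^{p_i}`. -/
abbrev Prism (p : ι → ℕ) : Type := ∀ i, stdSimplex ℝ (Fin (p i + 1))

variable {p p' p'' : ι → ℕ}

/-- The map of products of simplices induced by an operator. -/
noncomputable def Ops.push (f : Ops p' p) (t : Prism p') : Prism p :=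
  fun i => stdSimplex.map (f i) (t i)

theorem Ops.push_comp (f : Ops p' p) (g : Ops p'' p') (t : Prism p'') :
    (f.comp g).push t = f.push (g.push t) :=
  funext fun i => (stdSimplex.map_comp_apply (g i) (f i) (t i)).symm

theorem Ops.push_id (t : Prism p) : (Ops.id p).push t = t :=
  funext fun i => stdSimplex.map_id_apply (t i)

theorem Ops.continuous_push (f : Ops p' p) : Continuous f.push :=
  continuous_pi fun i => (stdSimplex.continuous_map (f i)).comp (continuous_apply i)

theorem Ops.push_congr {f g : Ops p' p} {t : Prism p'} (h : ∀ i a, t i a ≠ 0 → f i a = g i a) :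
    f.push t = g.push t :=
  funext fun i => stdSimplex_map_congr (h i)

/-- The boundary of a product of simplices. -/
def IsBoundary (t : Prism p) : Prop := ∃ i a, t i a = 0

/-- The retraction of a product of simplices onto the smallest face that contains a point. -/
noncomputable def faceOps (t : Prism p) : Ops p p := fun i => retract {a | t i a ≠ 0}

theorem faceOps_mem (t : Prism p) (i : ι) (a : Fin (p i + 1)) : t i (faceOps t i a) ≠ 0 := by
  obtain ⟨b, hb⟩ := exists_stdSimplex_ne_zero (t i)
  have := retract_mem (S := {a | t i a ≠ 0}) ⟨b, by simpa using hb⟩ a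
  exact (Finset.mem_filter.1 this).2

theorem faceOps_of_ne_zero {t : Prism p} {i : ι} {a : Fin (p i + 1)} (h : t i a ≠ 0) :
    faceOps t i a = a :=
  retract_of_mem (by simpa using h)

theorem faceOps_push (t : Prism p) : (faceOps t).push t = t := by
  refine (Ops.push_congr fun i a ha => ?_).trans (Ops.push_id t)
  exact faceOps_of_ne_zero ha

theorem IsBoundary.not_surj {t : Prism p} (h : IsBoundary t) : ¬(faceOps t).Surj := by
  obtain ⟨i, a, ha⟩ := h
  intro hs
  obtain ⟨b, hb⟩ := hs i a
  exact faceOps_mem t i b (by rw [hb, ha])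

theorem isBoundary_push {f : Ops p' p} (hf : ¬f.Surj) (t : Prism p') : IsBoundary (f.push t) := by
  obtain ⟨i, hi⟩ := not_forall.1 hf
  obtain ⟨b, hb⟩ : ∃ b, ∀ a, f i a ≠ b := by simpa [Function.Surjective] using hi
  refine ⟨i, b, ?_⟩
  change stdSimplex.map (f i) (t i) b = 0
  rw [stdSimplex_map_apply, Finset.sum_filter]
  exact Finset.sum_eq_zero fun a _ => if_neg (hb a)

/-- A compatible family of functions on the faces of a product of simplices is determined on the
boundary by the retractions onto the smallest faces. -/
theorem faceOps_eq {Y : Type*} (G : ∀ {p' : ι → ℕ} (f : Ops p' p), ¬f.Surj → Prism p' → Y)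
    (hG : ∀ {p' p'' : ι → ℕ} (f : Ops p' p) (g : Ops p'' p') (hf : ¬f.Surj) (hfg : ¬(f.comp g).Surj)
      (t : Prism p''), G (f.comp g) hfg t = G f hf (g.push t))
    {f : Ops p' p} (hf : ¬f.Surj) (t : Prism p') (h : ¬(faceOps (f.push t)).Surj) :
    G (faceOps (f.push t)) h (f.push t) = G f hf t := by
  have h₁ : ¬((faceOps (f.push t)).comp f).Surj := fun hs => h hs.of_comp
  have h₂ : ¬(((faceOps (f.push t)).comp f).comp (faceOps t)).Surj := fun hs => h₁ hs.of_comp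
  have h₃ : ¬(f.comp (faceOps t)).Surj := fun hs => hf hs.of_comp
  have e : ((faceOps (f.push t)).comp f).comp (faceOps t) = f.comp (faceOps t) := by
    funext i
    ext a : 2
    exact faceOps_of_ne_zero (stdSimplex_map_ne_zero (f i) (faceOps_mem t i a))
  have a₁ := hG _ (faceOps t) h₁ h₂ t
  have a₂ := hG f (faceOps t) hf h₃ t
  rw [faceOps_push] at a₁ a₂
  rw [← hG _ f h h₁, ← a₁, ← a₂]
  simp only [e]

/-- The retraction of a product of simplices onto a face of codimension one. -/
theorem exists_ops_of_eq_zero (i : ι) (a : Fin (p i + 1)) :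
    ∃ e : Ops p p, ∀ t : Prism p, t i a = 0 → ¬e.Surj ∧ e.push t = t := by
  classical
  refine ⟨fun j => retract {b | (⟨j, b⟩ : Σ j, Fin (p j + 1)) ≠ ⟨i, a⟩}, fun t ht => ⟨fun hs => ?_, ?_⟩⟩
  · obtain ⟨b, hb⟩ := exists_stdSimplex_ne_zero (t i)
    have hne : (Finset.univ.filter
        fun b => (⟨i, b⟩ : Σ j, Fin (p j + 1)) ≠ ⟨i, a⟩).Nonempty := by
      refine ⟨b, ?_⟩
      simp only [ne_eq, Sigma.mk.injEq, heq_eq_eq, true_and, Finset.mem_filter, Finset.mem_univ]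
      rintro rfl
      exact hb ht
    obtain ⟨c, hc⟩ := hs i a
    have := retract_mem hne c
    dsimp only at hc
    rw [hc] at this
    simp at this
  · refine (Ops.push_congr fun j b hb => ?_).trans (Ops.push_id t)
    refine retract_of_mem ?_
    simp only [ne_eq, Finset.mem_filter, Finset.mem_univ, true_and]
    rintro h
    obtain ⟨rfl, h⟩ := Sigma.mk.inj_iff.1 h
    obtain rfl := eq_of_heq h
    exact hb ht

variable [Fintype ι]

/-- The distance from the boundary of a product of simplices, normalized to be one at the
barycenter. -/
noncomputable def depth (t : Prism p) : ℝ :=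
  (Finset.univ : Finset (Option (Σ i, Fin (p i + 1)))).inf' Finset.univ_nonempty
    fun o => o.elim 1 fun z => (p z.1 + 1) * t z.1 z.2

theorem continuous_depth : Continuous (depth : Prism p → ℝ) := by
  refine Continuous.finset_inf'_apply Finset.univ_nonempty fun o _ => ?_
  cases o with
  | none => exact continuous_const
  | some z => exact continuous_const.mul ((continuous_stdSimplex_apply _).comp (continuous_apply z.1))

theorem depth_le (t : Prism p) (i : ι) (a : Fin (p i + 1)) : depth t ≤ (p i + 1) * t i a :=
  Finset.inf'_le (fun o : Option (Σ i, Fin (p i + 1)) => o.elim 1 fun z => (p z.1 + 1) * t z.1 z.2)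
    (Finset.mem_univ (some (⟨i, a⟩ : Σ i, Fin (p i + 1))))

theorem depth_nonneg (t : Prism p) : 0 ≤ depth t := by
  refine Finset.le_inf' _ _ fun o _ => ?_
  cases o with
  | none => exact zero_le_one
  | some z => exact mul_nonneg (by positivity) (stdSimplex.zero_le _ _)

theorem IsBoundary.depth_eq {t : Prism p} (h : IsBoundary t) : depth t = 0 := by
  obtain ⟨i, a, h⟩ := h
  refine le_antisymm ((depth_le t i a).trans ?_) (depth_nonneg t)
  rw [h, mul_zero]

theorem exists_depth_eq {t : Prism p} (h : depth t < 1) : ∃ i a, (p i + 1) * t i a = depth t := by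
  obtain ⟨o, -, ho⟩ := Finset.exists_mem_eq_inf' (Finset.univ_nonempty)
    (fun o : Option (Σ i, Fin (p i + 1)) => o.elim 1 fun z => (p z.1 + 1) * t z.1 z.2)
  cases o with
  | none => exact absurd ho h.ne
  | some z => exact ⟨z.1, z.2, ho.symm⟩

/-- The time at which the point that starts at `t` and moves away from the barycenter reaches the
boundary. The bound `2 / 3` on the depth cuts it off at two, which keeps it finite at the
barycenter. -/
noncomputable def hitTime (t : Prism p) : ℝ := (1 - min (depth t) (2 / 3))⁻¹ - 1

theorem one_sub_min_pos (t : Prism p) : 0 < 1 - min (depth t) (2 / 3) := by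
  have := min_le_right (depth t) (2 / 3)
  linarith

@[fun_prop]
theorem continuous_hitTime : Continuous (hitTime : Prism p → ℝ) :=
  (Continuous.inv₀ (continuous_const.sub (continuous_depth.min continuous_const))
    fun t => (one_sub_min_pos t).ne').sub continuous_const

theorem hitTime_nonneg (t : Prism p) : 0 ≤ hitTime t := by
  have h := one_sub_min_pos t
  have := (one_le_inv₀ h).2 (by
    have := le_min (depth_nonneg t) (show (0 : ℝ) ≤ 2 / 3 by norm_num)
    linarith)
  unfold hitTime
  linarith

theorem IsBoundary.hitTime_eq {t : Prism p} (h : IsBoundary t) : hitTime t = 0 := by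
  unfold hitTime
  rw [h.depth_eq]
  norm_num

theorem mul_le_one_of_le_hitTime {t : Prism p} {c : ℝ} (hc : c ≤ 1 + hitTime t) (hc' : 0 ≤ c) :
    c * (1 - depth t) ≤ 1 := by
  have h := one_sub_min_pos t
  have h₁ : c * (1 - min (depth t) (2 / 3)) ≤ 1 := by
    refine (mul_le_mul_of_nonneg_right hc h.le).trans (le_of_eq ?_)
    unfold hitTime
    field_simp
    ring
  refine le_trans (mul_le_mul_of_nonneg_left ?_ hc') h₁
  have := min_le_left (depth t) (2 / 3)
  linarith

/-- The dilation by a factor `c` from the barycenter in one coordinate. -/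
theorem dilate_mem {t : Prism p} {c : ℝ} (hc : c ≤ 1 + hitTime t) (hc' : 0 ≤ c) (i : ι) :
    (fun a => (p i + 1 : ℝ)⁻¹ + c * (t i a - (p i + 1 : ℝ)⁻¹)) ∈ stdSimplex ℝ (Fin (p i + 1)) := by
  have hp : (0 : ℝ) < p i + 1 := by positivity
  constructor
  · intro a
    have h₁ := mul_le_one_of_le_hitTime hc hc'
    have h₂ := mul_le_mul_of_nonneg_left (depth_le t i a) hc'
    have h₃ : (p i + 1 : ℝ)⁻¹ + c * (t i a - (p i + 1 : ℝ)⁻¹) =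
        (p i + 1 : ℝ)⁻¹ * (1 - c + c * ((p i + 1) * t i a)) := by
      field_simp
      ring
    beta_reduce
    rw [h₃]
    refine mul_nonneg (by positivity) ?_
    linarith
  · rw [Finset.sum_add_distrib, ← Finset.mul_sum, Finset.sum_sub_distrib, stdSimplex.sum_eq_one]
    simp [hp.ne']

/-- The point that starts at `t` and moves away from the barycenter until it reaches the
boundary. -/
noncomputable def flow (t : Prism p) (r : I) : Prism p := fun i =>
  ⟨_, dilate_mem (c := min (1 + r) (1 + hitTime t)) (min_le_right _ _)
    (le_min (add_nonneg zero_le_one r.2.1) (add_nonneg zero_le_one (hitTime_nonneg t))) i⟩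

theorem flow_apply (t : Prism p) (r : I) (i : ι) (a : Fin (p i + 1)) : flow t r i a =
    (p i + 1 : ℝ)⁻¹ + min (1 + (r : ℝ)) (1 + hitTime t) * (t i a - (p i + 1 : ℝ)⁻¹) := rfl

@[fun_prop]
theorem continuous_flow : Continuous fun z : Prism p × I => flow z.1 z.2 := by
  refine continuous_pi fun i => Continuous.subtype_mk (continuous_pi fun a => ?_) _
  have h : Continuous fun z : Prism p × I => z.1 i a :=
    (continuous_stdSimplex_apply a).comp ((continuous_apply i).comp continuous_fst)
  have h' : Continuous fun z : Prism p × I => hitTime z.1 := continuous_hitTime.comp continuous_fst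
  fun_prop

theorem flow_eq_self {t : Prism p} {r : I} (h : min (r : ℝ) (hitTime t) = 0) : flow t r = t := by
  funext i
  refine Subtype.ext (funext fun a => ?_)
  change flow t r i a = t i a
  have h' : min (1 + (r : ℝ)) (1 + hitTime t) = 1 + min (r : ℝ) (hitTime t) :=
    min_add_add_left 1 _ _
  rw [flow_apply, h', h]
  ring

theorem flow_zero (t : Prism p) : flow t 0 = t := flow_eq_self (min_eq_left (hitTime_nonneg t))

theorem IsBoundary.flow_eq {t : Prism p} (h : IsBoundary t) (r : I) : flow t r = t :=
  flow_eq_self (by rw [h.hitTime_eq, min_eq_right r.2.1])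

theorem isBoundary_flow {t : Prism p} {r : I} (h : hitTime t ≤ r) : IsBoundary (flow t r) := by
  have h₀ := one_sub_min_pos t
  have h₁ : hitTime t ≤ 1 := h.trans r.2.2
  have h₂ : min (depth t) (2 / 3) ≤ 1 / 2 := by
    unfold hitTime at h₁
    have : (1 - min (depth t) (2 / 3))⁻¹ ≤ 2 := by linarith
    rw [inv_le_comm₀ h₀ (by norm_num)] at this
    linarith
  have h₃ : min (depth t) (2 / 3) = depth t := by
    rcases min_choice (depth t) (2 / 3) with h | h
    · exact h
    · rw [h] at h₂
      norm_num at h₂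
  obtain ⟨i, a, ha⟩ := exists_depth_eq (t := t) (by linarith)
  refine ⟨i, a, ?_⟩
  rw [flow_apply, min_eq_right (by linarith)]
  unfold hitTime
  rw [h₃] at h₀ ⊢
  have hp : (0 : ℝ) < p i + 1 := by positivity
  have : t i a = depth t / (p i + 1) := by
    rw [← ha]
    field_simp
  rw [this]
  field_simp
  ring

/-- The time left after the boundary has been reached, rescaled so that the homotopy on the boundary is
completed at time one if the boundary is reached by the time `1 / 3`. -/
noncomputable def restTime (t : Prism p) (r : I) : I :=
  clamp ((r - hitTime t) / (1 - min (hitTime t) (1 / 3)))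

theorem one_sub_min_hitTime_pos (t : Prism p) : 0 < 1 - min (hitTime t) (1 / 3) := by
  have := min_le_right (hitTime t) (1 / 3)
  linarith

@[fun_prop]
theorem continuous_restTime : Continuous fun z : Prism p × I => restTime z.1 z.2 := by
  refine continuous_clamp.comp (Continuous.div ?_ ?_ fun z => (one_sub_min_hitTime_pos z.1).ne')
  · exact (continuous_subtype_val.comp continuous_snd).sub (continuous_hitTime.comp continuous_fst)
  · exact continuous_const.sub ((continuous_hitTime.comp continuous_fst).min continuous_const)

theorem restTime_of_eq {t : Prism p} {r : I} (h : (r : ℝ) = hitTime t) : restTime t r = 0 := by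
  rw [restTime, h, sub_self, zero_div]
  exact clamp_of_nonpos le_rfl

theorem IsBoundary.restTime_eq {t : Prism p} (h : IsBoundary t) (r : I) : restTime t r = r := by
  rw [restTime, h.hitTime_eq, min_eq_left (by norm_num), sub_zero, sub_zero, div_one, clamp_coe]

theorem restTime_one {t : Prism p} (h : hitTime t ≤ 1 / 3) : restTime t 1 = 1 := by
  rw [restTime, min_eq_left h]
  refine clamp_of_one_le (le_of_eq ?_)
  change (1 : ℝ) = (1 - _) / (1 - _)
  rw [div_self]
  linarith

open Classical in
/-- The extension of a homotopy `B` on the boundary and its initial value `A` on a product of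
simplices: points move away from the barycenter until they reach the boundary, where the homotopy
starts. On the boundary, `B` is given by functions on the faces. -/
noncomputable def collar {Z : Type*} (A : Prism p → Z) (B : Ops p p → Prism p → I → Z) (t : Prism p)
    (r : I) : Z :=
  if (r : ℝ) ≤ hitTime t then A (flow t r) else B (faceOps (flow t r)) (flow t r) (restTime t r)

theorem collar_zero {Z : Type*} (A : Prism p → Z) (B : Ops p p → Prism p → I → Z) (t : Prism p) :
    collar A B t 0 = A t := by
  rw [collar, if_pos (show ((0 : I) : ℝ) ≤ hitTime t from hitTime_nonneg t), flow_zero]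

theorem collar_of_isBoundary {Z : Type*} {A : Prism p → Z} {B : Ops p p → Prism p → I → Z}
    {t : Prism p} (h : IsBoundary t) (hAB : A t = B (faceOps t) t 0) (r : I) :
    collar A B t r = B (faceOps t) t r := by
  rw [collar, h.hitTime_eq, h.flow_eq, h.restTime_eq]
  split_ifs with hr
  · rw [hAB, show r = 0 from Subtype.ext (le_antisymm hr r.2.1)]
  · rfl

theorem collar_one {Z : Type*} {A : Prism p → Z} {B : Ops p p → Prism p → I → Z}
    {t : Prism p} (h : hitTime t ≤ 1 / 3) :
    collar A B t 1 = B (faceOps (flow t 1)) (flow t 1) 1 := by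
  rw [collar, if_neg, restTime_one h]
  change ¬(1 : ℝ) ≤ _
  linarith

theorem collar_congr {Z : Type*} {A A' : Prism p → Z} {B B' : Ops p p → Prism p → I → Z}
    (hA : ∀ t, A t = A' t) (hB : ∀ f, ¬f.Surj → ∀ t r, B f t r = B' f t r) (t : Prism p) (r : I) :
    collar A B t r = collar A' B' t r := by
  unfold collar
  split_ifs with h
  · exact hA _
  · exact hB _ (isBoundary_flow (not_le.1 h).le).not_surj _ _

theorem map_collar {Z Z' : Type*} (g : Z → Z') (A : Prism p → Z) (B : Ops p p → Prism p → I → Z)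
    (t : Prism p) (r : I) :
    g (collar A B t r) = collar (fun t => g (A t)) (fun f t r => g (B f t r)) t r := by
  unfold collar
  split_ifs <;> rfl

/-- Continuity is checked on the finitely many closed faces that cover the boundary. -/
theorem continuousOn_boundary {V Z : Type*} [TopologicalSpace V] [TopologicalSpace Z]
    {B : V → Ops p p → Prism p → I → Z}
    (hB : ∀ f : Ops p p, ¬f.Surj → Continuous fun z : V × Prism p × I => B z.1 f z.2.1 z.2.2)
    (hB' : ∀ (v : V) (f : Ops p p) (t : Prism p) (r : I), ¬f.Surj → f.push t = t →
      B v (faceOps t) t r = B v f t r) :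
    ContinuousOn (fun z : V × Prism p × I => B z.1 (faceOps z.2.1) z.2.1 z.2.2)
      {z | IsBoundary z.2.1} := by
  have e : {z : V × Prism p × I | IsBoundary z.2.1} =
      ⋃ w : Σ i, Fin (p i + 1), {z | z.2.1 w.1 w.2 = 0} := by
    ext z
    simp [IsBoundary]
  rw [e]
  have hc : ∀ w : Σ i, Fin (p i + 1), Continuous fun z : V × Prism p × I => z.2.1 w.1 w.2 := fun w =>
    (continuous_stdSimplex_apply w.2).comp ((continuous_apply w.1).comp
      (continuous_fst.comp continuous_snd))
  refine (locallyFinite_of_finite _).continuousOn_iUnion (fun w => ?_) (fun w => ?_)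
  · exact isClosed_eq (hc w) continuous_const
  · obtain ⟨f, hf⟩ := exists_ops_of_eq_zero (p := p) w.1 w.2
    by_cases hs : f.Surj
    · intro z hz
      exact absurd hs (hf _ hz).1
    · exact (hB f hs).continuousOn.congr fun z hz => hB' _ f _ _ hs (hf _ hz).2

theorem continuous_collar {V Z : Type*} [TopologicalSpace V] [TopologicalSpace Z]
    {A : V → Prism p → Z} {B : V → Ops p p → Prism p → I → Z}
    (hA : Continuous fun z : V × Prism p => A z.1 z.2)
    (hB : ∀ f : Ops p p, ¬f.Surj → Continuous fun z : V × Prism p × I => B z.1 f z.2.1 z.2.2)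
    (hB' : ∀ (v : V) (f : Ops p p) (t : Prism p) (r : I), ¬f.Surj → f.push t = t →
      B v (faceOps t) t r = B v f t r)
    (hAB : ∀ (v : V) (t : Prism p), IsBoundary t → A v t = B v (faceOps t) t 0) :
    Continuous fun z : V × Prism p × I => collar (A z.1) (B z.1) z.2.1 z.2.2 := by
  have hf : Continuous fun z : V × Prism p × I => flow z.2.1 z.2.2 := continuous_flow.comp continuous_snd
  refine continuous_if_le (by fun_prop) (continuous_hitTime.comp (continuous_fst.comp continuous_snd))
    (hA.comp (continuous_fst.prodMk hf)).continuousOn ?_ fun z hz => ?_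
  · have hc : Continuous fun z : V × Prism p × I => (z.1, flow z.2.1 z.2.2, restTime z.2.1 z.2.2) :=
      continuous_fst.prodMk (hf.prodMk (continuous_restTime.comp continuous_snd))
    exact (continuousOn_boundary hB hB').comp hc.continuousOn fun z hz => isBoundary_flow hz
  · rw [restTime_of_eq hz, hAB _ _ (isBoundary_flow hz.ge)]

end

/-! ### Extension of homotopies over realizations -/

/-- The homotopy extension property of a multisimplicial subset, for compatible families of maps on
products of simplices. The maps depend on a parameter in `V`; where they are constant with value `z₀`,
they stay constant. -/
theorem MultisimplicialSet.exists_homotopy_extension {ι : Type} [Fintype ι]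
    (X : MultisimplicialSet.{u} ι) {V : Type} {Z : Type v} [TopologicalSpace V] [TopologicalSpace Z]
    (A : ∀ {p : ι → ℕ}, X.cell p → V → Prism p → Z)
    (hA : ∀ {p : ι → ℕ} (x : X.cell p), Continuous fun z : V × Prism p => A x z.1 z.2)
    (hA' : ∀ {p p' : ι → ℕ} (f : Ops p' p) (x : X.cell p) (v : V) (t : Prism p'),
      A (X.map f x) v t = A x v (f.push t))
    (D : ∀ {p : ι → ℕ}, X.cell p → Prop)
    (hD : ∀ {p p' : ι → ℕ} (f : Ops p' p) {x : X.cell p}, D x → D (X.map f x))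
    (κ₀ : ∀ {p : ι → ℕ}, X.cell p → V → Prism p → I → Z)
    (hκ₀ : ∀ {p : ι → ℕ} {x : X.cell p}, D x →
      Continuous fun z : V × Prism p × I => κ₀ x z.1 z.2.1 z.2.2)
    (hκ₀' : ∀ {p p' : ι → ℕ} (f : Ops p' p) {x : X.cell p}, D x → ∀ (v : V) (t : Prism p') (r : I),
      κ₀ (X.map f x) v t r = κ₀ x v (f.push t) r)
    (hκA : ∀ {p : ι → ℕ} {x : X.cell p}, D x → ∀ (v : V) (t : Prism p), κ₀ x v t 0 = A x v t)
    (V₀ : Set V) (z₀ : Z)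
    (hV : ∀ {p : ι → ℕ} (x : X.cell p), ∀ v ∈ V₀, ∀ t : Prism p, A x v t = z₀)
    (hV' : ∀ {p : ι → ℕ} {x : X.cell p}, D x → ∀ v ∈ V₀, ∀ (t : Prism p) (r : I), κ₀ x v t r = z₀) :
    ∃ κ : ∀ {p : ι → ℕ}, X.cell p → V → Prism p → I → Z,
      (∀ {p : ι → ℕ} (x : X.cell p), Continuous fun z : V × Prism p × I => κ x z.1 z.2.1 z.2.2) ∧
      (∀ {p p' : ι → ℕ} (f : Ops p' p) (x : X.cell p) (v : V) (t : Prism p') (r : I),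
        κ (X.map f x) v t r = κ x v (f.push t) r) ∧
      (∀ {p : ι → ℕ} (x : X.cell p) (v : V) (t : Prism p), κ x v t 0 = A x v t) ∧
      (∀ {p : ι → ℕ} {x : X.cell p}, D x → ∀ (v : V) (t : Prism p) (r : I),
        κ x v t r = κ₀ x v t r) ∧
      ∀ {p : ι → ℕ} (x : X.cell p), ∀ v ∈ V₀, ∀ (t : Prism p) (r : I), κ x v t r = z₀ := by
  classical
  let Φ : ∀ {p : ι → ℕ}, X.cell p → Type v := fun {p} x => {κ : V → Prism p → I → Z //
    (Continuous fun z : V × Prism p × I => κ z.1 z.2.1 z.2.2) ∧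
    (∀ (v : V) (t : Prism p), κ v t 0 = A x v t) ∧
    ∀ v ∈ V₀, ∀ (t : Prism p) (r : I), κ v t r = z₀}
  let Rel : ∀ {p p' : ι → ℕ} (f : Ops p' p) {x : X.cell p} {y : X.cell p'}, X.map f x = y →
      Φ x → Φ y → Prop := fun f _ _ _ φ φ' => ∀ v t r, φ'.1 v t r = φ.1 v (f.push t) r
  have hcp : ∀ {p p' : ι → ℕ} (f : Ops p' p), Continuous fun z : V × Prism p' × I =>
      (z.1, f.push z.2.1, z.2.2) := fun f => continuous_fst.prodMk
    ((f.continuous_push.comp (continuous_fst.comp continuous_snd)).prodMk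
      (continuous_snd.comp continuous_snd))
  let S₀ : Set (Σ p : ι → ℕ, Σ x : X.cell p, Φ x) :=
    {z | D z.2.1 ∧ ∀ v t r, z.2.2.1 v t r = κ₀ z.2.1 v t r}
  obtain ⟨s, hs, hs'⟩ := X.exists_section (Φ := Φ) Rel
    (fun {p p'} d _ {x y} h φ => ⟨fun v t r => φ.1 v (d.push t) r, φ.2.1.comp (hcp d),
      fun v t => (φ.2.2.1 v _).trans (by rw [← h, hA']), fun v hv t r => φ.2.2.2 v hv _ r⟩)
    (fun _ _ _ _ _ _ _ _ _ => rfl)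
    (fun d _ f _ _ _ _ _ _ φ φ' hr v t r => by rw [hr, Ops.push_comp])
    S₀
    { unique := fun h h' => Subtype.ext (funext fun v => funext fun t => funext fun r =>
        (h.2 v t r).trans (h'.2 v t r).symm)
      closed := fun {p p'} f {x φ} h => ⟨⟨fun v t r => κ₀ (X.map f x) v t r, hκ₀ (hD f h.1),
        hκA (hD f h.1), hV' (hD f h.1)⟩, ⟨hD f h.1, fun _ _ _ => rfl⟩, fun v t r => by
          rw [h.2, ← hκ₀' f h.1]⟩ }
    (fun {p} x F hF => by
      let B : V → Ops p p → Prism p → I → Z := fun v f t r =>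
        if h : f.Surj then z₀ else (F f h).1 v t r
      have hB : ∀ v (f : Ops p p) (h : ¬f.Surj) t r, B v f t r = (F f h).1 v t r :=
        fun v f h t r => dif_neg h
      have hFe : ∀ {p' : ι → ℕ} (f : Ops p' p) (hf : ¬f.Surj) (v : V) (t : Prism p') (r : I)
          {t' : Prism p} (_ : f.push t = t') (h : ¬(faceOps t').Surj),
          (F _ h).1 v t' r = (F f hf).1 v t r := by
        rintro p' f hf v t r _ rfl h
        exact faceOps_eq (fun f hf t => (F f hf).1 v t r)
          (fun f g hf hfg t => hF f g hf hfg v t r) hf t h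
      have hAB : ∀ (v : V) (t : Prism p), IsBoundary t → A x v t = B v (faceOps t) t 0 :=
        fun v t ht => by rw [hB _ _ ht.not_surj, (F _ _).2.2.1, hA', faceOps_push]
      refine ⟨⟨fun v t r => collar (A x v) (B v) t r, ?_, ?_, ?_⟩, ?_⟩
      · refine continuous_collar (hA x) (fun f hf => ?_) (fun v f t r hf ht => ?_) hAB
        · simp only [hB _ f hf]
          exact (F f hf).2.1
        · have ht' : IsBoundary t := ht ▸ isBoundary_push hf t
          rw [hB _ _ ht'.not_surj, hB _ _ hf, hFe f hf v t r ht]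
      · exact fun v t => collar_zero _ _ _
      · intro v hv t r
        refine (collar_congr (A' := fun _ => z₀) (B' := fun _ _ _ => z₀) (hV x v hv)
          (fun f hf t r => ?_) t r).trans ?_
        · rw [hB _ f hf]
          exact (F f hf).2.2.2 v hv t r
        · unfold collar
          exact ite_self _
      · intro p' f hf v t r
        have ht := isBoundary_push hf t
        refine Eq.trans ?_ (collar_of_isBoundary ht (hAB v _ ht) r).symm
        rw [hB _ _ ht.not_surj]
        exact (hFe f hf v t r rfl ht.not_surj).symm)
  refine ⟨fun x => (s x).1, fun x => (s x).2.1, fun f x v t r => hs f x v t r,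
    fun x => (s x).2.2.1, fun {p x} hx v t r => ?_, fun x => (s x).2.2.2⟩
  have := hs' x ⟨κ₀ x, hκ₀ hx, hκA hx, hV' hx⟩ ⟨hx, fun _ _ _ => rfl⟩
  exact congrArg (fun φ : Φ x => φ.1 v t r) this

namespace SymmetricMultisimplicialSet

variable {X : SymmetricMultisimplicialSet.{u}} {n : ℕ}

/-- The map out of the realization given by a compatible family of maps on products of simplices. -/
def descend {Z : Type*} (F : ∀ {p : Fin n → ℕ} {q : ℕ}, X.cell p q → Prism p →
      stdSimplex ℝ (Fin (q + 1)) → Z)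
    (hF : ∀ {p p' : Fin n → ℕ} {q q' : ℕ} (f : Ops p' p) (g : Fin (q' + 1) →o Fin (q + 1))
      (x : X.cell p q) (t : Prism p') (u : stdSimplex ℝ (Fin (q' + 1))),
      F (X.smap f g x) t u = F x (f.push t) (stdSimplex.map g u)) : X.Realization n → Z :=
  Quot.lift (fun z => F z.1.2.2 z.2.1 z.2.2) (by
    rintro _ _ ⟨f, g, x, t, u⟩
    exact hF f g x t u)

/-- The map of realizations induced by a map of symmetric multisimplicial sets. -/
def real {X Y : SymmetricMultisimplicialSet.{u}} (F : X ⟶ Y) (n : ℕ) :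
    X.Realization n → Y.Realization n :=
  SymmetricSpectrum.Hom.toFun (realization.map F) n

theorem continuous_real {Y : SymmetricMultisimplicialSet.{u}} (F : X ⟶ Y) :
    Continuous (real F n) :=
  SymmetricSpectrum.Hom.continuous_toFun (realization.map F) n

theorem real_basePt {Y : SymmetricMultisimplicialSet.{u}} (F : X ⟶ Y) :
    real F n (X.basePt n) = Y.basePt n :=
  SymmetricSpectrum.Hom.map_pt (realization.map F) n

theorem zero_str (x : X.Realization n) : str 0 x = X.basePt (n + 1) := X.spectrum.str_zero n x

theorem str_basePt (s : I) : str s (X.basePt n) = X.basePt (n + 1) := X.spectrum.str_pt n s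

theorem continuous_of_point_prod {V Z : Type*} [TopologicalSpace V] [LocallyCompactSpace V]
    [TopologicalSpace Z] {F : V → X.Realization n → Z}
    (h : ∀ {p : Fin n → ℕ} {q : ℕ} (x : X.cell p q), Continuous fun z :
      V × Prism p × stdSimplex ℝ (Fin (q + 1)) => F z.1 (point x z.2.1 z.2.2)) :
    Continuous fun z : V × X.Realization n => F z.1 z.2 := by
  have h₀ : ∀ x : X.Realization n, Continuous fun v => F v x := by
    intro x
    induction x using ind with
    | h x t u => exact (h x).comp (continuous_id.prodMk (continuous_const (y := (t, u))))
  have h₁ : Continuous fun x : X.Realization n => (⟨fun v => F v x, h₀ x⟩ : C(V, Z)) := by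
    refine continuous_of_point fun x => ContinuousMap.continuous_of_continuous_uncurry _ ?_
    exact (h x).comp (continuous_snd.prodMk continuous_fst)
  exact (ContinuousMap.continuous_uncurry_of_continuous ⟨_, h₁⟩).comp continuous_swap

theorem continuous_point_comp {V : Type*} [TopologicalSpace V] {p : Fin n → ℕ} {q : ℕ}
    (x : X.cell p q) {t : V → Prism p} {u : V → stdSimplex ℝ (Fin (q + 1))} (ht : Continuous t)
    (hu : Continuous u) : Continuous fun v => point x (t v) (u v) :=
  (continuous_point x).comp (ht.prodMk hu)

variable (X n) in
/-- The cells in level `n`, with the last simplicial direction on a par with the others. -/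
def underlying : MultisimplicialSet.{u} (Option (Fin n)) where
  cell p := X.cell (fun i => p (some i)) (p none)
  map f x := X.smap (fun i => f (some i)) (f none) x
  map_id x := X.map_id x
  map_map _ _ x := X.map_map 1 1 _ _ _ _ x

/-- The coordinates in the first directions and in the last direction together. -/
def joinPt {p : Fin n → ℕ} {q : ℕ} (t : Prism p) (u : stdSimplex ℝ (Fin (q + 1))) :
    Prism (fun o : Option (Fin n) => o.elim q p) := fun o =>
  match o with
  | none => u
  | some i => t i

theorem continuous_joinPt {p : Fin n → ℕ} {q : ℕ} :
    Continuous fun z : Prism p × stdSimplex ℝ (Fin (q + 1)) => joinPt z.1 z.2 := by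
  refine continuous_pi fun o => ?_
  cases o with
  | none => exact continuous_snd
  | some i => exact (continuous_apply i).comp continuous_fst

/-- The homotopy extension property for realizations. -/
theorem exists_homotopy_extension {Z : Type v} [TopologicalSpace Z]
    (A : I → X.Realization n → Z) (hA : Continuous fun z : I × X.Realization n => A z.1 z.2)
    (D : ∀ {p : Fin n → ℕ} {q : ℕ}, X.cell p q → Prop)
    (hD : ∀ {p p' : Fin n → ℕ} {q q' : ℕ} (f : Ops p' p) (g : Fin (q' + 1) →o Fin (q + 1))
      {x : X.cell p q}, D x → D (X.smap f g x))
    (κ₀ : I → I → X.Realization n → Z)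
    (hκ₀ : Continuous fun z : I × I × X.Realization n => κ₀ z.1 z.2.1 z.2.2)
    (hκA : ∀ {p : Fin n → ℕ} {q : ℕ} {x : X.cell p q}, D x → ∀ s t u,
      κ₀ 0 s (point x t u) = A s (point x t u))
    (V₀ : Set I) (z₀ : Z) (hV : ∀ s ∈ V₀, ∀ x, A s x = z₀) (hV' : ∀ r, ∀ s ∈ V₀, ∀ x, κ₀ r s x = z₀) :
    ∃ κ : I → I → X.Realization n → Z,
      (Continuous fun z : I × I × X.Realization n => κ z.1 z.2.1 z.2.2) ∧
      (∀ s x, κ 0 s x = A s x) ∧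
      (∀ {p : Fin n → ℕ} {q : ℕ} {x : X.cell p q}, D x → ∀ r s t u,
        κ r s (point x t u) = κ₀ r s (point x t u)) ∧
      ∀ r, ∀ s ∈ V₀, ∀ x, κ r s x = z₀ := by
  let pt : ∀ {p : Option (Fin n) → ℕ}, (X.underlying n).cell p → Prism p → X.Realization n :=
    fun x t => point (X := X) x (fun i => t (some i)) (t none)
  have hpt : ∀ {p p' : Option (Fin n) → ℕ} (f : Ops p' p) (x : (X.underlying n).cell p)
      (t : Prism p'), pt ((X.underlying n).map f x) t = pt x (f.push t) :=
    fun f x t => point_smap _ _ _ _ _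
  have hptc : ∀ {p : Option (Fin n) → ℕ} (x : (X.underlying n).cell p), Continuous (pt x) :=
    fun x => continuous_point_comp x (continuous_pi fun i => continuous_apply (some i))
      (continuous_apply none)
  obtain ⟨κ, h₁, h₂, h₃, h₄, h₅⟩ := (X.underlying n).exists_homotopy_extension
    (fun x s t => A s (pt x t)) (fun x => hA.comp (continuous_fst.prodMk
      ((hptc x).comp continuous_snd))) (fun f x v t => by rw [hpt])
    (fun x => D (show X.cell _ _ from x)) (fun {p p'} f {x} hx => hD (p := fun i => p (some i)) (p' := fun i => p' (some i))
      (fun i => f (some i)) (f none) hx)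
    (fun x s t r => κ₀ r s (pt x t)) (fun {_ x} _ => hκ₀.comp
      ((continuous_snd.comp continuous_snd).prodMk (continuous_fst.prodMk
        ((hptc x).comp (continuous_fst.comp continuous_snd)))))
    (fun f x _ v t r => by rw [hpt]) (fun hx v t => hκA hx v _ _) V₀ z₀ (fun x v hv t => hV v hv _)
    (fun _ v hv t r => hV' r v hv _)
  let K : I → I → X.Realization n → Z := fun r s => descend
    (fun {p q} x t u => κ (p := fun o => o.elim q p) x s (joinPt t u) r) (by
      intro p p' q q' f g x t u
      let f' : Ops (fun o : Option (Fin n) => o.elim q' p') (fun o : Option (Fin n) => o.elim q p) :=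
        fun o => match o with
          | none => g
          | some i => f i
      refine (h₂ f' x s (joinPt t u) r).trans ?_
      congr 1
      funext o
      cases o <;> rfl)
  refine ⟨K, ?_, fun s x => ?_, fun {p q x} hx r s t u => ?_, fun r s hs x => ?_⟩
  · have : Continuous fun z : (I × I) × X.Realization n => K z.1.1 z.1.2 z.2 := by
      refine continuous_of_point_prod (F := fun (v : I × I) x => K v.1 v.2 x) fun {p q} x => ?_
      exact (h₁ (p := fun o => o.elim q p) x).comp ((continuous_snd.comp continuous_fst).prodMk
        ((continuous_joinPt.comp continuous_snd).prodMk (continuous_fst.comp continuous_fst)))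
    exact this.comp ((continuous_fst.prodMk (continuous_fst.comp continuous_snd)).prodMk
      (continuous_snd.comp continuous_snd))
  · induction x using ind with
    | @h p q x t u => exact h₃ (p := fun o => o.elim q p) x s (joinPt t u)
  · exact h₄ (p := fun o => o.elim q p) (x := x) hx s (joinPt t u) r
  · induction x using ind with
    | @h p q x t u => exact h₅ (p := fun o => o.elim q p) x s hs (joinPt t u) r

end SymmetricMultisimplicialSet

/-! ### The wedge as a homotopy cofiber -/

namespace SymmetricSpectrum

variable {X P : SymmetricSpectrum.{u}}

/-- The difference loop of a point and the base point. -/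
noncomputable def leftLoop (P : SymmetricSpectrum.{u}) : ShiftMap P P where
  toFun n s x := loopDiff s x (P.pt n)
  continuous_toFun _ := continuous_loopDiff continuous_fst continuous_snd continuous_const
  map_zero _ _ := loopDiff_zero _ _
  map_one _ _ := loopDiff_one _ _
  map_pt _ _ := loopDiff_pt _

theorem leftLoop_homotopic (P : SymmetricSpectrum.{u}) :
    (leftLoop P).Homotopic (ShiftMap.str P) := by
  intro n
  refine ⟨fun r s x => P.str n (clamp ((2 - r) * s)) x, continuous_str_comp (by fun_prop)
    (continuous_snd.comp continuous_snd), fun s x => ?_, fun s x => ?_, fun r x => ?_,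
    fun r x => ?_, fun r s => P.str_pt n _⟩
  · change P.str n (clamp ((2 - ((0 : I) : ℝ)) * s)) x = loopDiff s x (P.pt n)
    rw [loopDiff, Set.Icc.coe_zero, sub_zero]
    split_ifs with h
    · rw [tent_eq h]
    · rw [P.str_pt, clamp_of_one_le (by linarith), P.str_one]
  · change P.str n (clamp ((2 - ((1 : I) : ℝ)) * s)) x = P.str n s x
    rw [Set.Icc.coe_one, show (2 : ℝ) - 1 = 1 by norm_num, one_mul, clamp_coe]
  · change P.str n (clamp ((2 - r) * ((0 : I) : ℝ))) x = _
    rw [clamp_of_nonpos (by simp), P.str_zero]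
  · change P.str n (clamp ((2 - r) * ((1 : I) : ℝ))) x = _
    rw [clamp_of_one_le (by
      have := r.2.2
      rw [Set.Icc.coe_one, mul_one]
      linarith), P.str_one]

/-- Let `w : X ⟶ P` be a map that sends the image of a section `i` of `r : X ⟶ A` to the base point.
Then the composite `hofib r ⟶ X ⟶ P` is an equivalence, if the map `splitLoop r i` factors through
`w` up to homotopy, by a map that is compatible with `w`. -/
theorem isEquivalence_hofibProj_comp {A : SymmetricSpectrum.{u}} (r : X ⟶ A) (i : A ⟶ X)
    (hi : i ≫ r = 𝟙 A) (w : X ⟶ P) (hw : ∀ n a, Hom.toFun w n (Hom.toFun i n a) = P.pt n)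
    (G : ShiftMap P X) (h₁ : (splitLoop r i).Homotopic (G.precomp w))
    (h₂ : (leftLoop P).Homotopic (G.postcomp w)) : IsEquivalence (hofibProj r ≫ w) := by
  have e : (splitLoop r i).postcomp w = (leftLoop P).precomp w :=
    ShiftMap.ext_toFun fun n s x => by
      change Hom.toFun w (n + 1) (loopDiff s x _) = loopDiff s (Hom.toFun w n x) (P.pt n)
      rw [map_loopDiff, hw]
  have hG : ∀ k b, Hom.onPre w k (G.onPre k b) = step P k b := fun k b => by
    rw [← ShiftMap.onPre_postcomp, ← h₂.onPre_eq, (leftLoop_homotopic P).onPre_eq]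
  refine isEquivalence_of_interleaving _ 2 (fun k b => (splitLift r i hi).onPre k (G.onPre k b)) ?_ ?_
  · intro k a
    rw [Hom.onPre_comp, ← ShiftMap.onPre_precomp, ← h₁.onPre_eq, ← splitLift_postcomp r i hi,
      ShiftMap.onPre_postcomp, splitLift_onPre_hofibProj, splitLift_onPre_hofibProj]
    rfl
  · intro k b
    rw [Hom.onPre_comp, ← ShiftMap.onPre_postcomp, splitLift_postcomp, ← ShiftMap.onPre_postcomp, e,
      ShiftMap.onPre_precomp, hG, (leftLoop_homotopic P).onPre_eq]
    rfl

end SymmetricSpectrum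

section

open SymmetricMultisimplicialSet SymmetricSpectrum

variable {C : Type u} [Category.{v} C] [Preadditive C] [ExactCategory C] (M : BiadditiveFunctor C)

theorem wedge_base {n : ℕ} {p : Fin n → ℕ} {q : ℕ} {c : Coprod M p q} (hc : c.IsBase) (t : Prism p)
    (u : stdSimplex ℝ (Fin (q + 1))) :
    real (coprodToWedge M) n (point (X := coprodS M) c t u) = (wedgeS M).basePt n := by
  change point (X := wedgeS M) (Quotient.mk _ c) t u = _
  rw [Wedge.eq_pt hc]
  exact point_pt p q t u

theorem objToCoprod_coprodToObj_of_isBase {n : ℕ} {p : Fin n → ℕ} {q : ℕ} {c : Coprod M p q}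
    (hc : c.IsBase) (t : Prism p) (u : stdSimplex ℝ (Fin (q + 1))) :
    real (objToCoprod M) n (real (coprodToObj M) n (point (X := coprodS M) c t u)) =
      point (X := coprodS M) c t u := by
  change point (X := coprodS M) (Coprod.base M q c.1) t u = _
  rw [← Coprod.base_eq_of_isBase hc]

/-- A map out of the disjoint union of classifying spaces that is constant on the base points factors
through the wedge. -/
theorem exists_wedge_lift {n : ℕ} {V : Type} [TopologicalSpace V] [LocallyCompactSpace V]
    {Z : Type*} [TopologicalSpace Z] (F : V → (coprodS M).Realization n → Z)
    (hF : Continuous fun z : V × (coprodS M).Realization n => F z.1 z.2) (z₀ : Z)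
    (h₀ : ∀ {p : Fin n → ℕ} {q : ℕ} {c : Coprod M p q}, c.IsBase → ∀ v t u,
      F v (point (X := coprodS M) c t u) = z₀) :
    ∃ G : V → (wedgeS M).Realization n → Z,
      (Continuous fun z : V × (wedgeS M).Realization n => G z.1 z.2) ∧
      ∀ v x, G v (real (coprodToWedge M) n x) = F v x := by
  let K : ∀ {p : Fin n → ℕ} {q : ℕ}, Wedge M p q → V → Prism p → stdSimplex ℝ (Fin (q + 1)) → Z :=
    fun {p q} y v t u => Quotient.lift (fun c : Coprod M p q => F v (point (X := coprodS M) c t u)) (by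
      rintro c c' (rfl | h)
      · rfl
      · exact (h₀ h.1 v t u).trans (h₀ h.2 v t u).symm) y
  have hK : ∀ v, ∀ {p p' : Fin n → ℕ} {q q' : ℕ} (f : Ops p' p) (g : Fin (q' + 1) →o Fin (q + 1))
      (y : Wedge M p q) (t : Prism p') (u : stdSimplex ℝ (Fin (q' + 1))),
      K ((wedgeS M).smap f g y) v t u = K y v (f.push t) (stdSimplex.map g u) := by
    intro v p p' q q' f g y t u
    induction y using Quotient.inductionOn with
    | h c => exact congrArg (F v) (point_smap (X := coprodS M) f g c t u)
  let G : V → (wedgeS M).Realization n → Z := fun v =>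
    descend (X := wedgeS M) (fun {p q} y t u => K (p := p) y v t u) (hK v)
  refine ⟨G, ?_, ?_⟩
  · refine continuous_of_point_prod (X := wedgeS M) (F := G) fun {p q} y => ?_
    induction y using Quotient.inductionOn with
    | h c => exact hF.comp (continuous_fst.prodMk ((continuous_point (X := coprodS M) c).comp
        continuous_snd))
  · intro v x
    induction x using ind with
    | h c t u => rfl

theorem exists_wedge_point {n : ℕ} (x : (wedgeS M).Realization n) :
    ∃ y : (coprodS M).Realization n, real (coprodToWedge M) n y = x := by
  induction x using ind with
  | h x t u =>
    induction x using Quotient.inductionOn with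
    | h c => exact ⟨point (X := coprodS M) c t u, rfl⟩

/-- The difference loop of a point and the base point of its classifying space contracts to the base
point over the base points: it is homotopic to a map that factors through the wedge. -/
theorem exists_splitLoop_homotopy (n : ℕ) :
    ∃ κ : I → I → (coprodS M).Realization n → (coprodS M).Realization (n + 1),
      (Continuous fun z : I × I × (coprodS M).Realization n => κ z.1 z.2.1 z.2.2) ∧
      (∀ s x, κ 0 s x = (splitLoop (realization.map (coprodToObj M))
        (realization.map (objToCoprod M))).toFun n s x) ∧
      (∀ {p : Fin n → ℕ} {q : ℕ} {c : Coprod M p q}, c.IsBase → ∀ r s t u,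
        κ r s (point (X := coprodS M) c t u) =
          str (min (tent s) (unitInterval.symm r)) (point (X := coprodS M) c t u)) ∧
      ∀ r, ∀ s ∈ ({0, 1} : Set I), ∀ x, κ r s x = (coprodS M).basePt (n + 1) := by
  let δ := splitLoop (realization.map (coprodToObj M)) (realization.map (objToCoprod M))
  -- Over the base points, the difference loop goes back and forth along the same path, and it is
  -- contracted by cutting off the tent.
  refine exists_homotopy_extension (X := coprodS M) (fun s x => δ.toFun n s x)
    (δ.continuous_toFun n) (fun c => Coprod.IsBase c) (fun f g _ hc => hc.map _ _ g)
    (fun r s x => str (min (tent s) (unitInterval.symm r)) x) ?_ ?_ {0, 1} _ ?_ ?_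
  · exact (continuous_str n).comp (Continuous.prodMk (by fun_prop)
      (continuous_snd.comp continuous_snd))
  · intro p q c hc s t u
    rw [unitInterval.symm_zero, min_eq_left unitInterval.le_one']
    refine Eq.trans ?_ (congrArg (loopDiff (X := (coprodS M).spectrum) s _)
      (objToCoprod_coprodToObj_of_isBase M hc t u)).symm
    exact (loopDiff_self (X := (coprodS M).spectrum) s (point (X := coprodS M) c t u)).symm
  · rintro s (rfl | rfl) x
    · exact δ.map_zero n x
    · exact δ.map_one n x
  · rintro r s (rfl | rfl) x
    · rw [tent_zero, min_eq_left unitInterval.nonneg', zero_str]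
    · rw [tent_one, min_eq_left unitInterval.nonneg', zero_str]

/-- The homotopy fiber of the projection to the objects is equivalent to the wedge. -/
theorem isEquivalence_hofibProj_coprodToWedge :
    IsEquivalence (hofibProj (realization.map (coprodToObj M)) ≫
      realization.map (coprodToWedge M)) := by
  have hi : realization.map (objToCoprod M) ≫ realization.map (coprodToObj M) = 𝟙 _ :=
    (realization.map_comp _ _).symm.trans (realization.map_id (objS C))
  let w : ∀ n, (coprodS M).Realization n → (wedgeS M).Realization n := real (coprodToWedge M)
  choose κ hκc hκ₀ hκb hκs using exists_splitLoop_homotopy M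
  have hb : ∀ {n : ℕ} {p : Fin n → ℕ} {q : ℕ} {c : Coprod M p q}, c.IsBase → ∀ s t u,
      κ n 1 s (point (X := coprodS M) c t u) = (coprodS M).basePt (n + 1) := by
    intro n p q c hc s t u
    rw [hκb n hc, unitInterval.symm_one, min_eq_right unitInterval.nonneg', zero_str]
  have hbase : ∀ n, (Coprod.base M 0 (SCat.zero C fun _ : Fin n => 0)).IsBase := fun n _ _ _ => rfl
  have hκpt : ∀ n r s, κ n r s ((coprodS M).basePt n) = (coprodS M).basePt (n + 1) := fun n r s =>
    (hκb n (hbase n) r s _ _).trans (str_basePt _)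
  choose G hGc hG using fun n => exists_wedge_lift M (fun s x => κ n 1 s x)
    ((hκc n).comp (continuous_const.prodMk continuous_id)) ((coprodS M).basePt (n + 1))
    (fun hc s t u => hb hc s t u)
  choose H hHc hH using fun n => exists_wedge_lift M (V := I × I)
    (fun v x => w (n + 1) (κ n v.1 v.2 x))
    ((continuous_real (coprodToWedge M)).comp ((hκc n).comp ((continuous_fst.comp
      continuous_fst).prodMk ((continuous_snd.comp continuous_fst).prodMk continuous_snd))))
    ((wedgeS M).basePt (n + 1)) (fun hc v t u => by
      rw [hκb n hc]
      exact wedge_base M (hc.map _ _ _) _ _)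
  have hG₀ : ∀ n, ∀ s ∈ ({0, 1} : Set I), ∀ x, G n s x = (coprodS M).basePt (n + 1) := by
    intro n s hs x
    obtain ⟨y, rfl⟩ := exists_wedge_point M x
    rw [hG, hκs n 1 s hs]
  have hH₀ : ∀ n r, ∀ s ∈ ({0, 1} : Set I), ∀ x, H n (r, s) x = (wedgeS M).basePt (n + 1) := by
    intro n r s hs x
    obtain ⟨y, rfl⟩ := exists_wedge_point M x
    rw [hH, hκs n r s hs]
    exact real_basePt _
  have hGpt : ∀ n s, G n s ((wedgeS M).basePt n) = (coprodS M).basePt (n + 1) := by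
    intro n s
    rw [← real_basePt (coprodToWedge M), hG, hκpt]
  have hHpt : ∀ n v, H n v ((wedgeS M).basePt n) = (wedgeS M).basePt (n + 1) := by
    intro n v
    rw [← real_basePt (coprodToWedge M), hH, hκpt]
    exact real_basePt _
  let G' : ShiftMap (wedgeS M).spectrum (coprodS M).spectrum :=
    { toFun := G
      continuous_toFun := hGc
      map_zero := fun n x => hG₀ n 0 (by simp) x
      map_one := fun n x => hG₀ n 1 (by simp) x
      map_pt := hGpt }
  refine isEquivalence_hofibProj_comp _ (realization.map (objToCoprod M)) hi _ (fun n a => ?_) G' ?_ ?_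
  · induction a using ind with
    | h X t u => exact wedge_base M (fun _ _ _ => rfl) t u
  · intro n
    exact ⟨κ n, hκc n, hκ₀ n, fun s x => (hG n s x).symm, fun r x => hκs n r 0 (by simp) x,
      fun r x => hκs n r 1 (by simp) x, hκpt n⟩
  · intro n
    refine ⟨fun r s x => H n (r, s) x, (hHc n).comp ((continuous_fst.prodMk
      (continuous_fst.comp continuous_snd)).prodMk (continuous_snd.comp continuous_snd)),
      fun s x => ?_, fun s x => ?_, fun r x => hH₀ n r 0 (by simp) x,
      fun r x => hH₀ n r 1 (by simp) x, fun r s => hHpt n (r, s)⟩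
    · obtain ⟨y, rfl⟩ := exists_wedge_point M x
      refine (hH n (0, s) y).trans ((congrArg (w (n + 1)) (hκ₀ n s y)).trans ?_)
      refine (map_loopDiff (realization.map (coprodToWedge M)) s y _).trans ?_
      refine congrArg (loopDiff (X := (wedgeS M).spectrum) s _) ?_
      induction y using ind with
      | h c t u => exact wedge_base M (fun _ _ _ => rfl) t u
    · obtain ⟨y, rfl⟩ := exists_wedge_point M x
      exact (hH n (1, s) y).trans (congrArg (w (n + 1)) (hG n s y).symm)

end

/-! ### Extension of compatible elements of exact bimodules -/

section

variable {n : ℕ} {p : Fin n → ℕ}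

/-- The object of `∏ Cat([1], [p_i])` with source `a` and target `b`. -/
def MultiArrow.ofLE (a b : ∀ i, Fin (p i + 1)) (h : a ≤ b) : MultiArrow p :=
  ⟨fun i => ⟨![a i, b i], by
    intro x y hxy
    fin_cases x <;> fin_cases y
    · exact le_rfl
    · exact h i
    · exact absurd hxy (by decide)
    · exact le_rfl⟩⟩

theorem MultiArrow.ofLE_le {a b a' b' : ∀ i, Fin (p i + 1)} {h : a ≤ b} {h' : a' ≤ b'} (ha : a ≤ a')
    (hb : b ≤ b') : ofLE a b h ≤ ofLE a' b' h' := by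
  intro i x
  fin_cases x
  · exact ha i
  · exact hb i

theorem MultiArrow.arr_le (θ : MultiArrow p) (i : Fin n) : θ.arr i 0 ≤ θ.arr i 1 :=
  (θ.arr i).monotone (by decide)

/-- The objects `θ₁`, `θ₂`, `θ₃` agree outside of the direction `i`, where they are of the form
`a ≤ b`, `a ≤ c`, `b ≤ c`. -/
structure MultiArrow.IsTriple (i : Fin n) (θ₁ θ₂ θ₃ : MultiArrow p) : Prop where
  le : θ₁ ≤ θ₂
  le' : θ₂ ≤ θ₃
  eq : ∀ j, j ≠ i → θ₁.arr j = θ₂.arr j ∧ θ₂.arr j = θ₃.arr j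
  src : θ₁.arr i 0 = θ₂.arr i 0
  mid : θ₁.arr i 1 = θ₃.arr i 0
  tgt : θ₂.arr i 1 = θ₃.arr i 1

theorem MultiArrow.isTriple_ofLE (i : Fin n) {a a' b b' : ∀ i, Fin (p i + 1)} {h : a ≤ b'}
    {h' : a ≤ b} {h'' : a' ≤ b} (ha : a ≤ a') (ha' : ∀ j, j ≠ i → a j = a' j) (hb : b' ≤ b)
    (hb' : ∀ j, j ≠ i → b' j = b j) (hm : b' i = a' i) :
    IsTriple i (ofLE a b' h) (ofLE a b h') (ofLE a' b h'') where
  le := ofLE_le le_rfl hb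
  le' := ofLE_le ha le_rfl
  eq j hj := by
    constructor
    · ext x : 2
      fin_cases x
      · rfl
      · exact hb' j hj
    · ext x : 2
      fin_cases x
      · exact ha' j hj
      · rfl
  src := rfl
  mid := hm
  tgt := rfl

end

section

variable {C : Type u} [Category.{v} C] [Preadditive C] [ExactCategory C] (M : Bimodule C)
  {n : ℕ} {p : Fin n → ℕ}

/-- The restriction `M(X_θ, c) → M(X_ρ, c)`. -/
def SCat.res (X : SCat C p) (c : C) {ρ θ : MultiArrow p} (h : ρ ≤ θ) :
    M.val (X.obj.obj θ) c →+ M.val (X.obj.obj ρ) c :=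
  M.pull (X.obj.map (homOfLE h))

namespace SCat

variable (X : SCat C p) (c : C)

theorem res_res {ρ θ κ : MultiArrow p} (h : ρ ≤ θ) (h' : θ ≤ κ) (x : M.val (X.obj.obj κ) c) :
    X.res M c h (X.res M c h' x) = X.res M c (h.trans h') x := by
  unfold res
  rw [← M.pull_comp, ← Functor.map_comp]
  rfl

theorem res_self {θ : MultiArrow p} (h : θ ≤ θ) (x : M.val (X.obj.obj θ) c) : X.res M c h x = x := by
  unfold res
  rw [show homOfLE h = 𝟙 θ from rfl, CategoryTheory.Functor.map_id, M.pull_id]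

variable {i : Fin n} {θ₁ θ₂ θ₃ : MultiArrow p} (T : MultiArrow.IsTriple i θ₁ θ₂ θ₃)

include T

theorem res_injective : Function.Injective (X.res M c T.le') := by
  obtain ⟨w, h⟩ := X.property.exact i _ _ _ (homOfLE T.le) (homOfLE T.le') T.eq T.src T.mid T.tgt
  exact M.pull_injective _ h c

theorem res_surjective : Function.Surjective (X.res M c T.le) := by
  obtain ⟨w, h⟩ := X.property.exact i _ _ _ (homOfLE T.le) (homOfLE T.le') T.eq T.src T.mid T.tgt
  exact M.pull_surjective _ h c

theorem res_exact (x : M.val (X.obj.obj θ₂) c) :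
    X.res M c T.le x = 0 ↔ ∃ y, X.res M c T.le' y = x := by
  obtain ⟨w, h⟩ := X.property.exact i _ _ _ (homOfLE T.le) (homOfLE T.le') T.eq T.src T.mid T.tgt
  exact M.pull_exact _ h c x

omit T

theorem res_ofLE_injective {a a' b : ∀ i, Fin (p i + 1)} (h : a ≤ b) (h' : a' ≤ b) (ha : a ≤ a') :
    Function.Injective (X.res M c (MultiArrow.ofLE_le (h := h) (h' := h') ha le_rfl)) := by
  classical
  -- the coordinates in `S` have been moved
  let m : Finset (Fin n) → ∀ i, Fin (p i + 1) := fun S i => if i ∈ S then a' i else a i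
  have hm : ∀ S, m S ≤ b := fun S i => by
    by_cases hi : i ∈ S
    · simpa [m, hi] using h' i
    · simpa [m, hi] using h i
  have hm' : ∀ S, a ≤ m S := fun S i => by
    by_cases hi : i ∈ S
    · simpa [m, hi] using ha i
    · simp [m, hi]
  have key : ∀ S, Function.Injective
      (X.res M c (MultiArrow.ofLE_le (h := h) (h' := hm S) (hm' S) le_rfl)) := by
    intro S
    induction S using Finset.induction_on with
    | empty =>
      intro x y hxy
      have e : MultiArrow.ofLE (m ∅) b (hm ∅) ≤ MultiArrow.ofLE a b h :=
        MultiArrow.ofLE_le (fun i => by simp [m]) le_rfl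
      have := congrArg (X.res M c e) hxy
      rwa [res_res, res_res, res_self, res_self] at this
    | insert k S hk ih =>
      have hle : m S ≤ m (insert k S) := fun i => by
        by_cases hi : i ∈ S
        · simp [m, hi]
        · by_cases hik : i = k
          · subst hik
            simpa [m, hi] using ha i
          · simp [m, hi, hik]
      have T : MultiArrow.IsTriple k
          (MultiArrow.ofLE (m S) (Function.update b k (a' k)) (fun i => by
            by_cases hik : i = k
            · subst hik
              simpa [m, hk] using ha i
            · simpa [hik] using hm S i))
          (MultiArrow.ofLE (m S) b (hm S)) (MultiArrow.ofLE (m (insert k S)) b (hm _)) := by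
        refine MultiArrow.isTriple_ofLE k hle (fun j hj => by simp [m, hj]) (fun i => ?_)
          (fun j hj => by simp [hj]) (by simp [m])
        by_cases hik : i = k
        · subst hik
          simpa using h' i
        · simp [hik]
      intro x y hxy
      refine res_injective M X c T (ih ?_)
      rwa [res_res, res_res]
  intro x y hxy
  have e : MultiArrow.ofLE (m Finset.univ) b (hm _) ≤ MultiArrow.ofLE a' b h' :=
    MultiArrow.ofLE_le (fun i => by simp [m]) le_rfl
  have e' : MultiArrow.ofLE a' b h' ≤ MultiArrow.ofLE (m Finset.univ) b (hm _) :=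
    MultiArrow.ofLE_le (fun i => by simp [m]) le_rfl
  have := key Finset.univ (a₁ := X.res M c e x) (a₂ := X.res M c e y) (by rwa [res_res, res_res])
  have := congrArg (X.res M c e') this
  rwa [res_res, res_res, res_self, res_self] at this

/-- An element of `M(X_{0 ≤ b}, c)` comes from the quotient `X_{a ≤ b}` of `X_{0 ≤ b}`, if its
restrictions to the subobjects that are collapsed in the quotient vanish. -/
theorem exists_res_eq {a b : ∀ i, Fin (p i + 1)} (h : a ≤ b) (h₀ : 0 ≤ b)
    (w : M.val (X.obj.obj (MultiArrow.ofLE 0 b h₀)) c)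
    (hw : ∀ k (b' : ∀ i, Fin (p i + 1)) (h' : 0 ≤ b') (hb : b' ≤ b), b' k = a k →
      X.res M c (MultiArrow.ofLE_le (h := h') (h' := h₀) le_rfl hb) w = 0) :
    ∃ v, X.res M c (MultiArrow.ofLE_le (h := h₀) (h' := h) (fun i => Fin.zero_le (a i)) le_rfl) v = w := by
  classical
  let m : Finset (Fin n) → ∀ i, Fin (p i + 1) := fun S i => if i ∈ S then a i else 0
  have hm : ∀ S, m S ≤ b := fun S i => by
    by_cases hi : i ∈ S
    · simpa [m, hi] using h i
    · simp [m, hi]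
  have hm' : ∀ S, 0 ≤ m S := fun S i => Fin.zero_le _
  have key : ∀ S, ∃ v, X.res M c (MultiArrow.ofLE_le (h := h₀) (h' := hm S) (hm' S) le_rfl) v = w := by
    intro S
    induction S using Finset.induction_on with
    | empty =>
      have e : MultiArrow.ofLE (m ∅) b (hm ∅) ≤ MultiArrow.ofLE 0 b h₀ :=
        MultiArrow.ofLE_le (fun i => by simp [m]) le_rfl
      exact ⟨X.res M c e w, by rw [res_res, res_self]⟩
    | insert k S hk ih =>
      obtain ⟨v, hv⟩ := ih
      have hle : m S ≤ m (insert k S) := fun i => by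
        by_cases hi : i ∈ S
        · simp [m, hi]
        · simp [m, hi]
      have hb : Function.update b k (a k) ≤ b := fun i => by
        by_cases hik : i = k
        · subst hik
          simpa using h i
        · simp [hik]
      have hmb : m S ≤ Function.update b k (a k) := fun i => by
        by_cases hik : i = k
        · subst hik
          simp [m, hk]
        · simpa [hik] using hm S i
      have T : MultiArrow.IsTriple k (MultiArrow.ofLE (m S) (Function.update b k (a k)) hmb)
          (MultiArrow.ofLE (m S) b (hm S)) (MultiArrow.ofLE (m (insert k S)) b (hm _)) :=
        MultiArrow.isTriple_ofLE k hle (fun j hj => by simp [m, hj]) hb (fun j hj => by simp [hj])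
          (by simp [m])
      obtain ⟨y, hy⟩ := (res_exact M X c T v).1 (by
        have h' : 0 ≤ Function.update b k (a k) := fun i => Fin.zero_le _
        refine res_ofLE_injective M X c h' hmb (hm' S) ?_
        rw [map_zero, res_res, ← hw k _ h' hb (by simp), ← hv, res_res])
      exact ⟨y, by rw [← hv, ← hy, res_res]⟩
  obtain ⟨v, hv⟩ := key Finset.univ
  have e : MultiArrow.ofLE a b h ≤ MultiArrow.ofLE (m Finset.univ) b (hm _) :=
    MultiArrow.ofLE_le (fun i => by simp [m]) le_rfl
  exact ⟨X.res M c e v, by rw [res_res, hv]⟩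

/-- The target of an object after the coordinates in `S` have been lowered from `b` to `l`. -/
def lower (l b : ∀ i, Fin (p i + 1)) (S : Finset (Fin n)) : ∀ i, Fin (p i + 1) :=
  fun i => if i ∈ S then l i else b i

omit [ExactCategory C] [Preadditive C] [Category C] in
theorem le_lower {a l b : ∀ i, Fin (p i + 1)} (hl : a ≤ l) (hb : l ≤ b) (S : Finset (Fin n)) :
    a ≤ lower l b S := fun i => by
  unfold lower
  split_ifs
  · exact hl i
  · exact (hl i).trans (hb i)

theorem lower_anti {l b : ∀ i, Fin (p i + 1)} (hb : l ≤ b) {S S' : Finset (Fin n)} (h : S ⊆ S') :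
    lower l b S' ≤ lower l b S := fun i => by
  unfold lower
  by_cases h₁ : i ∈ S
  · simp [h₁, h h₁]
  · by_cases h₂ : i ∈ S'
    · simpa [h₁, h₂] using hb i
    · simp [h₁, h₂]

/-- Compatible elements on the subobjects of `X_{a ≤ b}` that arise by lowering some of the
coordinates of `b` extend to `X_{a ≤ b}`. -/
theorem exists_res_lower_eq (B : Finset (Fin n)) : ∀ {a l b : ∀ i, Fin (p i + 1)} (hl : a ≤ l)
    (hb : l ≤ b)
    (y : ∀ S, M.val (X.obj.obj (MultiArrow.ofLE a (lower l b S) (le_lower hl hb S))) c),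
    (∀ {S S' : Finset (Fin n)} (h : S ⊆ S'), S' ⊆ B → S.Nonempty →
      X.res M c (MultiArrow.ofLE_le le_rfl (lower_anti hb h)) (y S) = y S') →
    ∃ z : M.val (X.obj.obj (MultiArrow.ofLE a (lower l b ∅) (le_lower hl hb ∅))) c,
      ∀ S, S ⊆ B → S.Nonempty →
        X.res M c (MultiArrow.ofLE_le le_rfl (lower_anti hb S.empty_subset)) z = y S := by
  classical
  induction B using Finset.induction_on with
  | empty =>
    intro a l b hl hb y _
    exact ⟨0, fun S hS hS' => absurd (Finset.subset_empty.1 hS) hS'.ne_empty⟩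
  | insert k B hk ih =>
    intro a l b hl hb y hy
    let a' := Function.update a k (l k)
    have ha : a ≤ a' := fun i => by
      by_cases hik : i = k
      · subst hik
        simpa [a'] using hl i
      · simp [a', hik]
    have hl' : a' ≤ l := fun i => by
      by_cases hik : i = k
      · subst hik
        simp [a']
      · simpa [a', hik] using hl i
    have T : ∀ S, k ∉ S → MultiArrow.IsTriple k
        (MultiArrow.ofLE a (lower l b (insert k S)) (le_lower hl hb _))
        (MultiArrow.ofLE a (lower l b S) (le_lower hl hb S))
        (MultiArrow.ofLE a' (lower l b S) (le_lower hl' hb S)) := fun S hS =>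
      MultiArrow.isTriple_ofLE k ha (fun j hj => by simp [a', hj])
        (lower_anti hb (Finset.subset_insert k S)) (fun j hj => by simp [lower, hj])
        (by simp [lower, a'])
    obtain ⟨z₀, hz₀⟩ := res_surjective M X c (T ∅ (Finset.notMem_empty k)) (y (insert k ∅))
    have hkB : insert k (∅ : Finset (Fin n)) ⊆ insert k B :=
      Finset.insert_subset_insert k B.empty_subset
    -- the elements that remain to be extended vanish after lowering the coordinate `k`
    have h₁ : ∀ S, S ⊆ B → S.Nonempty → ∃ v : M.val (X.obj.obj (MultiArrow.ofLE a' (lower l b S)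
        (le_lower hl' hb S))) c, X.res M c (MultiArrow.ofLE_le ha le_rfl) v =
          y S - X.res M c (MultiArrow.ofLE_le le_rfl (lower_anti hb S.empty_subset)) z₀ := by
      intro S hS hS'
      refine (res_exact M X c (T S fun h => hk (hS h)) _).1 ?_
      rw [map_sub, res_res, hy (Finset.subset_insert k S) (Finset.insert_subset_insert k hS) hS',
        ← hy (Finset.insert_subset_insert k S.empty_subset) (Finset.insert_subset_insert k hS)
          (Finset.insert_nonempty k _), ← hz₀, res_res, sub_self]
    let y' : ∀ S, M.val (X.obj.obj (MultiArrow.ofLE a' (lower l b S) (le_lower hl' hb S))) c :=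
      fun S => if h : S ⊆ B ∧ S.Nonempty then (h₁ S h.1 h.2).choose else 0
    have hy' : ∀ S, S ⊆ B → S.Nonempty → X.res M c (MultiArrow.ofLE_le ha le_rfl) (y' S) =
        y S - X.res M c (MultiArrow.ofLE_le le_rfl (lower_anti hb S.empty_subset)) z₀ := by
      intro S hS hS'
      rw [show y' S = _ from dif_pos ⟨hS, hS'⟩]
      exact (h₁ S hS hS').choose_spec
    obtain ⟨z, hz⟩ := ih hl' hb y' (by
      intro S S' h hS' hS
      refine res_injective M X c (T S' fun h' => hk (hS' h')) ?_
      rw [hy' S' hS' (hS.mono h), res_res, ← hy h (hS'.trans (Finset.subset_insert k B)) hS]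
      have := congrArg (X.res M c (MultiArrow.ofLE_le (h := le_lower hl hb S')
        (h' := le_lower hl hb S) le_rfl (lower_anti hb h))) (hy' S (h.trans hS') hS)
      rwa [map_sub, res_res, res_res] at this)
    refine ⟨z₀ + X.res M c (MultiArrow.ofLE_le ha le_rfl) z, fun S hS hS' => ?_⟩
    rw [map_add]
    by_cases hkS : k ∈ S
    · have h₂ : insert k (∅ : Finset (Fin n)) ⊆ S :=
        Finset.insert_subset hkS S.empty_subset
      have h₃ := congrArg (X.res M c (MultiArrow.ofLE_le (h := le_lower hl hb S)
        (h' := le_lower hl hb (insert k ∅)) le_rfl (lower_anti hb h₂))) ((res_exact M X c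
          (T ∅ (Finset.notMem_empty k)) _).2 ⟨z, rfl⟩)
      rw [res_res, map_zero] at h₃
      rw [h₃, add_zero, ← hy h₂ hS (Finset.insert_nonempty k _), ← hz₀, res_res]
    · have hSB : S ⊆ B := (Finset.subset_insert_iff_of_notMem hkS).1 hS
      have h₂ := hy' S hSB hS'
      rw [← hz S hSB hS', res_res] at h₂
      rw [res_res, h₂, add_sub_cancel]

end SCat

end

/-! ### Trivializations of diagrams in `C ⋉ M` -/

section

variable {C : Type u} [Category.{v} C] [Preadditive C] [ExactCategory C] (M : Bimodule C)
  {n : ℕ} {p : Fin n → ℕ}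

theorem BiadditiveFunctor.val_zero_right (M : BiadditiveFunctor C) {c : C}
    (m : M.val c ExactCategory.zero) : m = 0 := by
  rw [← M.push_id m, ExactCategory.isZero_zero.eq_of_src (𝟙 ExactCategory.zero) 0, M.zero_push]

section

variable (X : SCat (Semidirect M.toBiadditiveFunctor) p)

/-- The failure of the square with sides `(f, m) = X(a)`, `(f, 0)`, `(id, h)` and `(id, h')` to
commute. -/
def defect {ρ θ : MultiArrow p} (a : ρ ⟶ θ) (h : M.val (X.obj.obj ρ).of (X.obj.obj ρ).of)
    (h' : M.val (X.obj.obj θ).of (X.obj.obj θ).of) : M.val (X.obj.obj ρ).of (X.obj.obj θ).of :=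
  (X.obj.map a).snd + M.pull (X.obj.map a).fst h' - M.push (X.obj.map a).fst h

theorem defect_comp {ρ θ κ : MultiArrow p} (a : ρ ⟶ θ) (b : θ ⟶ κ)
    (h : M.val (X.obj.obj ρ).of (X.obj.obj ρ).of) (h' : M.val (X.obj.obj θ).of (X.obj.obj θ).of)
    (h'' : M.val (X.obj.obj κ).of (X.obj.obj κ).of) :
    defect M X (a ≫ b) h h'' = M.push (X.obj.map b).fst (defect M X a h h') +
      M.pull (X.obj.map a).fst (defect M X b h' h'') := by
  unfold defect
  rw [Functor.map_comp, Semidirect.comp_snd, Semidirect.comp_fst, M.pull_comp, M.push_comp, map_sub,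
    map_add, map_sub, map_add, M.push_pull]
  abel

theorem defect_id {θ : MultiArrow p} (a : θ ⟶ θ) (h h' : M.val (X.obj.obj θ).of (X.obj.obj θ).of) :
    defect M X a h h' = h' - h := by
  unfold defect
  rw [show a = 𝟙 θ from rfl, CategoryTheory.Functor.map_id, Semidirect.id_fst, Semidirect.id_snd,
    M.push_id, M.pull_id, zero_add]

theorem defect_eq_add {ρ θ : MultiArrow p} (a : ρ ⟶ θ)
    (h : M.val (X.obj.obj ρ).of (X.obj.obj ρ).of) (h' : M.val (X.obj.obj θ).of (X.obj.obj θ).of) :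
    defect M X a h h' = defect M X a h 0 + M.pull (X.obj.map a).fst h' := by
  unfold defect
  rw [map_zero]
  abel

theorem defect_eq_zero_of_pull {ρ θ : MultiArrow p} (a : ρ ⟶ θ)
    {h : M.val (X.obj.obj ρ).of (X.obj.obj ρ).of} {h' : M.val (X.obj.obj θ).of (X.obj.obj θ).of}
    (H : M.pull (X.obj.map a).fst h' = -defect M X a h 0) : defect M X a h h' = 0 := by
  rw [defect_eq_add, H, add_neg_cancel]

/-- The square for a composite through an object at which `X` vanishes commutes. -/
theorem defect_eq_zero {ρ θ κ : MultiArrow p} (a : ρ ⟶ θ) (b : θ ⟶ κ) (i : Fin n)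
    (hi : θ.arr i 0 = θ.arr i 1) (h : M.val (X.obj.obj ρ).of (X.obj.obj ρ).of) :
    defect M X (a ≫ b) h 0 = 0 := by
  have e : (X.obj.obj θ).of = ExactCategory.zero :=
    congrArg Semidirect.of (X.property.zero θ i hi)
  have h₁ : ∀ {c : C} (m : M.val c (X.obj.obj θ).of), m = 0 := by
    rw [e]
    exact M.val_zero_right
  have h₂ : ∀ {c : C} (m : M.val (X.obj.obj θ).of c), m = 0 := by
    rw [e]
    exact M.val_zero_left
  rw [defect_comp M X a b h 0, h₁ (defect M X a h 0), h₂ (defect M X b 0 0), map_zero, map_zero,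
    add_zero]

/-- A trivialization of a diagram in `C ⋉ M`: a family `h` such that the morphisms `(id, h_θ)` form an
isomorphism to the underlying diagram in `C`, regarded as a diagram in `C ⋉ M`. -/
abbrev Triv : Type v :=
  {h : ∀ θ, M.val (X.obj.obj θ).of (X.obj.obj θ).of //
    ∀ {ρ θ : MultiArrow p} (a : ρ ⟶ θ), defect M X a (h ρ) (h θ) = 0}

end

/-- The object with source zero and target `b`. -/
abbrev MultiArrow.init (b : ∀ i, Fin (p i + 1)) : MultiArrow p :=
  ofLE 0 b fun i => Fin.zero_le (b i)

theorem MultiArrow.init_le {b b' : ∀ i, Fin (p i + 1)} (h : b ≤ b') : init b ≤ init b' :=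
  ofLE_le le_rfl h

theorem MultiArrow.ext_arr {θ θ' : MultiArrow p} (h : ∀ i x, θ.arr i x = θ'.arr i x) : θ = θ' :=
  MultiArrow.ext (funext fun i => OrderHom.ext _ _ (funext (h i)))

theorem MultiArrow.eq_ofLE (θ : MultiArrow p) :
    θ = ofLE (fun i => θ.arr i 0) (fun i => θ.arr i 1) θ.arr_le := by
  refine ext_arr fun i x => ?_
  fin_cases x <;> rfl

theorem MultiArrow.init_le_self (θ : MultiArrow p) : init (fun i => θ.arr i 1) ≤ θ := by
  intro i x
  fin_cases x
  · exact Fin.zero_le _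
  · exact le_rfl

theorem SCat.res_init_injective (X : SCat C p) (c : C) (θ : MultiArrow p) :
    Function.Injective (X.res M c θ.init_le_self) := by
  have : ∀ θ' : MultiArrow p, θ' = MultiArrow.ofLE (fun i => θ.arr i 0) (fun i => θ.arr i 1) θ.arr_le →
      ∀ h : MultiArrow.init (fun i => θ.arr i 1) ≤ θ', Function.Injective (X.res M c h) := by
    rintro _ rfl h
    exact res_ofLE_injective M X c _ _ fun i => Fin.zero_le _
  exact this θ θ.eq_ofLE _

variable (X : SCat (Semidirect M.toBiadditiveFunctor) p)

/-- Trivializations of the restriction to the objects with source zero are constructed by induction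
on the target: an extension over the next object is an extension problem for compatible elements on
subobjects, which has a solution because `M` is exact. -/
theorem exists_triv_init : ∃ h : ∀ j : ∀ i, Fin (p i + 1), M.val (X.obj.obj (MultiArrow.init j)).of
      (X.obj.obj (MultiArrow.init j)).of,
    ∀ i j (hij : i ≤ j), defect M X (homOfLE (MultiArrow.init_le hij)) (h i) (h j) = 0 := by
  classical
  suffices key : ∀ N : ℕ, ∃ h : ∀ j : ∀ i, Fin (p i + 1), M.val
      (X.obj.obj (MultiArrow.init j)).of (X.obj.obj (MultiArrow.init j)).of,
      ∀ i j (hij : i ≤ j), ∑ k, (j k : ℕ) < N →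
        defect M X (homOfLE (MultiArrow.init_le hij)) (h i) (h j) = 0 by
    obtain ⟨h, hh⟩ := key (∑ k, p k + 1)
    exact ⟨h, fun i j hij => hh i j hij (Nat.lt_succ_of_le (Finset.sum_le_sum fun k _ =>
      Nat.le_of_lt_succ (j k).2))⟩
  intro N
  induction N with
  | zero => exact ⟨fun _ => 0, fun _ _ _ h => absurd h (Nat.not_lt_zero _)⟩
  | succ N ih =>
    obtain ⟨h, hh⟩ := ih
    have key : ∀ j : ∀ i, Fin (p i + 1), ∑ k, (j k : ℕ) = N → ∃ z : M.val
        (X.obj.obj (MultiArrow.init j)).of (X.obj.obj (MultiArrow.init j)).of,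
        ∀ i (hij : i ≤ j), i ≠ j →
          defect M X (homOfLE (MultiArrow.init_le hij)) (h i) z = 0 := by
      intro j hj
      let B : Finset (Fin n) := {k | j k ≠ 0}
      let l : ∀ i, Fin (p i + 1) := fun k => ⟨j k - 1, by omega⟩
      have hl : (0 : ∀ i, Fin (p i + 1)) ≤ l := fun k => Fin.zero_le _
      have hlj : l ≤ j := fun k => Nat.sub_le _ _
      have hlow : ∀ S, SCat.lower l j S ≤ j := fun S k => by
        unfold SCat.lower
        split_ifs
        · exact hlj k
        · exact le_rfl
      have hsum : ∀ S, S ⊆ B → S.Nonempty → ∑ k, (SCat.lower l j S k : ℕ) < N := by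
        rintro S hS ⟨k, hk⟩
        rw [← hj]
        refine Finset.sum_lt_sum (fun i _ => hlow S i) ⟨k, Finset.mem_univ k, ?_⟩
        have h₁ : j k ≠ 0 := by simpa [B] using hS hk
        have h₂ : (j k : ℕ) ≠ 0 := fun h => h₁ (Fin.ext h)
        rw [SCat.lower, if_pos hk]
        change (j k : ℕ) - 1 < j k
        omega
      let α : ∀ S, MultiArrow.init (SCat.lower l j S) ⟶ MultiArrow.init j := fun S =>
        homOfLE (MultiArrow.init_le (hlow S))
      let c := (X.obj.obj (MultiArrow.init j)).of
      obtain ⟨z, hz⟩ := SCat.exists_res_lower_eq M (projDiag M X) c B hl hlj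
        (fun S => -defect M X (α S) (h _) 0) (fun {S S'} hSS hS' hS => by
          have hle : SCat.lower l j S' ≤ SCat.lower l j S := SCat.lower_anti hlj hSS
          have e : α S' = homOfLE (MultiArrow.init_le hle) ≫ α S := rfl
          rw [e, defect_comp M X _ (α S) (h _) (h _) 0, hh _ _ hle (hsum S (hSS.trans hS') hS),
            map_zero, zero_add]
          exact map_neg _ _)
      have e₀ : MultiArrow.init j ≤ MultiArrow.init (SCat.lower l j ∅) :=
        MultiArrow.init_le fun k => by simp [SCat.lower]
      obtain ⟨z', hz'⟩ : ∃ z' : M.val (X.obj.obj (MultiArrow.init j)).of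
          (X.obj.obj (MultiArrow.init j)).of, ∀ S, S ⊆ B → S.Nonempty →
            M.pull (X.obj.map (α S)).fst z' = -defect M X (α S) (h _) 0 :=
        ⟨(projDiag M X).res M c e₀ z, fun S hS hS' =>
          (SCat.res_res M (projDiag M X) c _ e₀ z).trans (hz S hS hS')⟩
      refine ⟨z', fun i hij hne => ?_⟩
      obtain ⟨k, hk⟩ : ∃ k, i k < j k := by
        by_contra hk
        push Not at hk
        exact hne (le_antisymm hij hk)
      have hkB : {k} ⊆ B := Finset.singleton_subset_iff.2 (by
        have : j k ≠ 0 := fun h0 => by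
          rw [h0] at hk
          exact absurd hk (Nat.not_lt_zero _)
        simpa [B] using this)
      have hik : i ≤ SCat.lower l j {k} := fun m => by
        by_cases hm : m = k
        · subst hm
          rw [SCat.lower, if_pos (Finset.mem_singleton_self m)]
          exact Nat.le_sub_one_of_lt hk
        · rw [SCat.lower, if_neg (by simpa using hm)]
          exact hij m
      have e : (homOfLE (MultiArrow.init_le hij) : MultiArrow.init i ⟶ MultiArrow.init j) =
        homOfLE (MultiArrow.init_le hik) ≫ α {k} := rfl
      rw [e, defect_comp M X _ (α {k}) (h i) (h _) _,
        defect_eq_zero_of_pull M X (α {k}) (hz' _ hkB (Finset.singleton_nonempty k)),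
        hh _ _ hik (hsum _ hkB (Finset.singleton_nonempty k)), map_zero, map_zero, add_zero]
    let h' : ∀ j : ∀ i, Fin (p i + 1), M.val (X.obj.obj (MultiArrow.init j)).of
        (X.obj.obj (MultiArrow.init j)).of := fun j =>
      if hj : ∑ k, (j k : ℕ) = N then (key j hj).choose else h j
    refine ⟨h', fun i j hij hlt => ?_⟩
    by_cases hne : i = j
    · subst hne
      rw [defect_id, sub_self]
    · have hlt' : ∑ k, (i k : ℕ) < ∑ k, (j k : ℕ) := by
        obtain ⟨k, hk⟩ : ∃ k, i k < j k := by
          by_contra hk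
          push Not at hk
          exact hne (le_antisymm hij hk)
        exact Finset.sum_lt_sum (fun k _ => hij k) ⟨k, Finset.mem_univ k, hk⟩
      rw [show h' i = h i from dif_neg (by omega)]
      by_cases hj : ∑ k, (j k : ℕ) = N
      · rw [show h' j = _ from dif_pos hj]
        exact (key j hj).choose_spec i hij hne
      · rw [show h' j = h j from dif_neg hj]
        exact hh i j hij (by omega)

/-- Every diagram in `S_p (C ⋉ M)` is isomorphic to the diagram in `C` that underlies it. -/
theorem nonempty_triv : Nonempty (Triv M X) := by
  classical
  obtain ⟨h, hh⟩ := exists_triv_init M X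
  have key : ∀ θ : MultiArrow p, ∃ v, defect M X (homOfLE θ.init_le_self) (h _) v = 0 := by
    have key' : ∀ (a b : ∀ i, Fin (p i + 1)) (hab : a ≤ b), ∃ v : M.val
        (X.obj.obj (MultiArrow.ofLE a b hab)).of (X.obj.obj (MultiArrow.ofLE a b hab)).of,
        defect M X (homOfLE (MultiArrow.ofLE_le (fun i => Fin.zero_le (a i)) le_rfl)) (h b) v = 0 := by
      intro a b hab
      let π : MultiArrow.init b ⟶ MultiArrow.ofLE a b hab :=
        homOfLE (MultiArrow.ofLE_le (fun i => Fin.zero_le (a i)) le_rfl)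
      obtain ⟨v, hv⟩ := SCat.exists_res_eq M (projDiag M X)
        (X.obj.obj (MultiArrow.ofLE a b hab)).of hab (fun i => Fin.zero_le (b i))
        (-defect M X π (h b) 0) (fun k b' hb' hb hk => by
          let β : MultiArrow.init b' ⟶ MultiArrow.init b := homOfLE (MultiArrow.init_le hb)
          have h₁ := defect_comp M X β π (h b') (h b) 0
          rw [hh _ _ hb, map_zero, zero_add] at h₁
          refine (map_neg _ _).trans (neg_eq_zero.2 (h₁.symm.trans ?_))
          -- the composite factors through an object that vanishes in the direction `k`
          let κ : MultiArrow p := MultiArrow.ofLE (fun i => min (a i) (b' i)) b' fun i => min_le_right _ _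
          have h₂ : MultiArrow.init b' ≤ κ := MultiArrow.ofLE_le (fun i => Fin.zero_le _) le_rfl
          have h₃ : κ ≤ MultiArrow.ofLE a b hab := MultiArrow.ofLE_le (fun i => min_le_left _ _) hb
          exact defect_eq_zero M X (homOfLE h₂) (homOfLE h₃) k (by
            change min (a k) (b' k) = b' k
            rw [hk, min_self]) (h b'))
      exact ⟨v, defect_eq_zero_of_pull M X π hv⟩
    intro θ
    have : ∀ θ' : MultiArrow p, θ' = MultiArrow.ofLE (fun i => θ.arr i 0) (fun i => θ.arr i 1) θ.arr_le →
        ∀ hθ : MultiArrow.init (fun i => θ.arr i 1) ≤ θ', ∃ v, defect M X (homOfLE hθ) (h _) v = 0 := by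
      rintro _ rfl hθ
      exact key' _ _ _
    exact this θ θ.eq_ofLE _
  choose H hH using key
  refine ⟨⟨H, fun {ρ θ} a => ?_⟩⟩
  refine SCat.res_init_injective M (projDiag M X) _ ρ (Eq.trans ?_ (map_zero _).symm)
  have hle : (fun i => ρ.arr i 1) ≤ fun i => θ.arr i 1 := fun i => leOfHom a i 1
  have h₁ := defect_comp M X (homOfLE ρ.init_le_self) a (h _) (H ρ) (H θ)
  have h₂ := defect_comp M X (homOfLE (MultiArrow.init_le hle)) (homOfLE θ.init_le_self) (h _) (h _) (H θ)
  rw [hH, map_zero, zero_add] at h₁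
  rw [hH, hh _ _ hle, map_zero, map_zero, add_zero] at h₂
  exact h₁.symm.trans h₂

variable {M} {X}

/-- The trivialization of the diagram that arises from `X` by a permutation and monotone maps. -/
def Triv.reindex {p' : Fin n → ℕ} (e : Equiv.Perm (Fin n))
    (f : ∀ i, Fin (p' (e i) + 1) →o Fin (p i + 1)) (h : Triv M X) :
    Triv M ((SCat.reindex e f).obj X) :=
  ⟨fun θ => h.1 ((MultiArrow.reindex e f).obj θ), fun a => h.2 ((MultiArrow.reindex e f).map a)⟩

theorem heq_of_defect_eq_zero {θ θ' : MultiArrow p} (e : θ = θ') (a : θ ⟶ θ')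
    {h : M.val (X.obj.obj θ).of (X.obj.obj θ).of} {h' : M.val (X.obj.obj θ').of (X.obj.obj θ').of}
    (H : defect M X a h h' = 0) : h ≍ h' := by
  subst e
  rw [defect_id, sub_eq_zero] at H
  exact heq_of_eq H.symm

theorem Triv.heq {X' : SCat (Semidirect M.toBiadditiveFunctor) p} (e : X = X') {h : Triv M X}
    {h' : Triv M X'} (H : ∀ θ, h.1 θ ≍ h'.1 θ) : h ≍ h' := by
  subst e
  exact heq_of_eq (Subtype.ext (funext fun θ => eq_of_heq (H θ)))

/-- Trivializations of degenerate diagrams are degenerate. -/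
theorem Triv.exists_reindex_eq {p' : Fin n → ℕ} {d : Ops p' p} (hd : d.Surj)
    (h' : Triv M ((SCat.reindex 1 d).obj X)) : ∃ h : Triv M X, Triv.reindex 1 d h = h' := by
  let D := MultiArrow.reindex (p := p) (p' := p') 1 d
  have key₁ : ∀ θ κ : MultiArrow p', D.obj θ = D.obj κ → θ ≤ κ → h'.1 θ ≍ h'.1 κ := fun θ κ e hle =>
    heq_of_defect_eq_zero (X := X) e (D.map (homOfLE hle)) (h'.2 (homOfLE hle))
  have key : ∀ θ θ' : MultiArrow p', D.obj θ = D.obj θ' → h'.1 θ ≍ h'.1 θ' := by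
    intro θ θ' e
    let κ : MultiArrow p' := MultiArrow.ofLE (fun i => max (θ.arr i 0) (θ'.arr i 0))
      (fun i => max (θ.arr i 1) (θ'.arr i 1)) fun i => max_le_max (θ.arr_le i) (θ'.arr_le i)
    have e' : ∀ i x, d i (θ.arr i x) = d i (θ'.arr i x) := fun i x =>
      congrArg (fun φ : MultiArrow p => φ.arr i x) e
    have h₁ : D.obj θ = D.obj κ := by
      refine MultiArrow.ext_arr fun i x => ?_
      fin_cases x
      · exact (((d i).monotone.map_max).trans ((congrArg _ (e' i 0).symm).trans (max_self _))).symm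
      · exact (((d i).monotone.map_max).trans ((congrArg _ (e' i 1).symm).trans (max_self _))).symm
    have h₂ : θ ≤ κ := fun i x => by
      fin_cases x <;> exact le_max_left _ _
    have h₃ : θ' ≤ κ := fun i x => by
      fin_cases x <;> exact le_max_right _ _
    exact (key₁ θ κ h₁ h₂).trans (key₁ θ' κ (e.symm.trans h₁) h₃).symm
  obtain ⟨g, hg, -⟩ := hd.exists_section fun _ => 0
  have hg' : ∀ θ : MultiArrow p, D.obj ((MultiArrow.reindex (p := p') 1 g).obj θ) = θ := fun θ => by
    refine MultiArrow.ext_arr fun i x => ?_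
    exact congrArg (fun f : Ops p p => f i (θ.arr i x)) hg
  have e : (SCat.reindex (p := p') 1 g).obj ((SCat.reindex 1 d).obj X) = X :=
    SCat.ext (fun θ => congrArg X.obj.obj (hg' θ))
      (fun θ θ' a => map_heq X.obj (hg' θ) (hg' θ') _ _)
  obtain ⟨h, hh⟩ : ∃ h : Triv M X, ∀ θ, h.1 θ ≍ h'.1 ((MultiArrow.reindex (p := p') 1 g).obj θ) := by
    have : ∀ Y, Y = X → ∀ k : Triv M Y, ∃ h : Triv M X, ∀ θ, h.1 θ ≍ k.1 θ := by
      rintro _ rfl k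
      exact ⟨k, fun _ => HEq.rfl⟩
    exact this _ e (Triv.reindex 1 g h')
  refine ⟨h, Subtype.ext (funext fun θ => eq_of_heq ?_)⟩
  exact (hh (D.obj θ)).trans (key _ _ (hg' (D.obj θ)))

end

/-! ### The multisimplicial sets of trivialized diagrams -/

section

variable {C : Type u} [Category.{v} C] [Preadditive C] [ExactCategory C] (M : Bimodule C)

/-- The element `h` of `M(c, c)`, or zero. -/
def tzelt : ∀ (b : Bool) {c : Semidirect M.toBiadditiveFunctor}, M.val c.of c.of →
    M.val (zext b c).of (zext b c).of
  | true, _, h => h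
  | false, _, _ => 0

theorem tzelt_compat (b b' : Bool) {c c' : Semidirect M.toBiadditiveFunctor} (f : c ⟶ c')
    {h : M.val c.of c.of} {h' : M.val c'.of c'.of}
    (H : f.snd + M.pull f.fst h' - M.push f.fst h = 0) :
    (zmap b b' f).snd + M.pull (zmap b b' f).fst (tzelt M b' h') -
      M.push (zmap b b' f).fst (tzelt M b h) = 0 := by
  rcases b with _ | _ <;> rcases b' with _ | _
  · exact M.val_zero_left _
  · exact M.val_zero_left _
  · exact M.val_zero_right _
  · exact H

theorem tzelt_tzelt (b b' : Bool) {c : Semidirect M.toBiadditiveFunctor} (h : M.val c.of c.of) :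
    tzelt M b (tzelt M b' h) ≍ tzelt M b' (tzelt M b h) := by
  cases b <;> cases b' <;> rfl

theorem tzelt_heq {b b' : Bool} (hb : b = b') {c d : Semidirect M.toBiadditiveFunctor}
    {h : M.val c.of c.of} {h' : M.val d.of d.of} (hc : c = d) (hh : h ≍ h') :
    tzelt M b h ≍ tzelt M b' h' := by
  subst hb hc
  obtain rfl := eq_of_heq hh
  rfl

theorem tzelt_sub (b : Bool) {c : Semidirect M.toBiadditiveFunctor} (h h' : M.val c.of c.of) :
    tzelt M b h - tzelt M b h' ≍ zelt M.toBiadditiveFunctor b (h - h') := by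
  cases b
  · exact heq_of_eq (sub_zero _)
  · rfl

variable {M} {n : ℕ} {p : Fin n → ℕ}

/-- The trivialization of the suspension of a diagram. -/
def Triv.susp {X : SCat (Semidirect M.toBiadditiveFunctor) p} (h : Triv M X) :
    Triv M (SCat.susp.obj X) :=
  ⟨fun θ => tzelt M θ.head (h.1 (MultiArrow.tail.obj θ)), fun {ρ θ} a =>
    tzelt_compat M ρ.head θ.head _ (h.2 (MultiArrow.tail.map a))⟩

variable (M) in
/-- The trivialization of the zero diagram. -/
def Triv.zero (p : Fin n → ℕ) : Triv M (SCat.zero (Semidirect M.toBiadditiveFunctor) p) :=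
  ⟨fun _ => 0, fun _ => M.val_zero_left _⟩

theorem Triv.heq_of_zero {X X' : SCat (Semidirect M.toBiadditiveFunctor) p} (e : X = X')
    (e' : X = SCat.zero _ p) (h : Triv M X) (h' : Triv M X') : h ≍ h' := by
  subst e e'
  exact heq_of_eq (Subtype.ext (funext fun θ =>
    (M.val_zero_left (h.1 θ)).trans (M.val_zero_left (h'.1 θ)).symm))

/-- Diagrams in `C ⋉ M` with `q + 1` trivializations. -/
abbrev TrivCell (M : Bimodule C) (p : Fin n → ℕ) (q : ℕ) : Type (max u v) :=
  Σ X : SCat (Semidirect M.toBiadditiveFunctor) p, Fin (q + 1) → Triv M X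

theorem TrivCell.ext {q : ℕ} {c c' : TrivCell M p q} (h : c.1 = c'.1)
    (h' : ∀ j, c.2 j ≍ c'.2 j) : c = c' := by
  obtain ⟨X, c⟩ := c
  obtain ⟨X', c'⟩ := c'
  subst h
  exact congrArg (Sigma.mk X) (funext fun j => eq_of_heq (h' j))

variable (M) in
/-- The multisimplicial sets of diagrams in `S^{(n)}_• (C ⋉ M)` with trivializations, one for each
vertex in the last direction. -/
def trivS : SymmetricMultisimplicialSet.{max u v} where
  cell p q := TrivCell M p q
  map e f g c := ⟨(SCat.reindex e f).obj c.1, fun j => Triv.reindex e f (c.2 (g j))⟩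
  map_id _ := rfl
  map_map _ _ _ _ _ _ _ := rfl
  pt p q := ⟨SCat.zero _ p, fun _ => Triv.zero M p⟩
  map_pt _ _ _ := rfl
  susp c := ⟨SCat.susp.obj c.1, fun j => (c.2 j).susp⟩
  susp_pt p q := TrivCell.ext (SCat.susp_zero p) fun _ =>
    Triv.heq_of_zero (SCat.susp_zero p) (SCat.susp_zero p) _ _
  susp_map _ _ _ _ := rfl
  susp_face f _ h c := TrivCell.ext (SCat.susp_face f h c.1) fun _ =>
    Triv.heq_of_zero (SCat.susp_face f h c.1) (SCat.susp_face f h c.1) _ _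
  swap_susp c := by
    refine TrivCell.ext (SCat.swap_susp c.1) fun j => Triv.heq (SCat.swap_susp c.1) fun θ => ?_
    refine HEq.trans ?_ (tzelt_tzelt M _ _ _)
    refine tzelt_heq M (MultiArrow.head_swap θ) ?_ ?_
    · exact congrArg₂ (fun b j => zext b (c.1.obj.obj j))
        (MultiArrow.head_tail_swap θ) (MultiArrow.tail_tail_swap θ)
    · refine tzelt_heq M (MultiArrow.head_tail_swap θ)
        (congrArg _ (MultiArrow.tail_tail_swap θ)) ?_
      have := MultiArrow.tail_tail_swap θ
      generalize MultiArrow.tail.obj (MultiArrow.tail.obj θ) = t at *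
      subst this
      rfl

variable (M) in
/-- The map that forgets the trivializations. -/
def trivToObj : trivS M ⟶ objS (Semidirect M.toBiadditiveFunctor) where
  toFun _ _ c := c.1
  toFun_map _ _ _ _ := rfl
  toFun_pt _ _ := rfl
  toFun_susp _ := rfl

section

variable {X : SCat (Semidirect M.toBiadditiveFunctor) p}

/-- The difference of two trivializations. -/
def Triv.diff (h h' : Triv M X) : SBimod M.toBiadditiveFunctor (projDiag M X) (projDiag M X) :=
  ⟨fun θ => (show M.val (X.obj.obj θ).of (X.obj.obj θ).of from h'.1 θ - h.1 θ), fun ρ θ a => by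
    change M.pull (X.obj.map a).fst (h'.1 θ - h.1 θ) = M.push (X.obj.map a).fst (h'.1 ρ - h.1 ρ)
    have e := (h.2 a).trans (h'.2 a).symm
    unfold defect at e
    rw [map_sub, map_sub, sub_eq_sub_iff_add_eq_add]
    rw [sub_eq_sub_iff_add_eq_add, add_assoc, add_assoc, add_right_inj] at e
    rw [← e, add_comm]⟩

/-- The isomorphism given by a trivialization. -/
def Triv.iso (h : Triv M X) : X ≅ trivDiag M (projDiag M X) where
  hom := ⟨{
    app := fun θ => ⟨𝟙 (X.obj.obj θ).of, h.1 θ⟩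
    naturality := fun ρ θ a => by
      refine SemidirectHom.ext ?_ ?_
      · exact (Category.comp_id _).trans (Category.id_comp _).symm
      · change M.push (𝟙 (X.obj.obj θ).of) (X.obj.map a).snd + M.pull (X.obj.map a).fst (h.1 θ) =
          M.push (X.obj.map a).fst (h.1 ρ) + M.pull (𝟙 (X.obj.obj ρ).of)
            (0 : M.val (X.obj.obj ρ).of (X.obj.obj θ).of)
        rw [M.push_id, map_zero, add_zero]
        exact sub_eq_zero.1 (h.2 a) }⟩
  inv := ⟨{
    app := fun θ => ⟨𝟙 (X.obj.obj θ).of, -h.1 θ⟩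
    naturality := fun ρ θ a => by
      refine SemidirectHom.ext ?_ ?_
      · exact (Category.comp_id _).trans (Category.id_comp _).symm
      · change M.push (𝟙 (X.obj.obj θ).of) (0 : M.val (X.obj.obj ρ).of (X.obj.obj θ).of) +
            M.pull (X.obj.map a).fst (-h.1 θ) =
          M.push (X.obj.map a).fst (-h.1 ρ) + M.pull (𝟙 (X.obj.obj ρ).of) (X.obj.map a).snd
        rw [M.pull_id, map_zero, zero_add, map_neg, map_neg, ← sub_eq_zero.1 (h.2 a)]
        abel }⟩
  hom_inv_id := by
    refine ObjectProperty.hom_ext _ (NatTrans.ext (funext fun θ => SemidirectHom.ext ?_ ?_))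
    · exact Category.comp_id _
    · change M.push (𝟙 _) (h.1 θ) + M.pull (𝟙 _) (-h.1 θ) = 0
      rw [M.push_id, M.pull_id, add_neg_cancel]
  inv_hom_id := by
    refine ObjectProperty.hom_ext _ (NatTrans.ext (funext fun θ => SemidirectHom.ext ?_ ?_))
    · exact Category.comp_id _
    · change M.push (𝟙 _) (-h.1 θ) + M.pull (𝟙 _) (h.1 θ) = 0
      rw [M.push_id, M.pull_id, neg_add_cancel]

theorem Triv.inv_comp_hom (h h' : Triv M X) (θ : MultiArrow p) :
    (h.iso.inv ≫ h'.iso.hom).hom.app θ = (gaugeHom M (projDiag M X) (h.diff h')).hom.app θ := by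
  refine SemidirectHom.ext ?_ ?_
  · exact Category.comp_id _
  · change M.push (𝟙 _) (-h.1 θ) + M.pull (𝟙 _) (h'.1 θ) = h'.1 θ - h.1 θ
    rw [M.push_id, M.pull_id]
    abel

end

theorem projDiag_susp (X : SCat (Semidirect M.toBiadditiveFunctor) p) :
    projDiag M (SCat.susp.obj X) = SCat.susp.obj (projDiag M X) :=
  SCat.mapExact_susp (projExact M) X

/-- The simplex of the classifying space given by the differences of trivializations. -/
def TrivCell.toCoprod {q : ℕ} (c : TrivCell M p q) : Coprod M.toBiadditiveFunctor p q :=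
  ⟨projDiag M c.1,
    { obj := fun _ => SingleObj.star _
      map := fun {j j'} _ => (Multiplicative.ofAdd ((c.2 j).diff (c.2 j')) : Multiplicative
        (SBimod M.toBiadditiveFunctor (projDiag M c.1) (projDiag M c.1)))
      map_id := fun j => by
        refine congrArg Multiplicative.ofAdd (Subtype.ext (funext fun θ => ?_))
        exact sub_self ((c.2 j).1 θ)
      map_comp := fun {j j' j''} _ _ => by
        refine congrArg Multiplicative.ofAdd (Subtype.ext (funext fun θ => ?_))
        exact (sub_add_sub_cancel ((c.2 j'').1 θ) ((c.2 j').1 θ) ((c.2 j).1 θ)).symm }⟩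

variable (M) in
/-- The map that sends trivializations to their differences. -/
def trivToCoprod : trivS M ⟶ coprodS M.toBiadditiveFunctor where
  toFun _ _ c := c.toCoprod
  toFun_map _ _ _ _ := rfl
  toFun_pt _ _ := Coprod.ext rfl fun _ _ _ _ => heq_of_eq (sub_self _)
  toFun_susp c := Coprod.ext (projDiag_susp c.1) fun _ _ _ _ => tzelt_sub M _ _ _

end

/-! ### Chains of isomorphisms out of a fixed object -/

section

variable {G H : Type*} [Category G] [Category H]

/-- The chain of isomorphisms between the targets of isomorphisms out of a fixed object. -/
def chainOf {X : G} {q : ℕ} (D : Fin (q + 1) → Σ Y : G, X ≅ Y) : Fin (q + 1) ⥤ Core G where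
  obj j := ⟨(D j).1⟩
  map {j j'} _ := ⟨(D j).2.symm ≪≫ (D j').2⟩
  map_id j := by
    ext
    exact (D j).2.inv_hom_id
  map_comp {j j' j''} _ _ := by
    ext
    change (D j).2.inv ≫ (D j'').2.hom =
      ((D j).2.inv ≫ (D j').2.hom) ≫ ((D j').2.inv ≫ (D j'').2.hom)
    simp

/-- The monotone map between doubles. -/
def dbl {q q' : ℕ} (g : Fin (q' + 1) →o Fin (q + 1)) :
    Fin (q' + 1 + q' + 1) →o Fin (q + 1 + q + 1) where
  toFun := Fin.append (m := q' + 1) (n := q' + 1) (fun j => Fin.castAdd (q + 1) (g j))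
    (fun j => Fin.natAdd (q + 1) (g j))
  monotone' := by
    intro a b hab
    have hlt : ∀ (j j' : Fin (q' + 1)), Fin.castAdd (q' + 1) j ≤ Fin.natAdd (q' + 1) j' := by
      intro j j'
      simp only [Fin.le_def, Fin.val_castAdd, Fin.val_natAdd]
      omega
    induction a using Fin.addCases (m := q' + 1) (n := q' + 1) with
    | left a =>
      induction b using Fin.addCases (m := q' + 1) (n := q' + 1) with
      | left b =>
        rw [Fin.append_left, Fin.append_left]
        exact g.monotone hab
      | right b =>
        rw [Fin.append_left, Fin.append_right]
        simp only [Fin.le_def, Fin.val_castAdd, Fin.val_natAdd]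
        omega
    | right a =>
      induction b using Fin.addCases (m := q' + 1) (n := q' + 1) with
      | left b =>
        simp only [Fin.le_def, Fin.val_castAdd, Fin.val_natAdd] at hab
        omega
      | right b =>
        rw [Fin.append_right, Fin.append_right]
        have : a ≤ b := by
          simp only [Fin.le_def, Fin.val_natAdd] at hab
          exact Fin.le_def.2 (by omega)
        exact (Fin.natAdd_le_natAdd_iff _).2 (g.monotone this)

/-- The inclusion of the first half of the double. -/
def dblLeft (q : ℕ) : Fin (q + 1) →o Fin (q + 1 + q + 1) :=
  ⟨Fin.castAdd (q + 1), fun _ _ h => h⟩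

/-- The inclusion of the second half of the double. -/
def dblRight (q : ℕ) : Fin (q + 1) →o Fin (q + 1 + q + 1) :=
  ⟨Fin.natAdd (q + 1), fun _ _ h => Nat.add_le_add_left h _⟩

theorem append_comp_dbl {α : Type*} {q q' : ℕ} (g : Fin (q' + 1) →o Fin (q + 1))
    (a b : Fin (q + 1) → α) : Fin.append a b ∘ dbl g = Fin.append (a ∘ g) (b ∘ g) := by
  funext j
  change Fin.append a b (Fin.append (m := q' + 1) (n := q' + 1) _ _ j) = _
  induction j using Fin.addCases (m := q' + 1) (n := q' + 1) with
  | left j => rw [Fin.append_left, Fin.append_left, Fin.append_left, Function.comp_apply]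
  | right j => rw [Fin.append_right, Fin.append_right, Fin.append_right, Function.comp_apply]

theorem append_comp_dblLeft {α : Type*} {q : ℕ} (a b : Fin (q + 1) → α) :
    Fin.append a b ∘ dblLeft q = a := funext fun j => Fin.append_left a b j

theorem append_comp_dblRight {α : Type*} {q : ℕ} (a b : Fin (q + 1) → α) :
    Fin.append a b ∘ dblRight q = b := funext fun j => Fin.append_right a b j

theorem dbl_comp_dblLeft {q q' : ℕ} (g : Fin (q' + 1) →o Fin (q + 1)) :
    dbl g ∘ dblLeft q' = dblLeft q ∘ g :=
  funext fun j => Fin.append_left (fun j => Fin.castAdd (q + 1) (g j))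
    (fun j => Fin.natAdd (q + 1) (g j)) j

theorem dbl_comp_dblRight {q q' : ℕ} (g : Fin (q' + 1) →o Fin (q + 1)) :
    dbl g ∘ dblRight q' = dblRight q ∘ g :=
  funext fun j => Fin.append_right (fun j => Fin.castAdd (q + 1) (g j))
    (fun j => Fin.natAdd (q + 1) (g j)) j

/-- The point `(1 - r) x + r y`. -/
noncomputable def mix {m : ℕ} (r : I) (x y : stdSimplex ℝ (Fin (m + 1))) :
    stdSimplex ℝ (Fin (m + 1)) :=
  ⟨fun a => (1 - r) * x a + r * y a, fun a => add_nonneg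
    (mul_nonneg (sub_nonneg.2 r.2.2) (stdSimplex.zero_le x a))
    (mul_nonneg r.2.1 (stdSimplex.zero_le y a)), by
    rw [Finset.sum_add_distrib, ← Finset.mul_sum, ← Finset.mul_sum, stdSimplex.sum_eq_one,
      stdSimplex.sum_eq_one]
    ring⟩

theorem mix_apply {m : ℕ} (r : I) (x y : stdSimplex ℝ (Fin (m + 1))) (a : Fin (m + 1)) :
    mix r x y a = (1 - r) * x a + r * y a := rfl

theorem stdSimplex_ext {m : ℕ} {x y : stdSimplex ℝ (Fin (m + 1))} (h : ∀ a, x a = y a) : x = y :=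
  Subtype.ext (funext h)

theorem mix_zero {m : ℕ} (x y : stdSimplex ℝ (Fin (m + 1))) : mix 0 x y = x :=
  stdSimplex_ext fun a => by simp [mix_apply]

theorem mix_one {m : ℕ} (x y : stdSimplex ℝ (Fin (m + 1))) : mix 1 x y = y :=
  stdSimplex_ext fun a => by simp [mix_apply]

theorem map_mix {m k : ℕ} (f : Fin (m + 1) → Fin (k + 1)) (r : I)
    (x y : stdSimplex ℝ (Fin (m + 1))) :
    stdSimplex.map f (mix r x y) = mix r (stdSimplex.map f x) (stdSimplex.map f y) :=
  stdSimplex_ext fun a => by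
    rw [mix_apply, stdSimplex_map_apply, stdSimplex_map_apply, stdSimplex_map_apply, Finset.mul_sum,
      Finset.mul_sum, ← Finset.sum_add_distrib]
    rfl

theorem continuous_mix {V : Type*} [TopologicalSpace V] {m : ℕ} {r : V → I}
    {x y : V → stdSimplex ℝ (Fin (m + 1))} (hr : Continuous r) (hx : Continuous x)
    (hy : Continuous y) : Continuous fun v => mix (r v) (x v) (y v) := by
  refine Continuous.subtype_mk (continuous_pi fun a => ?_) _
  have h₁ : Continuous fun v => x v a := (continuous_stdSimplex_apply a).comp hx
  have h₂ : Continuous fun v => y v a := (continuous_stdSimplex_apply a).comp hy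
  have h₃ : Continuous fun v => (r v : ℝ) := continuous_subtype_val.comp hr
  exact ((continuous_const.sub h₃).mul h₁).add (h₃.mul h₂)

/-- The path from the first to the second copy of a point in the double. -/
noncomputable def dblPt {q : ℕ} (r : I) (u : stdSimplex ℝ (Fin (q + 1))) :
    stdSimplex ℝ (Fin (q + 1 + q + 1)) :=
  mix r (stdSimplex.map (dblLeft q) u) (stdSimplex.map (dblRight q) u)

theorem map_dblPt {q q' : ℕ} (g : Fin (q' + 1) →o Fin (q + 1)) (r : I)
    (u : stdSimplex ℝ (Fin (q' + 1))) :
    stdSimplex.map (dbl g) (dblPt r u) = dblPt r (stdSimplex.map g u) := by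
  unfold dblPt
  rw [map_mix, stdSimplex.map_comp_apply, stdSimplex.map_comp_apply, stdSimplex.map_comp_apply,
    stdSimplex.map_comp_apply, dbl_comp_dblLeft, dbl_comp_dblRight]

theorem continuous_dblPt {q : ℕ} :
    Continuous fun z : I × stdSimplex ℝ (Fin (q + 1)) => dblPt z.1 z.2 :=
  continuous_mix continuous_fst ((stdSimplex.continuous_map _).comp continuous_snd)
    ((stdSimplex.continuous_map _).comp continuous_snd)

end

/-! ### Trivialized diagrams and chains of isomorphisms -/

section

open SymmetricMultisimplicialSet

variable {A : Type u} [Category.{v} A] [Preadditive A] [ExactCategory A] {n : ℕ}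

theorem smap_chainOf {p p' : Fin n → ℕ} {q q' : ℕ} (f : Ops p' p) (g : Fin (q' + 1) →o Fin (q + 1))
    {X : SCat A p} (D : Fin (q + 1) → Σ Y : SCat A p, X ≅ Y) :
    (nerveS A).smap f g (chainOf D) = chainOf ((fun Z : Σ Y : SCat A p, X ≅ Y =>
      (⟨(SCat.reindex 1 f).obj Z.1, (SCat.reindex 1 f).mapIso Z.2⟩ :
        Σ Y : SCat A p', (SCat.reindex 1 f).obj X ≅ Y)) ∘ D ∘ g) :=
  chain_ext (fun _ => rfl) (fun _ _ _ _ => HEq.rfl)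

theorem chainOf_eq_pt {p : Fin n → ℕ} {q : ℕ} {X : SCat A p}
    (D : Fin (q + 1) → Σ Y : SCat A p, X ≅ Y) (h : ∀ j, (D j).1 = SCat.zero A p) :
    chainOf D = (nerveS A).pt p q := by
  have e : ∀ j θ, (D j).1.obj.obj θ = ExactCategory.zero := fun j θ => by
    rw [h]
    rfl
  exact chain_ext h fun j j' _ θ => zero_heq (e j θ) (e j' θ) (e j θ)

theorem comp_append {α β : Type*} {m k : ℕ} (φ : α → β) (a : Fin m → α) (b : Fin k → α) :
    φ ∘ Fin.append a b = Fin.append (φ ∘ a) (φ ∘ b) := by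
  funext j
  rw [Function.comp_apply]
  induction j using Fin.addCases with
  | left j => rw [Fin.append_left, Fin.append_left, Function.comp_apply]
  | right j => rw [Fin.append_right, Fin.append_right, Function.comp_apply]

theorem point_smap_id {X : SymmetricMultisimplicialSet.{u}} {p : Fin n → ℕ} {q q' : ℕ}
    (g : Fin (q' + 1) →o Fin (q + 1)) (x : X.cell p q) (t : Prism p)
    (u : stdSimplex ℝ (Fin (q' + 1))) :
    point (X.smap (Ops.id p) g x) t u = point x t (stdSimplex.map g u) :=
  (point_smap _ _ _ _ _).trans (congrArg (fun t => point x t (stdSimplex.map g u)) (Ops.push_id t))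

theorem point_dblPt_zero {X : SymmetricMultisimplicialSet.{u}} {p : Fin n → ℕ} {q : ℕ}
    (x : X.cell p (q + 1 + q)) (t : Prism p) (u : stdSimplex ℝ (Fin (q + 1))) :
    point x t (dblPt 0 u) = point (X.smap (Ops.id p) (dblLeft q) x) t u := by
  rw [point_smap_id, dblPt, mix_zero]

theorem point_dblPt_one {X : SymmetricMultisimplicialSet.{u}} {p : Fin n → ℕ} {q : ℕ}
    (x : X.cell p (q + 1 + q)) (t : Prism p) (u : stdSimplex ℝ (Fin (q + 1))) :
    point x t (dblPt 1 u) = point (X.smap (Ops.id p) (dblRight q) x) t u := by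
  rw [point_smap_id, dblPt, mix_one]

variable {C : Type u} [Category.{v} C] [Preadditive C] [ExactCategory C] (M : Bimodule C)

/-- The isomorphisms from a trivialized diagram to itself and to the underlying diagram in `C`. -/
def TrivCell.isos {p : Fin n → ℕ} {q : ℕ} (c : TrivCell M p q) :
    Fin (q + 1 + q + 1) → Σ Y : SCat (Semidirect M.toBiadditiveFunctor) p, c.1 ≅ Y :=
  Fin.append (m := q + 1) (n := q + 1) (fun _ => ⟨c.1, Iso.refl _⟩) (fun j => ⟨_, (c.2 j).iso⟩)

/-- The trivializations are a homotopy between the two maps from trivialized diagrams to chains of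
isomorphisms. -/
theorem exists_triv_homotopy : ∃ H : I → (trivS M).Realization n →
      (nerveS (Semidirect M.toBiadditiveFunctor)).Realization n,
    (Continuous fun z : I × (trivS M).Realization n => H z.1 z.2) ∧
    (∀ x, H 0 x = real (objToNerve _) n (real (trivToObj M) n x)) ∧
    (∀ x, H 1 x = real (coprodToNerve M) n (real (trivToCoprod M) n x)) ∧
    ∀ r, H r ((trivS M).basePt n) = SymmetricMultisimplicialSet.basePt _ n := by
  let N := nerveS (Semidirect M.toBiadditiveFunctor)
  let H : I → (trivS M).Realization n → N.Realization n := fun r => descend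
    (fun {p q} c t u => point (X := N) (q := q + 1 + q) (chainOf (TrivCell.isos M c)) t (dblPt r u))
    (fun {p p' q q'} f g c t u => by
      rw [← map_dblPt]
      refine Eq.trans ?_ (point_smap (X := N) f (dbl g) (chainOf (TrivCell.isos M c)) t (dblPt r u))
      refine congrArg (fun y => point (X := N) y t (dblPt r u)) ?_
      refine Eq.trans (congrArg chainOf ?_) (smap_chainOf f (dbl g) (TrivCell.isos M c)).symm
      unfold TrivCell.isos
      rw [append_comp_dbl, comp_append]
      refine congrArg₂ (Fin.append (m := q' + 1) (n := q' + 1)) ?_ rfl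
      exact funext fun _ => congrArg (Sigma.mk _) (Functor.mapIso_refl (SCat.reindex 1 f) c.1).symm)
  refine ⟨H, ?_, fun x => ?_, fun x => ?_, fun r => ?_⟩
  · refine continuous_of_point_prod fun {p q} c => ?_
    exact continuous_point_comp (X := N) (q := q + 1 + q) (chainOf (TrivCell.isos M c)) (continuous_fst.comp continuous_snd)
      (continuous_dblPt.comp (continuous_fst.prodMk (continuous_snd.comp continuous_snd)))
  · induction x using ind with
    | @h p q c t u =>
      refine (point_dblPt_zero (X := N) _ t u).trans (congrArg (fun y => point (X := N) y t u) ?_)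
      refine (smap_chainOf _ (dblLeft q) (TrivCell.isos M c)).trans ?_
      refine (congrArg chainOf (congrArg _ (append_comp_dblLeft _ _))).trans ?_
      exact chain_ext (fun _ => rfl) (fun _ _ _ _ => heq_of_eq (Category.comp_id _))
  · induction x using ind with
    | @h p q c t u =>
      refine (point_dblPt_one (X := N) _ t u).trans (congrArg (fun y => point (X := N) y t u) ?_)
      refine (smap_chainOf _ (dblRight q) (TrivCell.isos M c)).trans ?_
      refine (congrArg chainOf (congrArg _ (append_comp_dblRight _ _))).trans ?_
      exact chain_ext (fun _ => rfl) (fun j j' _ θ =>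
        heq_of_eq (Triv.inv_comp_hom (c.2 j) (c.2 j') θ))
  · change point (X := N) (q := 0 + 1 + 0) (chainOf _) _ _ = _
    rw [chainOf_eq_pt]
    · exact point_pt _ _ _ _
    · intro j
      induction j using Fin.addCases (m := 0 + 1) (n := 0 + 1) with
      | left j => exact congrArg Sigma.fst (Fin.append_left _ _ j)
      | right j => exact congrArg Sigma.fst (Fin.append_right _ _ j)

end

/-! ### Diagrams can be trivialized up to homotopy -/

section

open SymmetricMultisimplicialSet

variable {C : Type u} [Category.{v} C] [Preadditive C] [ExactCategory C] (M : Bimodule C) (n : ℕ)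

/-- The multisimplicial set of diagrams. -/
def objMS : MultisimplicialSet.{max u v} (Fin n) where
  cell p := SCat (Semidirect M.toBiadditiveFunctor) p
  map f X := (SCat.reindex 1 f).obj X
  map_id _ := rfl
  map_map _ _ _ := rfl

variable {M n}

/-- Deformations of the trivialized diagrams over a fixed diagram `x` to a point that depends neither
on the trivializations nor on the coordinate in the last direction. -/
structure Deformation {p : Fin n → ℕ} (x : SCat (Semidirect M.toBiadditiveFunctor) p) where
  toFun : ∀ q : ℕ, (Fin (q + 1) → Triv M x) → Prism p → stdSimplex ℝ (Fin (q + 1)) → I →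
    (trivS M).Realization n
  continuous_toFun : ∀ q ℓ, Continuous fun z : Prism p × stdSimplex ℝ (Fin (q + 1)) × I =>
    toFun q ℓ z.1 z.2.1 z.2.2
  zero : ∀ q ℓ t u, toFun q ℓ t u 0 = point (X := trivS M) (⟨x, ℓ⟩ : TrivCell M p q) t u
  one : ∀ q ℓ u q' ℓ' u' t, toFun q ℓ t u 1 = toFun q' ℓ' t u' 1
  natural : ∀ {q q' : ℕ} (g : Fin (q' + 1) →o Fin (q + 1)) ℓ t u r,
    toFun q' (ℓ ∘ g) t u r = toFun q ℓ t (stdSimplex.map g u) r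
  proj : ∀ q ℓ u q' ℓ' u' t r, real (trivToObj M) n (toFun q ℓ t u r) =
    real (trivToObj M) n (toFun q' ℓ' t u' r)

/-- The compatibility of deformations with an operator. -/
def Deformation.Rel {p p' : Fin n → ℕ} (f : Ops p' p) {x : SCat (Semidirect M.toBiadditiveFunctor) p}
    {y : SCat (Semidirect M.toBiadditiveFunctor) p'} (φ : Deformation x) (φ' : Deformation y) :
    Prop :=
  ∀ q (ℓ : Fin (q + 1) → Triv M x) (ℓ' : Fin (q + 1) → Triv M y),
    (trivS M).smap (p := p) (q := q) f OrderHom.id (⟨x, ℓ⟩ : TrivCell M p q) =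
      (⟨y, ℓ'⟩ : TrivCell M p' q) →
    ∀ t u r, φ'.toFun q ℓ' t u r = φ.toFun q ℓ (f.push t) u r

theorem Triv.reindex_injective {p p' : Fin n → ℕ} {X : SCat (Semidirect M.toBiadditiveFunctor) p}
    {d : Ops p' p} (hd : d.Surj) {h h' : Triv M X} (e : Triv.reindex 1 d h = Triv.reindex 1 d h') :
    h = h' := by
  obtain ⟨g, hg, -⟩ := hd.exists_section fun _ => 0
  refine Subtype.ext (funext fun θ => ?_)
  have hθ : (MultiArrow.reindex (p := p) (p' := p') 1 d).obj
      ((MultiArrow.reindex (p := p') (p' := p) 1 g).obj θ) = θ :=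
    MultiArrow.ext_arr fun i x => congrArg (fun f : Ops p p => f i (θ.arr i x)) hg
  have := congrArg (fun k : Triv M ((SCat.reindex 1 d).obj X) =>
    k.1 ((MultiArrow.reindex (p := p') (p' := p) 1 g).obj θ)) e
  change h.1 ((MultiArrow.reindex (p := p) (p' := p') 1 d).obj _) = h'.1 _ at this
  rwa [hθ] at this

/-- The pullback of a deformation along a degeneracy. -/
theorem Deformation.exists_pull {p p' : Fin n → ℕ} (d : Ops p' p) (hd : d.Surj)
    {x : SCat (Semidirect M.toBiadditiveFunctor) p} (φ : Deformation x) :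
    ∃ φ' : Deformation ((SCat.reindex 1 d).obj x), ∀ q (ℓ : Fin (q + 1) → Triv M x) t u r,
      φ'.toFun q (fun j => Triv.reindex 1 d (ℓ j)) t u r = φ.toFun q ℓ (d.push t) u r := by
  choose s hs using fun ℓ' : Triv M ((SCat.reindex 1 d).obj x) => Triv.exists_reindex_eq hd ℓ'
  have hcp : ∀ q, Continuous fun z : Prism p' × stdSimplex ℝ (Fin (q + 1)) × I =>
      (d.push z.1, z.2) := fun q => (d.continuous_push.comp continuous_fst).prodMk continuous_snd
  refine ⟨⟨fun q ℓ t u r => φ.toFun q (s ∘ ℓ) (d.push t) u r, fun q ℓ =>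
    (φ.continuous_toFun q (s ∘ ℓ)).comp (hcp q), fun q ℓ t u => ?_, fun q ℓ u q' ℓ' u' t =>
    φ.one _ _ _ _ _ _ _, fun g ℓ t u r => φ.natural g (s ∘ ℓ) _ _ _, fun q ℓ u q' ℓ' u' t r =>
    φ.proj _ _ _ _ _ _ _ _⟩, fun q ℓ t u r => ?_⟩
  · rw [φ.zero]
    have h := point_smap (X := trivS M) d OrderHom.id (⟨x, s ∘ ℓ⟩ : TrivCell M p q) t u
    rw [show (stdSimplex.map (OrderHom.id : Fin (q + 1) →o Fin (q + 1)) u) = u from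
      stdSimplex.map_id_apply u] at h
    refine h.symm.trans (congrArg (fun ℓ : Fin (q + 1) → Triv M ((SCat.reindex 1 d).obj x) =>
      point (X := trivS M) (⟨_, ℓ⟩ : TrivCell M p' q) t u) ?_)
    exact funext fun j => hs (ℓ j)
  · refine congrArg (fun ℓ => φ.toFun q ℓ (d.push t) u r) (funext fun j => ?_)
    exact Triv.reindex_injective hd (hs _)

/-- The constant deformation of the trivializations of the zero diagram. -/
def Deformation.const {p : Fin n → ℕ} {x : SCat (Semidirect M.toBiadditiveFunctor) p}
    (hx : x = SCat.zero _ p) : Deformation x where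
  toFun _ _ _ _ _ := (trivS M).basePt n
  continuous_toFun _ _ := continuous_const
  zero q ℓ t u := by
    refine (point_pt (X := trivS M) p q t u).symm.trans (congrArg (fun c => point (X := trivS M) c t u) ?_)
    exact TrivCell.ext hx.symm fun j => Triv.heq_of_zero hx.symm rfl _ _
  one _ _ _ _ _ _ _ := rfl
  natural _ _ _ _ _ := rfl
  proj _ _ _ _ _ _ _ _ := rfl

/-- The monotone map `[q' + 1] → [q + 1]` that preserves zero and agrees with `g` on the successors. -/
def consHom {q q' : ℕ} (g : Fin (q' + 1) →o Fin (q + 1)) : Fin (q' + 1 + 1) →o Fin (q + 1 + 1) where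
  toFun := Fin.cons 0 fun j => (g j).succ
  monotone' := by
    intro a b hab
    induction a using Fin.cases with
    | zero => exact Fin.zero_le _
    | succ a =>
      induction b using Fin.cases with
      | zero => exact absurd hab (by simp)
      | succ b => exact Fin.succ_le_succ_iff.2 (g.monotone (Fin.succ_le_succ_iff.1 hab))

/-- The inclusion `[q] → [q + 1]` onto the successors. -/
def succHom (q : ℕ) : Fin (q + 1) →o Fin (q + 1 + 1) := ⟨Fin.succ, fun _ _ h => Fin.succ_le_succ_iff.2 h⟩

/-- The path in the cone over a simplex from a point `u` of the simplex to the cone point. -/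
noncomputable def conePt {q : ℕ} (r : I) (u : stdSimplex ℝ (Fin (q + 1))) :
    stdSimplex ℝ (Fin (q + 1 + 1)) :=
  mix r (stdSimplex.map (succHom q) u) (stdSimplex.vertex 0)

theorem map_consHom_conePt {q q' : ℕ} (g : Fin (q' + 1) →o Fin (q + 1)) (r : I)
    (u : stdSimplex ℝ (Fin (q' + 1))) :
    stdSimplex.map (consHom g) (conePt r u) = conePt r (stdSimplex.map g u) := by
  unfold conePt
  rw [map_mix, stdSimplex.map_comp_apply, stdSimplex.map_comp_apply, stdSimplex.map_vertex]
  rfl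

theorem continuous_conePt {q : ℕ} :
    Continuous fun z : I × stdSimplex ℝ (Fin (q + 1)) => conePt z.1 z.2 :=
  continuous_mix continuous_fst ((stdSimplex.continuous_map _).comp continuous_snd) continuous_const

theorem conePt_zero {q : ℕ} (u : stdSimplex ℝ (Fin (q + 1))) :
    conePt 0 u = stdSimplex.map (succHom q) u := mix_zero _ _

theorem conePt_one {q : ℕ} (u : stdSimplex ℝ (Fin (q + 1))) : conePt 1 u = stdSimplex.vertex 0 :=
  mix_one _ _

theorem conePt_one_eq_map {q : ℕ} (u : stdSimplex ℝ (Fin (q + 1))) :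
    conePt 1 u = stdSimplex.map (OrderHom.const (Fin (0 + 1)) (0 : Fin (q + 1 + 1)))
      (stdSimplex.vertex 0) := by
  rw [conePt_one, stdSimplex.map_vertex]
  rfl

/-- How far the coordinate in the last direction has moved to the cone point at time `r`. The
coordinate does not move on the boundary; at time one, it has arrived at the cone point if the boundary
is not reached by the time `1 / 3`. -/
noncomputable def coneTime {p : Fin n → ℕ} (t : Prism p) (r : I) : I :=
  clamp (r * (3 * hitTime t))

theorem continuous_coneTime {p : Fin n → ℕ} :
    Continuous fun z : Prism p × I => coneTime z.1 z.2 :=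
  continuous_clamp.comp ((continuous_subtype_val.comp continuous_snd).mul
    (continuous_const.mul (continuous_hitTime.comp continuous_fst)))

section

variable {p : Fin n → ℕ} {x : SCat (Semidirect M.toBiadditiveFunctor) p}
  (F : ∀ {p' : Fin n → ℕ} (f : Ops p' p), ¬f.Surj → Deformation ((SCat.reindex 1 f).obj x))

open Classical in
/-- The values of deformations on the boundary. -/
noncomputable def Deformation.bdry (q : ℕ) (ℓ : Fin (q + 1) → Triv M x)
    (v : stdSimplex ℝ (Fin (q + 1))) (f : Ops p p) (t : Prism p) (r : I) : (trivS M).Realization n :=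
  if h : f.Surj then (trivS M).basePt n
  else (F f h).toFun q (fun j => Triv.reindex 1 f (ℓ j)) t v r

theorem Deformation.bdry_eq {q : ℕ} {ℓ : Fin (q + 1) → Triv M x} {v : stdSimplex ℝ (Fin (q + 1))}
    {f : Ops p p} (h : ¬f.Surj) {t : Prism p} {r : I} :
    Deformation.bdry F q ℓ v f t r = (F f h).toFun q (fun j => Triv.reindex 1 f (ℓ j)) t v r :=
  dif_neg h

/-- The extension of deformations on the boundary, before the coordinate in the last direction is
moved. -/
noncomputable def Deformation.ext₀ (q : ℕ) (ℓ : Fin (q + 1) → Triv M x)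
    (v : stdSimplex ℝ (Fin (q + 1))) (t : Prism p) (r : I) : (trivS M).Realization n :=
  collar (fun t => point (X := trivS M) (⟨x, ℓ⟩ : TrivCell M p q) t v)
    (Deformation.bdry F q ℓ v) t r

theorem Deformation.ext₀_natural {q q' : ℕ} (g : Fin (q' + 1) →o Fin (q + 1))
    (ℓ : Fin (q + 1) → Triv M x) (v : stdSimplex ℝ (Fin (q' + 1))) (t : Prism p) (r : I) :
    Deformation.ext₀ F q' (ℓ ∘ g) v t r = Deformation.ext₀ F q ℓ (stdSimplex.map g v) t r :=
  collar_congr (fun t => point_smap_id (X := trivS M) g (⟨x, ℓ⟩ : TrivCell M p q) t v)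
    (fun f hf t r => by
      rw [Deformation.bdry_eq F hf, Deformation.bdry_eq F hf]
      exact (F f hf).natural g (fun j => Triv.reindex 1 f (ℓ j)) t v r) t r

theorem Deformation.real_ext₀ {q q' : ℕ} (ℓ : Fin (q + 1) → Triv M x)
    (v : stdSimplex ℝ (Fin (q + 1))) (ℓ' : Fin (q' + 1) → Triv M x)
    (v' : stdSimplex ℝ (Fin (q' + 1))) (t : Prism p) (r : I) :
    real (trivToObj M) n (Deformation.ext₀ F q ℓ v t r) =
      real (trivToObj M) n (Deformation.ext₀ F q' ℓ' v' t r) := by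
  have h : ∀ {q : ℕ} (v : stdSimplex ℝ (Fin (q + 1))) (t : Prism p),
      point (X := objS (Semidirect M.toBiadditiveFunctor)) (p := p) (q := q) x t v =
        point (X := objS (Semidirect M.toBiadditiveFunctor)) (p := p) (q := 0) x t
          (stdSimplex.vertex 0) := fun {q} v t => by
    refine (point_smap_id (X := objS (Semidirect M.toBiadditiveFunctor)) (p := p) (q := 0)
      (OrderHom.const (Fin (q + 1)) (0 : Fin (0 + 1))) x t v).trans ?_
    exact congrArg _ (stdSimplex_eq_vertex _)
  refine (map_collar (real (trivToObj M) n) _ _ t r).trans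
    (Eq.trans ?_ (map_collar (real (trivToObj M) n) _ _ t r).symm)
  refine collar_congr (fun t => (h v t).trans (h v' t).symm) (fun f hf t r => ?_) t r
  rw [Deformation.bdry_eq F hf, Deformation.bdry_eq F hf]
  exact (F f hf).proj _ _ _ _ _ _ _ _

theorem Deformation.bdry_zero {q : ℕ} (ℓ : Fin (q + 1) → Triv M x)
    (v : stdSimplex ℝ (Fin (q + 1))) {t : Prism p} (ht : IsBoundary t) :
    point (X := trivS M) (⟨x, ℓ⟩ : TrivCell M p q) t v =
      Deformation.bdry F q ℓ v (faceOps t) t 0 := by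
  rw [Deformation.bdry_eq F ht.not_surj, Deformation.zero]
  have h := point_smap (X := trivS M) (faceOps t) OrderHom.id (⟨x, ℓ⟩ : TrivCell M p q) t v
  rw [show (stdSimplex.map (OrderHom.id : Fin (q + 1) →o Fin (q + 1)) v) = v from
    stdSimplex.map_id_apply v] at h
  refine Eq.trans ?_ h.symm
  exact congrArg (fun t => point (X := trivS M) (⟨x, ℓ⟩ : TrivCell M p q) t v) (faceOps_push t).symm

variable (hF : ∀ {p' p'' : Fin n → ℕ} (f : Ops p' p) (g : Ops p'' p') (hf : ¬f.Surj)
  (hfg : ¬(f.comp g).Surj), Deformation.Rel g (F f hf) (F (f.comp g) hfg))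

include hF

theorem Deformation.bdry_faceOps {p' : Fin n → ℕ} (f : Ops p' p) (hf : ¬f.Surj) {q : ℕ}
    (ℓ : Fin (q + 1) → Triv M x) (v : stdSimplex ℝ (Fin (q + 1))) (t : Prism p') (r : I)
    {t' : Prism p} (e : f.push t = t') :
    Deformation.bdry F q ℓ v (faceOps t') t' r =
      (F f hf).toFun q (fun j => Triv.reindex 1 f (ℓ j)) t v r := by
  subst e
  have h := (isBoundary_push hf t).not_surj
  rw [Deformation.bdry_eq F h]
  exact faceOps_eq (fun f hf t => (F f hf).toFun q (fun j => Triv.reindex 1 f (ℓ j)) t v r)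
    (fun f g hf hfg t => hF f g hf hfg q (fun j => Triv.reindex 1 f (ℓ j)) _ rfl t v r) hf t h

theorem Deformation.continuous_ext₀ (q : ℕ) (ℓ : Fin (q + 1) → Triv M x) :
    Continuous fun z : stdSimplex ℝ (Fin (q + 1)) × Prism p × I =>
      Deformation.ext₀ F q ℓ z.1 z.2.1 z.2.2 := by
  refine continuous_collar ?_ (fun f hf => ?_) (fun v f t r hf ht => ?_)
    (fun v t ht => Deformation.bdry_zero F ℓ v ht)
  · exact continuous_point_comp (X := trivS M) (⟨x, ℓ⟩ : TrivCell M p q) continuous_snd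
      continuous_fst
  · simp only [Deformation.bdry_eq F hf]
    exact ((F f hf).continuous_toFun q _).comp ((continuous_fst.comp continuous_snd).prodMk
      (continuous_fst.prodMk (continuous_snd.comp continuous_snd)))
  · rw [Deformation.bdry_faceOps F hF f hf ℓ v t r ht, Deformation.bdry_eq F hf]

/-- Deformations on the boundary extend: the collar carries the deformation, and away from the
boundary, the coordinate in the last direction is moved to an additional vertex with a fixed
trivialization. -/
theorem Deformation.exists_extension : ∃ φ : Deformation x, ∀ {p' : Fin n → ℕ} (f : Ops p' p)
    (hf : ¬f.Surj), Deformation.Rel f φ (F f hf) := by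
  obtain ⟨ℓ₀⟩ := nonempty_triv M x
  let e : ∀ {q : ℕ}, (Fin (q + 1) → Triv M x) → Fin (q + 1 + 1) → Triv M x := fun ℓ => Fin.cons ℓ₀ ℓ
  have hsucc : ∀ {q : ℕ} (ℓ : Fin (q + 1) → Triv M x), e ℓ ∘ succHom q = ℓ := fun _ => rfl
  refine ⟨⟨fun q ℓ t u r => Deformation.ext₀ F (q + 1) (e ℓ) (conePt (coneTime t r) u) t r,
    fun q ℓ => ?_, fun q ℓ t u => ?_, fun q ℓ u q' ℓ' u' t => ?_, fun {q q'} g ℓ t u r => ?_,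
    fun q ℓ u q' ℓ' u' t r => Deformation.real_ext₀ F _ _ _ _ t r⟩, fun f hf q ℓ ℓ' h t u r => ?_⟩
  · refine (Deformation.continuous_ext₀ F hF (q + 1) (e ℓ)).comp (Continuous.prodMk ?_
      (continuous_fst.prodMk (continuous_snd.comp continuous_snd)))
    exact continuous_conePt.comp ((continuous_coneTime.comp (continuous_fst.prodMk
      (continuous_snd.comp continuous_snd))).prodMk (continuous_fst.comp continuous_snd))
  · have h₀ : coneTime t 0 = 0 := clamp_of_nonpos (by simp)
    rw [h₀, conePt_zero, ← Deformation.ext₀_natural, hsucc]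
    exact collar_zero _ _ _
  · by_cases ht : hitTime t ≤ 1 / 3
    · unfold Deformation.ext₀
      rw [collar_one ht, collar_one ht]
      have h' : ¬(faceOps (flow t 1)).Surj := by
        refine (isBoundary_flow (r := 1) (ht.trans ?_)).not_surj
        change (1 / 3 : ℝ) ≤ 1
        norm_num
      rw [Deformation.bdry_eq F h', Deformation.bdry_eq F h']
      exact (F _ h').one _ _ _ _ _ _ _
    · have h₁ : coneTime t 1 = 1 := clamp_of_one_le (by
        have := not_le.1 ht
        change (1 : ℝ) ≤ 1 * (3 * hitTime t)
        linarith)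
      rw [h₁, conePt_one_eq_map, conePt_one_eq_map, ← Deformation.ext₀_natural,
        ← Deformation.ext₀_natural]
      rfl
  · rw [← map_consHom_conePt, ← Deformation.ext₀_natural]
    refine congrArg (fun ℓ => Deformation.ext₀ F (q' + 1) ℓ _ t r) (funext fun j => ?_)
    induction j using Fin.cases <;> rfl
  · have ht := isBoundary_push hf t
    have h₀ : coneTime (f.push t) r = 0 := clamp_of_nonpos (by simp [ht.hitTime_eq])
    obtain rfl : (fun j => Triv.reindex 1 f (ℓ j)) = ℓ' := eq_of_heq (Sigma.mk.inj h).2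
    change _ = Deformation.ext₀ F (q + 1) (e ℓ) (conePt (coneTime (f.push t) r) u) (f.push t) r
    rw [h₀, conePt_zero, ← Deformation.ext₀_natural, hsucc]
    refine Eq.trans ?_ (collar_of_isBoundary ht (Deformation.bdry_zero F ℓ u ht) r).symm
    exact (Deformation.bdry_faceOps F hF f hf ℓ u t r rfl).symm

end

variable (M n)

/-- A compatible choice of deformations. -/
theorem Deformation.exists_section : ∃ s : ∀ {p : Fin n → ℕ}
    (x : SCat (Semidirect M.toBiadditiveFunctor) p), Deformation x,
    (∀ {p p' : Fin n → ℕ} (f : Ops p' p) (x : SCat (Semidirect M.toBiadditiveFunctor) p),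
      Deformation.Rel f (s x) (s ((SCat.reindex 1 f).obj x))) ∧
    ∀ p : Fin n → ℕ, s (SCat.zero _ p) = Deformation.const rfl := by
  choose pull hpull using fun {p p' : Fin n → ℕ} (d : Ops p' p) (hd : d.Surj)
    {x : SCat (Semidirect M.toBiadditiveFunctor) p} (φ : Deformation x) => φ.exists_pull d hd
  obtain ⟨s, hs, hs'⟩ := (objMS M n).exists_section (Φ := fun x => Deformation x)
    (fun f _ _ _ φ φ' => Deformation.Rel f φ φ')
    (fun d hd _ _ h φ => h ▸ pull d hd φ)
    (fun {p p'} d hd {x y} h φ => by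
      subst h
      intro q ℓ ℓ' h t u r
      obtain rfl : (fun j => Triv.reindex 1 d (ℓ j)) = ℓ' := eq_of_heq (Sigma.mk.inj h).2
      exact hpull d hd φ q ℓ t u r)
    (fun {p p' p''} d hd f {x y z} h h' h'' φ φ' hr => by
      subst h
      intro q ℓ' ℓ'' e t u r
      choose ℓ hℓ using fun j => Triv.exists_reindex_eq hd (ℓ' j)
      obtain rfl : (fun j => Triv.reindex 1 d (ℓ j)) = ℓ' := funext hℓ
      refine (hr q ℓ ℓ'' e t u r).trans ?_
      rw [Ops.push_comp]
      exact (hpull d hd φ q ℓ _ u r).symm)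
    {z | ∃ h : z.2.1 = SCat.zero _ z.1, z.2.2 = Deformation.const h}
    { unique := fun ⟨_, h⟩ ⟨_, h'⟩ => h.trans h'.symm
      closed := fun {p p'} f {x φ} ⟨h, h'⟩ => by
        have e : (objMS M n).map f x = SCat.zero _ p' := by
          dsimp only at h
          rw [h]
          rfl
        exact ⟨Deformation.const e, ⟨e, rfl⟩, fun q ℓ ℓ' _ t u r => by
          dsimp only at h'
          rw [h']
          rfl⟩ }
    (fun x F hF => Deformation.exists_extension F hF)
  exact ⟨s, hs, fun p => hs' _ _ ⟨rfl, rfl⟩⟩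

/-- The map that forgets trivializations is a homotopy equivalence. -/
theorem exists_trivToObj_inverse :
    ∃ Ψ : (objS (Semidirect M.toBiadditiveFunctor)).Realization n → (trivS M).Realization n,
      Continuous Ψ ∧ Ψ (SymmetricMultisimplicialSet.basePt _ n) =
        SymmetricMultisimplicialSet.basePt _ n ∧
      (∃ P : I → (objS (Semidirect M.toBiadditiveFunctor)).Realization n →
          (objS (Semidirect M.toBiadditiveFunctor)).Realization n,
        (Continuous fun z : I × (objS (Semidirect M.toBiadditiveFunctor)).Realization n =>
          P z.1 z.2) ∧ (∀ x, P 0 x = x) ∧ (∀ x, P 1 x = real (trivToObj M) n (Ψ x)) ∧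
        ∀ r, P r (SymmetricMultisimplicialSet.basePt _ n) =
          SymmetricMultisimplicialSet.basePt _ n) ∧
      ∃ Q : I → (trivS M).Realization n → (trivS M).Realization n,
        (Continuous fun z : I × (trivS M).Realization n => Q z.1 z.2) ∧ (∀ x, Q 0 x = x) ∧
        (∀ x, Q 1 x = Ψ (real (trivToObj M) n x)) ∧
        ∀ r, Q r (SymmetricMultisimplicialSet.basePt _ n) =
          SymmetricMultisimplicialSet.basePt _ n := by
  obtain ⟨s, hs, hs₀⟩ := Deformation.exists_section M n
  choose τ hτ using fun {p : Fin n → ℕ} (x : SCat (Semidirect M.toBiadditiveFunctor) p) =>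
    (nonempty_triv M x).elim fun h => (⟨h, trivial⟩ : ∃ _ : Triv M x, True)
  have hsmap : ∀ {p p' : Fin n → ℕ} (f : Ops p' p) (x : SCat (Semidirect M.toBiadditiveFunctor) p)
      (q : ℕ) (ℓ : Fin (q + 1) → Triv M x) (t : Prism p') (u : stdSimplex ℝ (Fin (q + 1))) (r : I),
      (s ((SCat.reindex 1 f).obj x)).toFun q (fun j => Triv.reindex 1 f (ℓ j)) t u r =
        (s x).toFun q ℓ (f.push t) u r := fun f x q ℓ t u r => hs f x q ℓ _ rfl t u r
  let T : ∀ {p : Fin n → ℕ}, SCat (Semidirect M.toBiadditiveFunctor) p → Prism p → I →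
      (trivS M).Realization n := fun x t r => (s x).toFun 0 (fun _ => τ x) t (stdSimplex.vertex 0) r
  have hT : ∀ {p : Fin n → ℕ} (x : SCat (Semidirect M.toBiadditiveFunctor) p),
      Continuous fun z : Prism p × I => T x z.1 z.2 := fun x =>
    ((s x).continuous_toFun 0 fun _ => τ x).comp (continuous_fst.prodMk
      (continuous_const.prodMk continuous_snd))
  let Ψ : (objS (Semidirect M.toBiadditiveFunctor)).Realization n → (trivS M).Realization n :=
    descend (fun {p q} x t _ => T (p := p) x t 1) (fun {p p' q q'} f g x t u =>
      ((s _).one _ _ _ _ _ _ _).trans (hsmap f x 0 (fun _ => τ x) t (stdSimplex.vertex 0) 1))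
  let P : I → (objS (Semidirect M.toBiadditiveFunctor)).Realization n →
      (objS (Semidirect M.toBiadditiveFunctor)).Realization n := fun r =>
    descend (fun {p q} x t _ => real (trivToObj M) n (T (p := p) x t r))
      (fun {p p' q q'} f g x t u => ((s _).proj _ _ _ _ _ _ _ _).trans
        (congrArg _ (hsmap f x 0 (fun _ => τ x) t (stdSimplex.vertex 0) r)))
  let Q : I → (trivS M).Realization n → (trivS M).Realization n := fun r =>
    descend (fun {p q} c t u => (s c.1).toFun q c.2 t u r) (fun {p p' q q'} f g c t u =>
      (hsmap f c.1 q' (c.2 ∘ g) t u r).trans ((s c.1).natural g c.2 _ u r))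
  refine ⟨Ψ, ?_, ?_, ⟨P, ?_, fun x => ?_, fun x => ?_, fun r => ?_⟩, Q, ?_, fun x => ?_, fun x => ?_,
    fun r => ?_⟩
  · refine continuous_of_point fun {p q} x => ?_
    exact (hT (p := p) x).comp (continuous_fst.prodMk continuous_const)
  · change (s (SCat.zero _ _)).toFun _ _ _ _ _ = _
    rw [hs₀]
    rfl
  · refine continuous_of_point_prod fun {p q} x => (continuous_real _).comp ?_
    exact (hT (p := p) x).comp ((continuous_fst.comp continuous_snd).prodMk continuous_fst)
  · induction x using ind with
    | @h p q x t u =>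
      refine (congrArg (real (trivToObj M) n) ((s _).zero 0 _ t _)).trans ?_
      change point (X := objS (Semidirect M.toBiadditiveFunctor)) (p := p) (q := 0) x t _ = _
      refine Eq.trans ?_ (point_smap_id (X := objS (Semidirect M.toBiadditiveFunctor)) (p := p)
        (q := 0) (OrderHom.const (Fin (q + 1)) (0 : Fin (0 + 1))) x t u).symm
      exact congrArg _ (stdSimplex_eq_vertex _).symm
  · induction x using ind with
    | @h p q x t u => rfl
  · change real (trivToObj M) n ((s (SCat.zero _ _)).toFun _ _ _ _ _) = _
    rw [hs₀]
    exact real_basePt _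
  · refine continuous_of_point_prod fun {p q} c => ?_
    exact ((s c.1).continuous_toFun q c.2).comp ((continuous_fst.comp continuous_snd).prodMk
      ((continuous_snd.comp continuous_snd).prodMk continuous_fst))
  · induction x using ind with
    | @h p q c t u => exact (s c.1).zero q c.2 t u
  · induction x using ind with
    | @h p q c t u => exact (s c.1).one _ _ _ _ _ _ _
  · change (s (SCat.zero _ _)).toFun _ _ _ _ _ = _
    rw [hs₀]
    rfl

end

/-! ### Cones of chains of isomorphisms -/

/-- The multi-index `(k, p_1, …, p_n)`. -/
abbrev consN {n : ℕ} (k : ℕ) (p : Fin n → ℕ) : Fin (n + 1) → ℕ := Fin.cons k p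

/-- The operators `(g, f_1, …, f_n)`. -/
abbrev consOps {n k k' : ℕ} {p p' : Fin n → ℕ} (g : Fin (k' + 1) →o Fin (k + 1)) (f : Ops p' p) :
    Ops (consN k' p') (consN k p) :=
  Fin.cases (motive := fun i => Fin (consN k' p' i + 1) →o Fin (consN k p i + 1)) g f

/-- The coordinates `(v, t_1, …, t_n)`. -/
abbrev consCoord {n k : ℕ} {p : Fin n → ℕ} (v : stdSimplex ℝ (Fin (k + 1))) (t : Prism p) :
    Prism (consN k p) :=
  Fin.cases (motive := fun i => stdSimplex ℝ (Fin (consN k p i + 1))) v t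

theorem consOps_push {n k k' : ℕ} {p p' : Fin n → ℕ} (g : Fin (k' + 1) →o Fin (k + 1))
    (f : Ops p' p) (v : stdSimplex ℝ (Fin (k' + 1))) (t : Prism p') :
    (consOps g f).push (consCoord v t) = consCoord (stdSimplex.map g v) (f.push t) := by
  funext i
  induction i using Fin.cases <;> rfl

theorem continuous_consCoord {V : Type*} [TopologicalSpace V] {n k : ℕ} {p : Fin n → ℕ}
    {v : V → stdSimplex ℝ (Fin (k + 1))} {t : V → Prism p} (hv : Continuous v) (ht : Continuous t) :
    Continuous fun z => consCoord (v z) (t z) := by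
  refine continuous_pi fun i => ?_
  induction i using Fin.cases with
  | zero => exact hv
  | succ i => exact (continuous_apply i).comp ht

section

variable {A : Type u} [Category.{v} A] [Preadditive A] [ExactCategory A] {n : ℕ} {p : Fin n → ℕ}
  {q : ℕ}

/-- The isomorphism between any two objects of a chain of isomorphisms. -/
def chainTrans (Y : Fin (q + 1) ⥤ Core (SCat A p)) (j k : Fin (q + 1)) :
    (Y.obj j).of ⟶ (Y.obj k).of :=
  (Y.map (homOfLE (Fin.zero_le j))).iso.inv ≫ (Y.map (homOfLE (Fin.zero_le k))).iso.hom

variable (Y : Fin (q + 1) ⥤ Core (SCat A p))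

theorem chainTrans_self (j : Fin (q + 1)) : chainTrans Y j j = 𝟙 _ := Iso.inv_hom_id _

theorem chainTrans_comp (j k l : Fin (q + 1)) :
    chainTrans Y j k ≫ chainTrans Y k l = chainTrans Y j l := by
  simp [chainTrans]

theorem chainTrans_of_hom {j k : Fin (q + 1)} (a : j ⟶ k) :
    chainTrans Y j k = (Y.map a).iso.hom := by
  have h : (Y.map (homOfLE (Fin.zero_le k))) = Y.map (homOfLE (Fin.zero_le j)) ≫ Y.map a := by
    rw [← Functor.map_comp]
    rfl
  unfold chainTrans
  rw [h]
  change _ ≫ (_ ≫ _) = _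
  exact Iso.inv_hom_id_assoc _ _

/-- The morphisms between the values of the diagrams of a chain. -/
def chainEval (j k : Fin (q + 1)) {ρ θ : MultiArrow p} (a : ρ ⟶ θ) :
    (Y.obj j).of.obj.obj ρ ⟶ (Y.obj k).of.obj.obj θ :=
  (chainTrans Y j k).hom.app ρ ≫ (Y.obj k).of.obj.map a

theorem chainEval_comp (j k l : Fin (q + 1)) {ρ θ κ : MultiArrow p} (a : ρ ⟶ θ) (b : θ ⟶ κ) :
    chainEval Y j k a ≫ chainEval Y k l b = chainEval Y j l (a ≫ b) := by
  unfold chainEval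
  rw [← chainTrans_comp Y j k l, Functor.map_comp, ObjectProperty.FullSubcategory.comp_hom,
    NatTrans.comp_app, Category.assoc, Category.assoc, NatTrans.naturality_assoc]

theorem chainEval_self (j : Fin (q + 1)) {ρ θ : MultiArrow p} (a : ρ ⟶ θ) :
    chainEval Y j j a = (Y.obj j).of.obj.map a := by
  unfold chainEval
  rw [chainTrans_self]
  exact Category.id_comp _

theorem chainEval_id (j k : Fin (q + 1)) (ρ : MultiArrow p) :
    chainEval Y j k (𝟙 ρ) = (chainTrans Y j k).hom.app ρ := by
  unfold chainEval
  rw [CategoryTheory.Functor.map_id, Category.comp_id]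

theorem isIso_chainEval (j k : Fin (q + 1)) {ρ θ : MultiArrow p} (a : ρ ⟶ θ) (h : ρ = θ) :
    IsIso (chainEval Y j k a) := by
  subst h
  obtain rfl : a = 𝟙 ρ := rfl
  refine ⟨chainEval Y k j (𝟙 ρ), ?_, ?_⟩ <;>
  · rw [chainEval_comp, Category.comp_id, chainEval_self, CategoryTheory.Functor.map_id]

theorem chainEval_heq {j k j' k' : Fin (q + 1)} {ρ θ ρ' θ' : MultiArrow p} (hj : j = j')
    (hk : k = k') (hρ : ρ = ρ') (hθ : θ = θ') (a : ρ ⟶ θ) (a' : ρ' ⟶ θ') :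
    chainEval Y j k a ≍ chainEval Y j' k' a' := by
  subst hj hk hρ hθ
  obtain rfl : a = a' := Subsingleton.elim _ _
  rfl

namespace MultiArrow

/-- Whether the first component of an object is of the form `0 ⟶ b` with `b` different from zero. -/
def coneHead {k : ℕ} (θ : MultiArrow (consN (k + 1) p)) : Bool :=
  decide ((θ.arr 0 0 : Fin (k + 1 + 1)) = 0 ∧ (θ.arr 0 1 : Fin (k + 1 + 1)) ≠ 0)

/-- The target of the first component. -/
def coneIdx {k : ℕ} (θ : MultiArrow (consN (k + 1) p)) : Fin (k + 1 + 1) := θ.arr 0 1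

/-- The components of an object except for the first one. -/
def coneTail {k : ℕ} : MultiArrow (consN k p) ⥤ MultiArrow p where
  obj θ := ⟨fun i => θ.arr i.succ⟩
  map {θ θ'} h := homOfLE fun i a => leOfHom h i.succ a

theorem coneHead_iff {k : ℕ} (θ : MultiArrow (consN (k + 1) p)) : θ.coneHead = true ↔
    (θ.arr 0 0 : Fin (k + 1 + 1)) = 0 ∧ θ.coneIdx ≠ 0 := by
  unfold coneHead coneIdx
  exact decide_eq_true_iff

theorem coneHead_of_le {k : ℕ} {θ₁ θ₂ θ₃ : MultiArrow (consN (k + 1) p)} (h : θ₁ ≤ θ₂)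
    (h' : θ₂ ≤ θ₃) (h₁ : θ₁.coneHead = true) (h₃ : θ₃.coneHead = true) : θ₂.coneHead = true := by
  rw [coneHead_iff] at *
  have e₁ : θ₁.coneIdx ≤ θ₂.coneIdx := h 0 1
  have e₂ : (θ₂.arr 0 0 : Fin (k + 1 + 1)) ≤ θ₃.arr 0 0 := h' 0 0
  refine ⟨Fin.le_zero_iff.1 (e₂.trans_eq h₃.1), fun e => h₁.2 (Fin.le_zero_iff.1 (e₁.trans_eq e))⟩

/-- Which of the arrows `a ≤ b`, `a ≤ c`, `b ≤ c` are of the form `0 ⟶ x` with `x` different from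
zero. -/
theorem decide_cases {k : ℕ} (a b c : Fin (k + 1 + 1)) (hab : a ≤ b) (hbc : b ≤ c) :
    (decide (a = 0 ∧ b ≠ 0) = false ∧ decide (a = 0 ∧ c ≠ 0) = false ∧
        decide (b = 0 ∧ c ≠ 0) = false) ∨
      (decide (a = 0 ∧ b ≠ 0) = false ∧ decide (a = 0 ∧ c ≠ 0) = true ∧
        decide (b = 0 ∧ c ≠ 0) = true) ∨
      (decide (a = 0 ∧ b ≠ 0) = true ∧ decide (a = 0 ∧ c ≠ 0) = true ∧
        decide (b = 0 ∧ c ≠ 0) = false) := by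
  by_cases hc : c = 0
  · subst hc
    obtain rfl := Fin.le_zero_iff.1 hbc
    obtain rfl := Fin.le_zero_iff.1 hab
    simp
  · by_cases hb : b = 0
    · subst hb
      obtain rfl := Fin.le_zero_iff.1 hab
      simp [hc]
    · by_cases ha : a = 0
      · simp [ha, hb, hc]
      · simp [ha, hb]

theorem coneHead_cases {k : ℕ} {θ₁ θ₂ θ₃ : MultiArrow (consN (k + 1) p)}
    (h₀ : θ₁.arr 0 0 = θ₂.arr 0 0) (h₁ : θ₁.arr 0 1 = θ₃.arr 0 0) (h₂ : θ₂.arr 0 1 = θ₃.arr 0 1) :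
    (θ₁.coneHead = false ∧ θ₂.coneHead = false ∧ θ₃.coneHead = false) ∨
      (θ₁.coneHead = false ∧ θ₂.coneHead = true ∧ θ₃.coneHead = true) ∨
      (θ₁.coneHead = true ∧ θ₂.coneHead = true ∧ θ₃.coneHead = false) := by
  have := decide_cases (θ₁.arr 0 0) (θ₁.arr 0 1) (θ₂.arr 0 1) ((θ₁.arr 0).monotone (by decide)) (by
    rw [h₁, h₂]
    exact (θ₃.arr 0).monotone (by decide))
  unfold coneHead
  rw [← h₀, ← h₁, ← h₂]
  exact this

end MultiArrow

/-- The diagram with value zero at objects whose first component is not of the form `0 ⟶ b` with `b`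
different from zero, and with value `Y_{ι(b)}` at those. For `ι(b) = b - 1` this is the cone of the
chain `Y`, with edges `Y_0, …, Y_q` at the cone point. -/
def coneOf (ι : Fin (q + 1 + 1) → Fin (q + 1)) : SCat A (consN (q + 1) p) :=
  ⟨{ obj := fun θ => zext θ.coneHead ((Y.obj (ι θ.coneIdx)).of.obj.obj (MultiArrow.coneTail.obj θ))
     map := fun {θ θ'} h => zmap θ.coneHead θ'.coneHead
      (chainEval Y (ι θ.coneIdx) (ι θ'.coneIdx) (MultiArrow.coneTail.map h))
     map_id := fun θ => by
      rw [chainEval_self, CategoryTheory.Functor.map_id, CategoryTheory.Functor.map_id, zmap_id]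
     map_comp := fun h h' => by
      rw [zmap_comp (MultiArrow.coneHead_of_le (leOfHom h) (leOfHom h')), chainEval_comp,
        Functor.map_comp] }, by
    constructor
    · intro θ i h
      induction i using Fin.cases with
      | zero =>
        have : θ.coneHead = false := by
          rw [Bool.eq_false_iff, Ne, MultiArrow.coneHead_iff]
          rintro ⟨h₁, h₂⟩
          exact h₂ (h.symm.trans h₁)
        simp only [this]
        rfl
      | succ i =>
        have : (Y.obj (ι θ.coneIdx)).of.obj.obj (MultiArrow.coneTail.obj θ) = ExactCategory.zero :=
          (Y.obj (ι θ.coneIdx)).of.property.zero _ i h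
        dsimp only
        rw [this]
        exact zext_zero _
    · intro i θ₁ θ₂ θ₃ h h' hj h₀ h₁ h₂
      induction i using Fin.cases with
      | zero =>
        have t : MultiArrow.coneTail.obj θ₁ = MultiArrow.coneTail.obj θ₂ :=
          MultiArrow.ext (funext fun i => (hj i.succ (Fin.succ_ne_zero i)).1)
        have t' : MultiArrow.coneTail.obj θ₂ = MultiArrow.coneTail.obj θ₃ :=
          MultiArrow.ext (funext fun i => (hj i.succ (Fin.succ_ne_zero i)).2)
        exact conflation_zmap (MultiArrow.coneHead_cases h₀ h₁ h₂) (isIso_chainEval Y _ _ _ t)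
          (isIso_chainEval Y _ _ _ t')
      | succ i =>
        have c := (hj 0 (Fin.succ_ne_zero i).symm).1
        have c' := (hj 0 (Fin.succ_ne_zero i).symm).2
        have b : θ₁.coneHead = θ₂.coneHead := by
          simp only [MultiArrow.coneHead, c]
        have b' : θ₂.coneHead = θ₃.coneHead := by
          simp only [MultiArrow.coneHead, c']
        refine conflation_zmap_const b b' ?_
        have key : ∀ j k l : Fin (q + 1), j = k → k = l →
            ∃ w, ExactCategory.conflation (ShortComplex.mk
              (chainEval Y j k (MultiArrow.coneTail.map h))
              (chainEval Y k l (MultiArrow.coneTail.map h')) w) := by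
          rintro j _ _ rfl rfl
          simp only [chainEval_self]
          exact (Y.obj j).of.property.exact i _ _ _ _ _ (fun j hji => hj j.succ
            fun he => hji (Fin.succ_injective _ he)) h₀ h₁ h₂
        exact key _ _ _ (congrArg (fun φ : Fin 2 →o Fin (q + 1 + 1) => ι (φ 1)) c)
          (congrArg (fun φ : Fin 2 →o Fin (q + 1 + 1) => ι (φ 1)) c')⟩

/-- The isomorphisms between the diagrams `coneOf Y ι` for different `ι`, given by the isomorphisms of
the chain. -/
def coneHom (ι ι' : Fin (q + 1 + 1) → Fin (q + 1)) : coneOf Y ι ⟶ coneOf Y ι' :=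
  ⟨{ app := fun θ => zmap θ.coneHead θ.coneHead
      (chainEval Y (ι θ.coneIdx) (ι' θ.coneIdx) (𝟙 (MultiArrow.coneTail.obj θ)))
     naturality := fun θ θ' h => by
      refine (zmap_comp (by simp_all) _ _).trans (Eq.trans ?_ (zmap_comp (by simp_all) _ _).symm)
      rw [chainEval_comp, chainEval_comp, Category.comp_id, Category.id_comp] }⟩

theorem coneHom_comp (ι ι' ι'' : Fin (q + 1 + 1) → Fin (q + 1)) :
    coneHom Y ι ι' ≫ coneHom Y ι' ι'' = coneHom Y ι ι'' := by
  refine ObjectProperty.hom_ext _ (NatTrans.ext (funext fun θ => ?_))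
  refine (zmap_comp (by simp_all) _ _).trans ?_
  rw [chainEval_comp, Category.comp_id]
  rfl

theorem coneHom_self (ι : Fin (q + 1 + 1) → Fin (q + 1)) : coneHom Y ι ι = 𝟙 _ := by
  refine ObjectProperty.hom_ext _ (NatTrans.ext (funext fun θ => ?_))
  change zmap θ.coneHead θ.coneHead (chainEval Y _ _ (𝟙 (MultiArrow.coneTail.obj θ))) =
    𝟙 (zext θ.coneHead _)
  rw [chainEval_self, CategoryTheory.Functor.map_id, zmap_id]

/-- The chain of isomorphisms between the diagrams `coneOf Y (ι J)`. -/
def coneChain {m : ℕ} (ι : Fin (m + 1) → Fin (q + 1 + 1) → Fin (q + 1)) :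
    Fin (m + 1) ⥤ Core (SCat A (consN (q + 1) p)) where
  obj J := ⟨coneOf Y (ι J)⟩
  map {J J'} _ := ⟨{
    hom := coneHom Y (ι J) (ι J')
    inv := coneHom Y (ι J') (ι J)
    hom_inv_id := by rw [coneHom_comp, coneHom_self]
    inv_hom_id := by rw [coneHom_comp, coneHom_self] }⟩
  map_id J := Core.hom_ext (coneHom_self Y (ι J))
  map_comp _ _ := Core.hom_ext (coneHom_comp Y _ _ _).symm

theorem zmap_heq_of {b₁ b₁' b₂ b₂' : Bool} (h : b₁ = b₂) (h' : b₁' = b₂') {c c' d d' : A}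
    {f : c ⟶ c'} {g : d ⟶ d'} (hc : b₁ = true → c = d) (hc' : b₁' = true → c' = d')
    (hf : b₁ = true → b₁' = true → f ≍ g) : zmap b₁ b₁' f ≍ zmap b₂ b₂' g := by
  subst h h'
  cases b₁ <;> cases b₁'
  · rfl
  · obtain rfl := hc' rfl
    rfl
  · obtain rfl := hc rfl
    rfl
  · exact hf rfl rfl

theorem zext_eq_of {b₁ b₂ : Bool} (h : b₁ = b₂) {c d : A} (hc : b₁ = true → c = d) :
    zext b₁ c = zext b₂ d := by
  subst h
  cases b₁
  · rfl
  · exact hc rfl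

theorem SCat.eq_zero {X : SCat A p} (h : ∀ θ, X.obj.obj θ = ExactCategory.zero) :
    X = SCat.zero A p :=
  SCat.ext h fun θ θ' _ => zero_heq (h θ) (h θ') (h θ)

section

variable {p' : Fin n → ℕ} {q' : ℕ} (f : Ops p' p) (g : Fin (q' + 1) →o Fin (q + 1))

theorem chainTrans_smap (j k : Fin (q' + 1)) : chainTrans ((nerveS A).smap f g Y) j k =
    (SCat.reindex 1 f).map (chainTrans Y (g j) (g k)) := by
  have h : ∀ j, Y.map (homOfLE (Fin.zero_le (g j))) = Y.map (homOfLE (Fin.zero_le (g 0))) ≫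
      Y.map (homOfLE (g.monotone (Fin.zero_le j))) := fun j => by
    rw [← Functor.map_comp]
    rfl
  have e : chainTrans Y (g j) (g k) = (Y.map (homOfLE (g.monotone (Fin.zero_le j)))).iso.inv ≫
      (Y.map (homOfLE (g.monotone (Fin.zero_le k)))).iso.hom := by
    unfold chainTrans
    rw [h j, h k]
    change (_ ≫ _) ≫ (_ ≫ _) = _
    rw [Category.assoc, Iso.inv_hom_id_assoc]
  rw [e, Functor.map_comp]
  rfl

theorem coneHead_consHom (θ : MultiArrow (consN (q' + 1) p')) :
    ((MultiArrow.reindex 1 (consOps (consHom g) f)).obj θ).coneHead = θ.coneHead := by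
  have h : ∀ b : Fin (q' + 1 + 1), consHom g b = 0 ↔ b = 0 := fun b => by
    induction b using Fin.cases with
    | zero => exact iff_of_true rfl rfl
    | succ b => exact iff_of_false (Fin.succ_ne_zero (g b)) (Fin.succ_ne_zero b)
  rw [Bool.eq_iff_iff, MultiArrow.coneHead_iff, MultiArrow.coneHead_iff]
  exact and_congr (h _) (not_congr (h _))

variable {ι : Fin (q + 1 + 1) → Fin (q + 1)} {ι' : Fin (q' + 1 + 1) → Fin (q' + 1)}
  (hι : ∀ b : Fin (q' + 1), ι (g b).succ = g (ι' b.succ))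

include hι

theorem coneIdx_consHom {θ : MultiArrow (consN (q' + 1) p')} (h : θ.coneHead = true) :
    ι ((MultiArrow.reindex 1 (consOps (consHom g) f)).obj θ).coneIdx = g (ι' θ.coneIdx) := by
  have h₁ := (θ.coneHead_iff.1 h).2
  obtain ⟨b, hb⟩ := Fin.exists_succ_eq.2 h₁
  change ι (consHom g θ.coneIdx) = _
  rw [← hb]
  exact hι b

theorem reindex_coneOf : (SCat.reindex 1 (consOps (consHom g) f)).obj (coneOf Y ι) =
    coneOf ((nerveS A).smap f g Y) ι' := by
  refine SCat.ext (fun θ => ?_) (fun θ θ' a => ?_)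
  · refine zext_eq_of (coneHead_consHom f g θ) fun h => ?_
    rw [coneHead_consHom f g θ] at h
    exact congrArg (fun j => (Y.obj j).of.obj.obj _) (coneIdx_consHom f g hι h)
  · refine zmap_heq_of (coneHead_consHom f g θ) (coneHead_consHom f g θ') (fun h => ?_)
      (fun h => ?_) (fun h h' => ?_)
    · rw [coneHead_consHom f g θ] at h
      exact congrArg (fun j => (Y.obj j).of.obj.obj _) (coneIdx_consHom f g hι h)
    · rw [coneHead_consHom f g θ'] at h
      exact congrArg (fun j => (Y.obj j).of.obj.obj _) (coneIdx_consHom f g hι h)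
    · rw [coneHead_consHom f g θ] at h
      rw [coneHead_consHom f g θ'] at h'
      refine (chainEval_heq Y (coneIdx_consHom f g hι h) (coneIdx_consHom f g hι h') rfl rfl _
        ((MultiArrow.reindex 1 f).map (MultiArrow.coneTail.map a))).trans (heq_of_eq ?_)
      unfold chainEval
      rw [chainTrans_smap]
      rfl

omit hι in
theorem smap_coneChain {m m' : ℕ} (G : Fin (m' + 1) →o Fin (m + 1))
    (ι : Fin (m + 1) → Fin (q + 1 + 1) → Fin (q + 1))
    (ι' : Fin (m' + 1) → Fin (q' + 1 + 1) → Fin (q' + 1))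
    (hι : ∀ J (b : Fin (q' + 1)), ι (G J) (g b).succ = g (ι' J b.succ)) :
    (nerveS A).smap (consOps (consHom g) f) G (coneChain Y ι) =
      coneChain ((nerveS A).smap f g Y) ι' := by
  refine chain_ext (fun J => reindex_coneOf Y f g (hι J)) (fun J J' a θ => ?_)
  refine zmap_heq_of (coneHead_consHom f g θ) (coneHead_consHom f g θ) (fun h => ?_)
      (fun h => ?_) (fun h _ => ?_)
  · rw [coneHead_consHom f g θ] at h
    exact congrArg (fun j => (Y.obj j).of.obj.obj _) (coneIdx_consHom f g (hι J) h)
  · rw [coneHead_consHom f g θ] at h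
    exact congrArg (fun j => (Y.obj j).of.obj.obj _) (coneIdx_consHom f g (hι J') h)
  · rw [coneHead_consHom f g θ] at h
    refine (chainEval_heq Y (coneIdx_consHom f g (hι J) h) (coneIdx_consHom f g (hι J') h) rfl rfl (𝟙 _)
      ((MultiArrow.reindex 1 f).map (𝟙 (MultiArrow.coneTail.obj θ)))).trans (heq_of_eq ?_)
    unfold chainEval
    rw [chainTrans_smap]
    rfl

end

theorem reindex_coneOf_eq_zero {p' : Fin (n + 1) → ℕ} (f : Ops p' (consN (q + 1) p))
    (hf : (∀ a, (f 0 a : Fin (q + 1 + 1)) = 0) ∨ ∀ a, (f 0 a : Fin (q + 1 + 1)) ≠ 0)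
    (ι : Fin (q + 1 + 1) → Fin (q + 1)) :
    (SCat.reindex 1 f).obj (coneOf Y ι) = SCat.zero A p' := by
  refine SCat.eq_zero fun θ => ?_
  have h : ((MultiArrow.reindex 1 f).obj θ).coneHead = false := by
    rw [Bool.eq_false_iff, Ne, MultiArrow.coneHead_iff]
    rintro ⟨h₁, h₂⟩
    exact hf.elim (fun hf => h₂ (hf _)) fun hf => hf _ h₁
  change zext ((MultiArrow.reindex 1 f).obj θ).coneHead _ = _
  rw [h]
  rfl

theorem coneOf_eq_zero (h : ∀ j, (Y.obj j).of = SCat.zero A p)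
    (ι : Fin (q + 1 + 1) → Fin (q + 1)) : coneOf Y ι = SCat.zero A _ := by
  refine SCat.eq_zero fun θ => ?_
  change zext θ.coneHead ((Y.obj (ι θ.coneIdx)).of.obj.obj _) = _
  rw [h]
  exact zext_zero _

/-- The map `[q + 1] → [1]` that sends zero to zero and everything else to one. -/
def coneCollapse (q : ℕ) : Fin (q + 1 + 1) →o Fin (1 + 1) where
  toFun := Fin.cons 0 fun _ => 1
  monotone' := by
    intro a b hab
    induction a using Fin.cases with
    | zero => exact Fin.zero_le _
    | succ a =>
      induction b using Fin.cases with
      | zero => exact absurd hab (by simp)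
      | succ b => exact le_rfl

theorem head_coneCollapse (θ : MultiArrow (consN (q + 1) p)) :
    ((MultiArrow.reindex (p := consOne p) 1 (consOps (coneCollapse q) (Ops.id p))).obj θ).head =
      θ.coneHead := by
  have key : ∀ a b : Fin (q + 1 + 1), a ≤ b →
      (coneCollapse q a ≠ coneCollapse q b ↔ a = 0 ∧ b ≠ 0) := by
    intro a b hab
    induction a using Fin.cases with
    | zero =>
      induction b using Fin.cases with
      | zero => simp
      | succ b => exact iff_of_true (by change (0 : Fin 2) ≠ 1; decide) ⟨rfl, Fin.succ_ne_zero b⟩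
    | succ a =>
      induction b using Fin.cases with
      | zero => exact absurd hab (by simp)
      | succ b => exact iff_of_false (fun h => h rfl) fun h => Fin.succ_ne_zero a h.1
  rw [Bool.eq_iff_iff, MultiArrow.coneHead_iff, MultiArrow.head_iff]
  exact key _ _ (θ.arr_le 0)

/-- For constant `ι`, the diagrams `coneOf Y ι` are degenerations of suspensions. -/
theorem coneChain_const : coneChain Y (fun J _ => J) = (nerveS A).smap (p := consOne p)
    (consOps (coneCollapse q) (Ops.id p)) OrderHom.id ((nerveS A).susp Y) := by
  refine chain_ext (fun J => SCat.ext (fun θ => ?_) (fun θ θ' a => ?_)) (fun J J' a θ => ?_)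
  · exact zext_eq_of (head_coneCollapse θ).symm fun _ => rfl
  · refine zmap_heq_of (head_coneCollapse θ).symm (head_coneCollapse θ').symm (fun _ => rfl)
      (fun _ => rfl) fun _ _ => heq_of_eq ?_
    rw [chainEval_self]
    rfl
  · refine zmap_heq_of (head_coneCollapse θ).symm (head_coneCollapse θ).symm (fun _ => rfl)
      (fun _ => rfl) fun _ _ => heq_of_eq ?_
    rw [chainEval_id, chainTrans_of_hom Y a]
    rfl

/-- For constant chains of `ι`, the chain of the diagrams `coneOf Y ι` is constant. -/
theorem coneChain_eq_const {m : ℕ} (ι : Fin (q + 1 + 1) → Fin (q + 1)) :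
    coneChain Y (fun _ : Fin (m + 1) => ι) = (Functor.const _).obj ⟨coneOf Y ι⟩ := by
  refine chain_ext (fun _ => rfl) (fun _ _ _ θ => heq_of_eq ?_)
  change (coneHom Y ι ι).hom.app θ = _
  rw [coneHom_self]
  rfl

end

/-! ### Maps that raise the level by one, given by cones -/

section

open SymmetricMultisimplicialSet SymmetricSpectrum

theorem point_smap_orderHom_id (X : SymmetricMultisimplicialSet.{u}) {n : ℕ} {p p' : Fin n → ℕ} {q : ℕ}
    (f : Ops p' p) (x : X.cell p q) (t : Prism p') (u : stdSimplex ℝ (Fin (q + 1))) :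
    point (X.smap f OrderHom.id x) t u = point x (f.push t) u :=
  (point_smap _ _ _ _ _).trans (congrArg (point x _) (stdSimplex.map_id_apply u))

/-- Assignments of cells over `(q + 1, p)` to the cells over `p` in degree `q`. They are natural with
respect to the operators of `p` and `q` and vanish at the cone point and at the opposite face. -/
structure ConeMap (X Z : SymmetricMultisimplicialSet.{u}) where
  deg : ℕ → ℕ
  op : ∀ {q q' : ℕ}, (Fin (q' + 1) →o Fin (q + 1)) → (Fin (deg q' + 1) →o Fin (deg q + 1))
  cell : ∀ {n : ℕ} {p : Fin n → ℕ} {q : ℕ}, X.cell p q → Z.cell (consN (q + 1) p) (deg q)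
  cell_smap : ∀ {n : ℕ} {p p' : Fin n → ℕ} {q q' : ℕ} (f : Ops p' p)
    (g : Fin (q' + 1) →o Fin (q + 1)) (x : X.cell p q),
    cell (X.smap f g x) = Z.smap (consOps (consHom g) f) (op g) (cell x)
  cell_pt : ∀ {n : ℕ} (p : Fin n → ℕ) (q : ℕ), cell (X.pt p q) = Z.pt (consN (q + 1) p) (deg q)
  face : ∀ {n : ℕ} {p : Fin n → ℕ} {q : ℕ} {p' : Fin (n + 1) → ℕ} (f : Ops p' (consN (q + 1) p))
    (_ : (∀ a, (f 0 a : Fin (q + 1 + 1)) = 0) ∨ ∀ a, (f 0 a : Fin (q + 1 + 1)) ≠ 0) (x : X.cell p q),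
    Z.smap f OrderHom.id (cell x) = Z.pt p' (deg q)

namespace ConeMap

variable {X Z : SymmetricMultisimplicialSet.{u}} (Φ : ConeMap X Z)

/-- Maps from a simplex to the simplex of the degree of the cone that are compatible with the
operators. -/
structure Coord where
  toFun : ∀ {q : ℕ}, stdSimplex ℝ (Fin (q + 1)) → stdSimplex ℝ (Fin (Φ.deg q + 1))
  natural : ∀ {q q' : ℕ} (g : Fin (q' + 1) →o Fin (q + 1)) (u : stdSimplex ℝ (Fin (q' + 1))),
    stdSimplex.map (Φ.op g) (toFun u) = toFun (stdSimplex.map g u)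

variable {n : ℕ}

/-- The map of realizations at the parameter `s`, which runs through the lines from the cone point to
the opposite face. -/
noncomputable def run (w : Φ.Coord) (s : I) : X.Realization n → Z.Realization (n + 1) :=
  descend (fun {p q} x t u => point (X := Z) (p := consN (q + 1) p) (q := Φ.deg q) (Φ.cell x)
      (consCoord (conePt (unitInterval.symm s) u) t) (w.toFun u))
    (fun {p p' q q'} f g x t u => by
      rw [Φ.cell_smap, ← map_consHom_conePt, ← consOps_push, ← w.natural]
      exact point_smap (X := Z) (consOps (consHom g) f) (Φ.op g) (Φ.cell x) _ _)

theorem run_point (w : Φ.Coord) (s : I) {p : Fin n → ℕ} {q : ℕ} (x : X.cell p q) (t : Prism p)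
    (u : stdSimplex ℝ (Fin (q + 1))) : Φ.run w s (point x t u) =
      point (X := Z) (p := consN (q + 1) p) (q := Φ.deg q) (Φ.cell x)
        (consCoord (conePt (unitInterval.symm s) u) t) (w.toFun u) := rfl

theorem run_zero (w : Φ.Coord) (x : X.Realization n) : Φ.run w 0 x = Z.basePt (n + 1) := by
  induction x using ind with
  | @h p q x t u =>
    rw [run_point, unitInterval.symm_zero, conePt_one_eq_map]
    refine (congrArg (fun t => point (X := Z) (p := consN (q + 1) p) (q := Φ.deg q) (Φ.cell x) t
      (w.toFun u)) ?_).trans ((point_smap_orderHom_id Z (consOps (p := p) (p' := p)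
        (OrderHom.const (Fin (0 + 1)) (0 : Fin (q + 1 + 1))) (Ops.id p)) (Φ.cell x)
        (consCoord (stdSimplex.vertex 0) t) (w.toFun u)).symm.trans ?_)
    · rw [consOps_push, Ops.push_id]
    · rw [Φ.face _ (Or.inl fun _ => rfl)]
      exact point_pt _ _ _ _

theorem run_one (w : Φ.Coord) (x : X.Realization n) : Φ.run w 1 x = Z.basePt (n + 1) := by
  induction x using ind with
  | @h p q x t u =>
    rw [run_point, unitInterval.symm_one, conePt_zero]
    refine (congrArg (fun t => point (X := Z) (p := consN (q + 1) p) (q := Φ.deg q) (Φ.cell x) t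
      (w.toFun u)) ?_).trans ((point_smap_orderHom_id Z (consOps (p := p) (p' := p)
        (succHom q) (Ops.id p)) (Φ.cell x) (consCoord u t) (w.toFun u)).symm.trans ?_)
    · rw [consOps_push, Ops.push_id]
    · rw [Φ.face _ (Or.inr fun a => Fin.succ_ne_zero a)]
      exact point_pt _ _ _ _

theorem run_basePt (w : Φ.Coord) (s : I) : Φ.run w s (X.basePt n) = Z.basePt (n + 1) := by
  change point (X := Z) (Φ.cell (X.pt _ _)) _ _ = _
  rw [Φ.cell_pt]
  exact point_pt _ _ _ _

theorem continuous_run {V : Type*} [TopologicalSpace V] [LocallyCompactSpace V] (w : V → Φ.Coord)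
    (s : V → I) (hs : Continuous s) (hw : ∀ q : ℕ, Continuous fun z :
      V × stdSimplex ℝ (Fin (q + 1)) => (w z.1).toFun z.2) :
    Continuous fun z : V × X.Realization n => Φ.run (w z.1) (s z.1) z.2 := by
  refine continuous_of_point_prod (F := fun v => Φ.run (w v) (s v)) fun {p q} x => ?_
  have hv : Continuous fun z : V × Prism p × stdSimplex ℝ (Fin (q + 1)) =>
      conePt (unitInterval.symm (s z.1)) z.2.2 :=
    continuous_conePt.comp ((unitInterval.continuous_symm.comp (hs.comp continuous_fst)).prodMk
      (continuous_snd.comp continuous_snd))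
  have hu : Continuous fun z : V × Prism p × stdSimplex ℝ (Fin (q + 1)) =>
      (w z.1).toFun z.2.2 :=
    (hw q).comp (continuous_fst.prodMk (continuous_snd.comp continuous_snd))
  exact continuous_point_comp (X := Z) (p := consN (q + 1) p) (q := Φ.deg q) (Φ.cell x)
    (continuous_consCoord hv (continuous_fst.comp continuous_snd)) hu

/-- The maps `S¹ ∧ X_n → Z_{1+n}` given by cones. -/
noncomputable def shiftMap (w : Φ.Coord)
    (hw : ∀ q : ℕ, Continuous (w.toFun : stdSimplex ℝ (Fin (q + 1)) → _)) :
    ShiftMap (realization.obj X) (realization.obj Z) where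
  toFun _ s x := Φ.run w s x
  continuous_toFun _ := Φ.continuous_run (fun _ => w) id continuous_id
    fun q => (hw q).comp continuous_snd
  map_zero _ x := Φ.run_zero w x
  map_one _ x := Φ.run_one w x
  map_pt _ s := Φ.run_basePt w s

theorem homotopic_shiftMap (w : I → Φ.Coord) (hw : ∀ q : ℕ, Continuous fun z :
    I × stdSimplex ℝ (Fin (q + 1)) => (w z.1).toFun z.2)
    (h₀ : ∀ q : ℕ, Continuous ((w 0).toFun : stdSimplex ℝ (Fin (q + 1)) → _))
    (h₁ : ∀ q : ℕ, Continuous ((w 1).toFun : stdSimplex ℝ (Fin (q + 1)) → _)) :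
    (Φ.shiftMap (w 0) h₀).Homotopic (Φ.shiftMap (w 1) h₁) := by
  intro n
  refine ⟨fun r s x => Φ.run (n := n) (w r) s x, ?_, fun _ _ => rfl, fun _ _ => rfl,
    fun r x => Φ.run_zero _ x, fun r x => Φ.run_one _ x, fun r s => Φ.run_basePt _ s⟩
  have := Φ.continuous_run (n := n) (V := I × I) (fun v => w v.1) (fun v => v.2) continuous_snd
    fun q => (hw q).comp ((continuous_fst.comp continuous_fst).prodMk continuous_snd)
  exact this.comp ((continuous_fst.prodMk (continuous_fst.comp continuous_snd)).prodMk
    (continuous_snd.comp continuous_snd))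

end ConeMap

theorem map_coneCollapse_conePt {q : ℕ} (s : I) (u : stdSimplex ℝ (Fin (q + 1))) :
    stdSimplex.map (coneCollapse q) (conePt (unitInterval.symm s) u) = simplexPt s := by
  have h : stdSimplex.map (coneCollapse q) (stdSimplex.map (succHom q) u) =
      stdSimplex.vertex (1 : Fin (1 + 1)) := by
    have e : (coneCollapse q : Fin (q + 1 + 1) → Fin (1 + 1)) ∘ succHom q =
        (OrderHom.const (Fin (0 + 1)) (1 : Fin (1 + 1)) : Fin (0 + 1) → Fin (1 + 1)) ∘
          (OrderHom.const (Fin (q + 1)) (0 : Fin (0 + 1)) : Fin (q + 1) → Fin (0 + 1)) := rfl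
    rw [stdSimplex.map_comp_apply, e, ← stdSimplex.map_comp_apply, stdSimplex_eq_vertex
      (stdSimplex.map _ u), stdSimplex.map_vertex]
    rfl
  unfold conePt
  rw [map_mix, h, stdSimplex.map_vertex]
  refine (Homeomorph.eq_symm_apply _).2 (Subtype.ext ?_)
  change (mix _ _ _ : stdSimplex ℝ (Fin (1 + 1))) 1 = (s : ℝ)
  rw [mix_apply]
  change (1 - (1 - (s : ℝ))) * _ + _ * stdSimplex.vertex (0 : Fin (1 + 1)) 1 = _
  simp

theorem point_coneCollapse {X : SymmetricMultisimplicialSet.{u}} {n : ℕ} {p : Fin n → ℕ} {q : ℕ}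
    (x : X.cell p q) (s : I) (t : Prism p) (u : stdSimplex ℝ (Fin (q + 1))) :
    point (X := X) (p := consN (q + 1) p) (q := q) (X.smap (p := consOne p)
      (consOps (coneCollapse q) (Ops.id p)) OrderHom.id (X.susp x))
      (consCoord (conePt (unitInterval.symm s) u) t) u = str s (point x t u) := by
  refine (point_smap_orderHom_id X (consOps (p := p) (p' := p) (coneCollapse q) (Ops.id p)) (X.susp x)
    (consCoord (conePt (unitInterval.symm s) u) t) u).trans ?_
  rw [consOps_push, Ops.push_id, map_coneCollapse_conePt]
  rfl

end

/-! ### The structure maps of `K`-theory and cones -/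

section

open SymmetricMultisimplicialSet SymmetricSpectrum

section

variable (A : Type u) [Category.{v} A] [Preadditive A] [ExactCategory A]

variable {A} in
theorem chain_eq_pt {n : ℕ} {p : Fin n → ℕ} {q : ℕ} {Y : Fin (q + 1) ⥤ Core (SCat A p)}
    (h : ∀ j, (Y.obj j).of = SCat.zero A p) : Y = (nerveS A).pt p q := by
  have e : ∀ j θ, (Y.obj j).of.obj.obj θ = ExactCategory.zero := fun j θ => by
    rw [h]
    rfl
  exact chain_ext h fun j j' _ θ => zero_heq (e j θ) (e j' θ) (e j θ)

/-- The map `[q + 1] → [q]` that is left inverse to the inclusion onto the successors. -/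
abbrev conePred (q : ℕ) : Fin (q + 1 + 1) → Fin (q + 1) := Fin.cons 0 id

/-- The map `S¹ ∧ N_• i S^{(n)}_• A → Ob S^{(1+n)}_• A` given by the cones of chains of isomorphisms. -/
def coneObj : ConeMap (nerveS A) (objS A) where
  deg q := q
  op g := g
  cell {_ _ q} Y := coneOf Y (conePred q)
  cell_smap f g Y := (reindex_coneOf Y f g fun _ => rfl).symm
  cell_pt _ _ := coneOf_eq_zero _ (fun _ => rfl) _
  face f hf Y := reindex_coneOf_eq_zero Y f hf _

/-- The maps `[q + 1] → [q]` whose cones connect the degenerate suspensions of the terms of a chain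
with the cone of the chain. -/
def dblIdx (q : ℕ) : Fin (q + 1 + q + 1) → Fin (q + 1 + 1) → Fin (q + 1) :=
  Fin.append (m := q + 1) (n := q + 1) (fun j _ => j) fun _ => conePred q

/-- The homotopy between the structure map of the `K`-theory spectrum and the map given by the cones
of chains of isomorphisms. -/
def coneDouble : ConeMap (nerveS A) (nerveS A) where
  deg q := q + 1 + q
  op g := dbl g
  cell {_ _ q} Y := coneChain Y (dblIdx q)
  cell_smap {_ _ _ q q'} f g Y := by
    refine (smap_coneChain Y f g (dbl g) (dblIdx q) (dblIdx q') fun J b => ?_).symm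
    refine (congrFun (congrFun (append_comp_dbl g (fun j _ => j) fun _ => conePred q) J)
      (g b).succ).trans ?_
    unfold dblIdx
    induction J using Fin.addCases (m := q' + 1) (n := q' + 1) with
    | left J => rw [Fin.append_left, Fin.append_left, Function.comp_apply]
    | right J =>
      rw [Fin.append_right, Fin.append_right, Function.comp_apply]
      rfl
  cell_pt _ _ := chain_eq_pt fun _ => coneOf_eq_zero _ (fun _ => rfl) _
  face f hf Y := chain_eq_pt fun _ => reindex_coneOf_eq_zero Y f hf _

/-- The homotopy coordinate of `coneDouble`. -/
noncomputable def coneDouble.coord (r : I) : (coneDouble A).Coord where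
  toFun u := dblPt r u
  natural g u := map_dblPt g r u

/-- The map that takes the cones of chains of isomorphisms. -/
noncomputable def coneShift : ShiftMap (realization.obj (nerveS A)) (realization.obj (objS A)) :=
  (coneObj A).shiftMap ⟨fun u => u, fun _ _ => rfl⟩ fun _ => continuous_id

/-- The structure map of `K`-theory factors up to homotopy through the objects. -/
theorem homotopic_str_coneShift : (ShiftMap.str (realization.obj (nerveS A))).Homotopic
    ((coneShift A).postcomp (realization.map (objToNerve A))) := by
  have hc : ∀ q : ℕ, Continuous fun z : I × stdSimplex ℝ (Fin (q + 1)) =>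
      (coneDouble.coord A z.1).toFun z.2 := fun _ => continuous_dblPt
  have hr : ∀ (r : I) (q : ℕ), Continuous ((coneDouble.coord A r).toFun :
      stdSimplex ℝ (Fin (q + 1)) → _) := fun r q => (hc q).comp (continuous_const.prodMk continuous_id)
  have key := (coneDouble A).homotopic_shiftMap (coneDouble.coord A) hc (hr 0) (hr 1)
  have h₀ : (coneDouble A).shiftMap (coneDouble.coord A 0) (hr 0) =
      ShiftMap.str (realization.obj (nerveS A)) := by
    refine ShiftMap.ext_toFun fun n s x => ?_
    induction x using ind with
    | @h p q Y t u =>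
      refine (point_dblPt_zero (X := nerveS A) (p := consN (q + 1) p) (coneChain Y (dblIdx q)) _ u).trans
        (Eq.trans ?_ (point_coneCollapse (X := nerveS A) Y s t u))
      refine congrArg (fun Y => point (X := nerveS A) (p := consN (q + 1) p) (q := q) Y _ u) ?_
      refine Eq.trans (chain_ext (fun _ => rfl) fun _ _ _ _ => HEq.rfl) ((congrArg (coneChain Y)
        (append_comp_dblLeft (fun j _ => j) fun _ => conePred q)).trans (coneChain_const Y))
  have h₁ : (coneDouble A).shiftMap (coneDouble.coord A 1) (hr 1) =
      (coneShift A).postcomp (realization.map (objToNerve A)) := by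
    refine ShiftMap.ext_toFun fun n s x => ?_
    induction x using ind with
    | @h p q Y t u =>
      refine (point_dblPt_one (X := nerveS A) (p := consN (q + 1) p) (coneChain Y (dblIdx q)) _ u).trans ?_
      refine congrArg (fun Y => point (X := nerveS A) (p := consN (q + 1) p) (q := q) Y _ u) ?_
      refine Eq.trans (chain_ext (fun _ => rfl) fun _ _ _ _ => HEq.rfl) ((congrArg (coneChain Y)
        (append_comp_dblRight (fun j _ => j) fun _ => conePred q)).trans (coneChain_eq_const Y _))
  rwa [h₀, h₁] at key

end

end

/-! ### Trivializations of cones of chains of automorphisms over the identity -/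

section

open SymmetricMultisimplicialSet SymmetricSpectrum

variable {C : Type u} [Category.{v} C] [Preadditive C] [ExactCategory C] (M : Bimodule C)

theorem Coprod.elt_comp {M : BiadditiveFunctor C} {n : ℕ} {p : Fin n → ℕ} {q : ℕ} (c : Coprod M p q)
    {j k l : Fin (q + 1)} (a : j ⟶ k) (b : k ⟶ l) : c.elt (a ≫ b) = c.elt b + c.elt a :=
  congrArg Multiplicative.toAdd (c.2.map_comp a b)

/-- The element that a simplex of the classifying space of a group assigns to two vertices in any
order. -/
def Coprod.dif {M : BiadditiveFunctor C} {n : ℕ} {p : Fin n → ℕ} {q : ℕ} (c : Coprod M p q)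
    (j k : Fin (q + 1)) : SBimod M c.1 c.1 :=
  c.elt (homOfLE (Fin.zero_le k)) - c.elt (homOfLE (Fin.zero_le j))

theorem Coprod.dif_add_dif {M : BiadditiveFunctor C} {n : ℕ} {p : Fin n → ℕ} {q : ℕ}
    (c : Coprod M p q) (j k l : Fin (q + 1)) : c.dif j k + c.dif k l = c.dif j l := by
  unfold dif
  abel

theorem Coprod.dif_eq_elt {M : BiadditiveFunctor C} {n : ℕ} {p : Fin n → ℕ} {q : ℕ}
    (c : Coprod M p q) {j k : Fin (q + 1)} (a : j ⟶ k) : c.dif j k = c.elt a := by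
  unfold dif
  rw [sub_eq_iff_eq_add, ← Coprod.elt_comp]
  rfl

theorem Coprod.dif_map {M : BiadditiveFunctor C} {n : ℕ} {p p' : Fin n → ℕ} {q q' : ℕ}
    (c : Coprod M p q) (f : Ops p' p) (g : Fin (q' + 1) →o Fin (q + 1)) (j k : Fin (q' + 1)) :
    ((coprodS M).smap f g c : Coprod M p' q').dif j k =
      SBimod.reindex M 1 f c.1 (c.dif (g j) (g k)) := by
  have e : ∀ j, c.elt (homOfLE (Fin.zero_le (g j))) =
      c.elt (homOfLE (g.monotone (Fin.zero_le j))) + c.elt (homOfLE (Fin.zero_le (g 0))) :=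
    fun j => (c.elt_comp (homOfLE (Fin.zero_le (g 0))) (homOfLE (g.monotone (Fin.zero_le j))))
  have e' : c.dif (g j) (g k) = c.elt (homOfLE (g.monotone (Fin.zero_le k))) -
      c.elt (homOfLE (g.monotone (Fin.zero_le j))) := by
    unfold dif
    rw [e j, e k, add_sub_add_right_eq_sub]
  exact ((congrArg (SBimod.reindex M 1 f c.1) e').trans (map_sub (SBimod.reindex M 1 f c.1) _ _)).symm

variable {M} {n : ℕ} {p : Fin n → ℕ} {q : ℕ}

theorem chainTrans_coprodToNerve (c : Coprod M.toBiadditiveFunctor p q) (j k : Fin (q + 1)) :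
    chainTrans (c.2 ⋙ gauge M c.1) j k = gaugeHom M c.1 (c.dif j k) := by
  refine (gaugeHom_add M c.1 (-c.elt (homOfLE (Fin.zero_le j))) (c.elt (homOfLE (Fin.zero_le k)))).trans ?_
  rw [← sub_eq_add_neg]
  rfl

theorem gaugeHom_comp_map (X : SCat C p) (m : SBimod M.toBiadditiveFunctor X X) {ρ θ : MultiArrow p}
    (a : ρ ⟶ θ) : (gaugeHom M X m).hom.app ρ ≫ (trivDiag M X).obj.map a =
      (⟨X.obj.map a, M.push (X.obj.map a) (m.1 ρ)⟩ : SemidirectHom M.toBiadditiveFunctor _ _) := by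
  refine SemidirectHom.ext (Category.id_comp _) ?_
  refine (Semidirect.comp_snd _ _).trans ?_
  refine (congrArg (fun y => M.push (X.obj.map a) (m.1 ρ) + y) (map_zero _)).trans ?_
  exact add_zero _

theorem chainEval_coprodToNerve (c : Coprod M.toBiadditiveFunctor p q) (j k : Fin (q + 1))
    {ρ θ : MultiArrow p} (a : ρ ⟶ θ) : chainEval (c.2 ⋙ gauge M c.1) j k a =
      (⟨c.1.obj.map a, M.push (c.1.obj.map a) ((c.dif j k).1 ρ)⟩ :
        SemidirectHom M.toBiadditiveFunctor _ _) :=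
  (congrArg (fun f : trivDiag M c.1 ⟶ trivDiag M c.1 => f.hom.app ρ ≫ (trivDiag M c.1).obj.map a)
    (chainTrans_coprodToNerve c j k)).trans (gaugeHom_comp_map c.1 (c.dif j k) a)

/-- The trivialization of the cone of a chain of automorphisms over the identity that is determined
by the vertex `k` of the chain. -/
def coneTriv (c : Coprod M.toBiadditiveFunctor p q) (k : Fin (q + 1)) :
    Triv M (coneOf (c.2 ⋙ gauge M c.1) (conePred q)) :=
  ⟨fun θ => tzelt M θ.coneHead (c := ⟨c.1.obj.obj (MultiArrow.coneTail.obj θ)⟩)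
      ((c.dif (conePred q θ.coneIdx) k).1 (MultiArrow.coneTail.obj θ)), fun {ρ θ} a => by
    refine tzelt_compat M ρ.coneHead θ.coneHead (chainEval (c.2 ⋙ gauge M c.1) _ _ _) ?_
    refine Eq.trans (congrArg (fun f : SemidirectHom M.toBiadditiveFunctor _ _ =>
      f.snd + M.pull f.fst ((c.dif (conePred q θ.coneIdx) k).1 (MultiArrow.coneTail.obj θ)) -
        M.push f.fst ((c.dif (conePred q ρ.coneIdx) k).1 (MultiArrow.coneTail.obj ρ)))
        (chainEval_coprodToNerve c _ _ _)) ?_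
    have e := congrArg (fun m : SBimod M.toBiadditiveFunctor c.1 c.1 =>
      m.1 (MultiArrow.coneTail.obj ρ)) (c.dif_add_dif (conePred q ρ.coneIdx) (conePred q θ.coneIdx) k)
    have e' := (c.dif (conePred q θ.coneIdx) k).2 _ _ (MultiArrow.coneTail.map a)
    have e'' := (map_add (M.push (c.1.obj.map (MultiArrow.coneTail.map a))) _ _).symm.trans
      (congrArg (M.push (c.1.obj.map (MultiArrow.coneTail.map a))) e)
    exact sub_eq_zero.2 ((congrArg (fun y => M.push (c.1.obj.map (MultiArrow.coneTail.map a))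
      ((c.dif (conePred q ρ.coneIdx) (conePred q θ.coneIdx)).1 (MultiArrow.coneTail.obj ρ)) + y)
        e').trans e'')⟩

theorem tzelt_heq_of {b b' : Bool} (hb : b = b') {c d : Semidirect M.toBiadditiveFunctor}
    {h : M.val c.of c.of} {h' : M.val d.of d.of} (hc : b = true → c = d) (hh : b = true → h ≍ h') :
    tzelt M b h ≍ tzelt M b' h' := by
  subst hb
  cases b
  · rfl
  · exact hh rfl

theorem coneTriv_smap (c : Coprod M.toBiadditiveFunctor p q) {p' : Fin n → ℕ} {q' : ℕ} (f : Ops p' p)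
    (g : Fin (q' + 1) →o Fin (q + 1)) :
    (⟨coneOf _ _, coneTriv ((coprodS M.toBiadditiveFunctor).smap f g c)⟩ :
        TrivCell M (consN (q' + 1) p') q') =
      (trivS M).smap (consOps (consHom g) f) g
        (⟨coneOf _ _, coneTriv c⟩ : TrivCell M (consN (q + 1) p) q) := by
  have e : (coprodToNerve M).toFun p' q' ((coprodS M.toBiadditiveFunctor).smap f g c) =
    (nerveS _).smap f g ((coprodToNerve M).toFun p q c) := (coprodToNerve M).toFun_map 1 f g c
  have e' := (congrArg (fun Y => coneOf Y (conePred q')) e).trans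
    (reindex_coneOf _ f g (ι := conePred q) fun _ => rfl).symm
  refine TrivCell.ext e' fun k => Triv.heq e' fun θ => ?_
  refine tzelt_heq_of (coneHead_consHom f g θ).symm (fun _ => rfl) fun h => ?_
  refine heq_of_eq ?_
  rw [Coprod.dif_map]
  exact congrArg (fun j => (c.dif j (g k)).1 _)
    (coneIdx_consHom (ι := conePred q) (ι' := conePred q') f g (fun _ => rfl) h).symm

variable (M)

/-- The lift of the cones of chains of automorphisms over the identity to trivialized diagrams. -/
def coneLift : ConeMap (coprodS M.toBiadditiveFunctor) (trivS M) where
  deg q := q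
  op g := g
  cell {_ p q} c := (⟨coneOf _ _, coneTriv c⟩ : TrivCell M (consN (q + 1) p) q)
  cell_smap f g c := coneTriv_smap c f g
  cell_pt _ _ :=
    have e := coneOf_eq_zero _ (fun _ => rfl) _
    TrivCell.ext e fun _ => Triv.heq_of_zero e e _ _
  face f hf _ :=
    have e := reindex_coneOf_eq_zero _ f hf _
    TrivCell.ext e fun _ => Triv.heq_of_zero e e _ _

variable {M}

theorem zext_of (b : Bool) (c : Semidirect M.toBiadditiveFunctor) : (zext b c).of = zext b c.of := by
  cases b <;> rfl

theorem zmap_fst {b b' : Bool} {c c' : Semidirect M.toBiadditiveFunctor} (f : c ⟶ c') :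
    (zmap b b' f).fst ≍ zmap b b' f.fst := by
  cases b <;> cases b' <;> rfl

theorem toCoprod_coneTriv (c : Coprod M.toBiadditiveFunctor p q) :
    TrivCell.toCoprod (⟨coneOf _ _, coneTriv c⟩ : TrivCell M (consN (q + 1) p) q) =
      (coprodS M.toBiadditiveFunctor).smap (p := consOne p) (consOps (coneCollapse q) (Ops.id p))
        OrderHom.id ((coprodS M.toBiadditiveFunctor).susp c) := by
  refine Coprod.ext (SCat.ext (fun θ => ?_) fun θ θ' a => ?_) fun k k' a θ => ?_
  · refine Eq.trans ?_ (zext_eq_of (c := c.1.obj.obj (MultiArrow.coneTail.obj θ))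
      (head_coneCollapse θ).symm fun _ => rfl)
    exact zext_of θ.coneHead ⟨c.1.obj.obj (MultiArrow.coneTail.obj θ)⟩
  · refine (zmap_fst (b := θ.coneHead) (b' := θ'.coneHead)
      (chainEval (c.2 ⋙ gauge M c.1) _ _ (MultiArrow.coneTail.map a))).trans ?_
    rw [chainEval_coprodToNerve]
    exact zmap_heq_of (head_coneCollapse θ).symm (head_coneCollapse θ').symm (fun _ => rfl)
      (fun _ => rfl) fun _ _ => HEq.rfl
  · refine (tzelt_sub M θ.coneHead (c := ⟨c.1.obj.obj (MultiArrow.coneTail.obj θ)⟩) _ _).trans ?_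
    have e : (c.dif (conePred q θ.coneIdx) k').1 (MultiArrow.coneTail.obj θ) -
        (c.dif (conePred q θ.coneIdx) k).1 (MultiArrow.coneTail.obj θ) =
        (c.elt a).1 (MultiArrow.coneTail.obj θ) := by
      rw [← c.dif_eq_elt a, ← c.dif_add_dif _ k k']
      exact add_sub_cancel_left _ _
    refine zelt_heq M.toBiadditiveFunctor (head_coneCollapse θ).symm rfl ?_
    exact heq_of_eq e

variable (M)

/-- The lift of the cones of chains of automorphisms over the identity to trivialized diagrams. -/
noncomputable def coneLiftShift :
    ShiftMap (realization.obj (coprodS M.toBiadditiveFunctor)) (realization.obj (trivS M)) :=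
  (coneLift M).shiftMap ⟨fun u => u, fun _ _ => rfl⟩ fun _ => continuous_id

theorem coneLiftShift_trivToObj : (coneLiftShift M).postcomp (realization.map (trivToObj M)) =
    (coneShift (Semidirect M.toBiadditiveFunctor)).precomp (realization.map (coprodToNerve M)) := by
  refine ShiftMap.ext_toFun fun n s x => ?_
  induction x using ind with
  | @h p q c t u => rfl

theorem coneLiftShift_trivToCoprod :
    (coneLiftShift M).postcomp (realization.map (trivToCoprod M)) =
      ShiftMap.str (realization.obj (coprodS M.toBiadditiveFunctor)) := by
  refine ShiftMap.ext_toFun fun n s x => ?_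
  induction x using ind with
  | @h p q c t u =>
    refine Eq.trans ?_ (point_coneCollapse (X := coprodS M.toBiadditiveFunctor) c s t u)
    exact congrArg (fun c => point (X := coprodS M.toBiadditiveFunctor) (p := consN (q + 1) p)
      (q := q) c _ u) (toCoprod_coneTriv c)

end

/-! ### The comparison of the disjoint unions of classifying spaces with `K`-theory -/

section

open SymmetricMultisimplicialSet SymmetricSpectrum

namespace SymmetricSpectrum.ShiftMap

variable {X Y Z : SymmetricSpectrum.{u}}

/-- The composite with pointed maps of the levels of the target. -/
def postMap (g : ShiftMap X Y) (ψ : ∀ n, Y.level n → Z.level n) (hψ : ∀ n, Continuous (ψ n))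
    (hψ' : ∀ n, ψ n (Y.pt n) = Z.pt n) : ShiftMap X Z where
  toFun n s x := ψ (n + 1) (g.toFun n s x)
  continuous_toFun n := (hψ (n + 1)).comp (g.continuous_toFun n)
  map_zero n x := by rw [g.map_zero, hψ']
  map_one n x := by rw [g.map_one, hψ']
  map_pt n s := by rw [g.map_pt, hψ']

/-- Pointed homotopies of the levels of the target give homotopies of the composites. -/
theorem homotopic_of_levelwise (g : ShiftMap X Y) {g₀ g₁ : ShiftMap X Z}
    (H : ∀ n, I → Y.level n → Z.level n) (hH : ∀ n, Continuous fun z : I × Y.level n => H n z.1 z.2)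
    (hp : ∀ n r, H n r (Y.pt n) = Z.pt n)
    (h₀ : ∀ n s x, H (n + 1) 0 (g.toFun n s x) = g₀.toFun n s x)
    (h₁ : ∀ n s x, H (n + 1) 1 (g.toFun n s x) = g₁.toFun n s x) : Homotopic g₀ g₁ := fun n =>
  ⟨fun r s x => H (n + 1) r (g.toFun n s x),
    (hH (n + 1)).comp (continuous_fst.prodMk ((g.continuous_toFun n).comp continuous_snd)),
    h₀ n, h₁ n, fun r x => (congrArg (H (n + 1) r) (g.map_zero n x)).trans (hp _ _),
    fun r x => (congrArg (H (n + 1) r) (g.map_one n x)).trans (hp _ _),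
    fun r s => (congrArg (H (n + 1) r) (g.map_pt n s)).trans (hp _ _)⟩

end SymmetricSpectrum.ShiftMap

variable {C : Type u} [Category.{v} C] [Preadditive C] [ExactCategory C] (M : Bimodule C)

/-- The map from the disjoint unions of classifying spaces to `K`-theory is inverted, up to the
structure maps, by a map that raises the level by one: it takes the cone of a chain of isomorphisms,
trivializes it, and takes the differences of the trivializations. -/
theorem exists_coprodToNerve_inverse :
    ∃ Θ : ShiftMap (realization.obj (nerveS (Semidirect M.toBiadditiveFunctor)))
        (realization.obj (coprodS M.toBiadditiveFunctor)),
      (∀ k, (Θ.precomp (realization.map (coprodToNerve M))).onPre k =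
        (ShiftMap.str (realization.obj (coprodS M.toBiadditiveFunctor))).onPre k) ∧
      ∀ k, (Θ.postcomp (realization.map (coprodToNerve M))).onPre k =
        (ShiftMap.str (realization.obj (nerveS (Semidirect M.toBiadditiveFunctor)))).onPre k := by
  let A := Semidirect M.toBiadditiveFunctor
  choose Ψ hΨ hΨ' P Q using fun n => exists_trivToObj_inverse M n
  choose P hP hP₀ hP₁ hP' using P
  choose Q hQ hQ₀ hQ₁ hQ' using Q
  choose H hH hH₀ hH₁ hH' using fun n => exists_triv_homotopy M (n := n)
  let Θ : ShiftMap (realization.obj (nerveS A)) (realization.obj (coprodS M.toBiadditiveFunctor)) :=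
    ShiftMap.postMap (coneShift A) (fun n x => real (trivToCoprod M) n (Ψ n x))
      (fun n => (continuous_real _).comp (hΨ n))
      (fun n => (congrArg (real (trivToCoprod M) n) (hΨ' n)).trans (real_basePt _))
  refine ⟨Θ, fun k => ?_, fun k => ?_⟩
  · have h : ShiftMap.Homotopic (ShiftMap.str (realization.obj (coprodS M.toBiadditiveFunctor)))
        (Θ.precomp (realization.map (coprodToNerve M))) := by
      rw [← coneLiftShift_trivToCoprod]
      refine (coneLiftShift M).homotopic_of_levelwise
        (fun n r x => real (trivToCoprod M) n (Q n r x)) (fun n => (continuous_real _).comp (hQ n))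
        (fun n r => (congrArg (real (trivToCoprod M) n) (hQ' n r)).trans (real_basePt _))
        (fun n s x => congrArg (real (trivToCoprod M) (n + 1)) (hQ₀ (n + 1) _)) fun n s x => ?_
      refine congrArg (real (trivToCoprod M) (n + 1)) ((hQ₁ (n + 1) _).trans ?_)
      exact congrArg (Ψ (n + 1)) (congrArg (fun g : ShiftMap (realization.obj
        (coprodS M.toBiadditiveFunctor)) (realization.obj (objS A)) => g.toFun n s x)
          (coneLiftShift_trivToObj M))
    exact (h.onPre_eq k).symm
  · -- the trivializations are a homotopy to the constant chains of the trivialized diagrams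
    let ψ : ∀ n, (objS A).Realization n → (nerveS A).Realization n := fun n x =>
      real (objToNerve A) n (real (trivToObj M) n (Ψ n x))
    have hψ : ∀ n, Continuous (ψ n) := fun n =>
      (continuous_real _).comp ((continuous_real _).comp (hΨ n))
    have hψ' : ∀ n, ψ n (SymmetricMultisimplicialSet.basePt _ n) =
        SymmetricMultisimplicialSet.basePt _ n := fun n => by
      change real (objToNerve A) n (real (trivToObj M) n (Ψ n _)) = _
      rw [hΨ' n, real_basePt]
      exact real_basePt _
    have h₁ : ShiftMap.Homotopic (ShiftMap.postMap (Z := realization.obj (nerveS A)) (coneShift A) ψ hψ hψ')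
        (Θ.postcomp (realization.map (coprodToNerve M))) :=
      (coneShift A).homotopic_of_levelwise (fun n r x => H n r (Ψ n x))
        (fun n => (hH n).comp (continuous_fst.prodMk ((hΨ n).comp continuous_snd)))
        (fun n r => (congrArg (H n r) (hΨ' n)).trans (hH' n r)) (fun n s x => hH₀ (n + 1) _)
        fun n s x => hH₁ (n + 1) _
    have h₂ : ShiftMap.Homotopic ((coneShift A).postcomp (realization.map (objToNerve A)))
        (ShiftMap.postMap (Z := realization.obj (nerveS A)) (coneShift A) ψ hψ hψ') :=
      (coneShift A).homotopic_of_levelwise (fun n r x => real (objToNerve A) n (P n r x))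
        (fun n => (continuous_real _).comp (hP n))
        (fun n r => (congrArg (real (objToNerve A) n) (hP' n r)).trans (real_basePt _))
        (fun n s x => congrArg (real (objToNerve A) (n + 1)) (hP₀ (n + 1) _))
        fun n s x => congrArg (real (objToNerve A) (n + 1)) (hP₁ (n + 1) _)
    exact (h₁.onPre_eq k).symm.trans ((h₂.onPre_eq k).symm.trans
      ((homotopic_str_coneShift A).onPre_eq k).symm)

end

section

open SymmetricSpectrum

theorem isEquivalence_relativeCoprodToReduced (A : ExactBimod.{v, u}) :
    IsEquivalence (relativeCoprodToReduced.app A) :=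
  isEquivalence_hofibProj_coprodToWedge A.bimodule.toBiadditiveFunctor

/-- The inclusion `C ⟶ C ⋉ M`, as a morphism of exact categories. -/
def inclusion (A : ExactBimod.{v, u}) : baseFunctor.obj A ⟶ semidirectFunctor.obj A :=
  trivExt A.bimodule

theorem objToCoprod_comp_coprodToNerve (A : ExactBimod.{v, u}) :
    objToCoprod A.bimodule.toBiadditiveFunctor ≫ coprodToNerve A.bimodule =
      objToNerve A.carrier ≫ nerveSFunctor.map (inclusion A) := by
  refine SymmetricMultisimplicialSet.Hom.ext ?_
  funext n p q X
  exact chain_ext (fun _ => rfl) (fun _ _ _ _ => HEq.rfl)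

theorem isEquivalence_relativeCoprodToRelativeK (A : ExactBimod.{v, u}) :
    IsEquivalence (relativeCoprodToRelativeK.app A) := by
  obtain ⟨Θ, h₁, h₂⟩ := exists_coprodToNerve_inverse A.bimodule
  refine isEquivalence_hofibMap (squareHom A)
    (SymmetricMultisimplicialSet.realization.{max u v}.map
      (objToCoprod A.bimodule.toBiadditiveFunctor)) ?_ (K.{v, u}.map (inclusion A)) ?_ ?_
    (fun k => Θ.onPre k) (fun k a => ?_) fun k b => ?_
  · exact (Functor.map_comp _ _ _).symm.trans
      (SymmetricMultisimplicialSet.realization.{max u v}.map_id (objS A.carrier))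
  · exact (K.{v, u}.map_comp _ _).symm.trans (K.{v, u}.map_id (baseFunctor.obj A))
  · exact (Functor.map_comp _ _ _).symm.trans ((congrArg
      SymmetricMultisimplicialSet.realization.{max u v}.map
      (objToCoprod_comp_coprodToNerve A)).trans (Functor.map_comp _ _ _))
  · exact (ShiftMap.onPre_precomp _ Θ k a).symm.trans (congrFun (h₁ k) a)
  · exact (ShiftMap.onPre_postcomp Θ _ k b).symm.trans (congrFun (h₂ k) b)

end

end SplitK

/-- There is a natural equivalence of symmetric spectra `K̃(C; M) ≃ K̃(C ⋉ M)`: the functors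
`(C, M) ↦ K̃(C; M)` and `(C, M) ↦ K̃(C ⋉ M)` are connected by natural transformations that are
equivalences of symmetric spectra. -/
theorem mainTheorem3 :
    ∃ (F : SplitK.ExactBimod.{v, u} ⥤ SplitK.SymmetricSpectrum.{max u v})
      (α : F ⟶ SplitK.reducedModel.{v, u}) (β : F ⟶ SplitK.relativeK.{v, u}),
      (∀ A, SplitK.SymmetricSpectrum.IsEquivalence (α.app A)) ∧
      (∀ A, SplitK.SymmetricSpectrum.IsEquivalence (β.app A)) :=
  ⟨SplitK.relativeCoprod, SplitK.relativeCoprodToReduced, SplitK.relativeCoprodToRelativeK,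
    SplitK.isEquivalence_relativeCoprodToReduced, SplitK.isEquivalence_relativeCoprodToRelativeK⟩
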